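/- **Setting.** Let $\kappa,\lambda_\varphi>0$ and let $V:\mathbb R\to\mathbb R$ be smooth. The spatial slice is the torus $\mathbb R^3/\mathbb Z^3$ with coordinates $x$ (so spatial integrals are finite and integrations by parts have no boundary terms), and all fields on it are smooth. The extended ADM phase space of general relativity with a minimally coupled scalar field consists of $z=(q_{ab},P^{ab},\varphi,\pi_\varphi,N^\mu,\Pi_\mu)$, with $q_{ab}$ a Riemannian metric, $P^{ab}$ symmetric, $N^\mu=(N,N^a)$ lapse and shift and $\Pi_\mu$ their momenta, $\mu=0,\dots,3$. The nonvanishing brackets of the variables are $\{q_{ab}(x),P^{cd}(y)\}=\kappa\,\delta^c_{(a}\delta^d_{b)}\delta(x,y)$, $\{\varphi(x),\pi_\varphi(y)\}=\delta(x,y)$, $\{N^\mu(x),\Pi_\nu(y)\}=\delta^\mu_\nu\delta(x,y)$. The constraints are $\mathfrak C_I=(C_\mu,\Pi_\mu)$, $C_\mu=(C,C_a)$, with $$C=\tfrac1\kappa\Big[\tfrac{1}{\sqrt q}\big(P_{ab}P^{ab}-\tfrac12(P^a{}_a)^2\big)-\sqrt q\,R\Big]+\tfrac{\lambda_\varphi}{2\sqrt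 q}\pi_\varphi^2+\tfrac{\sqrt q}{2\lambda_\varphi}\big(q^{ab}\partial_a\varphi\,\partial_b\varphi+V(\varphi)\big),\qquad C_a=-\tfrac2\kappa q_{ac}D_bP^{bc}+\pi_\varphi\partial_a\varphi .$$ Let $J\subset\mathbb R$ be an open set of times and $U$ an open region of the space of the reduced variables $(q,P,\varphi,\pi_\varphi)$; everything below is considered for $t\in J$ and for $z$ with reduced part in $U$, while $N^\mu,\Pi_\mu$ are arbitrary. Smoothness of functionals and of field-valued maps means smoothness along smooth finite-parameter families of fields. A quantity depending on $(t,z)$ *vanishes weakly*, $\approx0$, if it is a linear combination $\int \alpha^I(x)\,\mathfrak C_I(x)\,d^3x$ of the constraints with (possibly distributional) coefficients that depend smoothly on $(t,z)$; in particular it then vanishes where all constraints vanish. **Clocks.** Let $G^\mu=-T^\mu$, where the clocks $T^\mu(x)=T^\mu(q,P,\varphi,\pi_\varphi;t,x)$ do not depend on $N^\mu,\Pi_\mu$ but may depend explicitly on $t$ and $x$. Assume that $T^\mu$ is smooth and that its smearings with test fields have functional derivatives which are smooth fields depending smoothly on all arguments; that $\mathcal A^\mu_\nu(x,y)=\{T^\mu(x),C_\nu(y)\}$,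 as an operator on smooth four-component fields, has a two-sided inverse $\mathcal B$; and that $\mathcal B$ and its transpose map smooth fields to smooth fields and depend smoothly on $t$, the reduced variables and the argument. Assume $$\frac{\partial\mathcal A^\mu_\nu}{\partial t}\approx0 .$$ **Observables.** Put $\dot T^\mu=\partial_tT^\mu+\int\mathcal A^\mu_\nu N^\nu$, $\mathfrak G^I=(G^\mu,\dot G^\mu)=(-T^\mu,-\dot T^\mu)$, let $$\mathfrak B=\begin{pmatrix}\mathcal B&0\\-\mathcal B\{\dot T,C\}\mathcal B&\mathcal B\end{pmatrix}$$ be the inverse of $-\{\mathfrak G^I,\mathfrak C_J\}$ (the $\dot G$–$C$ block being $\{\dot T^\mu,C_\nu\}$), and $\tilde{\mathfrak C}_I(x)=\int\mathfrak B^J_I(y,x)\mathfrak C_J(y)\,d^3y$. For a smooth real functional $f$ on the extended phase space (possibly depending on lapse, shift and their momenta, but not explicitly on $t$) define the formal power series $$\mathcal O_{f,T}=\sum_{n\ge0}\frac1{n!}\int d^3y_1\cdots\int d^3y_n\,\mathfrak G^{I_1}(y_1)\cdots\mathfrak G^{I_n}(y_n)\{\cdots\{f,\tilde{\mathfrak C}_{I_1}(y_1)\},\cdots,\tilde{\mathfrak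 C}_{I_n}(y_n)\}.$$ Let $H_{\rm can}=\int(N^\mu C_\mu+\lambda^\mu\Pi_\mu)$, where the Lagrange multipliers are those fixed by the stability of $\dot G^\mu$, i.e. $\lambda=\mathcal B\big(\partial_t\dot G-\int\{\dot T,C_\rho\}N^\rho\big)$, inserted after Poisson brackets with $H_{\rm can}$ have been taken; and let $\frac{d}{dt}=\partial_t+\{\cdot,H_{\rm can}\}$. **Lemma.** Under these assumptions $$\frac{d\mathcal O_{f,T}}{dt}\approx\mathcal O_{\{f,H_{\rm can}\},T},$$ as formal power series, that is, term by term in $n$. Consequently, at every $t$ and every point where all constraints vanish: if the series $\mathcal O_{f,T}$ may be differentiated term by term, i.e. the series of the total time derivatives of its terms converges unconditionally to $\frac{d}{dt}$ of its sum, then the series $\mathcal O_{\{f,H_{\rm can}\},T}$ converges and its sum is $\frac{d\mathcal O_{f,T}}{dt}$. -/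

import Mathlib

open scoped ContDiff

namespace ADM

noncomputable section

/-! ### Fields on the spatial slice

The spatial slice is the closed three-torus `ℝ³ / ℤ³`; a field is a smooth `ℤ³`-periodic function
of the spatial coordinates. -/

/-- Spatial coordinates. -/
abbrev Pt := Fin 3 → ℝ

/-- Components `t a b` of a two-index spatial tensor at a point. -/
abbrev Tens := Fin 3 → Fin 3 → ℝ

/-- Four components `μ = 0, 1, 2, 3`; `0` is the temporal one (lapse, Hamiltonian constraint) and
`1, 2, 3` are the spatial ones (shift, spatial diffeomorphism constraint). -/
abbrev Four := Fin 4 → ℝ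

/-- Values `(q_ab, P^ab, φ, π)` of the reduced ADM variables at a point. -/
abbrev RedVal := Tens × Tens × ℝ × ℝ

/-- Values `((q_ab, P^ab, φ, π), N^μ, Π_μ)` of the extended ADM variables at a point. -/
abbrev ExtVal := RedVal × Four × Four

/-- Values of an eight-component quantity with index `I`, the first four being paired with the
secondary constraints `C_μ` and the last four with the primary constraints `Π_μ`. -/
abbrev Eight := Four × Four

/-- Smooth periodic fields. -/
def IsField {V : Type*} [NormedAddCommGroup V] [NormedSpace ℝ V] (u : Pt → V) : Prop :=
  ContDiff ℝ ∞ u ∧ ∀ (x : Pt) (i : Fin 3), u (x + Pi.single i 1) = u x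

/-- The unit cell, a fundamental domain of the torus. -/
def cell : Set Pt := Set.Icc 0 1

/-- Partial derivative `∂_i u`. -/
def pd (i : Fin 3) (u : Pt → ℝ) (x : Pt) : ℝ := fderiv ℝ u x (Pi.single i 1)

/-! ### The extended ADM phase space -/

/-- Smooth periodic `(q, P, φ, π)` with symmetric `q_ab` and `P^ab`. -/
def IsRedVariation (v : Pt → RedVal) : Prop :=
  IsField v ∧ ∀ x a b, (v x).1 a b = (v x).1 b a ∧ (v x).2.1 a b = (v x).2.1 b a

/-- The reduced ADM phase space: `q_ab` is a Riemannian metric. -/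
def redPhase : Set (Pt → RedVal) :=
  {z | IsRedVariation z ∧ ∀ x, (Matrix.of (z x).1).PosDef}

/-- The reduced variables `(q, P, φ, π)` of a point of the extended phase space. -/
def red (z : Pt → ExtVal) : Pt → RedVal := fun x => (z x).1

/-- Lapse and shift `N^μ`. -/
def lapseShift (z : Pt → ExtVal) : Pt → Four := fun x => (z x).2.1

/-- The momenta `Π_μ` of lapse and shift. -/
def lapseMom (z : Pt → ExtVal) : Pt → Four := fun x => (z x).2.2

/-- The part of the extended phase space that lies over a set `U` of reduced phase space points;
lapse, shift and their momenta are unrestricted. -/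
def extOver (U : Set (Pt → RedVal)) : Set (Pt → ExtVal) :=
  {z | IsField z ∧ red z ∈ U}

/-- Tangent vectors of the extended phase space. -/
def IsVariation (v : Pt → ExtVal) : Prop := IsField v ∧ IsRedVariation (red v)

/-! ### Smooth functionals

Smoothness of functionals and of field-valued maps is tested on smooth finite-parameter families
of fields. -/

section Smooth

variable {V W : Type*} [NormedAddCommGroup V] [NormedSpace ℝ V]
  [NormedAddCommGroup W] [NormedSpace ℝ W]

/-- `Z` is a smooth `k`-parameter family, defined on the open set `O`, of elements of `D`. -/
def IsPlot {k : ℕ} (O : Set (Fin k → ℝ)) (D : Set (Pt → V)) (Z : (Fin k → ℝ) → Pt → V) : Prop :=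
  IsOpen O ∧ ContDiffOn ℝ ∞ (fun p : (Fin k → ℝ) × Pt => Z p.1 p.2) (O ×ˢ Set.univ) ∧
    ∀ s ∈ O, Z s ∈ D

/-- A real functional `F t z` of the time `t ∈ J` and the field `z ∈ D` is smooth. -/
def SmoothFunctional (J : Set ℝ) (D : Set (Pt → V)) (F : ℝ → (Pt → V) → ℝ) : Prop :=
  ∀ (k : ℕ) (O : Set (Fin k → ℝ)) (Z : (Fin k → ℝ) → Pt → V), IsPlot O D Z →
    ContDiffOn ℝ ∞ (fun p : ℝ × (Fin k → ℝ) => F p.1 (Z p.2)) (J ×ˢ O)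

/-- A field-valued map `Φ t z` of the time `t ∈ J` and the field `z ∈ D` is smooth. -/
def SmoothFieldMap (J : Set ℝ) (D : Set (Pt → V)) (Φ : ℝ → (Pt → V) → Pt → W) : Prop :=
  (∀ t ∈ J, ∀ z ∈ D, IsField (Φ t z)) ∧
  ∀ (k : ℕ) (O : Set (Fin k → ℝ)) (Z : (Fin k → ℝ) → Pt → V), IsPlot O D Z →
    ContDiffOn ℝ ∞ (fun p : ℝ × (Fin k → ℝ) × Pt => Φ p.1 (Z p.2.1) p.2.2)
      (J ×ˢ (O ×ˢ Set.univ))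

/-- Two fields regarded as one. -/
def joint (z : Pt → V) (c : Pt → W) : Pt → V × W := fun x => (z x, c x)

/-- Pairs of an element of `D` and an arbitrary field. -/
def jointDom (D : Set (Pt → V)) : Set (Pt → V × W) :=
  {y | (fun x => (y x).1) ∈ D ∧ IsField (fun x => (y x).2)}

end Smooth

/-- Open subsets of the reduced phase space: their preimages under all smooth families are open. -/
def IsOpenRegion (U : Set (Pt → RedVal)) : Prop :=
  U ⊆ redPhase ∧ ∀ (k : ℕ) (O : Set (Fin k → ℝ)) (Z : (Fin k → ℝ) → Pt → RedVal),
    IsPlot O redPhase Z → IsOpen {s | s ∈ O ∧ Z s ∈ U}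

/-! ### General relativity with a minimally coupled scalar field -/

/-- The coupling constants `κ = 16 π G` and `λ_φ`, and the potential of the scalar field (twice the
usual potential). -/
structure Couplings where
  κ : ℝ
  κ_pos : 0 < κ
  lamφ : ℝ
  lamφ_pos : 0 < lamφ
  pot : ℝ → ℝ
  pot_smooth : ContDiff ℝ ∞ pot

/-- The inverse metric `q^{ab}`. -/
def invMetric (q : Pt → Tens) (x : Pt) (a b : Fin 3) : ℝ := (Matrix.of (q x))⁻¹ a b

/-- `√det q`. -/
def sqrtDet (q : Pt → Tens) (x : Pt) : ℝ := Real.sqrt (Matrix.of (q x)).det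

/-- Christoffel symbols `Γ^c_{ab}`. -/
def christoffel (q : Pt → Tens) (c a b : Fin 3) (x : Pt) : ℝ :=
  (1 / 2) * ∑ d, invMetric q x c d *
    (pd a (fun y => q y d b) x + pd b (fun y => q y d a) x - pd d (fun y => q y a b) x)

/-- Ricci tensor `R_{ab}`. -/
def ricci (q : Pt → Tens) (a b : Fin 3) (x : Pt) : ℝ :=
  ∑ c, (pd c (christoffel q c a b) x - pd b (christoffel q c a c) x) +
    ∑ c, ∑ d, (christoffel q c c d x * christoffel q d a b x -
      christoffel q c b d x * christoffel q d a c x)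

/-- Ricci scalar. -/
def scalarCurv (q : Pt → Tens) (x : Pt) : ℝ := ∑ a, ∑ b, invMetric q x a b * ricci q a b x

/-- The total Hamiltonian constraint `C = C^geo + C^φ`, where
`κ C^geo = (P_ab P^ab - (P^a_a)² / 2) / √q - √q R` and
`C^φ = λ_φ π² / (2 √q) + √q (q^{ab} ∂_a φ ∂_b φ + V(φ)) / (2 λ_φ)`. -/
def hamConstraint (M : Couplings) (z : Pt → RedVal) (x : Pt) : ℝ :=
  let q : Pt → Tens := fun y => (z y).1;
  let P : Tens := (z x).2.1;
  let φ : Pt → ℝ := fun y => (z y).2.2.1;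
  let π : ℝ := (z x).2.2.2;
  (1 / M.κ) * (((∑ a, ∑ b, ∑ c, ∑ d, q x a c * q x b d * P a b * P c d) -
      (1 / 2) * (∑ a, ∑ b, q x a b * P a b) ^ 2) / sqrtDet q x - sqrtDet q x * scalarCurv q x) +
    M.lamφ / (2 * sqrtDet q x) * π ^ 2 +
    sqrtDet q x / (2 * M.lamφ) *
      ((∑ a, ∑ b, invMetric q x a b * pd a φ x * pd b φ x) + M.pot (φ x))

/-- The total spatial diffeomorphism constraint `C_a = -(2/κ) q_ac D_b P^{bc} + π ∂_a φ`; for the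
tensor density `P`, `D_b P^{bc} = ∂_b P^{bc} + Γ^c_{bd} P^{bd}`. -/
def diffConstraint (M : Couplings) (z : Pt → RedVal) (a : Fin 3) (x : Pt) : ℝ :=
  let q : Pt → Tens := fun y => (z y).1;
  let P : Pt → Tens := fun y => (z y).2.1;
  let φ : Pt → ℝ := fun y => (z y).2.2.1;
  let π : ℝ := (z x).2.2.2;
  π * pd a φ x - (2 / M.κ) * (∑ c, q x a c * ((∑ b, pd b (fun y => P y b c) x) +
    ∑ b, ∑ d, christoffel q c b d x * P x b d))

/-- The secondary constraints `C_μ`. -/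
def secondary (M : Couplings) (z : Pt → RedVal) (x : Pt) : Four :=
  Fin.cons (hamConstraint M z x) (fun a => diffConstraint M z a x)

/-- All constraints `ℭ_I = (C_μ, Π_μ)`. -/
def constraints (M : Couplings) (z : Pt → ExtVal) : Pt → Eight :=
  fun x => (secondary M (red z) x, lapseMom z x)

/-- Smeared constraints `∫ (ξ^μ C_μ + ζ^μ Π_μ)` for `σ = (ξ, ζ)`. -/
def smeared (M : Couplings) (σ : Pt → Eight) (z : Pt → ExtVal) : ℝ :=
  ∫ x in cell, ((∑ μ, (σ x).1 μ * (constraints M z x).1 μ) +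
    ∑ μ, (σ x).2 μ * (constraints M z x).2 μ)

/-! ### Poisson brackets -/

/-- Sum of the products of all components. -/
def valDot (v w : ExtVal) : ℝ :=
  (∑ a, ∑ b, v.1.1 a b * w.1.1 a b) + (∑ a, ∑ b, v.1.2.1 a b * w.1.2.1 a b) +
    v.1.2.2.1 * w.1.2.2.1 + v.1.2.2.2 * w.1.2.2.2 +
    (∑ μ, v.2.1 μ * w.2.1 μ) + ∑ μ, v.2.2 μ * w.2.2 μ

/-- `γ` is the functional derivative `δF/δz` of `F` at `z`: it is a smooth field, and
`δF = ∫ γ · v` for all variations `v` of `z`. -/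
def HasFunctionalDeriv (F : (Pt → ExtVal) → ℝ) (z γ : Pt → ExtVal) : Prop :=
  IsVariation γ ∧ ∀ v, IsVariation v →
    HasDerivAt (fun s : ℝ => F (z + s • v)) (∫ x in cell, valDot (γ x) (v x)) 0

open Classical in
/-- The functional derivative (zero if there is none). -/
def functionalDeriv (F : (Pt → ExtVal) → ℝ) (z : Pt → ExtVal) : Pt → ExtVal :=
  if h : ∃ γ, HasFunctionalDeriv F z γ then h.choose else 0

/-- The Hamiltonian vector field of a functional, for the canonical brackets
`{q_ab(x), P^cd(y)} = κ δ^c_(a δ^d_b) δ(x,y)`, `{φ(x), π(y)} = δ(x,y)` and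
`{N^μ(x), Π_ν(y)} = δ^μ_ν δ(x,y)`. -/
def hamVec (M : Couplings) (F : (Pt → ExtVal) → ℝ) (z : Pt → ExtVal) : Pt → ExtVal := fun x =>
  let γ : ExtVal := functionalDeriv F z x;
  ((M.κ • γ.1.2.1, -(M.κ • γ.1.1), γ.1.2.2.2, -γ.1.2.2.1), γ.2.2, -γ.2.1)

/-- The Poisson bracket `{F, H}`: the derivative of `F` along the Hamiltonian vector field of `H`.
Only `H` needs a functional derivative that is a smooth field, so `F` may be the value of a field
at a point. -/
def poisson (M : Couplings) (F H : (Pt → ExtVal) → ℝ) (z : Pt → ExtVal) : ℝ :=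
  deriv (fun s : ℝ => F (z + s • hamVec M H z)) 0

/-! ### Clocks, gauge fixing conditions and abelianized constraints

Clocks are maps `T t z x μ = T^μ(q, P, φ, π; t, x)` of the reduced variables, the time and the
spatial coordinates. A kernel `K^μ_ν(x,y)` is represented by the operator
`ξ ↦ ∫ K^μ_ν(x,y) ξ^ν(y) d³y`. -/

/-- Clocks. -/
abbrev Clock := ℝ → (Pt → RedVal) → Pt → Four

/-- Operators on four-component fields that depend on the time and on the reduced variables. -/
abbrev RedOp := ℝ → (Pt → RedVal) → (Pt → Four) → Pt → Four

/-- `∫ η_μ ξ^μ`. -/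
def pairing (η ξ : Pt → Four) : ℝ := ∫ x in cell, ∑ μ, η x μ * ξ x μ

/-- `𝒜^μ_ν(x,y) = {T^μ(x), C_ν(y)}`, smeared with `ξ^ν(y)`. -/
def clockMatrix (M : Couplings) (T : Clock) (t : ℝ) (z : Pt → ExtVal) (ξ : Pt → Four) :
    Pt → Four :=
  fun x μ => poisson M (fun z' => T t (red z') x μ) (smeared M (fun y => (ξ y, 0))) z

/-- Regularity of the clocks on the times `J` and the region `U` of the reduced phase space:
the clocks are smooth, their smearings have functional derivatives, and the kernel `𝒜` has an
inverse kernel `ℬ`, with transposed kernel `Bt`, acting on smooth fields. -/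
structure IsClockSystem (M : Couplings) (J : Set ℝ) (U : Set (Pt → RedVal)) (T : Clock)
    (B Bt : RedOp) : Prop where
  clock_smooth : SmoothFieldMap J U T
  clock_deriv : ∃ γ : ℝ → (Pt → ExtVal × Four) → Pt → ExtVal,
    SmoothFieldMap J (jointDom (extOver U)) γ ∧
    ∀ t ∈ J, ∀ z ∈ extOver U, ∀ η : Pt → Four, IsField η →
      HasFunctionalDeriv (fun z' => pairing η (T t (red z'))) z (γ t (joint z η))
  inv_smooth : SmoothFieldMap J (jointDom U)
    (fun t (y : Pt → RedVal × Four) => B t (fun x => (y x).1) (fun x => (y x).2))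
  transp_smooth : SmoothFieldMap J (jointDom U)
    (fun t (y : Pt → RedVal × Four) => Bt t (fun x => (y x).1) (fun x => (y x).2))
  right_inv : ∀ t ∈ J, ∀ z ∈ extOver U, ∀ η : Pt → Four, IsField η →
    clockMatrix M T t z (B t (red z) η) = η
  left_inv : ∀ t ∈ J, ∀ z ∈ extOver U, ∀ ξ : Pt → Four, IsField ξ →
    B t (red z) (clockMatrix M T t z ξ) = ξ
  transp : ∀ t ∈ J, ∀ z ∈ U, ∀ η ξ : Pt → Four, IsField η → IsField ξ →
    pairing η (B t z ξ) = pairing (Bt t z η) ξ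

/-- `Ṫ^μ = ∂_t T^μ + ∫ 𝒜^μ_ν N^ν`. -/
def clockDot (M : Couplings) (T : Clock) (t : ℝ) (z : Pt → ExtVal) : Pt → Four :=
  fun x μ => deriv (fun s => T s (red z) x μ) t + clockMatrix M T t z (lapseShift z) x μ

/-- `{Ṫ^μ(x), C_ν(y)}`, smeared with `ξ^ν(y)`. -/
def clockDotMatrix (M : Couplings) (T : Clock) (t : ℝ) (z : Pt → ExtVal) (ξ : Pt → Four) :
    Pt → Four :=
  fun x μ => poisson M (fun z' => clockDot M T t z' x μ) (smeared M (fun y => (ξ y, 0))) z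

/-- `𝔊^I = (G^μ, dG^μ/dt)` with `G^μ = -T^μ`. -/
def gaugeFix (M : Couplings) (T : Clock) (t : ℝ) (z : Pt → ExtVal) : Pt → Eight :=
  fun x => (-T t (red z) x, -clockDot M T t z x)

/-- The inverse `𝔅` of `𝔄^I_J = -{𝔊^I, ℭ_J}`, the lower triangular block matrix with diagonal
blocks `ℬ` and lower left block `-ℬ {Ṫ, C} ℬ`, applied to `β`. -/
def bigB (M : Couplings) (T : Clock) (B : RedOp) (t : ℝ) (z : Pt → ExtVal) (β : Pt → Eight) :
    Pt → Eight :=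
  let β₁ : Pt → Four := B t (red z) (fun x => (β x).1);
  fun x => (β₁ x,
    B t (red z) (fun y => (β y).2) x - B t (red z) (clockDotMatrix M T t z β₁) x)

/-- The abelianized constraints `ℭ̃_I(x) = ∫ 𝔅^J_I(y,x) ℭ_J(y) d³y`, smeared with a phase space
independent `β^I(x)`. -/
def abelianized (M : Couplings) (T : Clock) (B : RedOp) (t : ℝ) (β : Pt → Eight)
    (z : Pt → ExtVal) : ℝ :=
  smeared M (bigB M T B t z β) z

/-! ### The canonical Hamiltonian, observables and their evolution -/

/-- The Lagrange multipliers `λ^μ` that make `dG^μ/dt` stable, that is, the solution of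
`∂_t (dG/dt) - {Ṫ, C_ρ} N^ρ - 𝒜 λ = 0`. -/
def multiplier (M : Couplings) (T : Clock) (B : RedOp) (t : ℝ) (z : Pt → ExtVal) : Pt → Four :=
  B t (red z) (fun x μ => deriv (fun s => -clockDot M T s z x μ) t -
    clockDotMatrix M T t z (lapseShift z) x μ)

/-- `H_can = ∫ (N^μ C_μ + ℓ^μ Π_μ)` with multipliers `ℓ`. -/
def hamCan (M : Couplings) (ℓ : Pt → Four) (z : Pt → ExtVal) : ℝ :=
  smeared M (fun x => (lapseShift z x, ℓ x)) z

/-- `{F, H_can}`, the multipliers being inserted after taking the bracket. -/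
def evolve (M : Couplings) (T : Clock) (B : RedOp) (F : (Pt → ExtVal) → ℝ) (t : ℝ)
    (z : Pt → ExtVal) : ℝ :=
  poisson M F (hamCan M (multiplier M T B t z)) z

/-- The `n`-th term of the formal power series
`𝒪_{f,T} = ∑ₙ (1/n!) ∫…∫ 𝔊^{I₁}(y₁)…𝔊^{Iₙ}(yₙ) {…{f, ℭ̃_{I₁}(y₁)},…, ℭ̃_{Iₙ}(yₙ)}`.
The factors `𝔊` stand outside the brackets: the brackets are taken with the constraints smeared
with a fixed `β`, and afterwards `β` is replaced by the value of `𝔊`. -/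
def obsTerm (M : Couplings) (T : Clock) (B : RedOp) (f : (Pt → ExtVal) → ℝ) (t : ℝ) (n : ℕ)
    (z : Pt → ExtVal) : ℝ :=
  (1 / (n.factorial : ℝ)) *
    ((fun h => poisson M h (abelianized M T B t (gaugeFix M T t z)))^[n] f) z

/-- The total time derivative `∂_t + {·, H_can}` of the `n`-th term of `𝒪_{f,T}`. -/
def obsTermDot (M : Couplings) (T : Clock) (B : RedOp) (f : (Pt → ExtVal) → ℝ) (t : ℝ) (n : ℕ)
    (z : Pt → ExtVal) : ℝ :=
  deriv (fun s => obsTerm M T B f s n z) t + evolve M T B (fun z' => obsTerm M T B f t n z') t z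

/-- The sum of the series `𝒪_{f,T}`. -/
def obs (M : Couplings) (T : Clock) (B : RedOp) (f : (Pt → ExtVal) → ℝ) (t : ℝ)
    (z : Pt → ExtVal) : ℝ :=
  ∑' n, obsTerm M T B f t n z

/-- The total time derivative `∂_t + {·, H_can}` of the sum of the series `𝒪_{f,T}`. -/
def obsDot (M : Couplings) (T : Clock) (B : RedOp) (f : (Pt → ExtVal) → ℝ) (t : ℝ)
    (z : Pt → ExtVal) : ℝ :=
  deriv (fun s => obs M T B f s z) t + evolve M T B (fun z' => obs M T B f t z') t z

/-! ### Weak equality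

A quantity vanishes weakly if it is a linear combination of the constraints `ℭ_I`, with
coefficients that depend smoothly on the time and on the phase space point. -/

/-- The real functional `h` vanishes weakly: `h t z = ∫ α^I(t, z; x) ℭ_I(x)`, the coefficients
`α(t, z; ·)` being allowed to be distributional, i.e. linear functionals on fields. -/
def WeaklyZero (M : Couplings) (J : Set ℝ) (D : Set (Pt → ExtVal))
    (h : ℝ → (Pt → ExtVal) → ℝ) : Prop :=
  ∃ α : ℝ → (Pt → ExtVal × Eight) → ℝ,
    SmoothFunctional J (jointDom D) α ∧
    (∀ t ∈ J, ∀ z ∈ D, ∀ (a : ℝ) (c c' : Pt → Eight), IsField c → IsField c' →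
      α t (joint z (a • c + c')) = a * α t (joint z c) + α t (joint z c')) ∧
    ∀ t ∈ J, ∀ z ∈ D, h t z = α t (joint z (constraints M z))

/-- The operator `K t z` on four-component fields vanishes weakly:
`(K t z ξ)^μ(x) = ∫ α^{μ I}(t, z, ξ; x, y) ℭ_I(y) d³y`. -/
def OpWeaklyZero (M : Couplings) (J : Set ℝ) (D : Set (Pt → ExtVal))
    (K : ℝ → (Pt → ExtVal) → (Pt → Four) → Pt → Four) : Prop :=
  ∃ α : ℝ → (Pt → (ExtVal × Four) × Eight) → Pt → Four,
    SmoothFieldMap J (jointDom (jointDom D)) α ∧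
    (∀ t ∈ J, ∀ z ∈ D, ∀ (a : ℝ) (ξ : Pt → Four) (c c' : Pt → Eight), IsField ξ →
      IsField c → IsField c' →
      α t (joint (joint z ξ) (a • c + c')) =
        a • α t (joint (joint z ξ) c) + α t (joint (joint z ξ) c')) ∧
    ∀ t ∈ J, ∀ z ∈ D, ∀ ξ : Pt → Four, IsField ξ →
      K t z ξ = α t (joint (joint z ξ) (constraints M z))

end

end ADM

namespace ADM

noncomputable section

open scoped ContDiff Topology
open MeasureTheory Set

set_option linter.unusedSectionVars false

section

/-! ### Integrals depending smoothly on parameters -/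

section ParametricIntegral

variable {E Y : Type} [NormedAddCommGroup E] [NormedSpace ℝ E]
  [NormedAddCommGroup Y] [NormedSpace ℝ Y] [MeasurableSpace Y] [BorelSpace Y]

/-! The smearing `β` of the abelianized constraints is promoted to an independent variable. On
triples `(t, β, z)` there are two vector fields. The evolution `A` acts on `(t, z)` as `∂_t + {·,
H_can}` and moves `β = (β₁, β₂)` with velocity `(β₂, 0)`. The gauge flow `B` is the Hamiltonian
vector field of `∫ β^I C̃_I` at fixed `t` and `β`. The `n`-th term of the series for `f` is `(1/n!)
Bⁿ f` restricted to `β = 𝔊`. The multipliers are such that the clocks and their rates `(T, Ṫ)`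
evolve with velocity exactly `(Ṫ, 0)`, so `A` is tangent to the set `β = 𝔊`
(`ClockSystem.dd_gauge_evolution`, `ClockSystem.dd_insert`). Hence the total time derivative of the
`n`-th term is `(1/n!) A Bⁿ f` at `β = 𝔊`, while the `n`-th term for `{f, H_can}` is `(1/n!) Bⁿ A f`
there. It remains to show that `A` and `Bⁿ` commute modulo the constraints.

Both `A` and `B` are, apart from the motion of `t` and `β`, the Hamiltonian flow of the constraints
with a field dependent smearing, plus a weakly vanishing vector field. Since the constraints are
first class, `[A, B]` is again of this form, with some smearing `ρ` (`FirstClass.commutator_flow`).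
To see that `ρ ≈ 0`, apply the commutator to `(T, Ṫ)`: from `A (T, Ṫ) = (Ṫ, 0)` and `B (T, Ṫ) ≈ β`
the result is `A β - B (Ṫ, 0) ≈ (β₂, 0) - (β₂, 0) = 0`, and the bracket of `(T, Ṫ)` with the
constraints is invertible (`FirstClass.commutator_weak`, `ClockSystem.commute`). The passage from
`B` to `Bⁿ` is an induction that uses that derivatives along fields tangent to the constraint
surface preserve weak vanishing (`WZ.dd`, `FirstClass.iterate_weak`). On the constraint surface the
two series then agree term by term, which is the statement about convergence.

Two bodies of work support this. The first is a differential calculus for maps between spaces of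
fields in which smoothness is tested on finite-parameter families; Hadamard's lemma supplies the
chain rule (`Sm.der_comp`). Functional derivatives are handled as transposes of linearizations
(`HasAdj`), and their existence is stable under sums, products, spatial derivatives, brackets and
inversion of operators (`HasAdj.bracket`, `RegOp.inverse`), so that the abelianized constraints have
Hamiltonian vector fields.

The second is the hypersurface deformation algebra (`MetricDom.closure`). It is derived from
identities in a commutative ring with three commuting derivations: Palatini's formula and the
bracket of two Hamiltonian constraints (`DiffMetric.ham_ham`), and the covariance of the constraints
under Lie derivatives (`DiffMetric.lie_constraints`). These hold up to divergences, which integrate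
to zero on the torus. The ring is that of smooth maps from the phase space region to scalar fields.
-/

theorem hasFDerivAt_setIntegral {V : Type} [NormedAddCommGroup V] [NormedSpace ℝ V]
    {μ : Measure Y} [IsFiniteMeasureOnCompacts μ] {K : Set Y} (hK : IsCompact K)
    {Ω : Set (E × Y)} (hΩ : IsOpen Ω) {f : E × Y → V} (hf : ContDiffOn ℝ ∞ f Ω)
    {O : Set E} (hO : IsOpen O) (hOK : O ×ˢ K ⊆ Ω) {e : E} (he : e ∈ O) :
    HasFDerivAt (fun e => ∫ y in K, f (e, y) ∂μ)
      (∫ y in K, (fderiv ℝ f (e, y)).comp (ContinuousLinearMap.inl ℝ E Y) ∂μ) e := by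
  have hcont : ContinuousOn (fun p : E × Y => (fderiv ℝ f p).comp
      (ContinuousLinearMap.inl ℝ E Y)) Ω :=
    (hf.continuousOn_fderiv_of_isOpen hΩ (by simp)).clm_comp continuousOn_const
  have hslice : ∀ e' ∈ O, MapsTo (fun y : Y => (e', y)) K Ω := fun e' he' y hy => hOK ⟨he', hy⟩
  have hF : ∀ e' ∈ O, ContinuousOn (fun y => f (e', y)) K := fun e' he' =>
    hf.continuousOn.comp (by fun_prop) (hslice e' he')
  have hF' : ContinuousOn (fun y => (fderiv ℝ f (e, y)).comp
      (ContinuousLinearMap.inl ℝ E Y)) K :=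
    hcont.comp (f := fun y : Y => (e, y)) (by fun_prop) (hslice e he)
  obtain ⟨C, hC⟩ := hK.exists_bound_of_continuousOn hF'
  have hopen : IsOpen (Ω ∩ (fun p : E × Y => ‖(fderiv ℝ f p).comp
      (ContinuousLinearMap.inl ℝ E Y)‖) ⁻¹' Iio (C + 1)) :=
    hcont.norm.isOpen_inter_preimage hΩ isOpen_Iio
  -- The tube lemma makes the bound on the derivative, valid over `K` at the single parameter `e`,
  -- hold up to `1` on a whole neighbourhood of `e`; this constant is the dominating function.
  obtain ⟨u, v, hu, hv, heu, hKv, huv⟩ := generalized_tube_lemma (isCompact_singleton (x := e)) hK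
    hopen (by
      rintro ⟨e', y⟩ ⟨he', hy⟩
      rw [mem_singleton_iff] at he'
      simp only at he' hy
      subst he'
      exact ⟨hOK ⟨he, hy⟩, (hC y hy).trans_lt (lt_add_one C)⟩)
  have hs : O ∩ u ∈ 𝓝 e := Filter.inter_mem (hO.mem_nhds he) (hu.mem_nhds (heu rfl))
  refine hasFDerivAt_integral_of_dominated_of_fderiv_le (bound := fun _ => C + 1) (s := O ∩ u)
    (F' := fun e' y => (fderiv ℝ f (e', y)).comp (ContinuousLinearMap.inl ℝ E Y)) hs ?_ ?_ ?_ ?_ ?_ ?_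
  · filter_upwards [hO.mem_nhds he] with e' he'
    exact (hF e' he').aestronglyMeasurable_of_isCompact hK hK.measurableSet
  · exact (hF e he).integrableOn_compact hK
  · exact hF'.aestronglyMeasurable_of_isCompact hK hK.measurableSet
  · refine (ae_restrict_iff' hK.measurableSet).2 (Filter.Eventually.of_forall ?_)
    intro y hy e' he'
    exact (huv (⟨he'.2, hKv hy⟩ : (e', y) ∈ u ×ˢ v)).2.le
  · exact integrableOn_const hK.measure_lt_top.ne
  · refine (ae_restrict_iff' hK.measurableSet).2 (Filter.Eventually.of_forall ?_)
    intro y hy e' he'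
    have h1 : HasFDerivAt f (fderiv ℝ f (e', y)) (e', y) :=
      ((hf.contDiffAt (hΩ.mem_nhds (hOK ⟨he'.1, hy⟩))).differentiableAt (by simp)).hasFDerivAt
    exact h1.comp e' (hasFDerivAt_prodMk_left e' y)

/-- The derivative of such an integral is an integral of the same kind with values in a space of
linear maps, so one inducts on the order of differentiability with the target space left free. -/
theorem contDiffOn_setIntegral {V : Type} [NormedAddCommGroup V] [NormedSpace ℝ V]
    {μ : Measure Y} [IsFiniteMeasureOnCompacts μ] {K : Set Y} (hK : IsCompact K)
    {Ω : Set (E × Y)} (hΩ : IsOpen Ω) {f : E × Y → V} (hf : ContDiffOn ℝ ∞ f Ω)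
    {O : Set E} (hO : IsOpen O) (hOK : O ×ˢ K ⊆ Ω) :
    ContDiffOn ℝ ∞ (fun e => ∫ y in K, f (e, y) ∂μ) O := by
  rw [contDiffOn_infty]
  intro n
  induction n generalizing V with
  | zero =>
    rw [Nat.cast_zero, contDiffOn_zero]
    exact fun e he => (hasFDerivAt_setIntegral hK hΩ hf hO hOK he).continuousAt.continuousWithinAt
  | succ n ih =>
    have hd := fun e he => hasFDerivAt_setIntegral (μ := μ) hK hΩ hf hO hOK (e := e) he
    rw [Nat.cast_succ, contDiffOn_succ_iff_fderiv_of_isOpen hO]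
    refine ⟨fun e he => (hd e he).differentiableAt.differentiableWithinAt, by simp, ?_⟩
    refine (ih (f := fun p => (fderiv ℝ f p).comp (ContinuousLinearMap.inl ℝ E Y)) ?_).congr
      fun e he => (hd e he).fderiv
    exact (hf.fderiv_of_isOpen hΩ (by simp)).clm_comp contDiffOn_const

end ParametricIntegral

end

/-! ### Values of fields -/

/-- Value spaces of fields: a subspace `sym` of admissible values and an inner product. -/
class FVal (V : Type) [NormedAddCommGroup V] [NormedSpace ℝ V] where
  finiteDim : FiniteDimensional ℝ V
  sym : Submodule ℝ V
  dot : V → V → ℝ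
  dot_add_left : ∀ u v w, dot (u + v) w = dot u w + dot v w
  dot_smul_left : ∀ (a : ℝ) v w, dot (a • v) w = a * dot v w
  dot_comm : ∀ v w, dot v w = dot w v
  dot_self_nonneg : ∀ v, 0 ≤ dot v v
  dot_self_eq_zero : ∀ v, dot v v = 0 → v = 0
  dot_contDiff : ContDiff ℝ ∞ (fun p : V × V => dot p.1 p.2)

attribute [instance] FVal.finiteDim

open FVal (sym dot)

instance : FVal ℝ where
  finiteDim := inferInstance
  sym := ⊤
  dot v w := v * w
  dot_add_left := add_mul
  dot_smul_left := mul_assoc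
  dot_comm := mul_comm
  dot_self_nonneg := mul_self_nonneg
  dot_self_eq_zero _ := mul_self_eq_zero.1
  dot_contDiff := by fun_prop

instance : FVal (Fin 4 → ℝ) where
  finiteDim := inferInstance
  sym := ⊤
  dot v w := ∑ μ, v μ * w μ
  dot_add_left u v w := by simp [add_mul, Finset.sum_add_distrib]
  dot_smul_left a v w := by simp [mul_assoc, Finset.mul_sum]
  dot_comm v w := by simp [mul_comm]
  dot_self_nonneg v := Finset.sum_nonneg fun μ _ => mul_self_nonneg (v μ)
  dot_self_eq_zero v h := by
    rw [Finset.sum_eq_zero_iff_of_nonneg fun μ _ => mul_self_nonneg (v μ)] at h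
    exact funext fun μ => mul_self_eq_zero.1 (h μ (Finset.mem_univ μ))
  dot_contDiff := by fun_prop

/-- Two-index tensors occur only as symmetric ones. Restricting admissible values to the symmetric
subspace makes functional derivatives with respect to `q` and `P` unique. -/
instance : FVal (Fin 3 → Fin 3 → ℝ) where
  finiteDim := inferInstance
  sym :=
    { carrier := {v | ∀ a b, v a b = v b a}
      add_mem' := fun hv hw a b => by simp [hv a b, hw a b]
      zero_mem' := fun _ _ => rfl
      smul_mem' := fun c v hv a b => by simp [hv a b] }
  dot v w := ∑ a, ∑ b, v a b * w a b
  dot_add_left u v w := by simp [add_mul, Finset.sum_add_distrib]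
  dot_smul_left a v w := by simp [mul_assoc, Finset.mul_sum]
  dot_comm v w := by simp [mul_comm]
  dot_self_nonneg v :=
    Finset.sum_nonneg fun a _ => Finset.sum_nonneg fun b _ => mul_self_nonneg (v a b)
  dot_self_eq_zero v h := by
    rw [Finset.sum_eq_zero_iff_of_nonneg fun a _ =>
      Finset.sum_nonneg fun b _ => mul_self_nonneg (v a b)] at h
    refine funext fun a => funext fun b => ?_
    have ha := h a (Finset.mem_univ a)
    rw [Finset.sum_eq_zero_iff_of_nonneg fun b _ => mul_self_nonneg (v a b)] at ha
    exact mul_self_eq_zero.1 (ha b (Finset.mem_univ b))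
  dot_contDiff := by fun_prop

section Values

variable {V W : Type} [NormedAddCommGroup V] [NormedSpace ℝ V] [FVal V]
  [NormedAddCommGroup W] [NormedSpace ℝ W] [FVal W]

instance : FVal (V × W) where
  finiteDim := inferInstance
  sym := (sym : Submodule ℝ V).prod sym
  dot v w := dot v.1 w.1 + dot v.2 w.2
  dot_add_left u v w := by simp only [Prod.fst_add, Prod.snd_add, FVal.dot_add_left]; ring
  dot_smul_left a v w := by simp only [Prod.smul_fst, Prod.smul_snd, FVal.dot_smul_left]; ring
  dot_comm v w := by rw [FVal.dot_comm v.1, FVal.dot_comm v.2]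
  dot_self_nonneg v := add_nonneg (FVal.dot_self_nonneg _) (FVal.dot_self_nonneg _)
  dot_self_eq_zero v h := by
    rw [add_eq_zero_iff_of_nonneg (FVal.dot_self_nonneg _) (FVal.dot_self_nonneg _)] at h
    exact Prod.ext (FVal.dot_self_eq_zero _ h.1) (FVal.dot_self_eq_zero _ h.2)
  dot_contDiff :=
    (FVal.dot_contDiff.comp (f := fun p : (V × W) × (V × W) => (p.1.1, p.2.1)) (by fun_prop)).add
      (FVal.dot_contDiff.comp (f := fun p : (V × W) × (V × W) => (p.1.2, p.2.2)) (by fun_prop))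

/-- Difference quotients lie in the subspace, which is closed because the value space is finite
dimensional; where there is no derivative, the default value `0` lies in it too. -/
theorem deriv_mem_sym {f : ℝ → V} {O : Set ℝ} (hO : IsOpen O) {s : ℝ} (hs : s ∈ O)
    (hf : ∀ u ∈ O, f u ∈ (sym : Submodule ℝ V)) : deriv f s ∈ (sym : Submodule ℝ V) := by
  by_cases hd : DifferentiableAt ℝ f s
  · have hcl : IsClosed ((sym : Submodule ℝ V) : Set V) := Submodule.closed_of_finiteDimensional _
    refine hcl.mem_of_tendsto (hasDerivAt_iff_tendsto_slope.1 hd.hasDerivAt) ?_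
    filter_upwards [nhdsWithin_le_nhds (hO.mem_nhds hs)] with u hu
    rw [slope_def_module]
    exact Submodule.smul_mem _ _ (Submodule.sub_mem _ (hf u hu) (hf s hs))
  · rw [deriv_zero_of_not_differentiableAt hd]
    exact Submodule.zero_mem _

end Values

/-! ### Diffeological vector spaces -/

/-- Real vector spaces with a notion of smooth finite-parameter families (plots), of derivatives of
one-parameter families, and with a separating family of functionals. -/
class DVS (X : Type) [AddCommGroup X] [Module ℝ X] where
  pl : ∀ {E : Type} [NormedAddCommGroup E] [NormedSpace ℝ E], Set E → (E → X) → Prop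
  pl_comp : ∀ {E F : Type} [NormedAddCommGroup E] [NormedSpace ℝ E] [NormedAddCommGroup F]
    [NormedSpace ℝ F] {O : Set E} {O' : Set F} {p : E → X} {g : F → E}, pl O p →
    ContDiffOn ℝ ∞ g O' → MapsTo g O' O → pl O' (fun e => p (g e))
  pl_congr : ∀ {E : Type} [NormedAddCommGroup E] [NormedSpace ℝ E] {O : Set E} {p p' : E → X},
    pl O p → (∀ e ∈ O, p' e = p e) → pl O p'
  pl_add : ∀ {E : Type} [NormedAddCommGroup E] [NormedSpace ℝ E] {O : Set E} {p p' : E → X},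
    pl O p → pl O p' → pl O (fun e => p e + p' e)
  pl_smul : ∀ {E : Type} [NormedAddCommGroup E] [NormedSpace ℝ E] {O : Set E} {p : E → X}
    {a : E → ℝ}, ContDiffOn ℝ ∞ a O → pl O p → pl O (fun e => a e • p e)
  pl_zero : ∀ {E : Type} [NormedAddCommGroup E] [NormedSpace ℝ E] {O : Set E},
    pl O (fun _ : E => (0 : X))
  Idx : Type
  ev : Idx → X →ₗ[ℝ] ℝ
  ev_ext : ∀ {x y : X}, (∀ i, ev i x = ev i y) → x = y
  pl_ev : ∀ {E : Type} [NormedAddCommGroup E] [NormedSpace ℝ E] {O : Set E} {p : E → X} (i : Idx),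
    pl O p → ContDiffOn ℝ ∞ (fun e => ev i (p e)) O
  der : (ℝ → X) → X
  ev_der : ∀ {O : Set ℝ} {p : ℝ → X} (i : Idx), IsOpen O → 0 ∈ O → pl O p →
    ev i (der p) = deriv (fun s => ev i (p s)) 0
  pl_der : ∀ {E : Type} [NormedAddCommGroup E] [NormedSpace ℝ E] {O : Set (E × ℝ)}
    {p : E × ℝ → X}, IsOpen O → pl O p → pl O (fun e => der (fun u => p (e.1, e.2 + u)))
  -- No topology on `X` is assumed, so the chain rule cannot come from a linear approximation with
  -- small remainder. A smooth quotient `h` along each curve takes its place.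
  hadamard : ∀ {O : Set ℝ} {p : ℝ → X}, IsOpen O → 0 ∈ O → pl O p →
    ∃ (O' : Set ℝ) (h : ℝ → X), IsOpen O' ∧ 0 ∈ O' ∧ pl O' h ∧ ∀ s ∈ O', p s = p 0 + s • h s

open DVS (pl der ev)

section HadamardLemma

variable {V : Type} [NormedAddCommGroup V] [NormedSpace ℝ V] [FiniteDimensional ℝ V]

/-- Hadamard's lemma with parameters. -/
theorem hadamard_contDiffOn {Y : Type} [NormedAddCommGroup Y] [NormedSpace ℝ Y]
    {ε : ℝ} (hε : 0 < ε) {P : ℝ × Y → V}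
    (hP : ContDiffOn ℝ ∞ P (Metric.ball 0 ε ×ˢ univ)) :
    ∃ h : ℝ × Y → V, ContDiffOn ℝ ∞ h (Metric.ball 0 ε ×ˢ univ) ∧
      (∀ s ∈ Metric.ball (0 : ℝ) ε, ∀ y, P (s, y) = P (0, y) + s • h (s, y)) ∧
      ∀ y, h (0, y) = deriv (fun s => P (s, y)) 0 := by
  have : CompleteSpace V := FiniteDimensional.complete ℝ V
  have hO : IsOpen (Metric.ball (0 : ℝ) ε ×ˢ (univ : Set Y)) := Metric.isOpen_ball.prod isOpen_univ
  set P' : ℝ × Y → V := fun p => fderiv ℝ P p (1, 0) with hP'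
  have hP's : ContDiffOn ℝ ∞ P' (Metric.ball 0 ε ×ˢ univ) :=
    (hP.fderiv_of_isOpen hO (by simp)).clm_apply contDiffOn_const
  have hder : ∀ s ∈ Metric.ball (0 : ℝ) ε, ∀ y, HasDerivAt (fun u => P (u, y)) (P' (s, y)) s := by
    intro s hs y
    have h1 : HasFDerivAt P (fderiv ℝ P (s, y)) (s, y) :=
      ((hP.contDiffAt (hO.mem_nhds ⟨hs, mem_univ _⟩)).differentiableAt (by simp)).hasFDerivAt
    exact h1.comp_hasDerivAt s ((hasDerivAt_id s).prodMk (hasDerivAt_const s y))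
  have hseg : ∀ s ∈ Metric.ball (0 : ℝ) ε, ∀ τ ∈ Icc (0 : ℝ) 1, τ * s ∈ Metric.ball (0 : ℝ) ε := by
    intro s hs τ hτ
    rw [mem_ball_zero_iff] at hs ⊢
    rw [norm_mul, Real.norm_of_nonneg hτ.1]
    exact (mul_le_of_le_one_left (norm_nonneg s) hτ.2).trans_lt hs
  -- The quotient is the average of the partial derivative over the segment from `0` to `s`;
  -- smoothness up to `s = 0` is then smoothness of a parametric integral.
  refine ⟨fun p => ∫ τ in Icc (0 : ℝ) 1, P' (τ * p.1, p.2), ?_, ?_, ?_⟩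
  · have hg : Continuous (fun p : (ℝ × Y) × ℝ => p.2 * p.1.1) := by fun_prop
    refine contDiffOn_setIntegral (E := ℝ × Y) (f := fun p : (ℝ × Y) × ℝ => P' (p.2 * p.1.1, p.1.2))
      isCompact_Icc (Ω := (fun p : (ℝ × Y) × ℝ => p.2 * p.1.1) ⁻¹' Metric.ball 0 ε)
      (Metric.isOpen_ball.preimage hg) ?_ hO ?_
    · exact hP's.comp (f := fun p : (ℝ × Y) × ℝ => (p.2 * p.1.1, p.1.2)) (by fun_prop)
        fun p hp => ⟨hp, mem_univ _⟩
    · rintro ⟨⟨s, y⟩, τ⟩ ⟨⟨hs, -⟩, hτ⟩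
      exact hseg s hs τ hτ
  · intro s hs y
    have hder' : ∀ τ ∈ uIcc (0 : ℝ) 1,
        HasDerivAt (fun τ => P (τ * s, y)) (s • P' (τ * s, y)) τ := by
      intro τ hτ
      rw [uIcc_of_le zero_le_one] at hτ
      have := (hder (τ * s) (hseg s hs τ hτ) y).scomp τ ((hasDerivAt_id τ).mul_const s)
      simpa [Function.comp_def] using this
    have hcont : ContinuousOn (fun τ : ℝ => s • P' (τ * s, y)) (uIcc 0 1) := by
      rw [uIcc_of_le zero_le_one]
      refine ContinuousOn.const_smul ?_ s
      exact hP's.continuousOn.comp (f := fun τ : ℝ => (τ * s, y)) (by fun_prop)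
        fun τ hτ => ⟨hseg s hs τ hτ, mem_univ _⟩
    have := intervalIntegral.integral_eq_sub_of_hasDerivAt hder' hcont.intervalIntegrable
    rw [intervalIntegral.integral_smul, intervalIntegral.integral_of_le zero_le_one,
      ← integral_Icc_eq_integral_Ioc] at this
    simp only [one_mul, zero_mul] at this
    simp only [this]
    abel
  · intro y
    have := (hder 0 (Metric.mem_ball_self hε) y).deriv
    simp [this]

end HadamardLemma

instance : DVS ℝ where
  pl O p := ContDiffOn ℝ ∞ p O
  pl_comp hp hg h := hp.comp hg h
  pl_congr hp h := hp.congr h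
  pl_add hp hp' := hp.add hp'
  pl_smul ha hp := ha.smul hp
  pl_zero := contDiffOn_const
  Idx := Unit
  ev _ := LinearMap.id
  ev_ext h := h ()
  pl_ev _ hp := hp
  der p := deriv p 0
  ev_der _ _ _ _ := rfl
  pl_der {E} _ _ O p hO hp := by
    refine ((hp.fderiv_of_isOpen hO (m := ∞) (by simp)).clm_apply
      (contDiffOn_const (c := ((0 : E), (1 : ℝ))))).congr ?_
    rintro ⟨e, s⟩ he
    have h1 : HasFDerivAt p (fderiv ℝ p (e, s)) (e, s + 0) := by
      rw [add_zero]
      exact ((hp.contDiffAt (hO.mem_nhds he)).differentiableAt (by simp)).hasFDerivAt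
    exact (h1.comp_hasDerivAt 0 ((hasDerivAt_const (0 : ℝ) e).prodMk
      ((hasDerivAt_id (0 : ℝ)).const_add s))).deriv
  hadamard {O p} hO h0 hp := by
    obtain ⟨ε, hε, hb⟩ := Metric.isOpen_iff.1 hO 0 h0
    obtain ⟨h, hh, hP, -⟩ := hadamard_contDiffOn (Y := ℝ) hε (P := fun q => p q.1)
      (hp.comp contDiffOn_fst fun q hq => hb hq.1)
    refine ⟨Metric.ball 0 ε, fun s => h (s, 0), Metric.isOpen_ball, Metric.mem_ball_self hε, ?_,
      fun s hs => hP s hs 0⟩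
    exact hh.comp (f := fun s : ℝ => (s, (0 : ℝ))) (by fun_prop) fun s hs => ⟨hs, mem_univ _⟩

section Product

variable {X Y : Type} [AddCommGroup X] [Module ℝ X] [DVS X] [AddCommGroup Y] [Module ℝ Y] [DVS Y]

instance : DVS (X × Y) where
  pl O p := pl O (fun e => (p e).1) ∧ pl O (fun e => (p e).2)
  pl_comp {_ _} _ _ _ _ {_ _ p g} hp hg h :=
    ⟨DVS.pl_comp (p := fun e => (p e).1) (g := g) hp.1 hg h,
      DVS.pl_comp (p := fun e => (p e).2) (g := g) hp.2 hg h⟩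
  pl_congr hp h := ⟨DVS.pl_congr hp.1 fun e he => by rw [h e he],
    DVS.pl_congr hp.2 fun e he => by rw [h e he]⟩
  pl_add hp hp' := ⟨DVS.pl_add hp.1 hp'.1, DVS.pl_add hp.2 hp'.2⟩
  pl_smul ha hp := ⟨DVS.pl_smul ha hp.1, DVS.pl_smul ha hp.2⟩
  pl_zero := ⟨DVS.pl_zero, DVS.pl_zero⟩
  Idx := DVS.Idx X ⊕ DVS.Idx Y
  ev i := i.elim (fun j => (ev j).comp (LinearMap.fst ℝ X Y))
    (fun j => (ev j).comp (LinearMap.snd ℝ X Y))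
  ev_ext h := Prod.ext (DVS.ev_ext fun i => h (Sum.inl i)) (DVS.ev_ext fun i => h (Sum.inr i))
  pl_ev i hp := by
    cases i with
    | inl j => exact DVS.pl_ev j hp.1
    | inr j => exact DVS.pl_ev j hp.2
  der p := (der fun s => (p s).1, der fun s => (p s).2)
  ev_der i hO h0 hp := by
    cases i with
    | inl j => exact DVS.ev_der j hO h0 hp.1
    | inr j => exact DVS.ev_der j hO h0 hp.2
  pl_der hO hp := ⟨DVS.pl_der hO hp.1, DVS.pl_der hO hp.2⟩
  hadamard {O p} hO h0 hp := by
    obtain ⟨O₁, h₁, hO₁, m₁, p₁, e₁⟩ := DVS.hadamard hO h0 hp.1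
    obtain ⟨O₂, h₂, hO₂, m₂, p₂, e₂⟩ := DVS.hadamard hO h0 hp.2
    refine ⟨O₁ ∩ O₂, fun s => (h₁ s, h₂ s), hO₁.inter hO₂, ⟨m₁, m₂⟩,
      ⟨DVS.pl_comp (p := h₁) (g := fun s => s) p₁ contDiffOn_id fun s hs => hs.1,
        DVS.pl_comp (p := h₂) (g := fun s => s) p₂ contDiffOn_id fun s hs => hs.2⟩,
      fun s hs => Prod.ext (e₁ s hs.1) (e₂ s hs.2)⟩

end Product

section Fields

theorem hasDerivAt_slice {V : Type} [NormedAddCommGroup V] [NormedSpace ℝ V] {E : Type}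
    [NormedAddCommGroup E] [NormedSpace ℝ E] {Ω : Set (E × Pt)}
    (hΩ : IsOpen Ω) {P : E × Pt → V} (hP : ContDiffOn ℝ ∞ P Ω) {g : ℝ → E} {g' : E} {s : ℝ} {x : Pt}
    (hg : HasDerivAt g g' s) (hs : (g s, x) ∈ Ω) :
    HasDerivAt (fun u => P (g u, x)) (fderiv ℝ P (g s, x) (g', 0)) s := by
  have h1 : HasFDerivAt P (fderiv ℝ P (g s, x)) (g s, x) :=
    ((hP.contDiffAt (hΩ.mem_nhds hs)).differentiableAt (by simp)).hasFDerivAt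
  exact h1.comp_hasDerivAt s (hg.prodMk (hasDerivAt_const s x))

variable {V : Type} [NormedAddCommGroup V] [NormedSpace ℝ V] [FVal V]

/-- Periodic functions with admissible values. -/
def admissible : Set (Pt → V) :=
  {u | ∀ x, (∀ i, u (x + Pi.single i 1) = u x) ∧ u x ∈ (sym : Submodule ℝ V)}

theorem deriv_mem_admissible {O : Set ℝ} (hO : IsOpen O) {s : ℝ} (hs : s ∈ O) {p : ℝ → Pt → V}
    (hp : ∀ u ∈ O, p u ∈ (admissible : Set (Pt → V))) :
    (fun x => deriv (fun u => p u x) s) ∈ (admissible : Set (Pt → V)) := by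
  intro x
  refine ⟨fun i => ?_, deriv_mem_sym hO hs fun u hu => (hp u hu x).2⟩
  refine Filter.EventuallyEq.deriv_eq ?_
  filter_upwards [hO.mem_nhds hs] with u hu using (hp u hu x).1 i

/-- Plots are families that are jointly smooth in the parameter and the spatial point and whose
members are periodic with admissible values. Derivatives are taken pointwise, and the separating
functionals are linear functionals of the value at one point. -/
instance : DVS (Pt → V) where
  pl {E} _ _ O p := ContDiffOn ℝ ∞ (fun q : E × Pt => p q.1 q.2) (O ×ˢ univ) ∧
    ∀ e ∈ O, p e ∈ (admissible : Set (Pt → V))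
  pl_comp {E F} _ _ _ _ O O' p g hp hg h :=
    ⟨hp.1.comp (f := fun q : F × Pt => (g q.1, q.2))
      ((hg.comp contDiffOn_fst fun q hq => hq.1).prodMk contDiffOn_snd)
      fun q hq => ⟨h hq.1, mem_univ _⟩, fun e he => hp.2 _ (h he)⟩
  pl_congr hp h := ⟨hp.1.congr fun q hq => by rw [h q.1 hq.1], fun e he => by
    rw [h e he]; exact hp.2 e he⟩
  pl_add hp hp' := ⟨hp.1.add hp'.1, fun e he x => ⟨fun i => by
    simp only [Pi.add_apply, (hp.2 e he x).1 i, (hp'.2 e he x).1 i],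
    Submodule.add_mem _ (hp.2 e he x).2 (hp'.2 e he x).2⟩⟩
  pl_smul ha hp := ⟨(ha.comp contDiffOn_fst fun q hq => hq.1).smul hp.1, fun e he x => ⟨fun i => by
    simp only [Pi.smul_apply, (hp.2 e he x).1 i], Submodule.smul_mem _ _ (hp.2 e he x).2⟩⟩
  pl_zero := ⟨contDiffOn_const, fun _ _ _ => ⟨fun _ => rfl, Submodule.zero_mem _⟩⟩
  Idx := Pt × (V →L[ℝ] ℝ)
  ev i := (i.2 : V →ₗ[ℝ] ℝ).comp (LinearMap.proj i.1)
  ev_ext {u v} h := by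
    funext x
    exact (SeparatingDual.eq_iff_forall_dual_eq (R := ℝ)).2 fun φ => h (x, φ)
  pl_ev {E} _ _ O p i hp := i.2.contDiff.comp_contDiffOn
    (hp.1.comp (f := fun e : E => (e, i.1)) (by fun_prop) fun e he => ⟨he, mem_univ _⟩)
  der p := fun x => deriv (fun s => p s x) 0
  ev_der {O p} i hO h0 hp := by
    have := hasDerivAt_slice (hO.prod isOpen_univ) hp.1 (hasDerivAt_id (0 : ℝ)) (x := i.1)
      ⟨h0, mem_univ _⟩
    have h2 := (i.2.hasFDerivAt.comp_hasDerivAt 0 this).deriv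
    exact (congrArg i.2 this.deriv).trans h2.symm
  pl_der {E} _ _ O p hO hp := by
    constructor
    · refine ((hp.1.fderiv_of_isOpen (hO.prod isOpen_univ) (m := ∞) (by simp)).clm_apply
        (contDiffOn_const (c := (((0 : E), (1 : ℝ)), (0 : Pt))))).congr ?_
      rintro ⟨⟨e, s⟩, x⟩ he
      have := hasDerivAt_slice (hO.prod isOpen_univ) hp.1 (x := x) (s := 0)
        ((hasDerivAt_const (0 : ℝ) e).prodMk ((hasDerivAt_id (0 : ℝ)).const_add s))
        (by simpa using he)
      simpa using this.deriv
    · rintro ⟨e, s⟩ he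
      have hc : Continuous (fun u : ℝ => (e, s + u)) := by fun_prop
      exact deriv_mem_admissible (hO.preimage hc) (s := 0) (by simpa using he)
        (p := fun u => p (e, s + u)) fun u hu => hp.2 _ hu
  hadamard {O p} hO h0 hp := by
    obtain ⟨ε, hε, hb⟩ := Metric.isOpen_iff.1 hO 0 h0
    obtain ⟨h, hh, hP, hz⟩ := hadamard_contDiffOn (Y := Pt) hε (P := fun q => p q.1 q.2)
      (hp.1.mono (prod_mono hb subset_rfl))
    have heq : ∀ s ∈ Metric.ball (0 : ℝ) ε, p s = p 0 + s • fun x => h (s, x) := fun s hs =>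
      funext fun x => hP s hs x
    refine ⟨Metric.ball 0 ε, fun s x => h (s, x), Metric.isOpen_ball, Metric.mem_ball_self hε,
      ⟨hh, fun s hs => ?_⟩, heq⟩
    -- Admissibility of the Hadamard quotient: for `s ≠ 0` it is a difference quotient of admissible
    -- fields, at `s = 0` it is the derivative.
    by_cases hs0 : s = 0
    · subst hs0
      have := deriv_mem_admissible hO h0 hp.2
      convert this using 2 with x
      exact hz x
    · have h1 : (fun x => h (s, x)) = s⁻¹ • (p s - p 0) := by
        rw [heq s hs, add_sub_cancel_left, smul_smul, inv_mul_cancel₀ hs0, one_smul]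
      refine (show (fun x => h (s, x)) ∈ admissible from ?_)
      rw [h1]
      intro x
      have a1 := hp.2 s (hb hs) x
      have a0 := hp.2 0 h0 x
      exact ⟨fun i => by simp only [Pi.smul_apply, Pi.sub_apply, a1.1 i, a0.1 i],
        Submodule.smul_mem _ _ (Submodule.sub_mem _ a1.2 a0.2)⟩

end Fields

section

/-! ### Differential calculus on diffeological vector spaces -/

section Plane

variable {O : Set (ℝ × ℝ)} {q : ℝ × ℝ → ℝ}

theorem hasDerivAt_plane (hO : IsOpen O) (hq : ContDiffOn ℝ ∞ q O) {g : ℝ → ℝ × ℝ} {g' : ℝ × ℝ}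
    {s : ℝ} (hg : HasDerivAt g g' s) (hs : g s ∈ O) :
    HasDerivAt (fun u => q (g u)) (fderiv ℝ q (g s) g') s :=
  (((hq.contDiffAt (hO.mem_nhds hs)).differentiableAt (by simp)).hasFDerivAt).comp_hasDerivAt s hg

/-- This two-variable chain rule is the source of both the additivity of directional derivatives and
the chain rule for maps between spaces of fields. -/
theorem deriv_diagonal (hO : IsOpen O) (h0 : (0, 0) ∈ O) (hq : ContDiffOn ℝ ∞ q O) :
    deriv (fun s => q (s, s)) 0 = deriv (fun s => q (s, 0)) 0 + deriv (fun s => q (0, s)) 0 := by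
  have h1 := (hasDerivAt_plane hO hq ((hasDerivAt_id' (0 : ℝ)).prodMk (hasDerivAt_id' 0)) h0).deriv
  have h2 := (hasDerivAt_plane hO hq
    ((hasDerivAt_id' (0 : ℝ)).prodMk (hasDerivAt_const (0 : ℝ) (0 : ℝ))) h0).deriv
  have h3 := (hasDerivAt_plane hO hq
    ((hasDerivAt_const (0 : ℝ) (0 : ℝ)).prodMk (hasDerivAt_id' (0 : ℝ))) h0).deriv
  rw [h1, h2, h3, ← map_add]
  simp

theorem deriv_deriv_comm (hO : IsOpen O) (h0 : (0, 0) ∈ O) (hq : ContDiffOn ℝ ∞ q O) :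
    deriv (fun a => deriv (fun b => q (a, b)) 0) 0 =
      deriv (fun b => deriv (fun a => q (a, b)) 0) 0 := by
  have hq' : ContDiffOn ℝ ∞ (fderiv ℝ q) O := hq.fderiv_of_isOpen hO (by simp)
  have hd : HasFDerivAt (fderiv ℝ q) (fderiv ℝ (fderiv ℝ q) (0, 0)) (0, 0) :=
    ((hq'.contDiffAt (hO.mem_nhds h0)).differentiableAt (by simp)).hasFDerivAt
  have hsymm : IsSymmSndFDerivAt ℝ q (0, 0) :=
    (hq.contDiffAt (hO.mem_nhds h0)).isSymmSndFDerivAt (by simpa using ENat.LEInfty.out)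
  have e1 : (fun a => deriv (fun b => q (a, b)) 0) =ᶠ[𝓝 0] fun a => fderiv ℝ q (a, 0) (0, 1) := by
    have : ∀ᶠ a : ℝ in 𝓝 0, (a, (0 : ℝ)) ∈ O :=
      (show Continuous fun a : ℝ => (a, (0 : ℝ)) by fun_prop).continuousAt.eventually_mem
        (hO.mem_nhds h0)
    filter_upwards [this] with a ha
    exact (hasDerivAt_plane hO hq ((hasDerivAt_const 0 a).prodMk (hasDerivAt_id (0 : ℝ))) ha).deriv
  have e2 : (fun b => deriv (fun a => q (a, b)) 0) =ᶠ[𝓝 0] fun b => fderiv ℝ q (0, b) (1, 0) := by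
    have : ∀ᶠ b : ℝ in 𝓝 0, ((0 : ℝ), b) ∈ O :=
      (show Continuous fun b : ℝ => ((0 : ℝ), b) by fun_prop).continuousAt.eventually_mem
        (hO.mem_nhds h0)
    filter_upwards [this] with b hb
    exact (hasDerivAt_plane hO hq ((hasDerivAt_id (0 : ℝ)).prodMk (hasDerivAt_const 0 b)) hb).deriv
  rw [e1.deriv_eq, e2.deriv_eq]
  have d1 : HasDerivAt (fun a => fderiv ℝ q (a, 0) (0, 1))
      (fderiv ℝ (fderiv ℝ q) (0, 0) (1, 0) (0, 1)) 0 := by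
    have := HasFDerivAt.comp_hasDerivAt (f := fun a : ℝ => (a, (0 : ℝ))) (0 : ℝ) hd
      ((hasDerivAt_id' (0 : ℝ)).prodMk (hasDerivAt_const (0 : ℝ) (0 : ℝ)))
    exact this.clm_apply (hasDerivAt_const 0 (0, 1)) |>.congr_deriv (by simp)
  have d2 : HasDerivAt (fun b => fderiv ℝ q (0, b) (1, 0))
      (fderiv ℝ (fderiv ℝ q) (0, 0) (0, 1) (1, 0)) 0 := by
    have := HasFDerivAt.comp_hasDerivAt (f := fun a : ℝ => ((0 : ℝ), a)) (0 : ℝ) hd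
      ((hasDerivAt_const (0 : ℝ) (0 : ℝ)).prodMk (hasDerivAt_id' (0 : ℝ)))
    exact this.clm_apply (hasDerivAt_const 0 (1, 0)) |>.congr_deriv (by simp)
  rw [d1.deriv, d2.deriv]
  exact hsymm _ _

end Plane

variable {X Y Z : Type} [AddCommGroup X] [Module ℝ X] [DVS X] [AddCommGroup Y] [Module ℝ Y] [DVS Y]
  [AddCommGroup Z] [Module ℝ Z] [DVS Z]

/-- The smooth elements of a diffeological vector space. -/
def pts : Set X := {x | pl (univ : Set ℝ) (fun _ => x)}

section Points

variable {E : Type} [NormedAddCommGroup E] [NormedSpace ℝ E] {O : Set E}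

theorem mem_pts_of_pl {p : E → X} (hp : pl O p) {e : E} (he : e ∈ O) : p e ∈ (pts : Set X) :=
  DVS.pl_comp (g := fun _ : ℝ => e) hp contDiffOn_const fun _ _ => he

theorem pl_const {x : X} (hx : x ∈ (pts : Set X)) : pl O (fun _ : E => x) :=
  DVS.pl_comp (p := fun _ : ℝ => x) (g := fun _ : E => (0 : ℝ)) hx contDiffOn_const
    fun _ _ => mem_univ _

theorem pl_mono {O' : Set E} {p : E → X} (hp : pl O p) (h : O' ⊆ O) : pl O' p :=
  DVS.pl_comp (g := fun e => e) hp contDiffOn_id h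

theorem add_mem_pts {x y : X} (hx : x ∈ (pts : Set X)) (hy : y ∈ (pts : Set X)) :
    x + y ∈ (pts : Set X) := DVS.pl_add hx hy

theorem smul_mem_pts {x : X} (a : ℝ) (hx : x ∈ (pts : Set X)) : a • x ∈ (pts : Set X) :=
  DVS.pl_smul contDiffOn_const hx

theorem zero_mem_pts : (0 : X) ∈ (pts : Set X) := DVS.pl_zero

theorem neg_mem_pts {x : X} (hx : x ∈ (pts : Set X)) : -x ∈ (pts : Set X) := by
  simpa using smul_mem_pts (-1) hx

theorem sub_mem_pts {x y : X} (hx : x ∈ (pts : Set X)) (hy : y ∈ (pts : Set X)) :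
    x - y ∈ (pts : Set X) := by
  rw [sub_eq_add_neg]
  exact add_mem_pts hx (neg_mem_pts hy)

theorem mem_pts_prod {x : X × Y} :
    x ∈ (pts : Set (X × Y)) ↔ x.1 ∈ (pts : Set X) ∧ x.2 ∈ (pts : Set Y) := Iff.rfl

theorem prodMk_mem_pts {x : X} {y : Y} (hx : x ∈ (pts : Set X)) (hy : y ∈ (pts : Set Y)) :
    (x, y) ∈ (pts : Set (X × Y)) := ⟨hx, hy⟩

theorem pts_real (t : ℝ) : t ∈ (pts : Set ℝ) := contDiffOn_const (c := t)

theorem pl_neg {p : E → X} (hp : pl O p) : pl O (fun e => -p e) := by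
  simpa using DVS.pl_smul (a := fun _ => (-1 : ℝ)) contDiffOn_const hp

theorem pl_sub {p p' : E → X} (hp : pl O p) (hp' : pl O p') : pl O (fun e => p e - p' e) := by
  simp only [sub_eq_add_neg]
  exact DVS.pl_add hp (pl_neg hp')

end Points

/-- Sets of smooth elements whose preimages under plots are open. -/
structure POpen (D : Set X) : Prop where
  subset : D ⊆ pts
  isOpen : ∀ {E : Type} [NormedAddCommGroup E] [NormedSpace ℝ E] [FiniteDimensional ℝ E]
    {O : Set E} {p : E → X}, IsOpen O → pl O p → IsOpen {e | e ∈ O ∧ p e ∈ D}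

/-- Maps that send plots in `D` to plots. -/
structure Sm (D : Set X) (Φ : X → Y) : Prop where
  map : ∀ {E : Type} [NormedAddCommGroup E] [NormedSpace ℝ E] [FiniteDimensional ℝ E]
    {O : Set E} {p : E → X}, IsOpen O → pl O p → (∀ e ∈ O, p e ∈ D) → pl O (fun e => Φ (p e))

/-- The derivative of `Φ` at `x` in the direction `v`. -/
def dd (Φ : X → Y) (x v : X) : Y := der fun s : ℝ => Φ (x + s • v)

theorem POpen.pts : POpen (pts : Set X) where
  subset := subset_rfl
  isOpen := by
    intro E _ _ _ O p hO hp
    convert hO using 1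
    ext e
    exact ⟨fun h => h.1, fun h => ⟨h, mem_pts_of_pl hp h⟩⟩

theorem POpen.prod {D : Set X} {D' : Set Y} (hD : POpen D) (hD' : POpen D') :
    POpen (D ×ˢ D') where
  subset x hx := ⟨hD.subset hx.1, hD'.subset hx.2⟩
  isOpen := by
    intro E _ _ _ O p hO hp
    convert (hD.isOpen hO hp.1).inter (hD'.isOpen hO hp.2) using 1
    ext e
    exact ⟨fun h => ⟨⟨h.1, h.2.1⟩, h.1, h.2.2⟩, fun h => ⟨h.1.1, h.1.2, h.2.2⟩⟩

theorem POpen.real {J : Set ℝ} (hJ : IsOpen J) : POpen J where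
  subset t _ := pts_real t
  isOpen := by
    intro E _ _ _ O p hO hp
    exact ContinuousOn.isOpen_inter_preimage (f := p) hp.continuousOn hO hJ

theorem POpen.preimage {D : Set X} {D' : Set Y} (hD : POpen D) (hD' : POpen D') {Φ : X → Y}
    (hΦ : Sm D Φ) : POpen {x | x ∈ D ∧ Φ x ∈ D'} where
  subset x hx := hD.subset hx.1
  isOpen := by
    intro E _ _ _ O p hO hp
    have h1 := hD.isOpen hO hp
    convert hD'.isOpen h1 (hΦ.map h1 (pl_mono hp fun e he => he.1) fun e he => he.2) using 1
    ext e
    exact ⟨fun h => ⟨⟨h.1, h.2.1⟩, h.2.2⟩, fun h => ⟨h.1.1, h.1.2, h.2⟩⟩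

section Smooth

variable {D : Set X} {D' : Set Y}

theorem Sm.mono {Φ : X → Y} {D₁ : Set X} (hΦ : Sm D Φ) (h : D₁ ⊆ D) : Sm D₁ Φ :=
  ⟨fun hO hp hm => hΦ.map hO hp fun e he => h (hm e he)⟩

theorem Sm.congr {Φ Ψ : X → Y} (hΦ : Sm D Φ) (h : ∀ x ∈ D, Ψ x = Φ x) : Sm D Ψ :=
  ⟨fun hO hp hm => DVS.pl_congr (hΦ.map hO hp hm) fun e he => h _ (hm e he)⟩

theorem Sm.comp {Ψ : Y → Z} {Φ : X → Y} (hΨ : Sm D' Ψ) (hΦ : Sm D Φ) (h : MapsTo Φ D D') :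
    Sm D (fun x => Ψ (Φ x)) :=
  ⟨fun hO hp hm => hΨ.map hO (hΦ.map hO hp hm) fun e he => h (hm e he)⟩

theorem Sm.id : Sm D (fun x : X => x) := ⟨fun _ hp _ => hp⟩

theorem Sm.fst {D : Set (X × Y)} : Sm D (fun x => x.1) := ⟨fun _ hp _ => hp.1⟩

theorem Sm.snd {D : Set (X × Y)} : Sm D (fun x => x.2) := ⟨fun _ hp _ => hp.2⟩

theorem Sm.const {y : Y} (hy : y ∈ (pts : Set Y)) : Sm D (fun _ : X => y) :=
  ⟨fun _ _ _ => pl_const hy⟩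

theorem Sm.prodMk {Φ : X → Y} {Ψ : X → Z} (hΦ : Sm D Φ) (hΨ : Sm D Ψ) :
    Sm D (fun x => (Φ x, Ψ x)) := ⟨fun hO hp hm => ⟨hΦ.map hO hp hm, hΨ.map hO hp hm⟩⟩

theorem Sm.fst' {Φ : X → Y × Z} (hΦ : Sm D Φ) : Sm D (fun x => (Φ x).1) :=
  ⟨fun hO hp hm => (hΦ.map hO hp hm).1⟩

theorem Sm.snd' {Φ : X → Y × Z} (hΦ : Sm D Φ) : Sm D (fun x => (Φ x).2) :=
  ⟨fun hO hp hm => (hΦ.map hO hp hm).2⟩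

theorem Sm.add {Φ Ψ : X → Y} (hΦ : Sm D Φ) (hΨ : Sm D Ψ) : Sm D (fun x => Φ x + Ψ x) :=
  ⟨fun hO hp hm => DVS.pl_add (hΦ.map hO hp hm) (hΨ.map hO hp hm)⟩

theorem Sm.neg {Φ : X → Y} (hΦ : Sm D Φ) : Sm D (fun x => -Φ x) :=
  ⟨fun hO hp hm => pl_neg (hΦ.map hO hp hm)⟩

theorem Sm.sub {Φ Ψ : X → Y} (hΦ : Sm D Φ) (hΨ : Sm D Ψ) : Sm D (fun x => Φ x - Ψ x) :=
  ⟨fun hO hp hm => pl_sub (hΦ.map hO hp hm) (hΨ.map hO hp hm)⟩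

theorem Sm.smul {a : X → ℝ} {Φ : X → Y} (ha : Sm D a) (hΦ : Sm D Φ) : Sm D (fun x => a x • Φ x) :=
  ⟨fun hO hp hm => DVS.pl_smul (ha.map hO hp hm) (hΦ.map hO hp hm)⟩

theorem Sm.mem_pts {Φ : X → Y} (hΦ : Sm D Φ) (hD : POpen D) {x : X} (hx : x ∈ D) :
    Φ x ∈ (pts : Set Y) :=
  hΦ.map (E := ℝ) isOpen_univ (hD.subset hx) fun _ _ => hx

end Smooth

theorem der_congr {O : Set ℝ} (hO : IsOpen O) (h0 : 0 ∈ O) {p p' : ℝ → X} (hp : pl O p)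
    (h : ∀ s ∈ O, p' s = p s) : der p' = der p := by
  refine DVS.ev_ext fun i => ?_
  rw [DVS.ev_der i hO h0 hp, DVS.ev_der i hO h0 (DVS.pl_congr hp h)]
  refine Filter.EventuallyEq.deriv_eq ?_
  filter_upwards [hO.mem_nhds h0] with s hs
  rw [h s hs]

theorem pl_line {E : Type} [NormedAddCommGroup E] [NormedSpace ℝ E] {O : Set E} {p v : E → X}
    (hp : pl O p) (hv : pl O v) :
    pl (O ×ˢ (univ : Set ℝ)) (fun e : E × ℝ => p e.1 + e.2 • v e.1) :=
  DVS.pl_add (DVS.pl_comp (g := Prod.fst) hp contDiffOn_fst fun _ h => h.1)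
    (DVS.pl_smul contDiffOn_snd (DVS.pl_comp (g := Prod.fst) hv contDiffOn_fst fun _ h => h.1))

theorem pl_line_const {x v : X} (hx : x ∈ (pts : Set X)) (hv : v ∈ (pts : Set X)) {O : Set ℝ} :
    pl O (fun s : ℝ => x + s • v) :=
  DVS.pl_add (pl_const hx) (DVS.pl_smul contDiffOn_id (pl_const hv))

theorem der_line {x v : X} (hx : x ∈ (pts : Set X)) (hv : v ∈ (pts : Set X)) :
    der (fun s : ℝ => x + s • v) = v := by
  refine DVS.ev_ext fun i => ?_
  rw [DVS.ev_der i isOpen_univ (mem_univ 0) (pl_line_const hx hv)]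
  simp only [map_add, map_smul, smul_eq_mul]
  simp

section Calculus

variable {D : Set X} {D' : Set Y} {Φ Ψ : X → Y}

theorem POpen.isOpen_line (hD : POpen D) {x v : X} (hx : x ∈ D) (hv : v ∈ (ADM.pts : Set X)) :
    IsOpen {s : ℝ | x + s • v ∈ D} := by
  simpa using hD.isOpen isOpen_univ (pl_line_const (hD.subset hx) hv)

theorem Sm.pl_line (hΦ : Sm D Φ) (hD : POpen D) {x v : X} (hx : x ∈ D) (hv : v ∈ (pts : Set X)) :
    pl {s : ℝ | x + s • v ∈ D} (fun s : ℝ => Φ (x + s • v)) :=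
  hΦ.map (hD.isOpen_line hx hv) (pl_line_const (hD.subset hx) hv) fun _ h => h

theorem ev_dd (hΦ : Sm D Φ) (hD : POpen D) {x v : X} (hx : x ∈ D) (hv : v ∈ (pts : Set X))
    (i : DVS.Idx Y) : ev i (dd Φ x v) = deriv (fun s : ℝ => ev i (Φ (x + s • v))) 0 :=
  DVS.ev_der i (hD.isOpen_line hx hv) (by simpa using hx) (hΦ.pl_line hD hx hv)

theorem dd_congr (hΦ : Sm D Φ) (hD : POpen D) (h : ∀ y ∈ D, Ψ y = Φ y) {x v : X} (hx : x ∈ D)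
    (hv : v ∈ (pts : Set X)) : dd Ψ x v = dd Φ x v :=
  der_congr (hD.isOpen_line hx hv) (by simpa using hx) (hΦ.pl_line hD hx hv) fun s hs => h _ hs

/-- The derivative of a map along a curve depends only on the velocity of the curve. -/
theorem Sm.der_comp (hΦ : Sm D Φ) (hD : POpen D) {O : Set ℝ} (hO : IsOpen O) (h0 : 0 ∈ O)
    {p : ℝ → X} (hp : pl O p) (hm : ∀ s ∈ O, p s ∈ D) :
    der (fun s => Φ (p s)) = dd Φ (p 0) (der p) := by
  obtain ⟨O', h, hO', h0', hh, heq⟩ := DVS.hadamard hO h0 hp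
  have hx : p 0 ∈ D := hm 0 h0
  have hder : der p = h 0 := by
    refine DVS.ev_ext fun i => ?_
    rw [DVS.ev_der i hO h0 hp]
    have e1 : (fun s => ev i (p s)) =ᶠ[𝓝 0] fun s => ev i (p 0) + s * ev i (h s) := by
      filter_upwards [hO'.mem_nhds h0'] with s hs
      conv_lhs => rw [heq s hs]
      simp
    have hd : HasDerivAt (fun s => ev i (h s)) (deriv (fun s => ev i (h s)) 0) 0 :=
      (((DVS.pl_ev i hh).contDiffAt (hO'.mem_nhds h0')).differentiableAt (by simp)).hasDerivAt
    have h2 : HasDerivAt (fun s => ev i (p 0) + s * ev i (h s)) _ 0 :=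
      ((hasDerivAt_id' (0 : ℝ)).mul hd).const_add _
    rw [e1.deriv_eq, h2.deriv]
    simp
  -- The curve is the diagonal of the surface `W (s, r) = p 0 + r • h s`. On the diagonal the
  -- derivative is the sum of two partial ones; the first vanishes because `W (s, 0)` is constant,
  -- the second is the derivative along the straight line with direction `h 0`.
  set W : ℝ × ℝ → X := fun e => p 0 + e.2 • h e.1 with hW
  have hWp : pl (O' ×ˢ (univ : Set ℝ)) W := ADM.pl_line (pl_const (hD.subset hx)) hh
  have hO2 := hD.isOpen (hO'.prod isOpen_univ) hWp
  have hQ := hΦ.map hO2 (pl_mono hWp fun e he => he.1) fun e he => he.2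
  have h02 : ((0 : ℝ), (0 : ℝ)) ∈ {e | e ∈ O' ×ˢ (univ : Set ℝ) ∧ W e ∈ D} :=
    ⟨⟨h0', mem_univ _⟩, by simpa [hW] using hx⟩
  have hpl : pl (O ∩ O') (fun s => Φ (p s)) :=
    hΦ.map (hO.inter hO') (pl_mono hp inter_subset_left) fun s hs => hm s hs.1
  rw [hder]
  refine DVS.ev_ext fun i => ?_
  rw [DVS.ev_der i (hO.inter hO') ⟨h0, h0'⟩ hpl, ev_dd hΦ hD hx (mem_pts_of_pl hh h0')]
  have e2 : (fun s => ev i (Φ (p s))) =ᶠ[𝓝 0] fun s => ev i (Φ (W (s, s))) := by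
    filter_upwards [hO'.mem_nhds h0'] with s hs
    rw [hW, heq s hs]
  rw [e2.deriv_eq, deriv_diagonal hO2 h02 (DVS.pl_ev i hQ)]
  simp [hW]

/-- Differentiate the family `(e, s) ↦ Φ (p e + s • v e)` in `s` and set `s = 0`: derivatives of
families of curves are again plots. -/
theorem Sm.dd (hΦ : Sm D Φ) (hD : POpen D) :
    Sm (D ×ˢ (pts : Set X)) (fun y : X × X => ADM.dd Φ y.1 y.2) := by
  constructor
  intro E _ _ _ O p hO hp hm
  have hl := ADM.pl_line hp.1 hp.2
  have hO2 := hD.isOpen (hO.prod isOpen_univ) hl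
  have hQ := DVS.pl_der hO2 (hΦ.map hO2 (pl_mono hl fun e he => he.1) fun e he => he.2)
  have := DVS.pl_comp (g := fun e : E => (e, (0 : ℝ))) (O' := O) hQ (by fun_prop)
    fun e he => ⟨⟨he, mem_univ _⟩, by simpa using (hm e he).1⟩
  simpa only [zero_add, ADM.dd] using this

theorem Sm.dd_apply {D₁ : Set Z} (hΦ : Sm D Φ) (hD : POpen D) {a v : Z → X} (ha : Sm D₁ a)
    (hv : Sm D₁ v) (h : MapsTo a D₁ D) : Sm D₁ (fun z => ADM.dd Φ (a z) (v z)) :=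
  ⟨fun {_ _ _ _ _ p} hO hp hm => (hΦ.dd hD).map (p := fun e => (a (p e), v (p e))) hO
    ⟨ha.map hO hp hm, hv.map hO hp hm⟩
    fun _ he => ⟨h (hm _ he), mem_pts_of_pl (hv.map hO hp hm) he⟩⟩

theorem dd_mem_pts (hΦ : Sm D Φ) (hD : POpen D) {x v : X} (hx : x ∈ D) (hv : v ∈ (pts : Set X)) :
    dd Φ x v ∈ (pts : Set Y) :=
  (hΦ.dd hD).mem_pts (hD.prod POpen.pts) (x := (x, v)) ⟨hx, hv⟩

theorem pl_plane {x v w : X} (hx : x ∈ (pts : Set X)) (hv : v ∈ (pts : Set X))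
    (hw : w ∈ (pts : Set X)) {O : Set (ℝ × ℝ)} :
    pl O (fun e : ℝ × ℝ => x + e.1 • v + e.2 • w) :=
  DVS.pl_add (DVS.pl_add (pl_const hx) (DVS.pl_smul contDiffOn_fst (pl_const hv)))
    (DVS.pl_smul contDiffOn_snd (pl_const hw))

theorem dd_add (hΦ : Sm D Φ) (hD : POpen D) {x v w : X} (hx : x ∈ D) (hv : v ∈ (pts : Set X))
    (hw : w ∈ (pts : Set X)) : dd Φ x (v + w) = dd Φ x v + dd Φ x w := by
  refine DVS.ev_ext fun i => ?_
  have hO2 := hD.isOpen isOpen_univ (pl_plane (hD.subset hx) hv hw)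
  have hQ := DVS.pl_ev i (hΦ.map hO2 (pl_plane (hD.subset hx) hv hw) fun e he => he.2)
  rw [map_add, ev_dd hΦ hD hx hv, ev_dd hΦ hD hx hw, ev_dd hΦ hD hx (add_mem_pts hv hw)]
  have := deriv_diagonal hO2 (by simpa using hx) hQ
  simpa [add_assoc] using this

theorem dd_smul (hΦ : Sm D Φ) (hD : POpen D) {x v : X} (hx : x ∈ D) (hv : v ∈ (pts : Set X))
    (a : ℝ) : dd Φ x (a • v) = a • dd Φ x v := by
  refine DVS.ev_ext fun i => ?_
  rw [map_smul, ev_dd hΦ hD hx hv, ev_dd hΦ hD hx (smul_mem_pts a hv)]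
  have := deriv_comp_mul_left a (fun s : ℝ => ev i (Φ (x + s • v))) 0
  simp only [mul_zero] at this
  rw [← this]
  simp only [smul_smul, mul_comm a]

theorem dd_neg (hΦ : Sm D Φ) (hD : POpen D) {x v : X} (hx : x ∈ D) (hv : v ∈ (pts : Set X)) :
    dd Φ x (-v) = -dd Φ x v := by
  simpa using dd_smul hΦ hD hx hv (-1)

theorem dd_sub (hΦ : Sm D Φ) (hD : POpen D) {x v w : X} (hx : x ∈ D) (hv : v ∈ (pts : Set X))
    (hw : w ∈ (pts : Set X)) : dd Φ x (v - w) = dd Φ x v - dd Φ x w := by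
  rw [sub_eq_add_neg, dd_add hΦ hD hx hv (neg_mem_pts hw), dd_neg hΦ hD hx hw, sub_eq_add_neg]

theorem dd_comp {Ψ : Y → Z} (hΨ : Sm D' Ψ) (hD' : POpen D') (hΦ : Sm D Φ) (hD : POpen D)
    (h : MapsTo Φ D D') {x v : X} (hx : x ∈ D) (hv : v ∈ (pts : Set X)) :
    dd (fun y => Ψ (Φ y)) x v = dd Ψ (Φ x) (dd Φ x v) := by
  have := hΨ.der_comp hD' (hD.isOpen_line hx hv) (by simpa using hx) (hΦ.pl_line hD hx hv)
    fun s hs => h hs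
  simpa [dd] using this

/-- Testing with a separating functional reduces the claim to the symmetry of mixed partial
derivatives on the plane spanned by `v` and `w`. -/
theorem dd_comm (hΦ : Sm D Φ) (hD : POpen D) {x v w : X} (hx : x ∈ D) (hv : v ∈ (pts : Set X))
    (hw : w ∈ (pts : Set X)) :
    dd (fun y => dd Φ y w) x v = dd (fun y => dd Φ y v) x w := by
  refine DVS.ev_ext fun i => ?_
  have hO2 := hD.isOpen isOpen_univ (pl_plane (hD.subset hx) hv hw)
  have hQ := DVS.pl_ev i (hΦ.map hO2 (pl_plane (hD.subset hx) hv hw) fun e he => he.2)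
  have hw' : Sm D fun y => dd Φ y w := hΦ.dd_apply hD Sm.id (Sm.const hw) fun _ h => h
  have hv' : Sm D fun y => dd Φ y v := hΦ.dd_apply hD Sm.id (Sm.const hv) fun _ h => h
  rw [ev_dd hw' hD hx hv, ev_dd hv' hD hx hw]
  have e1 : (fun a : ℝ => ev i (dd Φ (x + a • v) w)) =ᶠ[𝓝 0]
      fun a => deriv (fun b : ℝ => ev i (Φ (x + a • v + b • w))) 0 := by
    filter_upwards [(hD.isOpen_line hx hv).mem_nhds (by simpa using hx)] with a ha
    exact ev_dd hΦ hD ha hw i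
  have e2 : (fun b : ℝ => ev i (dd Φ (x + b • w) v)) =ᶠ[𝓝 0]
      fun b => deriv (fun a : ℝ => ev i (Φ (x + a • v + b • w))) 0 := by
    filter_upwards [(hD.isOpen_line hx hw).mem_nhds (by simpa using hx)] with b hb
    rw [ev_dd hΦ hD hb hv i]
    simp only [add_right_comm]
  rw [e1.deriv_eq, e2.deriv_eq]
  exact deriv_deriv_comm hO2 (by simpa using hx) hQ

/-- Maps that are linear on smooth elements. -/
def IsLin (L : X → Y) : Prop :=
  ∀ x ∈ (pts : Set X), ∀ y ∈ (pts : Set X), ∀ a : ℝ, L (a • x + y) = a • L x + L y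

theorem IsLin.zero {L : X → Y} (hL : IsLin L) : L 0 = 0 := by
  have := hL 0 zero_mem_pts 0 zero_mem_pts 1
  simpa using this

theorem IsLin.add {L : X → Y} (hL : IsLin L) {x y : X} (hx : x ∈ (pts : Set X))
    (hy : y ∈ (pts : Set X)) : L (x + y) = L x + L y := by
  simpa using hL x hx y hy 1

theorem IsLin.smul {L : X → Y} (hL : IsLin L) {x : X} (hx : x ∈ (pts : Set X)) (a : ℝ) :
    L (a • x) = a • L x := by
  simpa [hL.zero] using hL x hx 0 zero_mem_pts a

theorem IsLin.neg {L : X → Y} (hL : IsLin L) {x : X} (hx : x ∈ (pts : Set X)) :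
    L (-x) = -L x := by
  simpa using hL.smul hx (-1)

theorem IsLin.sub {L : X → Y} (hL : IsLin L) {x y : X} (hx : x ∈ (pts : Set X))
    (hy : y ∈ (pts : Set X)) : L (x - y) = L x - L y := by
  rw [sub_eq_add_neg, hL.add hx (neg_mem_pts hy), hL.neg hy, sub_eq_add_neg]

theorem dd_isLin (hΦ : Sm D Φ) (hD : POpen D) {x : X} (hx : x ∈ D) : IsLin (dd Φ x) :=
  fun v hv w hw a => by
    rw [dd_add hΦ hD hx (smul_mem_pts a hv) hw, dd_smul hΦ hD hx hv]

theorem dd_of_isLin {L : X → Y} (hL : IsLin L) (hS : Sm (pts : Set X) L) {x v : X}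
    (hx : x ∈ (pts : Set X)) (hv : v ∈ (pts : Set X)) : dd L x v = L v := by
  have h : ∀ s : ℝ, L (x + s • v) = L x + s • L v := fun s => by
    rw [hL.add hx (smul_mem_pts s hv), hL.smul hv]
  simp only [dd, h]
  exact der_line (hS.mem_pts POpen.pts hx) (hS.mem_pts POpen.pts hv)

theorem dd_const {y : Y} (hy : y ∈ (pts : Set Y)) (x v : X) : dd (fun _ : X => y) x v = 0 := by
  have := der_line hy (zero_mem_pts (X := Y))
  simpa [dd] using this

theorem dd_id {x v : X} (hx : x ∈ (pts : Set X)) (hv : v ∈ (pts : Set X)) :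
    dd (fun y : X => y) x v = v := der_line hx hv

theorem dd_prodMk {Ψ : X → Z} {x v : X} :
    dd (fun y => (Φ y, Ψ y)) x v = (dd Φ x v, dd Ψ x v) := rfl

theorem dd_snd' {Φ : X → Y × Z} {x v : X} : (dd Φ x v).2 = dd (fun y => (Φ y).2) x v := rfl

theorem dd_fun_add (hΦ : Sm D Φ) (hΨ : Sm D Ψ) (hD : POpen D) {x v : X} (hx : x ∈ D)
    (hv : v ∈ (pts : Set X)) : dd (fun y => Φ y + Ψ y) x v = dd Φ x v + dd Ψ x v := by
  have hadd : Sm (pts : Set (Y × Y)) fun y => y.1 + y.2 := Sm.add Sm.fst Sm.snd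
  have hlin : IsLin fun y : Y × Y => y.1 + y.2 := fun y _ z _ a => by
    simp only [Prod.fst_add, Prod.snd_add, Prod.smul_fst, Prod.smul_snd, smul_add]; abel
  rw [dd_comp (Φ := fun y => (Φ y, Ψ y)) (Ψ := fun y : Y × Y => y.1 + y.2) hadd POpen.pts
    (hΦ.prodMk hΨ) hD (fun y hy => ⟨hΦ.mem_pts hD hy, hΨ.mem_pts hD hy⟩) hx hv,
    dd_of_isLin hlin hadd (prodMk_mem_pts (hΦ.mem_pts hD hx) (hΨ.mem_pts hD hx))
      (v := dd (fun y => (Φ y, Ψ y)) x v)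
      (prodMk_mem_pts (dd_mem_pts hΦ hD hx hv) (dd_mem_pts hΨ hD hx hv))]
  rfl

theorem dd_lin_comp {L : Y → Z} (hL : IsLin L) (hS : Sm (pts : Set Y) L) (hΦ : Sm D Φ)
    (hD : POpen D) {x v : X} (hx : x ∈ D) (hv : v ∈ (pts : Set X)) :
    dd (fun y => L (Φ y)) x v = L (dd Φ x v) := by
  rw [dd_comp hS POpen.pts hΦ hD (fun y hy => hΦ.mem_pts hD hy) hx hv,
    dd_of_isLin hL hS (hΦ.mem_pts hD hx) (dd_mem_pts hΦ hD hx hv)]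

theorem isLin_neg : IsLin (fun y : Y => -y) := fun y _ z _ a => by simp [add_comm]

theorem dd_fun_neg (hΦ : Sm D Φ) (hD : POpen D) {x v : X} (hx : x ∈ D)
    (hv : v ∈ (pts : Set X)) : dd (fun y => -Φ y) x v = -dd Φ x v :=
  dd_lin_comp isLin_neg Sm.id.neg hΦ hD hx hv

theorem dd_fun_sub (hΦ : Sm D Φ) (hΨ : Sm D Ψ) (hD : POpen D) {x v : X} (hx : x ∈ D)
    (hv : v ∈ (pts : Set X)) : dd (fun y => Φ y - Ψ y) x v = dd Φ x v - dd Ψ x v := by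
  simp only [sub_eq_add_neg]
  rw [dd_fun_add hΦ hΨ.neg hD hx hv, dd_fun_neg hΨ hD hx hv]

theorem dd_prod {Φ : X × Y → Z} {D : Set (X × Y)} (hΦ : Sm D Φ) (hD : POpen D) {x : X × Y}
    (hx : x ∈ D) {v : X} {w : Y} (hv : v ∈ (pts : Set X)) (hw : w ∈ (pts : Set Y)) :
    dd Φ x (v, w) = dd (fun x' => Φ (x', x.2)) x.1 v + dd (fun y' => Φ (x.1, y')) x.2 w := by
  have : (v, w) = (v, (0 : Y)) + ((0 : X), w) := by simp
  rw [this, dd_add hΦ hD hx (prodMk_mem_pts hv zero_mem_pts)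
    (prodMk_mem_pts zero_mem_pts hw)]
  congr 1 <;> simp only [dd, Prod.add_def, Prod.smul_fst, Prod.smul_snd, smul_zero, add_zero]

/-- Commutator of two derivations given by vector fields. -/
theorem dd_commutator {h : X → Y} (hh : Sm D h) (hD : POpen D) {A B : X → X} (hA : Sm D A)
    (hB : Sm D B) {x : X} (hx : x ∈ D) :
    dd (fun y => dd h y (B y)) x (A x) - dd (fun y => dd h y (A y)) x (B x) =
      dd h x (dd B x (A x) - dd A x (B x)) := by
  -- Product rule for a derivative along a variable direction: a second derivative with frozen
  -- directions plus the derivative of the direction. The former is symmetric and drops out of the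
  -- commutator.
  have key : ∀ {A B : X → X}, Sm D A → Sm D B → dd (fun y => dd h y (B y)) x (A x) =
      dd (fun y => dd h y (B x)) x (A x) + dd h x (dd B x (A x)) := by
    intro A B hA hB
    have hAx := hA.mem_pts hD hx
    have hBx := hB.mem_pts hD hx
    rw [dd_comp (Ψ := fun y : X × X => dd h y.1 y.2) (Φ := fun y => (y, B y)) (hh.dd hD)
      (hD.prod POpen.pts) (Sm.id.prodMk hB) hD (fun y hy => ⟨hy, hB.mem_pts hD hy⟩) hx hAx,
      dd_prodMk, dd_id (hD.subset hx) hAx,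
      dd_prod (hh.dd hD) (hD.prod POpen.pts) ⟨hx, hBx⟩ hAx (dd_mem_pts hB hD hx hAx)]
    congr 1
    exact dd_of_isLin (dd_isLin hh hD hx)
      (hh.dd_apply hD (Sm.const (hD.subset hx)) Sm.id fun _ _ => hx) hBx (dd_mem_pts hB hD hx hAx)
  have hAx := hA.mem_pts hD hx
  have hBx := hB.mem_pts hD hx
  rw [key hA hB, key hB hA, dd_comm hh hD hx hAx hBx,
    dd_sub hh hD hx (dd_mem_pts hB hD hx hAx) (dd_mem_pts hA hD hx hBx)]
  abel

end Calculus

end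

section

/-! ### Operations on fields -/

theorem isCompact_cell : IsCompact cell := isCompact_Icc

section Fields

variable {V W : Type} [NormedAddCommGroup V] [NormedSpace ℝ V] [FVal V]
  [NormedAddCommGroup W] [NormedSpace ℝ W] [FVal W]

theorem mem_pts_field {u : Pt → V} :
    u ∈ (pts : Set (Pt → V)) ↔ ContDiff ℝ ∞ u ∧ u ∈ (admissible : Set (Pt → V)) := by
  constructor
  · rintro ⟨h1, h2⟩
    refine ⟨?_, h2 0 (mem_univ _)⟩
    exact contDiffOn_univ.1 (h1.comp (f := fun x : Pt => ((0 : ℝ), x)) (by fun_prop)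
      fun x _ => ⟨mem_univ _, mem_univ _⟩)
  · rintro ⟨h1, h2⟩
    exact ⟨h1.contDiffOn.comp contDiffOn_snd fun _ _ => mem_univ _, fun _ _ => h2⟩

theorem contDiff_of_mem_pts {u : Pt → V} (hu : u ∈ (pts : Set (Pt → V))) : ContDiff ℝ ∞ u :=
  (mem_pts_field.1 hu).1

theorem isField_of_mem_pts {u : Pt → V} (hu : u ∈ (pts : Set (Pt → V))) : IsField u :=
  ⟨(mem_pts_field.1 hu).1, fun x i => ((mem_pts_field.1 hu).2 x).1 i⟩

/-- Composition with a smooth function of the values. -/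
theorem Sm.pointwise {S : Set V} {g : V → W} (hg : ContDiffOn ℝ ∞ g S)
    (hsym : ∀ v ∈ S, v ∈ (sym : Submodule ℝ V) → g v ∈ (sym : Submodule ℝ W)) :
    Sm {u : Pt → V | ∀ x, u x ∈ S} (fun (u : Pt → V) (x : Pt) => g (u x)) where
  map hO hp hm := ⟨hg.comp hp.1 fun q hq => hm q.1 hq.1 q.2, fun e he x =>
    ⟨fun i => by simp only [(hp.2 e he x).1 i], hsym _ (hm e he x) (hp.2 e he x).2⟩⟩

theorem Sm.pointwise_lin (L : V →L[ℝ] W)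
    (hsym : ∀ v ∈ (sym : Submodule ℝ V), L v ∈ (sym : Submodule ℝ W)) {D : Set (Pt → V)} :
    Sm D (fun (u : Pt → V) (x : Pt) => L (u x)) :=
  (Sm.pointwise (S := univ) L.contDiff.contDiffOn fun v _ => hsym v).mono fun _ _ _ => mem_univ _

theorem isLin_pointwise (L : V →L[ℝ] W) : IsLin (fun (u : Pt → V) (x : Pt) => L (u x)) :=
  fun u _ v _ a => by funext x; simp

theorem pl_joint {E : Type} [NormedAddCommGroup E] [NormedSpace ℝ E] {O : Set E}
    {p : E → Pt → V × W} :
    pl O p ↔ pl O (fun e x => (p e x).1) ∧ pl O (fun e x => (p e x).2) := by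
  constructor
  · rintro ⟨h1, h2⟩
    exact ⟨⟨h1.fst, fun e he x => ⟨fun i => by simp only [(h2 e he x).1 i], (h2 e he x).2.1⟩⟩,
      ⟨h1.snd, fun e he x => ⟨fun i => by simp only [(h2 e he x).1 i], (h2 e he x).2.2⟩⟩⟩
  · rintro ⟨⟨h1, h2⟩, h3, h4⟩
    exact ⟨h1.prodMk h3, fun e he x =>
      ⟨fun i => Prod.ext ((h2 e he x).1 i) ((h4 e he x).1 i), (h2 e he x).2, (h4 e he x).2⟩⟩

theorem Sm.joint {D : Set ((Pt → V) × (Pt → W))} :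
    Sm D (fun (y : (Pt → V) × (Pt → W)) => ADM.joint y.1 y.2) :=
  ⟨fun _ hp _ => pl_joint.2 hp⟩

theorem Sm.unjoint {D : Set (Pt → V × W)} :
    Sm D (fun (y : Pt → V × W) => ((fun x => (y x).1 : Pt → V), (fun x => (y x).2 : Pt → W))) :=
  ⟨fun _ hp _ => pl_joint.1 hp⟩

/-- The inner product of fields. -/
def ip (u v : Pt → V) : ℝ := ∫ x in cell, dot (u x) (v x)

theorem Sm.ip {D : Set ((Pt → V) × (Pt → V))} : Sm D (fun y => ip y.1 y.2) where
  map {E} _ _ _ O p hO hp _ := by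
    refine contDiffOn_setIntegral (f := fun q : E × Pt => dot ((p q.1).1 q.2) ((p q.1).2 q.2))
      isCompact_cell (hO.prod isOpen_univ) ?_ hO (prod_mono subset_rfl (subset_univ _))
    exact FVal.dot_contDiff.comp_contDiffOn (hp.1.1.prodMk hp.2.1)

theorem Sm.ip_apply {X : Type} [AddCommGroup X] [Module ℝ X] [DVS X] {D : Set X} {Φ Ψ : X → Pt → V}
    (hΦ : Sm D Φ) (hΨ : Sm D Ψ) : Sm D (fun x => ADM.ip (Φ x) (Ψ x)) :=
  (Sm.ip (D := univ)).comp (hΦ.prodMk hΨ) fun _ _ => mem_univ _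

theorem continuous_dot {u v : Pt → V} (hu : u ∈ (pts : Set (Pt → V)))
    (hv : v ∈ (pts : Set (Pt → V))) : Continuous (fun x => dot (u x) (v x)) :=
  (FVal.dot_contDiff.comp ((contDiff_of_mem_pts hu).prodMk (contDiff_of_mem_pts hv))).continuous

theorem integrableOn_dot {u v : Pt → V} (hu : u ∈ (pts : Set (Pt → V)))
    (hv : v ∈ (pts : Set (Pt → V))) : IntegrableOn (fun x => dot (u x) (v x)) cell :=
  (continuous_dot hu hv).continuousOn.integrableOn_compact isCompact_cell

theorem ip_comm (u v : Pt → V) : ip u v = ip v u := by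
  simp only [ip, FVal.dot_comm]

theorem ip_isLin_left {w : Pt → V} (hw : w ∈ (pts : Set (Pt → V))) :
    IsLin (fun u : Pt → V => ip u w) := by
  intro u hu v hv a
  simp only [ip, Pi.add_apply, Pi.smul_apply, FVal.dot_add_left, FVal.dot_smul_left, smul_eq_mul]
  rw [integral_add ((integrableOn_dot hu hw).const_mul a) (integrableOn_dot hv hw),
    integral_const_mul]

theorem ip_isLin_right {w : Pt → V} (hw : w ∈ (pts : Set (Pt → V))) :
    IsLin (fun u : Pt → V => ip w u) := by
  simp only [ip_comm w]
  exact ip_isLin_left hw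

theorem exists_int_shift (x : Pt) : ∃ n : Fin 3 → ℤ, (fun i => x i + n i) ∈ cell :=
  ⟨fun i => -⌊x i⌋, fun i => by simpa using Int.floor_le (x i),
    fun i => by simpa using by linarith [Int.lt_floor_add_one (x i)]⟩

theorem periodic_int_shift {U : Type} {u : Pt → U} (hu : ∀ x i, u (x + Pi.single i 1) = u x)
    (x : Pt) (n : Fin 3 → ℤ) : u (fun i => x i + n i) = u x := by
  have h1 : ∀ (i : Fin 3) (m : ℤ) (x : Pt), u (x + Pi.single i (m : ℝ)) = u x := by
    intro i m
    induction m using Int.induction_on with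
    | zero => intro x; simp
    | succ k ih =>
      intro x
      have h3 : x + Pi.single i ((((k : ℤ) + 1 : ℤ)) : ℝ) =
          x + Pi.single i ((k : ℤ) : ℝ) + Pi.single i 1 := by
        rw [add_assoc, ← Pi.single_add]; push_cast; rfl
      rw [h3, hu, ih]
    | pred k ih =>
      intro x
      have h3 : x + Pi.single i ((((-(k : ℤ) - 1 : ℤ)) : ℝ)) + Pi.single i 1 =
          x + Pi.single i ((-(k : ℤ) : ℤ) : ℝ) := by
        rw [add_assoc, ← Pi.single_add]; push_cast; simp
      rw [← hu, h3, ih]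
  have h2 : (fun i => x i + (n i : ℝ)) =
      x + Pi.single 0 (n 0 : ℝ) + Pi.single 1 (n 1 : ℝ) + Pi.single 2 (n 2 : ℝ) := by
    funext i
    fin_cases i <;> simp
  rw [h2, h1, h1, h1]

/-- A continuous nonnegative function with vanishing integral is zero on the interior of the cell,
hence on its closure, which is the cell; periodicity does the rest. -/
theorem eq_zero_of_ip_self {u : Pt → V} (hu : u ∈ (pts : Set (Pt → V))) (h : ip u u = 0) :
    u = 0 := by
  have hc : ContinuousOn (fun x => dot (u x) (u x)) cell := (continuous_dot hu hu).continuousOn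
  have h0 := (setIntegral_eq_zero_iff_of_nonneg_ae
    (Filter.Eventually.of_forall fun x => FVal.dot_self_nonneg (u x))
    (integrableOn_dot hu hu)).1 h
  have h_interior : interior cell ⊆ {x | dot (u x) (u x) = 0} := by
    have hae : (fun x => dot (u x) (u x)) =ᵐ[volume.restrict (interior cell)] fun _ => 0 :=
      ae_restrict_of_ae_restrict_of_subset interior_subset h0
    exact fun x hx => (Measure.eqOn_open_of_ae_eq hae isOpen_interior
      (continuous_dot hu hu).continuousOn continuousOn_const) hx
  have hcl : closure (interior cell) = cell := by
    have h1 : (cell : Set Pt) = Set.pi univ fun _ => Icc 0 1 := by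
      rw [cell, ← Set.pi_univ_Icc]; rfl
    rw [h1, interior_pi_set finite_univ, closure_pi_set]
    simp
  have hcell : ∀ x ∈ cell, u x = 0 := by
    intro x hx
    rw [← hcl] at hx
    exact FVal.dot_self_eq_zero _ (closure_minimal h_interior
      (isClosed_eq (continuous_dot hu hu) continuous_const) hx)
  funext x
  obtain ⟨n, hn⟩ := exists_int_shift x
  rw [← periodic_int_shift (isField_of_mem_pts hu).2 x n]
  exact hcell _ hn

/-- Nondegeneracy of the pairing. Identities between functional derivatives, and the linearity of
transposes, are obtained from it by pairing with arbitrary fields. -/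
theorem eq_of_ip {u v : Pt → V} (hu : u ∈ (pts : Set (Pt → V))) (hv : v ∈ (pts : Set (Pt → V)))
    (h : ∀ w ∈ (pts : Set (Pt → V)), ip w u = ip w v) : u = v := by
  have huv := sub_mem_pts hu hv
  refine sub_eq_zero.1 (eq_zero_of_ip_self huv ?_)
  rw [(ip_isLin_right huv).sub hu hv, h _ huv, sub_self]

end Fields

/-! ### Scalar fields -/

section Scalars

theorem mem_pts_scalar {u : Pt → ℝ} : u ∈ (pts : Set (Pt → ℝ)) ↔ IsField u := by
  rw [mem_pts_field]
  exact ⟨fun h => ⟨h.1, fun x i => (h.2 x).1 i⟩,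
    fun h => ⟨h.1, fun x => ⟨fun i => h.2 x i, Submodule.mem_top⟩⟩⟩

theorem Sm.pd {D : Set (Pt → ℝ)} (i : Fin 3) : Sm D (fun u : Pt → ℝ => pd i u) where
  map {E} _ _ _ O p hO hp _ := by
    have hΩ : IsOpen (O ×ˢ (univ : Set Pt)) := hO.prod isOpen_univ
    constructor
    · refine ((hp.1.fderiv_of_isOpen hΩ (m := ∞) (by simp)).clm_apply
        (contDiffOn_const (c := ((0 : E), (Pi.single i 1 : Pt))))).congr ?_
      rintro ⟨e, x⟩ he
      have h1 : HasFDerivAt (fun q : E × Pt => p q.1 q.2)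
          (fderiv ℝ (fun q : E × Pt => p q.1 q.2) (e, x)) (e, x) :=
        ((hp.1.contDiffAt (hΩ.mem_nhds he)).differentiableAt (by simp)).hasFDerivAt
      have h2 := (h1.comp x (hasFDerivAt_prodMk_right e x)).fderiv
      simp only [ADM.pd]
      refine (congrArg (fun L : Pt →L[ℝ] ℝ => L (Pi.single i 1)) h2).trans ?_
      simp
    · intro e he x
      refine ⟨fun j => ?_, Submodule.mem_top⟩
      simp only [ADM.pd]
      have : p e = fun y => p e (y + Pi.single j 1) :=
        funext fun y => ((hp.2 e he y).1 j).symm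
      conv_rhs => rw [this]
      rw [fderiv_comp_add_right]

theorem pd_add {u v : Pt → ℝ} (hu : u ∈ (pts : Set (Pt → ℝ))) (hv : v ∈ (pts : Set (Pt → ℝ)))
    (i : Fin 3) : pd i (u + v) = pd i u + pd i v := by
  funext x
  have h1 := ((contDiff_of_mem_pts hu).differentiable (by simp)) x
  have h2 := ((contDiff_of_mem_pts hv).differentiable (by simp)) x
  simp [pd, fderiv_add h1 h2]

theorem isLin_pd (i : Fin 3) : IsLin (fun u : Pt → ℝ => pd i u) := by
  intro u hu v hv a
  simp only
  rw [pd_add (smul_mem_pts a hu) hv]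
  congr 1
  funext x
  simp [pd, fderiv_const_smul_field]

theorem mul_mem_pts {u v : Pt → ℝ} (hu : u ∈ (pts : Set (Pt → ℝ)))
    (hv : v ∈ (pts : Set (Pt → ℝ))) : u * v ∈ (pts : Set (Pt → ℝ)) := by
  rw [mem_pts_scalar] at *
  exact ⟨hu.1.mul hv.1, fun x i => by simp [hu.2 x i, hv.2 x i]⟩

theorem pd_mem_pts {u : Pt → ℝ} (hu : u ∈ (pts : Set (Pt → ℝ))) (i : Fin 3) :
    pd i u ∈ (pts : Set (Pt → ℝ)) := (Sm.pd i).mem_pts POpen.pts hu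

theorem pd_mul {u v : Pt → ℝ} (hu : u ∈ (pts : Set (Pt → ℝ))) (hv : v ∈ (pts : Set (Pt → ℝ)))
    (i : Fin 3) : pd i (u * v) = pd i u * v + u * pd i v := by
  funext x
  have h1 := ((contDiff_of_mem_pts hu).differentiable (by simp)) x
  have h2 := ((contDiff_of_mem_pts hv).differentiable (by simp)) x
  simp [pd, fderiv_mul h1 h2]
  ring

/-- Divergence theorem on the unit box for a vector field with the single component `u` in direction
`i`; the contributions of opposite faces cancel by periodicity. -/
theorem integral_pd {u : Pt → ℝ} (hu : u ∈ (pts : Set (Pt → ℝ))) (i : Fin 3) :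
    ∫ x in cell, pd i u x = 0 := by
  have hd : ∀ x, HasFDerivAt u (fderiv ℝ u x) x := fun x =>
    (((contDiff_of_mem_pts hu).differentiable (by simp)) x).hasFDerivAt
  have hs : ∀ x, (∑ j, (if j = i then fderiv ℝ u x else 0) (Pi.single j (1 : ℝ))) = pd i u x := by
    intro x
    rw [Finset.sum_eq_single i]
    · simp [pd]
    · intro j _ hj
      simp [hj]
    · simp
  have key := integral_divergence_of_hasFDerivAt_off_countable' (n := 2) (a := (0 : Pt)) (b := 1)
    (fun _ => zero_le_one) (fun j => if j = i then u else 0)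
    (fun j x => if j = i then fderiv ℝ u x else 0) ∅ countable_empty ?_ ?_ ?_
  · simp only [hs] at key
    rw [cell, key]
    refine Finset.sum_eq_zero fun j _ => ?_
    by_cases hj : j = i
    · subst hj
      rw [sub_eq_zero]
      refine integral_congr_ae (Filter.Eventually.of_forall fun y => ?_)
      simp only [if_true]
      -- The point of the lower face, shifted by a unit in direction `j`, is the corresponding point
      -- of the upper face.
      rw [← (isField_of_mem_pts hu).2 (j.insertNth ((0 : Pt) j) y) j]
      congr 1
      funext k
      refine Fin.succAboveCases j ?_ (fun l => ?_) k
      · simp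
      · simp [Fin.succAbove_ne]
    · simp [hj]
  · intro j
    by_cases hj : j = i
    · simpa [hj] using (contDiff_of_mem_pts hu).continuous.continuousOn
    · simp only [hj, if_false]
      exact continuousOn_const (c := (0 : ℝ))
  · intro x _ j
    by_cases hj : j = i
    · simpa [hj] using hd x
    · simp only [hj, if_false]
      exact hasFDerivAt_const (0 : ℝ) x
  · simp only [hs]
    exact (contDiff_of_mem_pts (pd_mem_pts hu i)).continuous.continuousOn.integrableOn_compact
      isCompact_Icc

/-- Integration by parts. -/
theorem ip_pd {u v : Pt → ℝ} (hu : u ∈ (pts : Set (Pt → ℝ))) (hv : v ∈ (pts : Set (Pt → ℝ)))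
    (i : Fin 3) : ip u (pd i v) = ip (-pd i u) v := by
  have h := integral_pd (mul_mem_pts hu hv) i
  rw [pd_mul hu hv] at h
  have e1 := integral_add (integrableOn_dot (pd_mem_pts hu i) hv)
    (integrableOn_dot hu (pd_mem_pts hv i))
  have e2 : ip (pd i u) v + ip u (pd i v) = 0 := by
    rw [ip, ip, ← e1]
    exact h
  rw [(ip_isLin_left hv).neg (pd_mem_pts hu i)]
  linarith

end Scalars

end

section

/-! ### Maps whose linearization has a transpose -/

section Adjoint

variable {A : Type} [AddCommGroup A] [Module ℝ A] [DVS A]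
  {V W W' : Type} [NormedAddCommGroup V] [NormedSpace ℝ V] [FVal V]
  [NormedAddCommGroup W] [NormedSpace ℝ W] [FVal W]
  [NormedAddCommGroup W'] [NormedSpace ℝ W'] [FVal W']

/-- The map `Φ` of parameters and of a field is smooth, and `Ψ (x, η)` is the functional derivative
of `⟨η, Φ⟩` with respect to the field. -/
structure HasAdj (D : Set (A × (Pt → V))) (Φ : A × (Pt → V) → Pt → W)
    (Ψ : (A × (Pt → V)) × (Pt → W) → Pt → V) : Prop where
  sm : Sm D Φ
  adj_sm : Sm (D ×ˢ pts) Ψ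
  adj : ∀ x ∈ D, ∀ η ∈ (pts : Set (Pt → W)), ∀ v ∈ (pts : Set (Pt → V)),
    ip η (dd Φ x (0, v)) = ip (Ψ (x, η)) v

/-- The existence of functional derivatives of `⟨η, Φ⟩`. -/
def Reg (D : Set (A × (Pt → V))) (Φ : A × (Pt → V) → Pt → W) : Prop := ∃ Ψ, HasAdj D Φ Ψ

/-- A family of linear operators with a transpose and with functional derivatives. -/
structure RegOp (D : Set (A × (Pt → V))) (K : (A × (Pt → V)) × (Pt → W) → Pt → W') : Prop where
  sm : Sm (D ×ˢ pts) K
  lin : ∀ x ∈ D, IsLin fun ξ => K (x, ξ)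
  transp : ∃ Kt : (A × (Pt → V)) × (Pt → W') → Pt → W, Sm (D ×ˢ pts) Kt ∧
    ∀ x ∈ D, ∀ η ∈ (pts : Set (Pt → W')), ∀ ξ ∈ (pts : Set (Pt → W)),
      ip η (K (x, ξ)) = ip (Kt (x, η)) ξ
  reg : ∃ Kr : ((A × (Pt → V)) × (Pt → W)) × (Pt → W') → Pt → V, Sm ((D ×ˢ pts) ×ˢ pts) Kr ∧
    ∀ x ∈ D, ∀ ξ ∈ (pts : Set (Pt → W)), ∀ η ∈ (pts : Set (Pt → W')),
      ∀ v ∈ (pts : Set (Pt → V)), ip η (dd K (x, ξ) ((0, v), 0)) = ip (Kr ((x, ξ), η)) v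

variable {D : Set (A × (Pt → V))}

theorem zero_prod_mem_pts {v : Pt → V} (hv : v ∈ (pts : Set (Pt → V))) :
    ((0 : A), v) ∈ (pts : Set (A × (Pt → V))) := prodMk_mem_pts zero_mem_pts hv

theorem ip_dd_right {X : Type} [AddCommGroup X] [Module ℝ X] [DVS X] {D : Set X} (hD : POpen D)
    {Φ : X → Pt → W} (hΦ : Sm D Φ) {η : Pt → W} (hη : η ∈ (pts : Set (Pt → W))) {x v : X}
    (hx : x ∈ D) (hv : v ∈ (pts : Set X)) : dd (fun y => ip η (Φ y)) x v = ip η (dd Φ x v) :=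
  dd_lin_comp (L := fun ξ => ip η ξ) (ip_isLin_right hη) (Sm.ip_apply (Sm.const hη) Sm.id) hΦ hD
    hx hv

theorem ip_dd_left {X : Type} [AddCommGroup X] [Module ℝ X] [DVS X] {D : Set X} (hD : POpen D)
    {Φ : X → Pt → W} (hΦ : Sm D Φ) {η : Pt → W} (hη : η ∈ (pts : Set (Pt → W))) {x v : X}
    (hx : x ∈ D) (hv : v ∈ (pts : Set X)) : dd (fun y => ip (Φ y) η) x v = ip (dd Φ x v) η := by
  simp only [ip_comm _ η]
  exact ip_dd_right hD hΦ hη hx hv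

theorem dd_slice {X Y Z : Type} [AddCommGroup X] [Module ℝ X] [DVS X] [AddCommGroup Y] [Module ℝ Y]
    [DVS Y] [AddCommGroup Z] [Module ℝ Z] [DVS Z] (Ψ : X × Y → Z) (x v : X) (y : Y) :
    dd (fun x' => Ψ (x', y)) x v = dd Ψ (x, y) (v, 0) := by
  simp only [dd, Prod.smul_mk, Prod.mk_add_mk, smul_zero, add_zero]

theorem Sm.slice {X Y Z : Type} [AddCommGroup X] [Module ℝ X] [DVS X] [AddCommGroup Y] [Module ℝ Y]
    [DVS Y] [AddCommGroup Z] [Module ℝ Z] [DVS Z] {D : Set X} {D' : Set Y} {Ψ : X × Y → Z}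
    (hΨ : Sm (D ×ˢ D') Ψ) (hD' : POpen D') {y : Y} (hy : y ∈ D') : Sm D (fun x => Ψ (x, y)) :=
  hΨ.comp (Sm.id.prodMk (Sm.const (hD'.subset hy))) fun _ h => ⟨h, hy⟩

namespace HasAdj

variable {Φ : A × (Pt → V) → Pt → W} {Ψ : (A × (Pt → V)) × (Pt → W) → Pt → V}

theorem mem_pts (h : HasAdj D Φ Ψ) (hD : POpen D) {x : A × (Pt → V)} (hx : x ∈ D) {η : Pt → W}
    (hη : η ∈ (pts : Set (Pt → W))) : Ψ (x, η) ∈ (pts : Set (Pt → V)) :=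
  h.adj_sm.mem_pts (hD.prod POpen.pts) (x := (x, η)) ⟨hx, hη⟩

/-- Linearity in `η` need not be assumed: pairing with variations determines `Ψ (x, η)`, and the
pairing is linear in `η`. -/
theorem isLin (h : HasAdj D Φ Ψ) (hD : POpen D) {x : A × (Pt → V)} (hx : x ∈ D) :
    IsLin fun η => Ψ (x, η) := by
  intro η hη ζ hζ a
  have hη' := h.mem_pts hD hx hη
  have hζ' := h.mem_pts hD hx hζ
  refine eq_of_ip (h.mem_pts hD hx (add_mem_pts (smul_mem_pts a hη) hζ))
    (add_mem_pts (smul_mem_pts a hη') hζ') fun v hv => ?_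
  have hd := dd_mem_pts h.sm hD hx (zero_prod_mem_pts (A := A) hv)
  have e1 := ip_isLin_left hd η hη ζ hζ a
  have e2 := ip_isLin_right hv _ hη' _ hζ' a
  simp only at e1 e2 ⊢
  rw [ip_comm, ← h.adj x hx _ (add_mem_pts (smul_mem_pts a hη) hζ) v hv, e1, e2,
    h.adj x hx η hη v hv, h.adj x hx ζ hζ v hv, ip_comm v, ip_comm v]

/-- Symmetry of second functional derivatives. -/
theorem hessian_symm (h : HasAdj D Φ Ψ) (hD : POpen D) {x : A × (Pt → V)} (hx : x ∈ D) {η : Pt → W}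
    (hη : η ∈ (pts : Set (Pt → W))) {v w : Pt → V} (hv : v ∈ (pts : Set (Pt → V)))
    (hw : w ∈ (pts : Set (Pt → V))) :
    ip (dd Ψ (x, η) ((0, w), 0)) v = ip (dd Ψ (x, η) ((0, v), 0)) w := by
  -- Differentiating the defining identity of `Ψ` in the direction `w` exhibits the Hessian as a
  -- second derivative of `Φ`, which is symmetric.
  have key : ∀ {v w : Pt → V}, v ∈ (pts : Set (Pt → V)) → w ∈ (pts : Set (Pt → V)) →
      ip (dd Ψ (x, η) ((0, w), 0)) v = ip η (dd (fun y => dd Φ y (0, v)) x (0, w)) := by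
    intro v w hv hw
    have hv' := zero_prod_mem_pts (A := A) hv
    have hw' := zero_prod_mem_pts (A := A) hw
    have hs := h.adj_sm.slice POpen.pts hη
    have hs' : Sm D fun y => dd Φ y (0, v) :=
      h.sm.dd_apply hD Sm.id (Sm.const hv') fun _ h => h
    rw [← dd_slice Ψ, ← ip_dd_left hD hs hv hx hw', ← ip_dd_right hD hs' hη hx hw']
    exact dd_congr (Sm.ip_apply (Sm.const hη) hs') hD (fun y hy => (h.adj y hy η hη v hv).symm) hx
      hw'
  rw [key hv hw, key hw hv, dd_comm h.sm hD hx (zero_prod_mem_pts hw) (zero_prod_mem_pts hv)]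

/-- Functional derivatives of derivatives with respect to the parameters. -/
theorem param_deriv (h : HasAdj D Φ Ψ) (hD : POpen D) {a : A} (ha : a ∈ (pts : Set A)) :
    HasAdj D (fun x => dd Φ x (a, 0)) (fun y => dd Ψ y ((a, 0), 0)) := by
  have ha' : (a, (0 : Pt → V)) ∈ (pts : Set (A × (Pt → V))) := prodMk_mem_pts ha zero_mem_pts
  have ha'' := prodMk_mem_pts ha' (zero_mem_pts (X := Pt → W))
  refine ⟨h.sm.dd_apply hD Sm.id (Sm.const ha') fun _ h => h,
    h.adj_sm.dd_apply (hD.prod POpen.pts) Sm.id (Sm.const ha'') fun _ h => h, ?_⟩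
  intro x hx η hη v hv
  have hv' := zero_prod_mem_pts (A := A) hv
  have hs := h.adj_sm.slice POpen.pts hη
  have hs' : Sm D fun y => dd Φ y (0, v) :=
    h.sm.dd_apply hD Sm.id (Sm.const hv') fun _ h => h
  rw [dd_comm h.sm hD hx hv' ha', ← dd_slice Ψ, ← ip_dd_left hD hs hv hx ha',
    ← ip_dd_right hD hs' hη hx ha']
  exact (dd_congr (Sm.ip_apply (Sm.const hη) hs') hD (fun y hy => (h.adj y hy η hη v hv).symm) hx
    ha').symm

end HasAdj

theorem Reg.sm {Φ : A × (Pt → V) → Pt → W} (h : Reg D Φ) : Sm D Φ := h.choose_spec.sm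

theorem Reg.congr {Φ Φ' : A × (Pt → V) → Pt → W} (h : Reg D Φ) (hD : POpen D)
    (hΦ : ∀ x ∈ D, Φ' x = Φ x) : Reg D Φ' := by
  obtain ⟨Ψ, hΨ⟩ := h
  refine ⟨Ψ, hΨ.sm.congr hΦ, hΨ.adj_sm, fun x hx η hη v hv => ?_⟩
  rw [dd_congr hΨ.sm hD hΦ hx (zero_prod_mem_pts hv)]
  exact hΨ.adj x hx η hη v hv

theorem Reg.add {Φ Φ' : A × (Pt → V) → Pt → W} (h : Reg D Φ) (h' : Reg D Φ') (hD : POpen D) :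
    Reg D fun x => Φ x + Φ' x := by
  obtain ⟨Ψ, hΨ⟩ := h
  obtain ⟨Ψ', hΨ'⟩ := h'
  refine ⟨fun y => Ψ y + Ψ' y, hΨ.sm.add hΨ'.sm, hΨ.adj_sm.add hΨ'.adj_sm,
    fun x hx η hη v hv => ?_⟩
  have hv' := zero_prod_mem_pts (A := A) hv
  rw [dd_fun_add hΨ.sm hΨ'.sm hD hx hv', (ip_isLin_right hη).add (dd_mem_pts hΨ.sm hD hx hv')
    (dd_mem_pts hΨ'.sm hD hx hv'), hΨ.adj x hx η hη v hv, hΨ'.adj x hx η hη v hv,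
    (ip_isLin_left hv).add (hΨ.mem_pts hD hx hη) (hΨ'.mem_pts hD hx hη)]

/-- Composition with a linear operator on fields that has a transpose. -/
theorem Reg.lin_comp {Φ : A × (Pt → V) → Pt → W} (h : Reg D Φ) (hD : POpen D)
    {L : (Pt → W) → Pt → W'} (hL : IsLin L) (hS : Sm (pts : Set (Pt → W)) L)
    {Lt : (Pt → W') → Pt → W} (hSt : Sm (pts : Set (Pt → W')) Lt)
    (ht : ∀ η ∈ (pts : Set (Pt → W')), ∀ ξ ∈ (pts : Set (Pt → W)), ip η (L ξ) = ip (Lt η) ξ) :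
    Reg D fun x => L (Φ x) := by
  obtain ⟨Ψ, hΨ⟩ := h
  refine ⟨fun y => Ψ (y.1, Lt y.2), hS.comp hΨ.sm fun x hx => hΨ.sm.mem_pts hD hx,
    hΨ.adj_sm.comp (Sm.fst.prodMk (hSt.comp Sm.snd fun y hy => hy.2))
      fun y hy => ⟨hy.1, hSt.mem_pts POpen.pts hy.2⟩, fun x hx η hη v hv => ?_⟩
  have hv' := zero_prod_mem_pts (A := A) hv
  rw [dd_lin_comp hL hS hΨ.sm hD hx hv', ht η hη _ (dd_mem_pts hΨ.sm hD hx hv'),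
    hΨ.adj x hx _ (hSt.mem_pts POpen.pts hη) v hv]

theorem Reg.neg {Φ : A × (Pt → V) → Pt → W} (h : Reg D Φ) (hD : POpen D) : Reg D fun x => -Φ x :=
  h.lin_comp hD isLin_neg Sm.id.neg (Lt := fun η => -η) Sm.id.neg fun η hη ξ hξ => by
    rw [(ip_isLin_right hη).neg hξ, (ip_isLin_left hξ).neg hη]

theorem Reg.sub {Φ Φ' : A × (Pt → V) → Pt → W} (h : Reg D Φ) (h' : Reg D Φ') (hD : POpen D) :
    Reg D fun x => Φ x - Φ' x := by
  simp only [sub_eq_add_neg]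
  exact h.add (h'.neg hD) hD

/-- Maps of the parameters alone. -/
theorem Reg.of_param {Φ : A → Pt → W} {D' : Set A} (hΦ : Sm D' Φ) (hD : POpen D)
    (h : ∀ x ∈ D, x.1 ∈ D') : Reg D fun x => Φ x.1 := by
  have hs : Sm D fun x => Φ x.1 := hΦ.comp Sm.fst h
  refine ⟨fun _ => 0, hs, Sm.const zero_mem_pts, fun x hx η hη v hv => ?_⟩
  have : dd (fun y : A × (Pt → V) => Φ y.1) x (0, v) = 0 := by
    have := dd_const (hs.mem_pts hD hx) x (0, v)
    simpa [dd] using this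
  rw [this, (ip_isLin_right hη).zero, (ip_isLin_left hv).zero]

/-- Substitution of a field into an operator. -/
theorem RegOp.reg_comp {K : (A × (Pt → V)) × (Pt → W) → Pt → W'} (hK : RegOp D K) (hD : POpen D)
    {Φ : A × (Pt → V) → Pt → W} (h : Reg D Φ) : Reg D fun x => K (x, Φ x) := by
  obtain ⟨Ψ, hΨ⟩ := h
  obtain ⟨Kt, hKt, et⟩ := hK.transp
  obtain ⟨Kr, hKr, er⟩ := hK.reg
  have hΦ := hΨ.sm
  have hp : ∀ x ∈ D, Φ x ∈ (pts : Set (Pt → W)) := fun x hx => hΦ.mem_pts hD hx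
  have hKtp : ∀ x ∈ D, ∀ η ∈ (pts : Set (Pt → W')), Kt (x, η) ∈ (pts : Set (Pt → W)) :=
    fun x hx η hη => hKt.mem_pts (hD.prod POpen.pts) (x := (x, η)) ⟨hx, hη⟩
  have hDp := hD.prod (POpen.pts (X := Pt → W))
  have s1 : Sm (D ×ˢ (pts : Set (Pt → W'))) fun y => Kr ((y.1, Φ y.1), y.2) :=
    hKr.comp ((Sm.fst.prodMk (hΦ.comp Sm.fst fun y hy => hy.1)).prodMk Sm.snd)
      fun y hy => ⟨⟨hy.1, hp _ hy.1⟩, hy.2⟩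
  have s2 : Sm (D ×ˢ (pts : Set (Pt → W'))) fun y => Ψ (y.1, Kt y) :=
    hΨ.adj_sm.comp (Sm.fst.prodMk hKt) fun y hy => ⟨hy.1, hKtp _ hy.1 _ hy.2⟩
  -- Two contributions: the field dependence of the operator at fixed argument, and that of the
  -- argument, for which the operator is first moved to the test field by its transpose.
  refine ⟨fun y => Kr ((y.1, Φ y.1), y.2) + Ψ (y.1, Kt y),
    hK.sm.comp (Sm.id.prodMk hΦ) fun x hx => ⟨hx, hp x hx⟩, s1.add s2, fun x hx η hη v hv => ?_⟩
  have hv' := zero_prod_mem_pts (A := A) hv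
  have hd := dd_mem_pts hΦ hD hx hv'
  have hDK : dd (fun y => K (y, Φ y)) x (0, v) =
      dd K (x, Φ x) ((0, v), 0) + K (x, dd Φ x (0, v)) := by
    rw [dd_comp (Φ := fun y => (y, Φ y)) hK.sm hDp (Sm.id.prodMk hΦ) hD
      (fun y hy => ⟨hy, hp y hy⟩) hx hv', dd_prodMk, dd_id (hD.subset hx) hv',
      dd_prod hK.sm hDp ⟨hx, hp x hx⟩ hv' hd, dd_slice K]
    congr 1
    exact dd_of_isLin (hK.lin x hx) (hK.sm.comp ((Sm.const (hD.subset hx)).prodMk Sm.id)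
      fun ξ hξ => ⟨hx, hξ⟩) (hp x hx) hd
  have hd1 : dd K (x, Φ x) ((0, v), 0) ∈ (pts : Set (Pt → W')) :=
    dd_mem_pts hK.sm hDp ⟨hx, hp x hx⟩ (prodMk_mem_pts hv' zero_mem_pts)
  have hd2 : K (x, dd Φ x (0, v)) ∈ (pts : Set (Pt → W')) :=
    hK.sm.mem_pts hDp (x := (x, dd Φ x (0, v))) ⟨hx, hd⟩
  rw [hDK, (ip_isLin_right hη).add hd1 hd2,
    er x hx _ (hp x hx) η hη v hv, et x hx η hη _ hd, hΨ.adj x hx _ (hKtp x hx η hη) v hv,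
    (ip_isLin_left hv).add (s1.mem_pts (hD.prod POpen.pts) (x := (x, η)) ⟨hx, hη⟩)
      (s2.mem_pts (hD.prod POpen.pts) (x := (x, η)) ⟨hx, hη⟩)]

/-- The inverse of a family of operators. -/
theorem RegOp.inverse {K : (A × (Pt → V)) × (Pt → W) → Pt → W} (hK : RegOp D K) (hD : POpen D)
    {B Bt : (A × (Pt → V)) × (Pt → W) → Pt → W} (hB : Sm (D ×ˢ pts) B) (hBt : Sm (D ×ˢ pts) Bt)
    (hr : ∀ x ∈ D, ∀ η ∈ (pts : Set (Pt → W)), K (x, B (x, η)) = η)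
    (hl : ∀ x ∈ D, ∀ η ∈ (pts : Set (Pt → W)), B (x, K (x, η)) = η)
    (ht : ∀ x ∈ D, ∀ η ∈ (pts : Set (Pt → W)), ∀ ξ ∈ (pts : Set (Pt → W)),
      ip η (B (x, ξ)) = ip (Bt (x, η)) ξ) : RegOp D B := by
  obtain ⟨Kr, hKr, er⟩ := hK.reg
  have hDp := hD.prod (POpen.pts (X := Pt → W))
  have hBp : ∀ x ∈ D, ∀ η ∈ (pts : Set (Pt → W)), B (x, η) ∈ (pts : Set (Pt → W)) :=
    fun x hx η hη => hB.mem_pts hDp (x := (x, η)) ⟨hx, hη⟩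
  have hBtp : ∀ x ∈ D, ∀ η ∈ (pts : Set (Pt → W)), Bt (x, η) ∈ (pts : Set (Pt → W)) :=
    fun x hx η hη => hBt.mem_pts hDp (x := (x, η)) ⟨hx, hη⟩
  -- The derivative of an inverse is `-B (dK) B`. Transposing the left factor `B` gives the stated
  -- functional derivative.
  refine ⟨hB, fun x hx η hη ζ hζ a => ?_, ⟨Bt, hBt, ht⟩,
    fun y => -Kr ((y.1.1, B y.1), Bt (y.1.1, y.2)), ?_, fun x hx ξ hξ η hη v hv => ?_⟩
  · have h1 := hBp x hx η hη
    have h2 := hBp x hx ζ hζ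
    have h3 := hl x hx _ (add_mem_pts (smul_mem_pts a h1) h2)
    have h4 := hK.lin x hx _ h1 _ h2 a
    simp only at h4
    rwa [h4, hr x hx η hη, hr x hx ζ hζ] at h3
  · exact (hKr.comp (((Sm.fst.fst').prodMk (hB.comp Sm.fst fun y hy => hy.1)).prodMk
      (hBt.comp (Sm.fst.fst'.prodMk Sm.snd) fun y hy => ⟨hy.1.1, hy.2⟩))
      fun y hy => ⟨⟨hy.1.1, hBp _ hy.1.1 _ hy.1.2⟩, hBtp _ hy.1.1 _ hy.2⟩).neg
  · have hv' := zero_prod_mem_pts (A := A) hv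
    have hv'' : (((0 : A), v), (0 : Pt → W)) ∈ (pts : Set ((A × (Pt → V)) × (Pt → W))) :=
      prodMk_mem_pts hv' zero_mem_pts
    have hb := hBp x hx ξ hξ
    have hd : dd B (x, ξ) ((0, v), 0) ∈ (pts : Set (Pt → W)) := dd_mem_pts hB hDp ⟨hx, hξ⟩ hv''
    have hd1 : dd K (x, B (x, ξ)) ((0, v), 0) ∈ (pts : Set (Pt → W)) :=
      dd_mem_pts hK.sm hDp ⟨hx, hb⟩ hv''
    -- Differentiate `K (x, B (x, ξ)) = ξ` at fixed `ξ`.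
    have hzero : dd (fun y : (A × (Pt → V)) × (Pt → W) => K (y.1, B y)) (x, ξ) ((0, v), 0) = 0 := by
      rw [dd_congr (Sm.snd) hDp (fun y hy => hr y.1 hy.1 y.2 hy.2) ⟨hx, hξ⟩ hv'']
      exact dd_of_isLin (fun _ _ _ _ _ => rfl) (Sm.snd (D := pts)) (hDp.subset ⟨hx, hξ⟩) hv''
    have hsum : dd K (x, B (x, ξ)) ((0, v), 0) + K (x, dd B (x, ξ) ((0, v), 0)) = 0 := by
      refine Eq.trans ?_ hzero
      rw [dd_comp (Φ := fun y : (A × (Pt → V)) × (Pt → W) => (y.1, B y)) hK.sm hDp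
        (Sm.fst.prodMk hB) hDp (fun y hy => ⟨hy.1, hBp _ hy.1 _ hy.2⟩) ⟨hx, hξ⟩ hv'', dd_prodMk]
      have : dd (fun y : (A × (Pt → V)) × (Pt → W) => y.1) (x, ξ) ((0, v), 0) = ((0, v) : _ × _) :=
        dd_of_isLin (fun _ _ _ _ _ => rfl) (Sm.fst (D := pts)) (hDp.subset ⟨hx, hξ⟩) hv''
      rw [this, dd_prod hK.sm hDp ⟨hx, hb⟩ hv' hd, dd_slice K]
      congr 1
      exact (dd_of_isLin (hK.lin x hx) (hK.sm.comp ((Sm.const (hD.subset hx)).prodMk Sm.id)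
        fun ξ hξ => ⟨hx, hξ⟩) hb hd).symm
    have hKd : K (x, dd B (x, ξ) ((0, v), 0)) = -dd K (x, B (x, ξ)) ((0, v), 0) :=
      (neg_eq_of_add_eq_zero_right hsum).symm
    rw [← hl x hx _ hd, hKd, ht x hx η hη _ (neg_mem_pts hd1),
      (ip_isLin_right (hBtp x hx η hη)).neg hd1, er x hx _ hb _ (hBtp x hx η hη) v hv,
      (ip_isLin_left hv).neg (hKr.mem_pts (hDp.prod POpen.pts)
        (x := ((x, B (x, ξ)), Bt (x, η))) ⟨⟨hx, hb⟩, hBtp x hx η hη⟩)]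

/-- The bracket of a map with a family of functionals `⟨σ, c⟩`. -/
theorem HasAdj.bracket {Φ : A × (Pt → V) → Pt → W} {Ψ : (A × (Pt → V)) × (Pt → W) → Pt → V}
    (h : HasAdj D Φ Ψ) (hD : POpen D) {c : A × (Pt → V) → Pt → W'}
    {γ : (A × (Pt → V)) × (Pt → W') → Pt → V} (hc : HasAdj D c γ) {Ω : (Pt → V) → Pt → V}
    (hΩ : IsLin Ω) (hΩs : Sm (pts : Set (Pt → V)) Ω)
    (hΩa : ∀ u ∈ (pts : Set (Pt → V)), ∀ v ∈ (pts : Set (Pt → V)), ip u (Ω v) = -ip (Ω u) v) :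
    RegOp D (fun y : (A × (Pt → V)) × (Pt → W') => dd Φ y.1 (0, Ω (γ y))) ∧
    ∀ x ∈ D, ∀ σ ∈ (pts : Set (Pt → W')), ∀ η ∈ (pts : Set (Pt → W)), ∀ v ∈ (pts : Set (Pt → V)),
      ip η (dd (fun y : (A × (Pt → V)) × (Pt → W') => dd Φ y.1 (0, Ω (γ y))) (x, σ) ((0, v), 0)) =
        ip (dd Ψ (x, η) ((0, Ω (γ (x, σ))), 0) - dd γ (x, σ) ((0, Ω (Ψ (x, η))), 0)) v := by
  have hDp := hD.prod (POpen.pts (X := Pt → W'))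
  have hDp' := hD.prod (POpen.pts (X := Pt → W))
  have hΩp : ∀ u ∈ (pts : Set (Pt → V)), Ω u ∈ (pts : Set (Pt → V)) := fun u hu =>
    hΩs.mem_pts POpen.pts hu
  have sz : Sm (D ×ˢ (pts : Set (Pt → W'))) fun y => ((0 : A), Ω (γ y)) :=
    (Sm.const zero_mem_pts).prodMk (hΩs.comp hc.adj_sm fun y hy => hc.mem_pts hD hy.1 hy.2)
  have sz' : Sm (D ×ˢ (pts : Set (Pt → W))) fun y => ((0 : A), Ω (Ψ y)) :=
    (Sm.const zero_mem_pts).prodMk (hΩs.comp h.adj_sm fun y hy => h.mem_pts hD hy.1 hy.2)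
  have sK : Sm (D ×ˢ (pts : Set (Pt → W'))) fun y => dd Φ y.1 (0, Ω (γ y)) :=
    h.sm.dd_apply hD Sm.fst sz fun y hy => hy.1
  have key : ∀ x ∈ D, ∀ σ ∈ (pts : Set (Pt → W')), ∀ η ∈ (pts : Set (Pt → W)),
      ∀ v ∈ (pts : Set (Pt → V)),
      ip η (dd (fun y : (A × (Pt → V)) × (Pt → W') => dd Φ y.1 (0, Ω (γ y))) (x, σ) ((0, v), 0)) =
        ip (dd Ψ (x, η) ((0, Ω (γ (x, σ))), 0) - dd γ (x, σ) ((0, Ω (Ψ (x, η))), 0)) v := by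
    intro x hx σ hσ η hη v hv
    have hg := hc.mem_pts hD hx hσ
    have hΨ := h.mem_pts hD hx hη
    have hv' := zero_prod_mem_pts (A := A) hv
    have hw := zero_prod_mem_pts (A := A) (hΩp _ hg)
    have hu := zero_prod_mem_pts (A := A) (hΩp _ hΨ)
    have hdg : dd γ (x, σ) ((0, v), 0) ∈ (pts : Set (Pt → V)) :=
      dd_mem_pts hc.adj_sm hDp ⟨hx, hσ⟩ (prodMk_mem_pts hv' zero_mem_pts)
    have hdgu : dd γ (x, σ) ((0, Ω (Ψ (x, η))), 0) ∈ (pts : Set (Pt → V)) :=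
      dd_mem_pts hc.adj_sm hDp ⟨hx, hσ⟩ (prodMk_mem_pts hu zero_mem_pts)
    have hdΨ : dd Ψ (x, η) ((0, Ω (γ (x, σ))), 0) ∈ (pts : Set (Pt → V)) :=
      dd_mem_pts h.adj_sm hDp' ⟨hx, hη⟩ (prodMk_mem_pts hw zero_mem_pts)
    have s1 : Sm D fun y => Ω (γ (y, σ)) :=
      hΩs.comp (hc.adj_sm.slice POpen.pts hσ) fun y hy => hc.mem_pts hD hy hσ
    -- The direction of differentiation itself depends on the field. The first term becomes a
    -- derivative of `Ψ` by commuting second derivatives; the second is treated with antisymmetry of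
    -- `Ω` and symmetry of the Hessian of `⟨σ, c⟩`.
    have e1 : dd (fun y => dd Φ y (0, Ω (γ (y, σ)))) x (0, v) =
        dd (fun y => dd Φ y (0, Ω (γ (x, σ)))) x (0, v) +
          dd Φ x (0, Ω (dd γ (x, σ) ((0, v), 0))) := by
      rw [dd_comp (Ψ := fun y : (A × (Pt → V)) × (A × (Pt → V)) => dd Φ y.1 y.2)
        (Φ := fun y => (y, ((0 : A), Ω (γ (y, σ))))) (h.sm.dd hD) (hD.prod POpen.pts)
        (Sm.id.prodMk ((Sm.const zero_mem_pts).prodMk s1)) hD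
        (fun y hy => ⟨hy, zero_prod_mem_pts (hΩp _ (hc.mem_pts hD hy hσ))⟩) hx hv', dd_prodMk,
        dd_id (hD.subset hx) hv', dd_prodMk, dd_const zero_mem_pts,
        dd_lin_comp hΩ hΩs (hc.adj_sm.slice POpen.pts hσ) hD hx hv', dd_slice γ,
        dd_prod (h.sm.dd hD) (hD.prod POpen.pts) ⟨hx, hw⟩ hv' (zero_prod_mem_pts (hΩp _ hdg))]
      congr 1
      exact dd_of_isLin (dd_isLin h.sm hD hx)
        (h.sm.dd_apply hD (Sm.const (hD.subset hx)) Sm.id fun _ _ => hx) hw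
        (zero_prod_mem_pts (hΩp _ hdg))
    have hs1 : Sm D fun y => dd Φ y (0, Ω (γ (x, σ))) :=
      h.sm.dd_apply hD Sm.id (Sm.const hw) fun _ h => h
    have hsv : Sm D fun y => dd Φ y (0, v) := h.sm.dd_apply hD Sm.id (Sm.const hv') fun _ h => h
    have e2 : ip η (dd (fun y => dd Φ y (0, Ω (γ (x, σ)))) x (0, v)) =
        ip (dd Ψ (x, η) ((0, Ω (γ (x, σ))), 0)) v := by
      rw [dd_comm h.sm hD hx hv' hw, ← ip_dd_right hD hsv hη hx hw, ← dd_slice Ψ,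
        ← ip_dd_left hD (h.adj_sm.slice POpen.pts hη) hv hx hw]
      exact dd_congr (Sm.ip_apply (h.adj_sm.slice POpen.pts hη) (Sm.const hv)) hD
        (fun y hy => h.adj y hy η hη v hv) hx hw
    have e3 : ip η (dd Φ x (0, Ω (dd γ (x, σ) ((0, v), 0)))) =
        -ip (dd γ (x, σ) ((0, Ω (Ψ (x, η))), 0)) v := by
      rw [h.adj x hx η hη _ (hΩp _ hdg), hΩa _ hΨ _ hdg, ip_comm,
        hc.hessian_symm hD hx hσ hv (hΩp _ hΨ)]
    rw [← dd_slice (fun y : (A × (Pt → V)) × (Pt → W') => dd Φ y.1 (0, Ω (γ y)))]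
    refine (congrArg (ip η) e1).trans ?_
    rw [(ip_isLin_right hη).add (dd_mem_pts hs1 hD hx hv')
      (dd_mem_pts h.sm hD hx (zero_prod_mem_pts (hΩp _ hdg))), e2, e3,
      (ip_isLin_left hv).sub hdΨ hdgu, sub_eq_add_neg]
  -- The transpose is minus the bracket with the roles exchanged: `⟨Ψ η, Ω (γ σ)⟩ = -⟨Ω (Ψ η), γ
  -- σ⟩`, and pairing with `γ σ` differentiates `⟨σ, c⟩`.
  refine ⟨⟨sK, fun x hx => ?_, ⟨fun y => -dd c y.1 (0, Ω (Ψ y)), ?_, ?_⟩,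
    ⟨fun y => dd Ψ (y.1.1, y.2) ((0, Ω (γ y.1)), 0) - dd γ y.1 ((0, Ω (Ψ (y.1.1, y.2))), 0), ?_,
      key⟩⟩, key⟩
  · intro σ hσ τ hτ a
    have h1 := hc.mem_pts hD hx hσ
    have h2 := hc.mem_pts hD hx hτ
    have e1 : γ (x, a • σ + τ) = a • γ (x, σ) + γ (x, τ) := hc.isLin hD hx σ hσ τ hτ a
    have e2 : ((0 : A), a • Ω (γ (x, σ)) + Ω (γ (x, τ))) =
        a • ((0 : A), Ω (γ (x, σ))) + ((0 : A), Ω (γ (x, τ))) := by simp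
    simp only
    rw [e1, hΩ _ h1 _ h2 a, e2, dd_isLin h.sm hD hx _ (zero_prod_mem_pts (hΩp _ h1)) _
      (zero_prod_mem_pts (hΩp _ h2)) a]
  · exact (hc.sm.dd_apply hD Sm.fst sz' fun y hy => hy.1).neg
  · intro x hx η hη σ hσ
    have hg := hc.mem_pts hD hx hσ
    have hΨ := h.mem_pts hD hx hη
    have hu := zero_prod_mem_pts (A := A) (hΩp _ hΨ)
    have hd := dd_mem_pts hc.sm hD hx hu
    simp only
    rw [h.adj x hx η hη _ (hΩp _ hg), hΩa _ hΨ _ hg, (ip_isLin_left hσ).neg hd, ip_comm (Ω _),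
      ← hc.adj x hx σ hσ _ (hΩp _ hΨ), ip_comm σ]
  · have p1 : Sm ((D ×ˢ (pts : Set (Pt → W'))) ×ˢ (pts : Set (Pt → W)))
        fun y => (y.1.1, y.2) := (Sm.fst.fst').prodMk Sm.snd
    refine Sm.sub (h.adj_sm.dd_apply hDp' p1 ((sz.comp Sm.fst fun y hy => hy.1).prodMk
      (Sm.const zero_mem_pts)) fun y hy => ⟨hy.1.1, hy.2⟩)
      (hc.adj_sm.dd_apply hDp Sm.fst ((sz'.comp p1 fun y hy => ⟨hy.1.1, hy.2⟩).prodMk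
      (Sm.const zero_mem_pts)) fun y hy => hy.1)

end Adjoint

end

section

/-! ### Linear combinations of constraints -/

section WeakZero

variable {X Y Y' C : Type} [AddCommGroup X] [Module ℝ X] [DVS X] [AddCommGroup Y] [Module ℝ Y]
  [DVS Y] [AddCommGroup Y'] [Module ℝ Y'] [DVS Y'] [AddCommGroup C] [Module ℝ C] [DVS C]

/-- The map `Φ` is a linear combination of the constraints `c` with smooth coefficients. -/
def WZ (D : Set X) (c : X → C) (Φ : X → Y) : Prop :=
  ∃ α : X × C → Y, Sm (D ×ˢ pts) α ∧ (∀ x ∈ D, IsLin fun k => α (x, k)) ∧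
    ∀ x ∈ D, Φ x = α (x, c x)

variable {D : Set X} {c : X → C}

theorem WZ.sm {Φ : X → Y} (h : WZ D c Φ) (hD : POpen D) (hc : Sm D c) : Sm D Φ := by
  obtain ⟨α, hα, -, he⟩ := h
  exact (hα.comp (Sm.id.prodMk hc) fun x hx => ⟨hx, hc.mem_pts hD hx⟩).congr he

theorem WZ.congr {Φ Ψ : X → Y} (h : WZ D c Φ) (he : ∀ x ∈ D, Ψ x = Φ x) : WZ D c Ψ := by
  obtain ⟨α, hα, hl, h'⟩ := h
  exact ⟨α, hα, hl, fun x hx => (he x hx).trans (h' x hx)⟩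

theorem WZ.zero : WZ D c (fun _ => (0 : Y)) :=
  ⟨fun _ => 0, Sm.const zero_mem_pts, fun _ _ _ _ _ _ _ => by simp, fun _ _ => rfl⟩

theorem WZ.add {Φ Ψ : X → Y} (h : WZ D c Φ) (h' : WZ D c Ψ) : WZ D c (fun x => Φ x + Ψ x) := by
  obtain ⟨α, hα, hl, he⟩ := h
  obtain ⟨α', hα', hl', he'⟩ := h'
  refine ⟨fun y => α y + α' y, hα.add hα', fun x hx k hk k' hk' a => ?_, fun x hx => ?_⟩
  · have e1 := hl x hx k hk k' hk' a
    have e2 := hl' x hx k hk k' hk' a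
    simp only at e1 e2 ⊢
    rw [e1, e2, smul_add]
    abel
  · simp only [he x hx, he' x hx]

/-- Linear operators that depend smoothly on the point act on the coefficients, so weak vanishing
passes through brackets, derivatives in a weakly vanishing direction, and inverse matrices. -/
theorem WZ.map {L : X × Y → Y'} (hL : Sm (D ×ˢ pts) L) (hlin : ∀ x ∈ D, IsLin fun y => L (x, y))
    (hD : POpen D) {Φ : X → Y} (h : WZ D c Φ) : WZ D c (fun x => L (x, Φ x)) := by
  obtain ⟨α, hα, hl, he⟩ := h
  have hp : ∀ x ∈ D, ∀ k ∈ (pts : Set C), α (x, k) ∈ (pts : Set Y) := fun x hx k hk =>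
    hα.mem_pts (hD.prod POpen.pts) (x := (x, k)) ⟨hx, hk⟩
  refine ⟨fun y => L (y.1, α y), hL.comp (Sm.fst.prodMk hα) fun y hy => ⟨hy.1, hp _ hy.1 _ hy.2⟩,
    fun x hx k hk k' hk' a => ?_, fun x hx => by simp only [he x hx]⟩
  have e1 := hl x hx k hk k' hk' a
  have e2 := hlin x hx _ (hp x hx k hk) _ (hp x hx k' hk') a
  simp only at e1 e2 ⊢
  rw [e1, e2]

theorem WZ.neg (hD : POpen D) {Φ : X → Y} (h : WZ D c Φ) : WZ D c (fun x => -Φ x) :=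
  h.map (L := fun y => -y.2) Sm.snd.neg (fun _ _ => isLin_neg) hD

theorem WZ.sub (hD : POpen D) {Φ Ψ : X → Y} (h : WZ D c Φ) (h' : WZ D c Ψ) :
    WZ D c (fun x => Φ x - Ψ x) := by
  simp only [sub_eq_add_neg]
  exact h.add (h'.neg hD)

/-- Derivatives of a linear family of maps. -/
theorem isLin_dd_slice {α : X × C → Y} (hD : POpen D) (hα : Sm (D ×ˢ pts) α)
    (hl : ∀ x ∈ D, IsLin fun k => α (x, k)) {x v : X} (hx : x ∈ D) (hv : v ∈ (pts : Set X)) :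
    IsLin fun k => dd α (x, k) (v, 0) := by
  intro k hk k' hk' a
  have s := hα.slice POpen.pts hk
  have s' := hα.slice POpen.pts hk'
  have sa : Sm D fun y => a • α (y, k) := Sm.smul (Sm.const (pts_real a)) s
  have hlin : IsLin fun y : Y => a • y := fun y _ z _ b => by
    simp only [smul_add, smul_comm a b]
  simp only [← dd_slice]
  rw [dd_congr (sa.add s') hD (fun y hy => hl y hy k hk k' hk' a) hx hv, dd_fun_add sa s' hD hx hv,
    dd_lin_comp hlin (Sm.smul (Sm.const (pts_real a)) Sm.id) s hD hx hv]

/-- Vector fields tangent to the constraint surface preserve linear combinations of the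
constraints. -/
theorem WZ.dd {Φ : X → Y} (h : WZ D c Φ) (hD : POpen D) (hc : Sm D c) {A : X → X} (hA : Sm D A)
    (ht : WZ D c (fun x => ADM.dd c x (A x))) :
    WZ D c (fun x => ADM.dd Φ x (A x)) := by
  obtain ⟨α, hα, hl, he⟩ := h
  obtain ⟨δ, hδ, hδl, hδe⟩ := ht
  have hDp := hD.prod (POpen.pts (X := C))
  have hcp : ∀ x ∈ D, c x ∈ (pts : Set C) := fun x hx => hc.mem_pts hD hx
  have hδp : ∀ x ∈ D, ∀ k ∈ (pts : Set C), δ (x, k) ∈ (pts : Set C) := fun x hx k hk =>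
    hδ.mem_pts hDp (x := (x, k)) ⟨hx, hk⟩
  -- Leibniz rule for `α (x, c x)`: the derivative of the coefficients is still contracted with `c`,
  -- and the derivative of `c` along `A` is itself a combination `δ` of the constraints by tangency.
  refine ⟨fun y => ADM.dd α y (A y.1, 0) + α (y.1, δ y), ?_, fun x hx => ?_, fun x hx => ?_⟩
  · exact (hα.dd_apply hDp Sm.id ((hA.comp Sm.fst fun y hy => hy.1).prodMk (Sm.const zero_mem_pts))
      fun y hy => hy).add (hα.comp (Sm.fst.prodMk hδ) fun y hy => ⟨hy.1, hδp _ hy.1 _ hy.2⟩)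
  · intro k hk k' hk' a
    have e1 := isLin_dd_slice hD hα hl hx (hA.mem_pts hD hx) k hk k' hk' a
    have e2 := hδl x hx k hk k' hk' a
    have e3 := hl x hx _ (hδp x hx k hk) _ (hδp x hx k' hk') a
    simp only at e1 e2 e3 ⊢
    rw [e1, e2, e3, smul_add]
    abel
  · have hAx := hA.mem_pts hD hx
    have hd := dd_mem_pts hc hD hx hAx
    simp only at hδe ⊢
    rw [dd_congr (hα.comp (Sm.id.prodMk hc) fun x hx => ⟨hx, hcp x hx⟩) hD he hx hAx,
      dd_comp (Φ := fun y => (y, c y)) hα hDp (Sm.id.prodMk hc) hD (fun y hy => ⟨hy, hcp y hy⟩) hx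
        hAx, dd_prodMk, dd_id (hD.subset hx) hAx, dd_prod hα hDp ⟨hx, hcp x hx⟩ hAx hd, dd_slice α,
      ← hδe x hx]
    congr 1
    exact dd_of_isLin (hl x hx) (hα.comp ((Sm.const (hD.subset hx)).prodMk Sm.id)
      fun k hk => ⟨hx, hk⟩) (hcp x hx) hd

end WeakZero

/-! ### First class constraints and their gauge flows -/

section Flows

variable {A : Type} [AddCommGroup A] [Module ℝ A] [DVS A]
  {V W W' : Type} [NormedAddCommGroup V] [NormedSpace ℝ V] [FVal V]
  [NormedAddCommGroup W] [NormedSpace ℝ W] [FVal W]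
  [NormedAddCommGroup W'] [NormedSpace ℝ W'] [FVal W']

/-- First class constraints `c` that do not depend on the parameters, with functional derivatives
`γ`, Poisson tensor `Ω` and structure functions `κ`: `{⟨τ, c⟩, ⟨σ, c⟩} = ⟨κ (τ, σ), c⟩`. -/
structure FirstClass (D : Set (A × (Pt → V))) (c : A × (Pt → V) → Pt → W)
    (γ : (A × (Pt → V)) × (Pt → W) → Pt → V) (Ω : (Pt → V) → Pt → V)
    (κ : (A × (Pt → V)) × ((Pt → W) × (Pt → W)) → Pt → W) : Prop where
  isOpen : POpen D
  adj : HasAdj D c γ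
  indep : ∀ x ∈ D, ∀ a ∈ (pts : Set A), dd c x (a, 0) = 0
  indep_adj : ∀ x ∈ D, ∀ σ ∈ (pts : Set (Pt → W)), ∀ a ∈ (pts : Set A),
    dd γ (x, σ) ((a, 0), 0) = 0
  lin : IsLin Ω
  sm : Sm (pts : Set (Pt → V)) Ω
  antisymm : ∀ u ∈ (pts : Set (Pt → V)), ∀ v ∈ (pts : Set (Pt → V)), ip u (Ω v) = -ip (Ω u) v
  struct_sm : Sm (D ×ˢ pts) κ
  closure : ∀ x ∈ D, ∀ τ ∈ (pts : Set (Pt → W)), ∀ σ ∈ (pts : Set (Pt → W)),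
    ip τ (dd c x (0, Ω (γ (x, σ)))) = ip (κ (x, (τ, σ))) (c x)
  struct_adj : ∃ κr : ((A × (Pt → V)) × ((Pt → W) × (Pt → W))) × (Pt → W) → Pt → V,
    Sm ((D ×ˢ pts) ×ˢ pts) κr ∧
    ∀ x ∈ D, ∀ p ∈ (pts : Set ((Pt → W) × (Pt → W))), ∀ k ∈ (pts : Set (Pt → W)),
      ∀ v ∈ (pts : Set (Pt → V)), ip k (dd κ (x, p) ((0, v), 0)) = ip (κr ((x, p), k)) v
  struct_transp : ∃ κt : ((A × (Pt → V)) × (Pt → W)) × (Pt → W) → Pt → W,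
    Sm ((D ×ˢ pts) ×ˢ pts) κt ∧
    ∀ x ∈ D, ∀ τ ∈ (pts : Set (Pt → W)), ∀ σ ∈ (pts : Set (Pt → W)), ∀ k ∈ (pts : Set (Pt → W)),
      ip (κ (x, (τ, σ))) k = ip τ (κt ((x, σ), k))

namespace FirstClass

variable {D : Set (A × (Pt → V))} {c : A × (Pt → V) → Pt → W}
  {γ : (A × (Pt → V)) × (Pt → W) → Pt → V} {Ω : (Pt → V) → Pt → V}
  {κ : (A × (Pt → V)) × ((Pt → W) × (Pt → W)) → Pt → W}

theorem omega_mem (h : FirstClass D c γ Ω κ) {u : Pt → V} (hu : u ∈ (pts : Set (Pt → V))) :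
    Ω u ∈ (pts : Set (Pt → V)) := h.sm.mem_pts POpen.pts hu

theorem flow_mem (h : FirstClass D c γ Ω κ) {x : A × (Pt → V)} (hx : x ∈ D) {σ : Pt → W}
    (hσ : σ ∈ (pts : Set (Pt → W))) : Ω (γ (x, σ)) ∈ (pts : Set (Pt → V)) :=
  h.omega_mem (h.adj.mem_pts h.isOpen hx hσ)

theorem flow_sm (h : FirstClass D c γ Ω κ) {s : A × (Pt → V) → Pt → W} (hs : Sm D s) :
    Sm D fun x => Ω (γ (x, s x)) :=
  h.sm.comp (h.adj.adj_sm.comp (Sm.id.prodMk hs) fun _ hx => ⟨hx, hs.mem_pts h.isOpen hx⟩)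
    fun _ hx => h.adj.mem_pts h.isOpen hx (hs.mem_pts h.isOpen hx)

/-- The Lie bracket of the flows of two constraints. -/
theorem lie_bracket (h : FirstClass D c γ Ω κ) :
    ∃ κr : ((A × (Pt → V)) × ((Pt → W) × (Pt → W))) × (Pt → W) → Pt → V,
      Sm ((D ×ˢ pts) ×ˢ pts) κr ∧
      (∀ x ∈ D, ∀ p ∈ (pts : Set ((Pt → W) × (Pt → W))), IsLin fun k => κr ((x, p), k)) ∧
      ∀ x ∈ D, ∀ τ ∈ (pts : Set (Pt → W)), ∀ σ ∈ (pts : Set (Pt → W)),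
        dd γ (x, τ) ((0, Ω (γ (x, σ))), 0) - dd γ (x, σ) ((0, Ω (γ (x, τ))), 0) =
          κr ((x, (τ, σ)), c x) + γ (x, κ (x, (τ, σ))) := by
  obtain ⟨κr, hs, hr⟩ := h.struct_adj
  have hD := h.isOpen
  have hDp := hD.prod (POpen.pts (X := (Pt → W) × (Pt → W)))
  have hDw := hD.prod (POpen.pts (X := Pt → W))
  have hrp : ∀ x ∈ D, ∀ p ∈ (pts : Set ((Pt → W) × (Pt → W))), ∀ k ∈ (pts : Set (Pt → W)),
      κr ((x, p), k) ∈ (pts : Set (Pt → V)) := fun x hx p hp k hk =>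
    hs.mem_pts (hDp.prod POpen.pts) (x := ((x, p), k)) ⟨⟨hx, hp⟩, hk⟩
  refine ⟨κr, hs, fun x hx p hp k hk k' hk' a => ?_, fun x hx τ hτ σ hσ => ?_⟩
  · have hkk := add_mem_pts (smul_mem_pts a hk) hk'
    refine eq_of_ip (hrp x hx p hp _ hkk) (add_mem_pts (smul_mem_pts a (hrp x hx p hp k hk))
      (hrp x hx p hp k' hk')) fun v hv => ?_
    have hd : dd κ (x, p) ((0, v), 0) ∈ (pts : Set (Pt → W)) := dd_mem_pts h.struct_sm hDp ⟨hx, hp⟩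
      (prodMk_mem_pts (zero_prod_mem_pts hv) zero_mem_pts)
    have e1 := ip_isLin_left hd k hk k' hk' a
    have e2 := ip_isLin_right hv _ (hrp x hx p hp k hk) _ (hrp x hx p hp k' hk') a
    simp only at e1 e2 ⊢
    rw [e2, ip_comm v, ip_comm v, ip_comm v, ← hr x hx p hp _ hkk v hv, e1,
      hr x hx p hp k hk v hv, hr x hx p hp k' hk' v hv]
  · have hp : (τ, σ) ∈ (pts : Set ((Pt → W) × (Pt → W))) := prodMk_mem_pts hτ hσ
    have hcx := h.adj.sm.mem_pts hD hx
    have hκ : κ (x, (τ, σ)) ∈ (pts : Set (Pt → W)) :=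
      h.struct_sm.mem_pts hDp (x := (x, (τ, σ))) ⟨hx, hp⟩
    have hz := h.flow_mem hx hσ
    have hz' := h.flow_mem hx hτ
    refine eq_of_ip (sub_mem_pts
      (dd_mem_pts h.adj.adj_sm hDw ⟨hx, hτ⟩ (prodMk_mem_pts (zero_prod_mem_pts hz) zero_mem_pts))
      (dd_mem_pts h.adj.adj_sm hDw ⟨hx, hσ⟩ (prodMk_mem_pts (zero_prod_mem_pts hz') zero_mem_pts)))
      (add_mem_pts (hrp x hx _ hp _ hcx) (h.adj.mem_pts hD hx hκ)) fun v hv => ?_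
    have hv' := zero_prod_mem_pts (A := A) hv
    have hb := h.adj.bracket hD h.adj h.lin h.sm h.antisymm
    have sb := hb.1.sm.slice POpen.pts hσ
    have sκ := h.struct_sm.slice POpen.pts hp
    -- The gradient of the bracket of two smeared constraints is computed in two ways: by the
    -- bracket formula it is the left side, and by first class closure it is the gradient of `⟨κ,
    -- c⟩`, whose two Leibniz terms are the right side.
    rw [ip_comm, ← hb.2 x hx σ hσ τ hτ v hv, ← dd_slice, ← ip_dd_right hD sb hτ hx hv',
      dd_congr (Sm.ip_apply sκ h.adj.sm) hD (fun y hy => h.closure y hy τ hτ σ hσ) hx hv']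
    have e1 : dd (fun y => ip (κ (y, (τ, σ))) (c y)) x (0, v) =
        ip (dd κ (x, (τ, σ)) ((0, v), 0)) (c x) + ip (κ (x, (τ, σ))) (dd c x (0, v)) := by
      have hdc := dd_mem_pts h.adj.sm hD hx hv'
      have hdκ := dd_mem_pts sκ hD hx hv'
      rw [dd_comp (Φ := fun y => (κ (y, (τ, σ)), c y))
        (Ψ := fun y : (Pt → W) × (Pt → W) => ip y.1 y.2) Sm.ip POpen.pts (sκ.prodMk h.adj.sm) hD
        (fun y hy => ⟨sκ.mem_pts hD hy, h.adj.sm.mem_pts hD hy⟩) hx hv', dd_prodMk,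
        dd_prod Sm.ip POpen.pts (prodMk_mem_pts hκ hcx) hdκ hdc]
      rw [dd_of_isLin (ip_isLin_left hcx) (Sm.ip_apply Sm.id (Sm.const hcx)) hκ hdκ,
        dd_of_isLin (ip_isLin_right hκ) (Sm.ip_apply (Sm.const hκ) Sm.id) hcx hdc, dd_slice κ]
    rw [e1, ip_comm _ (c x), hr x hx _ hp _ hcx v hv, h.adj.adj x hx _ hκ v hv,
      (ip_isLin_right hv).add (hrp x hx _ hp _ hcx) (h.adj.mem_pts hD hx hκ), ip_comm v, ip_comm v]

/-- The flows of the constraints are tangent to the constraint surface. -/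
theorem tangent (h : FirstClass D c γ Ω κ) {s : A × (Pt → V) → Pt → W} (hs : Sm D s)
    {e : A × (Pt → V) → Pt → V} (he : WZ D c e) {a : A × (Pt → V) → A} (ha : Sm D a) :
    WZ D c fun x => dd c x (a x, Ω (γ (x, s x)) + e x) := by
  obtain ⟨κt, ht, et⟩ := h.struct_transp
  have hD := h.isOpen
  have hc := h.adj.sm
  have hsp : ∀ x ∈ D, s x ∈ (pts : Set (Pt → W)) := fun x hx => hs.mem_pts hD hx
  have htp : ∀ x ∈ D, ∀ σ ∈ (pts : Set (Pt → W)), ∀ k ∈ (pts : Set (Pt → W)),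
      κt ((x, σ), k) ∈ (pts : Set (Pt → W)) := fun x hx σ hσ k hk =>
    ht.mem_pts ((hD.prod POpen.pts).prod POpen.pts) (x := ((x, σ), k)) ⟨⟨hx, hσ⟩, hk⟩
  -- Closure is known after smearing with `τ`. Transposing the structure functions in the slot of
  -- `τ` removes this smearing and leaves an operator applied to `c`.
  have h1 : WZ D c fun x => dd c x (0, Ω (γ (x, s x))) := by
    refine ⟨fun y => κt ((y.1, s y.1), y.2), ht.comp ((Sm.fst.prodMk
      (hs.comp Sm.fst fun y hy => hy.1)).prodMk Sm.snd) fun y hy => ⟨⟨hy.1, hsp _ hy.1⟩, hy.2⟩,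
      fun x hx k hk k' hk' b => ?_, fun x hx => ?_⟩
    · have hkk := add_mem_pts (smul_mem_pts b hk) hk'
      have t1 := htp x hx _ (hsp x hx) k hk
      have t2 := htp x hx _ (hsp x hx) k' hk'
      refine eq_of_ip (htp x hx _ (hsp x hx) _ hkk) (add_mem_pts (smul_mem_pts b t1) t2)
        fun τ hτ => ?_
      have hκ : κ (x, (τ, s x)) ∈ (pts : Set (Pt → W)) := h.struct_sm.mem_pts
        (hD.prod POpen.pts) (x := (x, (τ, s x))) ⟨hx, prodMk_mem_pts hτ (hsp x hx)⟩
      have e1 := ip_isLin_right hκ k hk k' hk' b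
      have e2 := ip_isLin_right hτ _ t1 _ t2 b
      simp only at e1 e2 ⊢
      rw [e2, ← et x hx τ hτ _ (hsp x hx) _ hkk, e1, et x hx τ hτ _ (hsp x hx) _ hk,
        et x hx τ hτ _ (hsp x hx) _ hk']
    · refine eq_of_ip (dd_mem_pts hc hD hx (zero_prod_mem_pts (h.flow_mem hx (hsp x hx))))
        (htp x hx _ (hsp x hx) _ (hc.mem_pts hD hx)) fun τ hτ => ?_
      rw [h.closure x hx τ hτ _ (hsp x hx), et x hx τ hτ _ (hsp x hx) _ (hc.mem_pts hD hx)]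
  have h2 : WZ D c fun x => dd c x (0, e x) :=
    he.map (L := fun y : (A × (Pt → V)) × (Pt → V) => dd c y.1 (0, y.2))
      (hc.dd_apply hD Sm.fst ((Sm.const zero_mem_pts).prodMk Sm.snd) fun y hy => hy.1)
      (fun x hx u hu v hv b => by
        have := dd_isLin hc hD hx _ (zero_prod_mem_pts (A := A) hu) _ (zero_prod_mem_pts hv) b
        simpa using this) hD
  refine (h1.add h2).congr fun x hx => ?_
  have hex := (he.sm hD hc).mem_pts hD hx
  have hz := h.flow_mem hx (hsp x hx)
  have hax := ha.mem_pts hD hx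
  have hsplit : (a x, Ω (γ (x, s x)) + e x) =
      (a x, (0 : Pt → V)) + (((0 : A), Ω (γ (x, s x))) + ((0 : A), e x)) := by simp
  rw [hsplit, dd_add hc hD hx (prodMk_mem_pts hax zero_mem_pts)
    (add_mem_pts (zero_prod_mem_pts hz) (zero_prod_mem_pts hex)),
    dd_add hc hD hx (zero_prod_mem_pts hz) (zero_prod_mem_pts hex), h.indep x hx _ hax, zero_add]

/-- Product rule for a flow with field dependent smearing. The parameters enter only through the
smearing, because neither the constraints nor their functional derivatives depend on them. -/
theorem dd_flow (h : FirstClass D c γ Ω κ) {s : A × (Pt → V) → Pt → W} (hs : Sm D s)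
    {x : A × (Pt → V)} (hx : x ∈ D) {a : A} {v : Pt → V} (ha : a ∈ (pts : Set A))
    (hv : v ∈ (pts : Set (Pt → V))) :
    dd (fun y => Ω (γ (y, s y))) x (a, v) =
      Ω (dd γ (x, s x) ((0, v), 0)) + Ω (γ (x, dd s x (a, v))) := by
  have hD := h.isOpen
  have hDw := hD.prod (POpen.pts (X := Pt → W))
  have hav : (a, v) ∈ (pts : Set (A × (Pt → V))) := prodMk_mem_pts ha hv
  have hsx := hs.mem_pts hD hx
  have hds := dd_mem_pts hs hD hx hav
  have ha0 : (a, (0 : Pt → V)) ∈ (pts : Set (A × (Pt → V))) := prodMk_mem_pts ha zero_mem_pts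
  have h0v := zero_prod_mem_pts (A := A) hv
  have hg : Sm D fun y => γ (y, s y) :=
    h.adj.adj_sm.comp (Sm.id.prodMk hs) fun y hy => ⟨hy, hs.mem_pts hD hy⟩
  have hsplit : ((a, v), (0 : Pt → W)) = ((a, 0), 0) + ((0, v), 0) := by simp
  rw [dd_lin_comp h.lin h.sm hg hD hx hav, dd_comp (Φ := fun y => (y, s y)) h.adj.adj_sm hDw
    (Sm.id.prodMk hs) hD (fun y hy => ⟨hy, hs.mem_pts hD hy⟩) hx hav, dd_prodMk,
    dd_id (hD.subset hx) hav, dd_prod h.adj.adj_sm hDw ⟨hx, hsx⟩ hav hds, dd_slice γ, hsplit,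
    dd_add h.adj.adj_sm hDw ⟨hx, hsx⟩ (prodMk_mem_pts ha0 zero_mem_pts)
      (prodMk_mem_pts h0v zero_mem_pts), h.indep_adj x hx _ hsx a ha, zero_add,
    dd_of_isLin (h.adj.isLin hD hx) (h.adj.adj_sm.comp ((Sm.const (hD.subset hx)).prodMk Sm.id)
      fun k hk => ⟨hx, hk⟩) hsx hds,
    h.lin.add (dd_mem_pts h.adj.adj_sm hDw ⟨hx, hsx⟩ (prodMk_mem_pts h0v zero_mem_pts))
      (h.adj.mem_pts hD hx hds)]

variable {σA σB : A × (Pt → V) → Pt → W} {eA eB : A × (Pt → V) → Pt → V} {a : A × (Pt → V) → A}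
  {FA FB : A × (Pt → V) → A × (Pt → V)}

theorem field_sm (h : FirstClass D c γ Ω κ) (hσ : Sm D σA) (he : WZ D c eA) (ha : Sm D a)
    (hF : ∀ x, FA x = (a x, Ω (γ (x, σA x)) + eA x)) : Sm D FA := by
  rw [funext hF]
  exact ha.prodMk ((h.flow_sm hσ).add (he.sm h.isOpen h.adj.sm))

/-- The commutator of two gauge flows is a gauge flow, up to linear combinations of constraints. -/
theorem commutator_flow (h : FirstClass D c γ Ω κ) (hσA : Sm D σA) (hσB : Sm D σB)
    (heA : WZ D c eA) (heB : WZ D c eB) (ha : Sm D a)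
    (hA : ∀ x, FA x = (a x, Ω (γ (x, σA x)) + eA x)) (hB : ∀ x, FB x = (0, Ω (γ (x, σB x)) + eB x))
    (hBa : ∀ x ∈ D, dd a x (FB x) = 0) :
    ∃ (ρ : A × (Pt → V) → Pt → W) (w : A × (Pt → V) → Pt → V), Sm D ρ ∧ WZ D c w ∧
      ∀ x ∈ D, dd FB x (FA x) - dd FA x (FB x) = (0, Ω (γ (x, ρ x)) + w x) := by
  obtain ⟨κr, hs, hl, hr⟩ := h.lie_bracket
  have hD := h.isOpen
  have hc := h.adj.sm
  have hDw := hD.prod (POpen.pts (X := Pt → W))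
  have sA := h.field_sm hσA heA ha hA
  have sB := h.field_sm hσB heB (Sm.const zero_mem_pts) hB
  have tA : WZ D c fun x => dd c x (FA x) := (h.tangent hσA heA ha).congr fun x _ => by rw [hA]
  have tB : WZ D c fun x => dd c x (FB x) :=
    (h.tangent hσB heB (Sm.const zero_mem_pts)).congr fun x _ => by rw [hB]
  have mA : ∀ x ∈ D, σA x ∈ (pts : Set (Pt → W)) := fun x hx => hσA.mem_pts hD hx
  have mB : ∀ x ∈ D, σB x ∈ (pts : Set (Pt → W)) := fun x hx => hσB.mem_pts hD hx
  have sκ : Sm D fun x => κ (x, (σB x, σA x)) := h.struct_sm.comp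
    (Sm.id.prodMk (hσB.prodMk hσA)) fun x hx => ⟨hx, prodMk_mem_pts (mB x hx) (mA x hx)⟩
  have sdB : Sm D fun x => dd σB x (FA x) := hσB.dd_apply hD Sm.id sA fun _ h => h
  have sdA : Sm D fun x => dd σA x (FB x) := hσA.dd_apply hD Sm.id sB fun _ h => h
  -- The derivative of the structure functions multiplies the constraints, so this part of the Lie
  -- bracket vanishes weakly.
  have wr : WZ D c fun x => Ω (κr ((x, (σB x, σA x)), c x)) := by
    have hp : ∀ x ∈ D, (σB x, σA x) ∈ (pts : Set ((Pt → W) × (Pt → W))) := fun x hx =>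
      prodMk_mem_pts (mB x hx) (mA x hx)
    have hm : ∀ x ∈ D, ∀ k ∈ (pts : Set (Pt → W)), κr ((x, (σB x, σA x)), k) ∈
        (pts : Set (Pt → V)) := fun x hx k hk => hs.mem_pts
      ((hD.prod POpen.pts).prod POpen.pts) (x := ((x, (σB x, σA x)), k)) ⟨⟨hx, hp x hx⟩, hk⟩
    refine ⟨fun y => Ω (κr ((y.1, (σB y.1, σA y.1)), y.2)), h.sm.comp (hs.comp
      ((Sm.fst.prodMk ((hσB.prodMk hσA).comp Sm.fst fun y hy => hy.1)).prodMk Sm.snd)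
      fun y hy => ⟨⟨hy.1, hp _ hy.1⟩, hy.2⟩) fun y hy => hm _ hy.1 _ hy.2,
      fun x hx k hk k' hk' b => ?_, fun x hx => rfl⟩
    have e1 := hl x hx _ (hp x hx) k hk k' hk' b
    simp only at e1 ⊢
    rw [e1, h.lin _ (hm x hx k hk) _ (hm x hx k' hk') b]
  have we : ∀ {σ : A × (Pt → V) → Pt → W} {e : A × (Pt → V) → Pt → V}, Sm D σ → WZ D c e →
      WZ D c fun x => Ω (dd γ (x, σ x) ((0, e x), 0)) := by
    intro σ e hσ he
    refine he.map (L := fun y : (A × (Pt → V)) × (Pt → V) => Ω (dd γ (y.1, σ y.1) ((0, y.2), 0)))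
      (h.sm.comp (h.adj.adj_sm.dd_apply hDw (Sm.fst.prodMk (hσ.comp Sm.fst fun y hy => hy.1))
        (((Sm.const zero_mem_pts).prodMk Sm.snd).prodMk (Sm.const zero_mem_pts))
        fun y hy => ⟨hy.1, hσ.mem_pts hD hy.1⟩) fun y hy => ?_) (fun x hx u hu v hv b => ?_) hD
    · exact dd_mem_pts h.adj.adj_sm hDw ⟨hy.1, hσ.mem_pts hD hy.1⟩
        (prodMk_mem_pts (zero_prod_mem_pts hy.2) zero_mem_pts)
    · have hx' : (x, σ x) ∈ D ×ˢ (pts : Set (Pt → W)) := ⟨hx, hσ.mem_pts hD hx⟩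
      have hu' : (((0 : A), u), (0 : Pt → W)) ∈ (pts : Set ((A × (Pt → V)) × (Pt → W))) :=
        prodMk_mem_pts (zero_prod_mem_pts hu) zero_mem_pts
      have hv' : (((0 : A), v), (0 : Pt → W)) ∈ (pts : Set ((A × (Pt → V)) × (Pt → W))) :=
        prodMk_mem_pts (zero_prod_mem_pts hv) zero_mem_pts
      have e1 := dd_isLin h.adj.adj_sm hDw hx' _ hu' _ hv' b
      have e2 : b • (((0 : A), u), (0 : Pt → W)) + ((0, v), 0) = ((0, b • u + v), 0) := by simp
      rw [e2] at e1
      simp only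
      rw [e1, h.lin _ (dd_mem_pts h.adj.adj_sm hDw hx' hu') _
        (dd_mem_pts h.adj.adj_sm hDw hx' hv') b]
  -- The new smearing collects the rates of change of both smearings and the structure functions.
  -- Everything else comes from derivatives of the structure functions, from the error fields as
  -- directions, and from derivatives of the error fields along tangent flows.
  refine ⟨fun x => dd σB x (FA x) - dd σA x (FB x) + κ (x, (σB x, σA x)),
    fun x => Ω (κr ((x, (σB x, σA x)), c x)) + (Ω (dd γ (x, σB x) ((0, eA x), 0)) -
      Ω (dd γ (x, σA x) ((0, eB x), 0))) + (dd eB x (FA x) - dd eA x (FB x)),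
    (sdB.sub sdA).add sκ, (wr.add ((we hσB heA).sub hD (we hσA heB))).add
      ((heB.dd hD hc sA tA).sub hD (heA.dd hD hc sB tB)), fun x hx => ?_⟩
  have hAx := sA.mem_pts hD hx
  have hBx := sB.mem_pts hD hx
  have seA := heA.sm hD hc
  have seB := heB.sm hD hc
  have hzA := h.flow_mem hx (mA x hx)
  have hzB := h.flow_mem hx (mB x hx)
  have hax := ha.mem_pts hD hx
  have split : ∀ {σ τ : Pt → W} {e : Pt → V}, σ ∈ (pts : Set (Pt → W)) →
      τ ∈ (pts : Set (Pt → W)) → e ∈ (pts : Set (Pt → V)) →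
      Ω (dd γ (x, σ) ((0, Ω (γ (x, τ)) + e), 0)) =
        Ω (dd γ (x, σ) ((0, Ω (γ (x, τ))), 0)) + Ω (dd γ (x, σ) ((0, e), 0)) := by
    intro σ τ e hσ hτ he
    have h1 : (((0 : A), Ω (γ (x, τ))), (0 : Pt → W)) ∈ (pts : Set ((A × (Pt → V)) × (Pt → W))) :=
      prodMk_mem_pts (zero_prod_mem_pts (h.flow_mem hx hτ)) zero_mem_pts
    have h2 : (((0 : A), e), (0 : Pt → W)) ∈ (pts : Set ((A × (Pt → V)) × (Pt → W))) :=
      prodMk_mem_pts (zero_prod_mem_pts he) zero_mem_pts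
    have e2 : (((0 : A), Ω (γ (x, τ)) + e), (0 : Pt → W)) =
      ((0, Ω (γ (x, τ))), 0) + ((0, e), 0) := by simp
    rw [e2, dd_add h.adj.adj_sm hDw ⟨hx, hσ⟩ h1 h2, h.lin.add
      (dd_mem_pts h.adj.adj_sm hDw ⟨hx, hσ⟩ h1) (dd_mem_pts h.adj.adj_sm hDw ⟨hx, hσ⟩ h2)]
  have dB : dd FB x (FA x) = (0, dd (fun y => Ω (γ (y, σB y))) x (FA x) + dd eB x (FA x)) := by
    rw [funext hB, dd_prodMk, dd_const zero_mem_pts, dd_fun_add (h.flow_sm hσB) seB hD hx hAx]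
  have dA : dd FA x (FB x) = (0, dd (fun y => Ω (γ (y, σA y))) x (FB x) + dd eA x (FB x)) := by
    rw [funext hA, dd_prodMk, hBa x hx, dd_fun_add (h.flow_sm hσA) seA hD hx hBx]
  have fB : dd (fun y => Ω (γ (y, σB y))) x (FA x) = Ω (dd γ (x, σB x) ((0, Ω (γ (x, σA x))), 0)) +
      Ω (dd γ (x, σB x) ((0, eA x), 0)) + Ω (γ (x, dd σB x (FA x))) := by
    rw [hA, h.dd_flow hσB hx hax (add_mem_pts hzA (seA.mem_pts hD hx)),
      split (mB x hx) (mA x hx) (seA.mem_pts hD hx)]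
  have fA : dd (fun y => Ω (γ (y, σA y))) x (FB x) = Ω (dd γ (x, σA x) ((0, Ω (γ (x, σB x))), 0)) +
      Ω (dd γ (x, σA x) ((0, eB x), 0)) + Ω (γ (x, dd σA x (FB x))) := by
    rw [hB, h.dd_flow hσA hx zero_mem_pts (add_mem_pts hzB (seB.mem_pts hD hx)),
      split (mA x hx) (mB x hx) (seB.mem_pts hD hx)]
  have hκx := sκ.mem_pts hD hx
  have hd1 := sdB.mem_pts hD hx
  have hd2 := sdA.mem_pts hD hx
  have hp : (σB x, σA x) ∈ (pts : Set ((Pt → W) × (Pt → W))) := prodMk_mem_pts (mB x hx) (mA x hx)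
  have hγ1 : dd γ (x, σB x) ((0, Ω (γ (x, σA x))), 0) ∈ (pts : Set (Pt → V)) :=
    dd_mem_pts h.adj.adj_sm hDw ⟨hx, mB x hx⟩ (prodMk_mem_pts (zero_prod_mem_pts hzA) zero_mem_pts)
  have hγ2 : dd γ (x, σA x) ((0, Ω (γ (x, σB x))), 0) ∈ (pts : Set (Pt → V)) :=
    dd_mem_pts h.adj.adj_sm hDw ⟨hx, mA x hx⟩ (prodMk_mem_pts (zero_prod_mem_pts hzB) zero_mem_pts)
  have hrx := congrArg Ω (hr x hx _ (mB x hx) _ (mA x hx))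
  rw [h.lin.sub hγ1 hγ2, h.lin.add (hs.mem_pts ((hD.prod POpen.pts).prod POpen.pts)
    (x := ((x, (σB x, σA x)), c x)) ⟨⟨hx, hp⟩, hc.mem_pts hD hx⟩) (h.adj.mem_pts hD hx hκx)] at hrx
  have hρ : Ω (γ (x, dd σB x (FA x) - dd σA x (FB x) + κ (x, (σB x, σA x)))) =
      Ω (γ (x, dd σB x (FA x))) - Ω (γ (x, dd σA x (FB x))) + Ω (γ (x, κ (x, (σB x, σA x)))) := by
    have e1 := (h.adj.isLin hD hx).add (sub_mem_pts hd1 hd2) hκx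
    have e2 := (h.adj.isLin hD hx).sub hd1 hd2
    rw [e1, e2, h.lin.add (sub_mem_pts (h.adj.mem_pts hD hx hd1) (h.adj.mem_pts hD hx hd2))
      (h.adj.mem_pts hD hx hκx), h.lin.sub (h.adj.mem_pts hD hx hd1) (h.adj.mem_pts hD hx hd2)]
  rw [dA, dB, Prod.mk_sub_mk, sub_zero, fA, fB, hρ]
  congr 1
  change _ = _ + (Ω (κr ((x, (σB x, σA x)), c x)) + _ + _)
  generalize Ω (κr ((x, (σB x, σA x)), c x)) = k at hrx ⊢
  have hrx' := sub_eq_iff_eq_add.1 hrx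
  rw [hrx']
  abel

/-- Two gauge flows commute weakly if they do so on quantities `G` that separate the flows. -/
theorem commutator_weak (h : FirstClass D c γ Ω κ) (hσA : Sm D σA) (hσB : Sm D σB)
    (heA : WZ D c eA) (heB : WZ D c eB) (ha : Sm D a)
    (hA : ∀ x, FA x = (a x, Ω (γ (x, σA x)) + eA x)) (hB : ∀ x, FB x = (0, Ω (γ (x, σB x)) + eB x))
    (hBa : ∀ x ∈ D, dd a x (FB x) = 0)
    {G gA gB : A × (Pt → V) → Pt → W'} (hG : Sm D G)
    {𝔅 : (A × (Pt → V)) × (Pt → W') → Pt → W} (h𝔅 : Sm (D ×ˢ pts) 𝔅)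
    (h𝔅l : ∀ x ∈ D, IsLin fun k => 𝔅 (x, k))
    (h𝔅i : ∀ x ∈ D, ∀ σ ∈ (pts : Set (Pt → W)), 𝔅 (x, dd G x (0, Ω (γ (x, σ)))) = σ)
    (hgA : Sm D gA) (hgB : Sm D gB) (wA : WZ D c fun x => dd G x (FA x) - gA x)
    (wB : WZ D c fun x => dd G x (FB x) - gB x)
    (hg : WZ D c fun x => dd gB x (FA x) - dd gA x (FB x)) :
    WZ D c fun x => dd FB x (FA x) - dd FA x (FB x) := by
  obtain ⟨ρ, w, hρ, hw, hcomm⟩ := h.commutator_flow hσA hσB heA heB ha hA hB hBa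
  have hD := h.isOpen
  have hc := h.adj.sm
  have sA := h.field_sm hσA heA ha hA
  have sB := h.field_sm hσB heB (Sm.const zero_mem_pts) hB
  have tA : WZ D c fun x => dd c x (FA x) := (h.tangent hσA heA ha).congr fun x _ => by rw [hA]
  have tB : WZ D c fun x => dd c x (FB x) :=
    (h.tangent hσB heB (Sm.const zero_mem_pts)).congr fun x _ => by rw [hB]
  have sGA : Sm D fun x => dd G x (FA x) := hG.dd_apply hD Sm.id sA fun _ h => h
  have sGB : Sm D fun x => dd G x (FB x) := hG.dd_apply hD Sm.id sB fun _ h => h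
  have hGw : WZ D c fun x => dd G x (0, w x) :=
    hw.map (L := fun y : (A × (Pt → V)) × (Pt → V) => dd G y.1 (0, y.2))
      (hG.dd_apply hD Sm.fst ((Sm.const zero_mem_pts).prodMk Sm.snd) fun y hy => hy.1)
      (fun x hx u hu v hv b => by
        have := dd_isLin hG hD hx _ (zero_prod_mem_pts (A := A) hu) _ (zero_prod_mem_pts hv) b
        simpa using this) hD
  -- The commutator acts on `G` as `A (B G) - B (A G)`. Since both flows are tangent, `B G` and `A
  -- G` may be replaced by their weak values `gB` and `gA` before the second derivative is taken.
  have hGc : WZ D c fun x => dd G x (dd FB x (FA x) - dd FA x (FB x)) := by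
    have h1 := ((wB.dd hD hc sA tA).sub hD (wA.dd hD hc sB tB)).add hg
    refine h1.congr fun x hx => ?_
    have hAx := sA.mem_pts hD hx
    have hBx := sB.mem_pts hD hx
    rw [← dd_commutator hG hD sA sB hx, dd_fun_sub sGB hgB hD hx hAx, dd_fun_sub sGA hgA hD hx hBx]
    abel
  have hGρ : WZ D c fun x => dd G x (0, Ω (γ (x, ρ x))) := by
    refine (hGc.sub hD hGw).congr fun x hx => ?_
    have e1 : ((0 : A), Ω (γ (x, ρ x)) + w x) = (0, Ω (γ (x, ρ x))) + (0, w x) := by simp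
    rw [hcomm x hx, e1, dd_add hG hD hx
      (zero_prod_mem_pts (h.flow_mem hx (hρ.mem_pts hD hx)))
      (zero_prod_mem_pts ((hw.sm hD hc).mem_pts hD hx))]
    abel
  -- The quantities `G` separate flows: the left inverse `𝔅` recovers the smearing `ρ` from the
  -- action of its flow on `G`.
  have hρw : WZ D c ρ := (hGρ.map h𝔅 h𝔅l hD).congr fun x hx =>
    (h𝔅i x hx _ (hρ.mem_pts hD hx)).symm
  have hflow : WZ D c fun x => Ω (γ (x, ρ x)) := by
    refine hρw.map (L := fun y : (A × (Pt → V)) × (Pt → W) => Ω (γ y))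
      (h.sm.comp h.adj.adj_sm fun y hy => h.adj.mem_pts hD hy.1 hy.2)
      (fun x hx σ hσ τ hτ b => ?_) hD
    have e1 := h.adj.isLin hD hx σ hσ τ hτ b
    simp only at e1 ⊢
    rw [e1, h.lin _ (h.adj.mem_pts hD hx hσ) _ (h.adj.mem_pts hD hx hτ) b]
  refine ((hflow.add hw).map (L := fun y : (A × (Pt → V)) × (Pt → V) => ((0 : A), y.2))
    ((Sm.const zero_mem_pts).prodMk Sm.snd) (fun x _ u _ v _ b => by simp) hD).congr hcomm

theorem iterate_sm (h : FirstClass D c γ Ω κ) (sB : Sm D FB) {f : A × (Pt → V) → ℝ} (hf : Sm D f)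
    (n : ℕ) : Sm D ((fun (g : A × (Pt → V) → ℝ) x => dd g x (FB x))^[n] f) := by
  induction n generalizing f with
  | zero => exact hf
  | succ n ih => exact ih (hf.dd_apply h.isOpen Sm.id sB fun _ h => h)

/-- A flow that commutes weakly with a second, tangent one commutes weakly with its iterates. -/
theorem iterate_weak (h : FirstClass D c γ Ω κ) (sA : Sm D FA) (sB : Sm D FB)
    (tB : WZ D c fun x => dd c x (FB x))
    (hcomm : WZ D c fun x => dd FB x (FA x) - dd FA x (FB x))
    {f : A × (Pt → V) → ℝ} (hf : Sm D f) (n : ℕ) :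
    WZ D c fun x => dd ((fun (g : A × (Pt → V) → ℝ) x => dd g x (FB x))^[n] f) x (FA x) -
      ((fun (g : A × (Pt → V) → ℝ) x => dd g x (FB x))^[n] fun y => dd f y (FA y)) x := by
  have hD := h.isOpen
  induction n with
  | zero =>
    refine WZ.zero.congr fun x _ => ?_
    simp
  | succ n ih =>
    set op := fun (g : A × (Pt → V) → ℝ) x => dd g x (FB x) with hop
    have sf := h.iterate_sm sB hf n
    have sfA := h.iterate_sm sB (hf.dd_apply hD Sm.id sA fun _ h => h) n
    have sn : Sm D fun x => dd (op^[n] f) x (FA x) := sf.dd_apply hD Sm.id sA fun _ h => h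
    -- The induction step is `[A, Bⁿ⁺¹] = [A, B] Bⁿ + B [A, Bⁿ]`; the second term stays weakly zero
    -- because `B` is tangent to the constraint surface.
    have h1 : WZ D c fun x => dd (op^[n] f) x (dd FB x (FA x) - dd FA x (FB x)) :=
      hcomm.map (L := fun y : (A × (Pt → V)) × (A × (Pt → V)) => dd (op^[n] f) y.1 y.2)
        (sf.dd hD) (fun x hx => dd_isLin sf hD hx) hD
    refine (h1.add (ih.dd hD h.adj.sm sB tB)).congr fun x hx => ?_
    simp only [Function.iterate_succ_apply']
    rw [← dd_commutator sf hD sA sB hx, dd_fun_sub sn sfA hD hx (sB.mem_pts hD hx)]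
    simp only [hop]
    abel

end FirstClass

end Flows

end

section

/-! ### Riemannian geometry in a differential ring -/

section DiffRing

variable {R : Type} [CommRing R]

/-- A metric `q` with inverse `h` and Christoffel symbols `Γ` in a ring with three commuting
derivations. -/
structure DiffMetric (d : Fin 3 → Derivation ℤ R R) (q h : Fin 3 → Fin 3 → R)
    (Γ : Fin 3 → Fin 3 → Fin 3 → R) : Prop where
  comm : ∀ a b f, d a (d b f) = d b (d a f)
  two : ∀ x : R, 2 * x = 0 → x = 0
  q_symm : ∀ a b, q a b = q b a
  h_symm : ∀ a b, h a b = h b a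
  inv : ∀ a b, ∑ c, h a c * q c b = if a = b then 1 else 0
  Γ_symm : ∀ c a b, Γ c a b = Γ c b a
  compat : ∀ c a b, d c (q a b) = ∑ e, (q a e * Γ e c b + q b e * Γ e c a)

/-- The Ricci tensor of Christoffel symbols. -/
def ricciOf (d : Fin 3 → Derivation ℤ R R) (Γ : Fin 3 → Fin 3 → Fin 3 → R) (a b : Fin 3) : R :=
  ∑ c, (d c (Γ c a b) - d b (Γ c a c)) +
    ∑ c, ∑ e, (Γ c c e * Γ e a b - Γ c b e * Γ e a c)

/-- The scalar curvature. -/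
def scalOf (d : Fin 3 → Derivation ℤ R R) (h : Fin 3 → Fin 3 → R) (Γ : Fin 3 → Fin 3 → Fin 3 → R) :
    R := ∑ a, ∑ b, h a b * ricciOf d Γ a b

namespace DiffMetric

variable {d : Fin 3 → Derivation ℤ R R} {q h : Fin 3 → Fin 3 → R} {Γ : Fin 3 → Fin 3 → Fin 3 → R}

theorem lower_raise (m : DiffMetric d q h Γ) (v : Fin 3 → R) (a : Fin 3) :
    ∑ c, h a c * ∑ b, q c b * v b = v a := by
  have : ∑ c, h a c * ∑ b, q c b * v b = ∑ b, (∑ c, h a c * q c b) * v b := by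
    simp only [Finset.mul_sum, Finset.sum_mul]
    rw [Finset.sum_comm]
    simp only [mul_assoc]
  rw [this]
  simp [m.inv]

theorem eq_of_lower (m : DiffMetric d q h Γ) {u v : Fin 3 → R}
    (huv : ∀ a, ∑ b, q a b * u b = ∑ b, q a b * v b) : u = v := by
  funext a
  rw [← m.lower_raise u a, ← m.lower_raise v a]
  simp only [huv]

theorem inv' (m : DiffMetric d q h Γ) (a b : Fin 3) :
    ∑ c, q a c * h c b = if a = b then 1 else 0 := by
  have h1 := m.inv b a
  simp only [eq_comm (a := b)] at h1
  rw [← h1]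
  exact Finset.sum_congr rfl fun c _ => by rw [m.q_symm a c, m.h_symm c b, mul_comm]

/-- Derivations of the inverse metric. -/
theorem deriv_inv (m : DiffMetric d q h Γ) (δ : Derivation ℤ R R) (a b : Fin 3) :
    δ (h a b) = -∑ c, ∑ e, h a c * δ (q c e) * h e b := by
  have h1 : ∀ f, ∑ c, (δ (h a c) * q c f + h a c * δ (q c f)) = 0 := by
    intro f
    have := congrArg δ (m.inv a f)
    simp only [map_sum, Derivation.leibniz, smul_eq_mul] at this
    have h0 : δ (if a = f then (1 : R) else 0) = 0 := by split_ifs <;> simp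
    rw [h0] at this
    rw [← this]
    exact Finset.sum_congr rfl fun c _ => by ring
  have h2 : ∑ f, (∑ c, (δ (h a c) * q c f + h a c * δ (q c f))) * h f b = 0 := by
    simp only [h1, zero_mul, Finset.sum_const_zero]
  have h3 : ∑ f, (∑ c, δ (h a c) * q c f) * h f b = δ (h a b) := by
    have : ∑ f, (∑ c, δ (h a c) * q c f) * h f b = ∑ c, δ (h a c) * ∑ f, q c f * h f b := by
      simp only [Finset.mul_sum, Finset.sum_mul]
      rw [Finset.sum_comm]
      simp only [mul_assoc]
    rw [this]
    simp [m.inv']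
  simp only [Finset.sum_add_distrib, add_mul] at h2
  rw [h3] at h2
  rw [eq_neg_of_add_eq_zero_left h2]
  congr 1
  simp only [Finset.sum_mul]
  rw [Finset.sum_comm]

/-- Uniqueness of the Levi-Civita connection. -/
theorem christoffel_unique (m : DiffMetric d q h Γ) {Y Y' : Fin 3 → Fin 3 → Fin 3 → R}
    (hs : ∀ c a b, Y c a b = Y c b a) (hs' : ∀ c a b, Y' c a b = Y' c b a)
    (hY : ∀ c a b, ∑ e, (q a e * Y e c b + q b e * Y e c a) =
      ∑ e, (q a e * Y' e c b + q b e * Y' e c a)) : Y = Y' := by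
  have key : ∀ f a b, ∑ e, q f e * Y e a b = ∑ e, q f e * Y' e a b := by
    intro f a b
    have e1 := hY a f b
    have e2 := hY b a f
    have e3 := hY f a b
    simp only [Fin.sum_univ_three] at e1 e2 e3 ⊢
    rw [← sub_eq_zero]
    refine m.two _ ?_
    -- The Koszul combination of the three cyclic versions of the compatibility condition isolates
    -- twice one lowered symbol; absence of 2-torsion finishes.
    simp only [hs _ b a, hs' _ b a, hs _ b f, hs' _ b f, hs _ f a, hs' _ f a] at e1 e2 e3 ⊢
    linear_combination e1 + e2 - e3
  funext c a b
  exact congrFun (m.eq_of_lower (u := fun c => Y c a b) (v := fun c => Y' c a b)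
    fun f => key f a b) c

/-- Linearization of the Ricci tensor in the Christoffel symbols. -/
theorem deriv_ricciOf {δ : Derivation ℤ R R} (hδ : ∀ a f, δ (d a f) = d a (δ f)) (a b : Fin 3) :
    δ (ricciOf d Γ a b) = ∑ c, (d c (δ (Γ c a b)) - d b (δ (Γ c a c))) +
      ∑ c, ∑ e, (δ (Γ c c e) * Γ e a b + Γ c c e * δ (Γ e a b) -
        δ (Γ c b e) * Γ e a c - Γ c b e * δ (Γ e a c)) := by
  simp only [ricciOf, map_add, map_sub, map_sum, Derivation.leibniz, smul_eq_mul, hδ]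
  congr 1
  exact Finset.sum_congr rfl fun c _ => Finset.sum_congr rfl fun e _ => by ring

/-- The inverse metric is covariantly constant because the metric is: insert `compat` into the
formula for derivations of an inverse. -/
theorem grad_inv (m : DiffMetric d q h Γ) (c a b : Fin 3) :
    d c (h a b) = -∑ e, (h a e * Γ b c e + h b e * Γ a c e) := by
  have h1 : ∀ a b, ∑ f, ∑ g, h a f * (∑ e, q f e * Γ e c g) * h g b = ∑ e, h b e * Γ a c e := by
    intro a b
    rw [Finset.sum_comm]
    refine Finset.sum_congr rfl fun g _ => ?_
    rw [← Finset.sum_mul, m.lower_raise (fun e => Γ e c g) a, m.h_symm b g, mul_comm]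
  rw [m.deriv_inv, Finset.sum_add_distrib, ← h1 a b, ← h1 b a, add_comm]
  congr 1
  rw [Finset.sum_comm (f := fun f g => h b f * (∑ e, q f e * Γ e c g) * h g a),
    ← Finset.sum_add_distrib]
  refine Finset.sum_congr rfl fun f _ => ?_
  rw [← Finset.sum_add_distrib]
  refine Finset.sum_congr rfl fun g _ => ?_
  rw [m.compat, Finset.sum_add_distrib, m.h_symm b g, m.h_symm f a]
  ring

/-- The covariant derivative `∇_c k_ab`. -/
def nabla (d : Fin 3 → Derivation ℤ R R) (Γ : Fin 3 → Fin 3 → Fin 3 → R) (k : Fin 3 → Fin 3 → R)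
    (c a b : Fin 3) : R := d c (k a b) - ∑ e, (k a e * Γ e c b + k b e * Γ e c a)

/-- Variation of the Christoffel symbols. -/
theorem deriv_christoffel (m : DiffMetric d q h Γ) {δ : Derivation ℤ R R}
    (hδ : ∀ a f, δ (d a f) = d a (δ f)) (c a b : Fin 3) :
    2 * δ (Γ c a b) = ∑ f, h c f * (nabla d Γ (fun a b => δ (q a b)) a f b +
      nabla d Γ (fun a b => δ (q a b)) b f a - nabla d Γ (fun a b => δ (q a b)) f a b) := by
  -- Applying `δ` to metric compatibility expresses the covariant derivative of `δ q` through `δ Γ`;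
  -- the Koszul combination then solves for `δ Γ`.
  have key : ∀ f a b, nabla d Γ (fun a b => δ (q a b)) f a b =
      ∑ e, (q a e * δ (Γ e f b) + q b e * δ (Γ e f a)) := by
    intro f a b
    have h1 := congrArg δ (m.compat f a b)
    rw [hδ] at h1
    simp only [map_sum, map_add, Derivation.leibniz, smul_eq_mul] at h1
    rw [nabla, h1, ← Finset.sum_sub_distrib]
    exact Finset.sum_congr rfl fun e _ => by ring
  have h2 := m.lower_raise (fun e => 2 * δ (Γ e a b)) c
  rw [← h2]
  refine Finset.sum_congr rfl fun f _ => ?_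
  rw [key, key, key, ← Finset.sum_add_distrib, ← Finset.sum_sub_distrib]
  refine congrArg _ (Finset.sum_congr rfl fun e _ => ?_)
  rw [m.Γ_symm e b a, m.Γ_symm e b f, m.Γ_symm e f a]
  ring

end DiffMetric

end DiffRing

end

section

/-! ### The volume density and the variation of the densitized scalar curvature -/

section DiffRing

variable {R : Type} [CommRing R] {d : Fin 3 → Derivation ℤ R R} {q h : Fin 3 → Fin 3 → R}
  {Γ : Fin 3 → Fin 3 → Fin 3 → R} {r ri : R}

/-- The volume density `r` of a metric and its inverse `ri`. -/
structure DiffVol (q h : Fin 3 → Fin 3 → R) (r ri : R) : Prop where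
  mul_inv : r * ri = 1
  deriv : ∀ δ : Derivation ℤ R R, 2 * δ r = r * ∑ a, ∑ b, h a b * δ (q a b)

theorem DiffVol.deriv_inv (w : DiffVol q h r ri) (δ : Derivation ℤ R R) :
    δ ri = -(ri * ri * δ r) := by
  have h1 := congrArg δ w.mul_inv
  simp only [Derivation.leibniz, smul_eq_mul, Derivation.map_one_eq_zero] at h1
  linear_combination ri * h1 - δ ri * w.mul_inv

namespace DiffMetric

/-- The derivative of the volume is half the trace of the derivative of the metric, and by
compatibility this trace is twice the contracted connection. -/
theorem grad_vol (m : DiffMetric d q h Γ) (w : DiffVol q h r ri) (c : Fin 3) :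
    d c r = r * ∑ e, Γ e c e := by
  have h1 : ∑ a, ∑ b, h a b * d c (q a b) = 2 * ∑ e, Γ e c e := by
    have h2 : ∀ b, ∑ a, h b a * ∑ e, q a e * Γ e c b = Γ b c b := fun b =>
      m.lower_raise (fun e => Γ e c b) b
    have h3 : ∑ a, ∑ b, h a b * d c (q a b) =
        ∑ b, ∑ a, h b a * (∑ e, q a e * Γ e c b) + ∑ b, ∑ a, h b a * (∑ e, q a e * Γ e c b) := by
      conv_lhs => simp only [m.compat, Finset.sum_add_distrib, mul_add]
      congr 1
      rw [Finset.sum_comm]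
      simp only [m.h_symm]
    rw [h3]
    simp only [h2]
    ring
  have h2 := w.deriv (d c)
  rw [h1] at h2
  rw [← sub_eq_zero]
  refine m.two _ ?_
  linear_combination h2

/-- The trace of the linearized Ricci tensor is a divergence. -/
theorem trace_ricci_variation (m : DiffMetric d q h Γ) (w : DiffVol q h r ri)
    {Y : Fin 3 → Fin 3 → Fin 3 → R} (hY : ∀ c a b, Y c a b = Y c b a) :
    r * ∑ a, ∑ b, h a b * (∑ c, (d c (Y c a b) - d b (Y c a c)) +
      ∑ c, ∑ e, (Y c c e * Γ e a b + Γ c c e * Y e a b - Y c b e * Γ e a c - Γ c b e * Y e a c)) =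
    ∑ c, d c (r * ∑ a, ∑ b, (h a b * Y c a b - h c b * Y a a b)) := by
  have y1 : ∀ c, Y c 1 0 = Y c 0 1 := fun c => hY c 1 0
  have y2 : ∀ c, Y c 2 0 = Y c 0 2 := fun c => hY c 2 0
  have y3 : ∀ c, Y c 2 1 = Y c 1 2 := fun c => hY c 2 1
  have g1 : ∀ c, Γ c 1 0 = Γ c 0 1 := fun c => m.Γ_symm c 1 0
  have g2 : ∀ c, Γ c 2 0 = Γ c 0 2 := fun c => m.Γ_symm c 2 0
  have g3 : ∀ c, Γ c 2 1 = Γ c 1 2 := fun c => m.Γ_symm c 2 1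
  simp only [Fin.sum_univ_three, map_add, map_sub, Derivation.leibniz, smul_eq_mul, m.grad_inv,
    m.grad_vol w]
  simp only [m.h_symm 1 0, m.h_symm 2 0, m.h_symm 2 1, y1, y2, y3, g1, g2, g3]
  ring

/-- The divergence in the variation of the scalar curvature, in terms of the variation of the
metric. -/
theorem palatini_current (m : DiffMetric d q h Γ) {δ : Derivation ℤ R R}
    (hδ : ∀ a f, δ (d a f) = d a (δ f)) (c : Fin 3) :
    ∑ a, ∑ b, (h a b * δ (Γ c a b) - h c b * δ (Γ a a b)) =
      ∑ f, ∑ a, ∑ b, h c f * h a b * (nabla d Γ (fun a b => δ (q a b)) a b f -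
        nabla d Γ (fun a b => δ (q a b)) f a b) := by
  rw [← sub_eq_zero]
  refine m.two _ ?_
  have hs : ∀ f a b, nabla d Γ (fun a b => δ (q a b)) f a b =
      nabla d Γ (fun a b => δ (q a b)) f b a := by
    intro f a b
    simp only [nabla, m.q_symm a b, add_comm]
  have h1 : ∀ c a b, 2 * δ (Γ c a b) = _ := fun c a b => m.deriv_christoffel hδ c a b
  generalize nabla d Γ (fun a b => δ (q a b)) = T at *
  have h2 : 2 * (∑ a, ∑ b, (h a b * δ (Γ c a b) - h c b * δ (Γ a a b))) =
      ∑ a, ∑ b, (h a b * (2 * δ (Γ c a b)) - h c b * (2 * δ (Γ a a b))) := by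
    simp only [Finset.mul_sum]
    exact Finset.sum_congr rfl fun a _ => Finset.sum_congr rfl fun b _ => by ring
  rw [mul_sub, h2]
  have y1 : ∀ c, T c 1 0 = T c 0 1 := fun c => hs c 1 0
  have y2 : ∀ c, T c 2 0 = T c 0 2 := fun c => hs c 2 0
  have y3 : ∀ c, T c 2 1 = T c 1 2 := fun c => hs c 2 1
  simp only [h1, Fin.sum_univ_three, m.h_symm 1 0, m.h_symm 2 0, m.h_symm 2 1, y1, y2, y3]
  ring

/-- Palatini's formula. -/
theorem deriv_scalOf (m : DiffMetric d q h Γ) (w : DiffVol q h r ri) {δ : Derivation ℤ R R}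
    (hδ : ∀ a f, δ (d a f) = d a (δ f)) :
    δ (r * scalOf d h Γ) = δ r * scalOf d h Γ + r * ∑ a, ∑ b, δ (h a b) * ricciOf d Γ a b +
      ∑ c, d c (r * ∑ f, ∑ a, ∑ b, h c f * h a b * (nabla d Γ (fun a b => δ (q a b)) a b f -
        nabla d Γ (fun a b => δ (q a b)) f a b)) := by
  have h1 := m.trace_ricci_variation w (Y := fun c a b => δ (Γ c a b))
    fun c a b => by rw [m.Γ_symm]
  simp only [m.palatini_current hδ] at h1
  rw [← h1, Derivation.leibniz, scalOf]
  simp only [← deriv_ricciOf hδ, map_sum, Derivation.leibniz, smul_eq_mul, Finset.sum_add_distrib,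
    mul_add, mul_comm (δ (h _ _)) (ricciOf _ _ _ _)]
  ring

end DiffMetric

end DiffRing

end

section

/-! ### The momentum of the metric and its divergence -/

section DiffRing

variable {R : Type} [CommRing R] {d : Fin 3 → Derivation ℤ R R} {q h P : Fin 3 → Fin 3 → R}
  {Γ : Fin 3 → Fin 3 → Fin 3 → R} {r ri φ π V hf k lam lami : R}

/-- The trace-reversed momentum `2 P_ab - P q_ab`. -/
def revMom (q P : Fin 3 → Fin 3 → R) (a b : Fin 3) : R :=
  2 * (∑ c, ∑ e, q a c * q b e * P c e) - (∑ c, ∑ e, q c e * P c e) * q a b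

/-- The divergence `D_b P^{bc}` of a tensor density. -/
def divMom (d : Fin 3 → Derivation ℤ R R) (Γ : Fin 3 → Fin 3 → Fin 3 → R) (P : Fin 3 → Fin 3 → R)
    (c : Fin 3) : R := ∑ b, d b (P b c) + ∑ b, ∑ e, Γ c b e * P b e

/-- The covariant derivative of a tensor density. -/
def nablaMom (d : Fin 3 → Derivation ℤ R R) (Γ : Fin 3 → Fin 3 → Fin 3 → R) (P : Fin 3 → Fin 3 → R)
    (c a b : Fin 3) : R := d c (P a b) + ∑ s, (Γ a c s * P s b + Γ b c s * P a s - Γ s c s * P a b)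

/-- The Hamiltonian constraint. -/
def hamOf (d : Fin 3 → Derivation ℤ R R) (q h P : Fin 3 → Fin 3 → R) (Γ : Fin 3 → Fin 3 → Fin 3 → R)
    (r ri φ π V hf k lam lami : R) : R :=
  k * (((∑ a, ∑ b, ∑ c, ∑ e, q a c * q b e * P a b * P c e) -
      hf * (∑ a, ∑ b, q a b * P a b) ^ 2) * ri - r * scalOf d h Γ) +
    lam * hf * ri * π ^ 2 + r * lami * hf * ((∑ a, ∑ b, h a b * d a φ * d b φ) + V)

/-- The spatial diffeomorphism constraint. -/
def momOf (d : Fin 3 → Derivation ℤ R R) (q P : Fin 3 → Fin 3 → R) (Γ : Fin 3 → Fin 3 → Fin 3 → R)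
    (φ π k : R) (a : Fin 3) : R := π * d a φ - 2 * k * ∑ c, q a c * divMom d Γ P c

namespace DiffMetric

/-- The momentum is a tensor density of weight one, hence the contracted connection on the left.
Since the metric is covariantly constant, lowering indices and taking traces commute with the
covariant derivative. -/
theorem nabla_revMom (m : DiffMetric d q h Γ) (hP : ∀ a b, P a b = P b a) (c a b : Fin 3) :
    nabla d Γ (revMom q P) c a b - (∑ e, Γ e c e) * revMom q P a b =
      2 * (∑ e, ∑ g, q a e * q b g * nablaMom d Γ P c e g) -
        (∑ e, ∑ g, q e g * nablaMom d Γ P c e g) * q a b := by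
  have q1 := m.q_symm 1 0
  have q2 := m.q_symm 2 0
  have q3 := m.q_symm 2 1
  have p1 := hP 1 0
  have p2 := hP 2 0
  have p3 := hP 2 1
  simp only [nabla, revMom, nablaMom, map_sub, map_add, Derivation.leibniz, smul_eq_mul,
    Fin.sum_univ_three, m.compat, m.q_symm b 0, m.q_symm b 1, m.q_symm b 2,
    m.q_symm a 0, m.q_symm a 1, m.q_symm a 2]
  have h2 : d c 2 = 0 := by exact_mod_cast (d c).map_natCast 2
  simp only [h2, q1, q2, q3, p1, p2, p3]
  ring

/-- Pure index algebra, with no derivatives. Each of the three trace contributions is a multiple of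
the raised trace, with coefficients `-1`, `-2` and `3`, so they cancel; the last one is the trace of
the identity, which is where dimension three enters. -/
theorem contract_revMom (m : DiffMetric d q h Γ) {E : Fin 3 → Fin 3 → Fin 3 → R}
    (c : Fin 3) {X : Fin 3 → Fin 3 → Fin 3 → R}
    (hX : ∀ c a b, X c a b = 2 * (∑ e, ∑ g, q a e * q b g * E c e g) -
        (∑ e, ∑ g, q e g * E c e g) * q a b) :
    ∑ f, ∑ a, ∑ b, h c f * h a b * (X a b f - X f a b) = 2 * ∑ a, E a a c := by
  set tr : Fin 3 → R := fun c => ∑ e, ∑ g, q e g * E c e g with htr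
  have hA : ∑ f, ∑ a, ∑ b, h c f * h a b * (∑ e, ∑ g, q b e * q f g * E a e g) = ∑ a, E a a c := by
    have h1 : ∀ a, ∑ f, h c f * ∑ g, q f g * (∑ b, h a b * ∑ e, q b e * E a e g) = E a a c := by
      intro a
      rw [m.lower_raise (fun g => ∑ b, h a b * ∑ e, q b e * E a e g) c]
      exact m.lower_raise (fun e => E a e c) a
    simp only [← h1]
    simp only [Fin.sum_univ_three]
    ring
  have hB : ∑ f, ∑ a, ∑ b, h c f * h a b * (tr a * q b f) = ∑ a, h c a * tr a := by
    have h1 : ∀ a, ∑ f, (∑ b, h a b * q b f) * h c f = h c a := by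
      intro a
      simp [m.inv]
    have h2 : ∑ a, h c a * tr a = ∑ a, (∑ f, (∑ b, h a b * q b f) * h c f) * tr a := by
      simp only [h1]
    rw [h2]
    simp only [Fin.sum_univ_three]
    ring
  have hC : ∑ f, ∑ a, ∑ b, h c f * h a b * (∑ e, ∑ g, q a e * q b g * E f e g) =
      ∑ f, h c f * tr f := by
    refine Finset.sum_congr rfl fun f _ => ?_
    have h1 : ∑ a, ∑ e, q a e * (∑ b, h a b * ∑ g, q b g * E f e g) = tr f := by
      simp only [htr, m.lower_raise (fun g => E f _ g)]
      rw [Finset.sum_comm]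
      simp only [m.q_symm]
    rw [← h1]
    simp only [Fin.sum_univ_three]
    ring
  have hD : ∑ f, ∑ a, ∑ b, h c f * h a b * (tr f * q a b) = 3 * ∑ f, h c f * tr f := by
    have h1 : ∑ a, ∑ b, h a b * q b a = 3 := by simp [m.inv]
    simp only [m.q_symm _ _] at h1 ⊢
    rw [← h1]
    simp only [Fin.sum_univ_three]
    ring
  have h0 : ∑ f, ∑ a, ∑ b, h c f * h a b * (X a b f - X f a b) =
      2 * (∑ f, ∑ a, ∑ b, h c f * h a b * (∑ e, ∑ g, q b e * q f g * E a e g)) -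
      ∑ f, ∑ a, ∑ b, h c f * h a b * (tr a * q b f) -
      2 * (∑ f, ∑ a, ∑ b, h c f * h a b * (∑ e, ∑ g, q a e * q b g * E f e g)) +
      ∑ f, ∑ a, ∑ b, h c f * h a b * (tr f * q a b) := by
    simp only [Finset.mul_sum (a := (2 : R)), ← Finset.sum_sub_distrib, ← Finset.sum_add_distrib]
    refine Finset.sum_congr rfl fun f _ => Finset.sum_congr rfl fun a _ =>
      Finset.sum_congr rfl fun b _ => ?_
    rw [hX, hX]
    simp only [htr]
    ring
  rw [h0, hA, hB, hC, hD]
  ring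

/-- The current of the extrinsic curvature is the divergence of the momentum. -/
theorem momentum_current (m : DiffMetric d q h Γ) (w : DiffVol q h r ri)
    (hP : ∀ a b, P a b = P b a) (c : Fin 3) :
    r * ∑ f, ∑ a, ∑ b, h c f * h a b * (nabla d Γ (fun a b => ri * revMom q P a b) a b f -
      nabla d Γ (fun a b => ri * revMom q P a b) f a b) = 2 * divMom d Γ P c := by
  have h1 : ∀ c a b, r * nabla d Γ (fun a b => ri * revMom q P a b) c a b =
      nabla d Γ (revMom q P) c a b - (∑ e, Γ e c e) * revMom q P a b := by
    intro c a b
    simp only [nabla, Derivation.leibniz, smul_eq_mul, w.deriv_inv, m.grad_vol w,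
      Fin.sum_univ_three]
    linear_combination (d c (revMom q P a b) - revMom q P a b * (Γ 0 c 0 + Γ 1 c 1 + Γ 2 c 2) * 
      (r * ri + 1) - (revMom q P a 0 * Γ 0 c b + revMom q P b 0 * Γ 0 c a +
      (revMom q P a 1 * Γ 1 c b + revMom q P b 1 * Γ 1 c a) +
      (revMom q P a 2 * Γ 2 c b + revMom q P b 2 * Γ 2 c a))) * w.mul_inv
  have h2 := m.contract_revMom c (X := fun c a b => r * nabla d Γ (fun a b =>
    ri * revMom q P a b) c a b) (E := nablaMom d Γ P) fun c a b => by
      rw [h1, m.nabla_revMom hP]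
  have h3 : ∑ a, nablaMom d Γ P a a c = divMom d Γ P c := by
    simp only [nablaMom, divMom, Fin.sum_univ_three, hP 1 0, hP 2 0, hP 2 1, m.Γ_symm _ 1 0,
      m.Γ_symm _ 2 0, m.Γ_symm _ 2 1]
    fin_cases c <;> simp only [Fin.zero_eta, Fin.mk_one, Fin.reduceFinMk, hP 1 0, hP 2 0, hP 2 1] <;> ring
  rw [← h3, ← h2, Finset.mul_sum]
  refine Finset.sum_congr rfl fun f _ => ?_
  rw [Finset.mul_sum]
  refine Finset.sum_congr rfl fun a _ => ?_
  rw [Finset.mul_sum]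
  refine Finset.sum_congr rfl fun b _ => ?_
  ring

end DiffMetric
end DiffRing

end

section

/-! ### The bracket of two Hamiltonian constraints -/

section DiffRing

variable {R : Type} [CommRing R] {d : Fin 3 → Derivation ℤ R R} {q h P : Fin 3 → Fin 3 → R}
  {Γ : Fin 3 → Fin 3 → Fin 3 → R} {r ri φ π V V' hf k lam lami : R}

/-- Derivations that commute with spatial derivatives, vanish on the coupling constants and satisfy
the chain rule for the potential. -/
structure Variation (d : Fin 3 → Derivation ℤ R R) (φ V V' hf k lam lami : R)
    (δ : Derivation ℤ R R) : Prop where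
  comm : ∀ a f, δ (d a f) = d a (δ f)
  half : δ hf = 0
  kap : δ k = 0
  lam : δ lam = 0
  lami : δ lami = 0
  pot : δ V = V' * δ φ

/-- Equality of `M δ_N f` and `N δ_M f`. -/
def Ultralocal (δN δM : Derivation ℤ R R) (N M f : R) : Prop := M * δN f = N * δM f

namespace Ultralocal

variable {δN δM : Derivation ℤ R R} {N M f g : R}

theorem add (hf : Ultralocal δN δM N M f) (hg : Ultralocal δN δM N M g) :
    Ultralocal δN δM N M (f + g) := by
  unfold Ultralocal at *
  rw [map_add, map_add, mul_add, mul_add, hf, hg]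

theorem sub (hf : Ultralocal δN δM N M f) (hg : Ultralocal δN δM N M g) :
    Ultralocal δN δM N M (f - g) := by
  unfold Ultralocal at *
  rw [map_sub, map_sub, mul_sub, mul_sub, hf, hg]

theorem mul (hf : Ultralocal δN δM N M f) (hg : Ultralocal δN δM N M g) :
    Ultralocal δN δM N M (f * g) := by
  unfold Ultralocal at *
  simp only [Derivation.leibniz, smul_eq_mul]
  linear_combination f * hg + g * hf

theorem sum {ι : Type} {s : Finset ι} {f : ι → R} (hf : ∀ i, Ultralocal δN δM N M (f i)) :
    Ultralocal δN δM N M (∑ i ∈ s, f i) := by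
  unfold Ultralocal at *
  simp only [map_sum, Finset.mul_sum, hf]

theorem of_zero (h1 : δN f = 0) (h2 : δM f = 0) : Ultralocal δN δM N M f := by
  simp [Ultralocal, h1, h2]

theorem of_eq {g : R} (h1 : δN f = N * g) (h2 : δM f = M * g) : Ultralocal δN δM N M f := by
  simp only [Ultralocal, h1, h2]
  ring

end Ultralocal

namespace DiffMetric

theorem nabla_smul (N : R) (K : Fin 3 → Fin 3 → R) (c a b : Fin 3) :
    nabla d Γ (fun a b => N * K a b) c a b = N * nabla d Γ K c a b + d c N * K a b := by
  simp only [nabla, Derivation.leibniz, smul_eq_mul, Fin.sum_univ_three]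
  ring

/-- The bracket of two smeared Hamiltonian constraints, up to a divergence. -/
theorem ham_ham (m : DiffMetric d q h Γ) (w : DiffVol q h r ri) (hP : ∀ a b, P a b = P b a)
    (hhalf : 2 * hf = 1) (hlam : lam * lami = 1) {δN δM : Derivation ℤ R R} {N M : R}
    (vN : Variation d φ V V' hf k lam lami δN) (vM : Variation d φ V V' hf k lam lami δM)
    (qN : ∀ a b, δN (q a b) = N * (ri * revMom q P a b))
    (qM : ∀ a b, δM (q a b) = M * (ri * revMom q P a b))
    (pN : ∀ a b, δN (P a b) = 0) (pM : ∀ a b, δM (P a b) = 0)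
    (fN : δN φ = N * (lam * ri * π)) (fM : δM φ = M * (lam * ri * π))
    (πN : δN π = 0) (πM : δM π = 0) (kd : ∀ c, d c k = 0) :
    ∃ J : Fin 3 → R, M * δN (hamOf d q h P Γ r ri φ π V hf k lam lami) -
      N * δM (hamOf d q h P Γ r ri φ π V hf k lam lami) =
      ∑ c, ∑ b, (M * d c N - N * d c M) * h c b * momOf d q P Γ φ π k b + ∑ c, d c (J c) := by
  -- Velocities without derivatives of the lapse are proportional to it, so they drop out of `M δ_N
  -- - N δ_M`. Only the scalar gradient term and the curvature term survive, since there spatial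
  -- derivatives hit the lapse.
  have uq : ∀ a b, Ultralocal δN δM N M (q a b) := fun a b => .of_eq (qN a b) (qM a b)
  have uP : ∀ a b, Ultralocal δN δM N M (P a b) := fun a b => .of_zero (pN a b) (pM a b)
  have uh : ∀ a b, Ultralocal δN δM N M (h a b) := by
    intro a b
    refine .of_eq (g := -∑ c, ∑ e, h a c * (ri * revMom q P c e) * h e b) ?_ ?_
    · rw [m.deriv_inv]
      simp only [qN, Fin.sum_univ_three]
      ring
    · rw [m.deriv_inv]
      simp only [qM, Fin.sum_univ_three]
      ring
  have ur : Ultralocal δN δM N M r := by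
    unfold Ultralocal
    rw [← sub_eq_zero]
    refine m.two _ ?_
    have h1 := w.deriv δN
    have h2 := w.deriv δM
    simp only [qN, qM, Fin.sum_univ_three] at h1 h2
    linear_combination M * h1 - N * h2
  have uri : Ultralocal δN δM N M ri := by
    unfold Ultralocal at *
    rw [w.deriv_inv, w.deriv_inv]
    linear_combination -(ri * ri) * ur
  have uk : Ultralocal δN δM N M k := .of_zero vN.kap vM.kap
  have uhf : Ultralocal δN δM N M hf := .of_zero vN.half vM.half
  have ul : Ultralocal δN δM N M lam := .of_zero vN.lam vM.lam
  have uli : Ultralocal δN δM N M lami := .of_zero vN.lami vM.lami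
  have uV : Ultralocal δN δM N M V := .of_eq (g := V' * (lam * ri * π))
    (by rw [vN.pot, fN]; ring) (by rw [vM.pot, fM]; ring)
  have uπ : Ultralocal δN δM N M π := .of_zero πN πM
  set kin := ((∑ a, ∑ b, ∑ c, ∑ e, q a c * q b e * P a b * P c e) -
      hf * ((∑ a, ∑ b, q a b * P a b) * (∑ a, ∑ b, q a b * P a b))) * ri with hkin
  have ukin : Ultralocal δN δM N M kin := by
    have uqP : Ultralocal δN δM N M (∑ a, ∑ b, q a b * P a b) :=
      .sum fun a => .sum fun b => (uq a b).mul (uP a b)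
    exact (Ultralocal.sub (.sum fun a => .sum fun b => .sum fun c => .sum fun e =>
      (((uq a c).mul (uq b e)).mul (uP a b)).mul (uP c e)) (uhf.mul (uqP.mul uqP))).mul uri
  have umat : Ultralocal δN δM N M (lam * hf * ri * (π * π) + r * lami * hf * V) :=
    ((((ul.mul uhf).mul uri).mul (uπ.mul uπ))).add (((ur.mul uli).mul uhf).mul uV)
  have ugrad : M * δN (r * lami * hf * ∑ a, ∑ b, h a b * d a φ * d b φ) -
      N * δM (r * lami * hf * ∑ a, ∑ b, h a b * d a φ * d b φ) =
      ∑ c, ∑ b, (M * d c N - N * d c M) * h c b * (π * d b φ) := by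
    have u1 : Ultralocal δN δM N M (r * lami * hf) := (ur.mul uli).mul uhf
    unfold Ultralocal at u1 uh
    have h1 := uh 0 0
    have h2 := uh 0 1
    have h3 := uh 0 2
    have h4 := uh 1 1
    have h5 := uh 1 2
    have h6 := uh 2 2
    rw [δN.leibniz (r * lami * hf), δM.leibniz (r * lami * hf)]
    generalize hA : r * lami * hf = A at *
    -- The coefficient of the gradient term and the coefficient in the velocity of `φ` are
    -- reciprocal up to the factor `2` of the quadratic form, so that exactly `π d φ` remains.
    have hA' : 2 * A * lam * ri = 1 := by
      rw [← hA]
      linear_combination r * lami * lam * ri * hhalf + r * ri * hlam + w.mul_inv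
    simp only [Fin.sum_univ_three, map_add, Derivation.leibniz, smul_eq_mul, vN.comm, vM.comm, fN,
      fM, m.h_symm 1 0, m.h_symm 2 0, m.h_symm 2 1]
    linear_combination (h 0 0 * d 0 φ * d 0 φ + h 1 1 * d 1 φ * d 1 φ + h 2 2 * d 2 φ * d 2 φ +
      2 * h 0 1 * d 0 φ * d 1 φ + 2 * h 0 2 * d 0 φ * d 2 φ + 2 * h 1 2 * d 1 φ * d 2 φ) * u1 +
      A * (d 0 φ * d 0 φ * h1 + 2 * d 0 φ * d 1 φ * h2 + 2 * d 0 φ * d 2 φ * h3 +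
        d 1 φ * d 1 φ * h4 + 2 * d 1 φ * d 2 φ * h5 + d 2 φ * d 2 φ * h6) +
      π * ((M * d 0 N - N * d 0 M) * (h 0 0 * d 0 φ + h 0 1 * d 1 φ + h 0 2 * d 2 φ) +
        (M * d 1 N - N * d 1 M) * (h 0 1 * d 0 φ + h 1 1 * d 1 φ + h 1 2 * d 2 φ) +
        (M * d 2 N - N * d 2 M) * (h 0 2 * d 0 φ + h 1 2 * d 1 φ + h 2 2 * d 2 φ)) * hA'
  set K : Fin 3 → Fin 3 → R := fun a b => ri * revMom q P a b with hK
  have Ksymm : ∀ a b, K a b = K b a := by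
    intro a b
    simp only [hK, revMom, m.q_symm a b, Fin.sum_univ_three, hP 1 0, hP 2 0, hP 2 1]
    ring
  have mc : ∀ c, r * ∑ f, ∑ a, ∑ b, h c f * h a b * (nabla d Γ K a b f - nabla d Γ K f a b) =
      2 * divMom d Γ P c := m.momentum_current w hP
  replace qN : ∀ a b, δN (q a b) = N * K a b := qN
  replace qM : ∀ a b, δM (q a b) = M * K a b := qM
  clear_value K
  -- The part of the Palatini current in which the derivative acts on the lapse; in the other part
  -- it acts on `K` and gives the divergence of the momentum.
  set s : (Fin 3 → R) → Fin 3 → R := fun n c =>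
    r * ∑ f, ∑ a, ∑ b, h c f * h a b * (n a * K b f - n f * K a b) with hs
  have cur : ∀ {δ : Derivation ℤ R R} {L : R}, (∀ a b, δ (q a b) = L * K a b) → ∀ c,
      r * ∑ f, ∑ a, ∑ b, h c f * h a b * (nabla d Γ (fun a b => δ (q a b)) a b f -
        nabla d Γ (fun a b => δ (q a b)) f a b) =
      L * (2 * divMom d Γ P c) + s (fun a => d a L) c := by
    intro δ L hδ c
    rw [← mc c]
    simp only [hδ, nabla_smul]
    simp only [hs, Fin.sum_univ_three]
    ring
  -- This bilinear form is symmetric, so the terms quadratic in derivatives of the two lapses cancel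
  -- in the antisymmetrized variation.
  have ssymm : ∀ n l : Fin 3 → R, ∑ c, l c * s n c = ∑ c, n c * s l c := by
    intro n l
    simp only [hs, Fin.sum_univ_three, m.h_symm 1 0, m.h_symm 2 0, m.h_symm 2 1, Ksymm 1 0,
      Ksymm 2 0, Ksymm 2 1]
    ring
  -- Palatini's divergence is integrated by parts against the other lapse; besides a total
  -- divergence, only the divergence of the momentum times the gradients of the lapses remains.
  have uscal : M * δN (r * scalOf d h Γ) - N * δM (r * scalOf d h Γ) =
      ∑ c, d c (M * (N * (2 * divMom d Γ P c) + s (fun a => d a N) c) -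
        N * (M * (2 * divMom d Γ P c) + s (fun a => d a M) c)) +
      ∑ c, (N * d c M - M * d c N) * -(2 * divMom d Γ P c) := by
    rw [m.deriv_scalOf w vN.comm, m.deriv_scalOf w vM.comm]
    simp only [cur qN, cur qM]
    have e1 : ∑ a, ∑ b, M * δN (h a b) * ricciOf d Γ a b = ∑ a, ∑ b, N * δM (h a b) *
        ricciOf d Γ a b := by
      unfold Ultralocal at uh
      simp only [uh]
    unfold Ultralocal at ur
    have e2 := ssymm (fun a => d a N) (fun a => d a M)
    simp only [Fin.sum_univ_three, Derivation.leibniz, map_sub, smul_eq_mul] at e1 e2 ⊢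
    linear_combination scalOf d h Γ * ur + r * e1 - e2
  refine ⟨fun c => -(k * (M * (N * (2 * divMom d Γ P c) + s (fun a => d a N) c) -
        N * (M * (2 * divMom d Γ P c) + s (fun a => d a M) c))), ?_⟩
  have hC : hamOf d q h P Γ r ri φ π V hf k lam lami = k * (kin - r * scalOf d h Γ) +
      (lam * hf * ri * (π * π) + r * lami * hf * V) +
        r * lami * hf * ∑ a, ∑ b, h a b * d a φ * d b φ := by
    simp only [hamOf, hkin]
    ring
  -- Contraction with the inverse metric raises the index of the diffeomorphism constraint, so its
  -- gravitational part is the divergence of the momentum that the curvature term produced.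
  have hmom : ∑ c, ∑ b, (M * d c N - N * d c M) * h c b * momOf d q P Γ φ π k b =
      ∑ c, ∑ b, (M * d c N - N * d c M) * h c b * (π * d b φ) +
        k * ∑ c, (N * d c M - M * d c N) * (2 * divMom d Γ P c) := by
    have h1 : ∀ c, ∑ b, (M * d c N - N * d c M) * h c b * momOf d q P Γ φ π k b =
        ∑ b, (M * d c N - N * d c M) * h c b * (π * d b φ) -
          2 * k * (M * d c N - N * d c M) * ∑ b, h c b * ∑ e, q b e * divMom d Γ P e := by
      intro c
      simp only [momOf, Fin.sum_univ_three]
      ring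
    have h2 : ∀ c, ∑ b, h c b * ∑ e, q b e * divMom d Γ P e = divMom d Γ P c := fun c =>
      m.lower_raise (fun e => divMom d Γ P e) c
    simp only [h1, h2]
    simp only [Fin.sum_univ_three]
    ring
  rw [hC, hmom, ← ugrad]
  unfold Ultralocal at ukin umat
  have hk : ∀ {δ : Derivation ℤ R R}, δ k = 0 → ∀ f, δ (k * f) = k * δ f := by
    intro δ h0 f
    rw [δ.leibniz, h0, smul_zero, add_zero, smul_eq_mul]
  have hk' : ∀ c f, d c (k * f) = k * d c f := fun c => hk (kd c)
  have e : ∑ c, (N * d c M - M * d c N) * -(2 * divMom d Γ P c) =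
    -∑ c, (N * d c M - M * d c N) * (2 * divMom d Γ P c) := by simp
  rw [e] at uscal
  simp only [map_neg, hk', Finset.sum_neg_distrib, ← Finset.mul_sum]
  rw [map_add δN, map_add δN, map_add δM, map_add δM, hk vN.kap, hk vM.kap, map_sub δN, map_sub δM]
  linear_combination k * ukin + umat - k * uscal

end DiffMetric
end DiffRing

end

section

/-! ### Momentum variations, Lie derivatives and infinitesimal diffeomorphisms -/

section DiffRing

variable {R : Type} [CommRing R] {d : Fin 3 → Derivation ℤ R R} {q h P : Fin 3 → Fin 3 → R}
  {Γ : Fin 3 → Fin 3 → Fin 3 → R} {r ri φ π V V' hf k lam lami : R}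

namespace DiffMetric

/-- Variation of the Hamiltonian constraint with respect to the momenta. -/
theorem ham_momentum (m : DiffMetric d q h Γ) (w : DiffVol q h r ri)
    (hhalf : 2 * hf = 1) {δ : Derivation ℤ R R} (v : Variation d φ V V' hf k lam lami δ)
    (hq : ∀ a b, δ (q a b) = 0) (hφ : δ φ = 0) :
    δ (hamOf d q h P Γ r ri φ π V hf k lam lami) =
      k * ∑ a, ∑ b, ri * revMom q P a b * δ (P a b) + lam * ri * π * δ π := by
  -- With `q` and `φ` fixed, the inverse metric, volume, connection, curvature and potential are
  -- fixed as well; only the parts quadratic in the momenta vary.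
  have hh : ∀ a b, δ (h a b) = 0 := fun a b => by simp [m.deriv_inv, hq]
  have hr : δ r = 0 := m.two _ (by rw [w.deriv]; simp [hq])
  have hri : δ ri = 0 := by rw [w.deriv_inv, hr]; ring
  have hΓ : ∀ c a b, δ (Γ c a b) = 0 := fun c a b =>
    m.two _ (by rw [m.deriv_christoffel v.comm]; simp [hq, nabla])
  have hs : δ (scalOf d h Γ) = 0 := by
    simp [scalOf, Derivation.leibniz, hh, deriv_ricciOf v.comm, hΓ]
  have hV : δ V = 0 := by rw [v.pot, hφ, mul_zero]
  have hg : δ (∑ a, ∑ b, h a b * d a φ * d b φ) = 0 := by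
    simp [Derivation.leibniz, hh, v.comm, hφ]
  have htr : δ (∑ a, ∑ b, q a b * P a b) = ∑ a, ∑ b, q a b * δ (P a b) := by
    simp [Derivation.leibniz, hq]
  have hkin : δ (∑ a, ∑ b, ∑ c, ∑ e, q a c * q b e * P a b * P c e) =
      2 * ∑ a, ∑ b, (∑ c, ∑ e, q a c * q b e * P c e) * δ (P a b) := by
    simp only [map_sum, Derivation.leibniz, hq, smul_eq_mul, mul_zero, add_zero]
    simp only [Fin.sum_univ_three, m.q_symm 1 0, m.q_symm 2 0, m.q_symm 2 1]
    ring
  have e : ∑ a, ∑ b, ri * revMom q P a b * δ (P a b) =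
      ri * (2 * (∑ a, ∑ b, (∑ c, ∑ e, q a c * q b e * P c e) * δ (P a b)) -
        (∑ a, ∑ b, q a b * P a b) * ∑ a, ∑ b, q a b * δ (P a b)) := by
    simp only [revMom]
    generalize ∑ a, ∑ b, q a b * P a b = t
    rw [Finset.mul_sum, Finset.mul_sum, ← Finset.sum_sub_distrib, Finset.mul_sum]
    refine Finset.sum_congr rfl fun a _ => ?_
    rw [Finset.mul_sum, Finset.mul_sum, ← Finset.sum_sub_distrib, Finset.mul_sum]
    refine Finset.sum_congr rfl fun b _ => ?_
    ring
  rw [e, hamOf]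
  generalize (∑ a, ∑ b, ∑ c, ∑ e, q a c * q b e * P a b * P c e) = kin at *
  generalize (∑ a, ∑ b, h a b * d a φ * d b φ) = g at *
  generalize (∑ a, ∑ b, q a b * P a b) = t at *
  simp only [map_add, map_sub, Derivation.leibniz, smul_eq_mul, pow_two, hkin, htr, hs, hr, hri, hV,
    hg, v.half, v.kap, v.lam, v.lami]
  linear_combination (lam * ri * π * δ π - k * ri * t * (∑ a, ∑ b, q a b * δ (P a b))) * hhalf

/-- The Lie derivative of a symmetric tensor. -/
def lieMetric (d : Fin 3 → Derivation ℤ R R) (N : Fin 3 → R) (q : Fin 3 → Fin 3 → R)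
    (a b : Fin 3) : R := ∑ e, (N e * d e (q a b) + q e b * d a (N e) + q a e * d b (N e))

/-- The Lie derivative of a symmetric tensor density. -/
def lieMom (d : Fin 3 → Derivation ℤ R R) (N : Fin 3 → R) (P : Fin 3 → Fin 3 → R)
    (a b : Fin 3) : R :=
  ∑ e, (N e * d e (P a b) - P e b * d e (N a) - P a e * d e (N b) + d e (N e) * P a b)

/-- The smeared diffeomorphism constraint generates Lie derivatives. -/
theorem mom_variation (m : DiffMetric d q h Γ) (hP : ∀ a b, P a b = P b a)
    {δ : Derivation ℤ R R} (comm : ∀ a f, δ (d a f) = d a (δ f)) (hk : δ k = 0)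
    (kd : ∀ c, d c k = 0) {N : Fin 3 → R} (hN : ∀ a, δ (N a) = 0) :
    ∃ J : Fin 3 → R, ∑ a, N a * δ (momOf d q P Γ φ π k a) =
      k * (∑ a, ∑ b, (δ (P a b) * lieMetric d N q a b - δ (q a b) * lieMom d N P a b)) +
      δ π * ∑ e, N e * d e φ - δ φ * (∑ e, d e (N e * π)) + ∑ c, d c (J c) := by
  -- By symmetry of `P` the connection enters the lowered divergence only through first derivatives
  -- of the metric, so the variation of `Γ` is never needed.
  have h0 : ∀ a, ∑ c, 2 * (q a c * ∑ b, ∑ e, Γ c b e * P b e) =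
      ∑ b, ∑ e, (2 * d b (q a e) - d a (q b e)) * P b e := by
    intro a
    have q1 := m.q_symm 1 0
    have q2 := m.q_symm 2 0
    have q3 := m.q_symm 2 1
    simp only [m.compat, Fin.sum_univ_three, hP 1 0, hP 2 0, hP 2 1, m.Γ_symm _ 1 0,
      m.Γ_symm _ 2 0, m.Γ_symm _ 2 1]
    have g0 : ∀ e, Γ e 0 a = Γ e a 0 := fun e => m.Γ_symm e 0 a
    have g1 : ∀ e, Γ e 1 a = Γ e a 1 := fun e => m.Γ_symm e 1 a
    have g2 : ∀ e, Γ e 2 a = Γ e a 2 := fun e => m.Γ_symm e 2 a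
    simp only [q1, q2, q3, g0, g1, g2]
    ring
  -- Up to a divergence, the smeared constraint is momentum times Lie derivative of configuration.
  -- Varying it and integrating by parts once more moves the Lie derivative onto the momenta.
  have h1 : ∑ a, N a * momOf d q P Γ φ π k a = π * (∑ e, N e * d e φ) +
      k * (∑ a, ∑ b, P a b * lieMetric d N q a b) -
      ∑ b, d b (2 * k * ∑ a, ∑ c, N a * q a c * P b c) := by
    have h2 : ∀ b f, d b (2 * k * f) = 2 * k * d b f := by
      intro b f
      have : d b 2 = 0 := by exact_mod_cast (d b).map_natCast 2
      simp [Derivation.leibniz, kd, this]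
    have h3 : ∑ a, N a * momOf d q P Γ φ π k a = π * (∑ e, N e * d e φ) -
        2 * k * (∑ a, ∑ b, ∑ c, N a * q a c * d b (P b c)) -
        k * ∑ a, N a * ∑ c, 2 * (q a c * ∑ b, ∑ e, Γ c b e * P b e) := by
      simp only [momOf, divMom, Fin.sum_univ_three]
      ring
    rw [h3]
    simp only [h0, h2]
    simp only [lieMetric, Fin.sum_univ_three, map_add, Derivation.leibniz, smul_eq_mul, hP 1 0,
      hP 2 0, hP 2 1, m.q_symm 1 0, m.q_symm 2 0, m.q_symm 2 1]
    ring
  refine ⟨fun b => -δ (2 * k * ∑ a, ∑ c, N a * q a c * P b c) +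
    k * (N b * ∑ a, ∑ c, P a c * δ (q a c)) + N b * π * δ φ, ?_⟩
  have h2 := congrArg δ h1
  rw [map_sum] at h2
  have h3 : ∀ a, δ (N a * momOf d q P Γ φ π k a) = N a * δ (momOf d q P Γ φ π k a) := by
    intro a
    rw [δ.leibniz, hN, smul_zero, add_zero, smul_eq_mul]
  simp only [h3] at h2
  rw [h2, map_sub, map_add, map_sum]
  simp only [comm, map_add, map_neg, Finset.sum_add_distrib, Finset.sum_neg_distrib]
  generalize ∑ b, d b (δ (2 * k * ∑ a, ∑ c, N a * q a c * P b c)) = S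
  have hdN : ∀ a b, δ (d a (N b)) = 0 := fun a b => by rw [comm, hN, map_zero]
  simp only [lieMetric, lieMom, Fin.sum_univ_three, map_add, Derivation.leibniz, smul_eq_mul, hk,
    kd, hN, hdN, comm]
  ring

/-- Infinitesimal diffeomorphisms with generator `N`, the transport term being removed. -/
structure Covariant (d : Fin 3 → Derivation ℤ R R) (N : Fin 3 → R) (q P : Fin 3 → Fin 3 → R)
    (φ π V hf k lam lami : R) (D : Derivation ℤ R R) : Prop where
  comm : ∀ a f, D (d a f) = d a (D f) + ∑ e, d a (N e) * d e f
  metric : ∀ a b, D (q a b) = ∑ e, (q e b * d a (N e) + q a e * d b (N e))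
  mom : ∀ a b, D (P a b) =
    ∑ e, (-(P e b * d e (N a)) - P a e * d e (N b) + d e (N e) * P a b)
  phi : D φ = 0
  pi : D π = (∑ e, d e (N e)) * π
  pot : D V = 0
  half : D hf = 0
  kap : D k = 0
  lam : D lam = 0
  lami : D lami = 0

variable {N : Fin 3 → R} {D : Derivation ℤ R R}

/-- Applying `D` to metric compatibility gives a linear system for `D Γ` that the tensorial
expression with the inhomogeneous term `∂∂N` also solves; symmetric solutions are unique. -/
theorem covariant_christoffel (m : DiffMetric d q h Γ)
    (v : Covariant d N q P φ π V hf k lam lami D) (c a b : Fin 3) :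
    D (Γ c a b) = ∑ e, (Γ c e b * d a (N e) + Γ c a e * d b (N e) - Γ e a b * d e (N c)) +
      d a (d b (N c)) := by
  have key := m.christoffel_unique (Y := fun c a b => D (Γ c a b))
    (Y' := fun c a b => ∑ e, (Γ c e b * d a (N e) + Γ c a e * d b (N e) - Γ e a b * d e (N c)) +
      d a (d b (N c))) (fun c a b => by rw [m.Γ_symm])
    (fun c a b => by
      rw [m.comm a b]
      congr 1
      refine Finset.sum_congr rfl fun e _ => ?_
      rw [m.Γ_symm c e b, m.Γ_symm c a e, m.Γ_symm e a b]
      ring) ?_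
  · exact congrFun (congrFun (congrFun key c) a) b
  · intro c a b
    have h1 := congrArg D (m.compat c a b)
    rw [v.comm] at h1
    simp only [map_sum, map_add, Derivation.leibniz, smul_eq_mul, v.metric, m.compat,
      Finset.mul_sum] at h1
    simp only [Fin.sum_univ_three, m.q_symm 1 0, m.q_symm 2 0, m.q_symm 2 1, m.q_symm b 0,
      m.q_symm b 1, m.q_symm b 2, m.q_symm a 0, m.q_symm a 1, m.q_symm a 2] at h1 ⊢
    linear_combination -h1

/-- The Ricci tensor is a tensor: the second and third derivatives of `N`, coming from the
inhomogeneous part of `D Γ` and from the failure of `D` to commute with `d`, cancel. -/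
theorem covariant_ricci (m : DiffMetric d q h Γ)
    (v : Covariant d N q P φ π V hf k lam lami D) (a b : Fin 3) :
    D (ricciOf d Γ a b) = ∑ e, (ricciOf d Γ e b * d a (N e) + ricciOf d Γ a e * d b (N e)) := by
  have g1 : ∀ c, Γ c 1 0 = Γ c 0 1 := fun c => m.Γ_symm c 1 0
  have g2 : ∀ c, Γ c 2 0 = Γ c 0 2 := fun c => m.Γ_symm c 2 0
  have g3 : ∀ c, Γ c 2 1 = Γ c 1 2 := fun c => m.Γ_symm c 2 1
  have g4 : ∀ c, Γ c 0 b = Γ c b 0 := fun c => m.Γ_symm c 0 b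
  have g5 : ∀ c, Γ c 1 b = Γ c b 1 := fun c => m.Γ_symm c 1 b
  have g6 : ∀ c, Γ c 2 b = Γ c b 2 := fun c => m.Γ_symm c 2 b
  simp only [ricciOf, map_add, map_sub, Derivation.leibniz, smul_eq_mul, v.comm,
    m.covariant_christoffel v, Fin.sum_univ_three]
  simp only [m.comm 1 0, m.comm 2 0, m.comm 2 1, m.comm 0 a, m.comm 1 a, m.comm 2 a, m.comm 0 b,
    m.comm 1 b, m.comm 2 b, m.comm b a, g1, g2, g3, g4, g5, g6]
  ring

end DiffMetric
end DiffRing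

end

section

/-! ### The constraints as tensor densities -/

section DiffRing

variable {R : Type} [CommRing R] {d : Fin 3 → Derivation ℤ R R} {q h P : Fin 3 → Fin 3 → R}
  {Γ : Fin 3 → Fin 3 → Fin 3 → R} {r ri φ π V V' hf k lam lami : R} {N : Fin 3 → R}
  {D : Derivation ℤ R R}

namespace DiffMetric

theorem covariant_inv (m : DiffMetric d q h Γ) (v : Covariant d N q P φ π V hf k lam lami D)
    (a b : Fin 3) : D (h a b) = -∑ e, (h e b * d e (N a) + h a e * d e (N b)) := by
  have e1 : ∑ c, ∑ e, h a c * (∑ s, q c s * d e (N s)) * h e b = ∑ e, h e b * d e (N a) := by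
    rw [Finset.sum_comm]
    refine Finset.sum_congr rfl fun e _ => ?_
    rw [← Finset.sum_mul, m.lower_raise (fun s => d e (N s)) a, mul_comm]
  have e2 : ∑ c, ∑ e, h a c * (∑ s, q s e * d c (N s)) * h e b = ∑ e, h a e * d e (N b) := by
    refine Finset.sum_congr rfl fun c _ => ?_
    have := m.lower_raise (fun s => d c (N s)) b
    rw [← this, Finset.mul_sum]
    refine Finset.sum_congr rfl fun e _ => ?_
    simp only [m.q_symm e, m.h_symm e b]
    ring
  rw [m.deriv_inv, Finset.sum_add_distrib, ← e1, ← e2, ← Finset.sum_add_distrib]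
  congr 1
  refine Finset.sum_congr rfl fun c _ => ?_
  rw [← Finset.sum_add_distrib]
  refine Finset.sum_congr rfl fun e _ => ?_
  rw [v.metric, Finset.sum_add_distrib]
  ring

/-- The trace of the tensorial change of the metric is twice the divergence of `N`, so the volume is
a density of weight one. -/
theorem covariant_vol (m : DiffMetric d q h Γ) (w : DiffVol q h r ri)
    (v : Covariant d N q P φ π V hf k lam lami D) : D r = (∑ e, d e (N e)) * r := by
  have h1 : ∑ a, ∑ b, h a b * D (q a b) = 2 * ∑ e, d e (N e) := by
    have h2 : ∀ b, ∑ a, h b a * ∑ e, q a e * d b (N e) = d b (N b) := fun b =>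
      m.lower_raise (fun e => d b (N e)) b
    have h3 : ∑ a, ∑ b, h a b * D (q a b) =
        ∑ b, ∑ a, h b a * (∑ e, q a e * d b (N e)) +
          ∑ b, ∑ a, h b a * (∑ e, q a e * d b (N e)) := by
      conv_lhs => simp only [v.metric, Finset.sum_add_distrib, mul_add]
      congr 1
      · simp only [m.q_symm]
      · rw [Finset.sum_comm]
        simp only [m.h_symm]
    rw [h3]
    simp only [h2]
    ring
  have h2 := w.deriv D
  rw [h1] at h2
  rw [← sub_eq_zero]
  refine m.two _ ?_
  linear_combination h2

theorem covariant_scal (m : DiffMetric d q h Γ) (v : Covariant d N q P φ π V hf k lam lami D) :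
    D (scalOf d h Γ) = 0 := by
  simp only [scalOf, map_sum, Derivation.leibniz, smul_eq_mul, m.covariant_inv v,
    m.covariant_ricci v]
  generalize ricciOf d Γ = K
  simp only [Fin.sum_univ_three]
  ring

/-- The Hamiltonian constraint is a scalar density. -/
theorem covariant_ham (m : DiffMetric d q h Γ) (w : DiffVol q h r ri)
    (v : Covariant d N q P φ π V hf k lam lami D) :
    D (hamOf d q h P Γ r ri φ π V hf k lam lami) =
      (∑ e, d e (N e)) * hamOf d q h P Γ r ri φ π V hf k lam lami := by
  set t := ∑ e, d e (N e) with ht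
  have hr : D r = t * r := m.covariant_vol w v
  have hri : D ri = -(t * ri) := by
    rw [w.deriv_inv, hr]
    linear_combination -(t * ri) * w.mul_inv
  have hmom : ∀ a b, D (P a b) = ∑ e, (-(P e b * d e (N a)) - P a e * d e (N b)) + t * P a b := by
    intro a b
    rw [v.mom, Finset.sum_add_distrib, ht, Finset.sum_mul]
  have hg : D (∑ a, ∑ b, h a b * d a φ * d b φ) = 0 := by
    simp only [map_add, Derivation.leibniz, smul_eq_mul, m.covariant_inv v, v.comm, v.phi, map_zero,
      Fin.sum_univ_three]
    ring
  have htr : D (∑ a, ∑ b, q a b * P a b) = t * ∑ a, ∑ b, q a b * P a b := by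
    simp only [map_sum, Derivation.leibniz, smul_eq_mul, v.metric, hmom]
    clear_value t
    simp only [Fin.sum_univ_three]
    ring
  have hlow : ∀ a b, D (∑ c, ∑ e, q a c * q b e * P c e) = t * (∑ c, ∑ e, q a c * q b e * P c e) +
      ∑ s, ((∑ c, ∑ e, q s c * q b e * P c e) * d a (N s) +
        (∑ c, ∑ e, q a c * q s e * P c e) * d b (N s)) := by
    intro a b
    simp only [map_sum, Derivation.leibniz, smul_eq_mul, v.metric, hmom]
    clear_value t
    simp only [Fin.sum_univ_three]
    ring
  have hkin : D (∑ a, ∑ b, ∑ c, ∑ e, q a c * q b e * P a b * P c e) =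
      2 * t * ∑ a, ∑ b, ∑ c, ∑ e, q a c * q b e * P a b * P c e := by
    have e1 : ∑ a, ∑ b, ∑ c, ∑ e, q a c * q b e * P a b * P c e =
        ∑ a, ∑ b, P a b * ∑ c, ∑ e, q a c * q b e * P c e := by
      simp only [Finset.mul_sum]
      refine Finset.sum_congr rfl fun a _ => Finset.sum_congr rfl fun b _ =>
        Finset.sum_congr rfl fun c _ => Finset.sum_congr rfl fun e _ => ?_
      ring
    rw [e1]
    rw [map_sum]
    simp only [map_sum D, D.leibniz (P _ _), smul_eq_mul, hmom]
    simp only [← map_sum D, hlow]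
    generalize hL : (fun a b => ∑ c, ∑ e, q a c * q b e * P c e) = L
    have hL' : ∀ a b, ∑ c, ∑ e, q a c * q b e * P c e = L a b := fun a b => by rw [← hL]
    simp only [hL']
    clear_value t
    simp only [Fin.sum_univ_three]
    ring
  rw [hamOf]
  generalize (∑ a, ∑ b, ∑ c, ∑ e, q a c * q b e * P a b * P c e) = kin at *
  generalize (∑ a, ∑ b, h a b * d a φ * d b φ) = g at *
  generalize (∑ a, ∑ b, q a b * P a b) = u at *
  have hπ : D π = t * π := v.pi
  clear_value t
  simp only [map_add, map_sub, Derivation.leibniz, smul_eq_mul, pow_two, hkin, htr,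
    m.covariant_scal v, hr, hri, v.pot, hg, v.half, v.kap, v.lam, v.lami, hπ]
  ring

/-- The divergence of a symmetric tensor density is a vector density; the second derivatives of `N`
from the connection compensate those from differentiating the change of `P`. -/
theorem covariant_divMom (m : DiffMetric d q h Γ) (hP : ∀ a b, P a b = P b a)
    (v : Covariant d N q P φ π V hf k lam lami D) (c : Fin 3) :
    D (divMom d Γ P c) = (∑ e, d e (N e)) * divMom d Γ P c - ∑ e, divMom d Γ P e * d e (N c) := by
  simp only [divMom, map_add, Derivation.leibniz, smul_eq_mul, v.comm, v.mom,
    m.covariant_christoffel v, Fin.sum_univ_three, map_sub, map_neg]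
  simp only [m.comm 1 0, m.comm 2 0, m.comm 2 1, hP 1 0, hP 2 0,
    hP 2 1, m.Γ_symm _ 1 0, m.Γ_symm _ 2 0, m.Γ_symm _ 2 1]
  ring

/-- The diffeomorphism constraint is a covector density. -/
theorem covariant_mom (m : DiffMetric d q h Γ) (hP : ∀ a b, P a b = P b a)
    (v : Covariant d N q P φ π V hf k lam lami D) (a : Fin 3) :
    D (momOf d q P Γ φ π k a) = (∑ e, d e (N e)) * momOf d q P Γ φ π k a +
      ∑ e, d a (N e) * momOf d q P Γ φ π k e := by
  have h2 : D 2 = 0 := by exact_mod_cast D.map_natCast 2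
  simp only [momOf, map_sub, map_sum, Derivation.leibniz, smul_eq_mul, v.comm, v.phi, v.pi, v.kap,
    h2, m.covariant_divMom hP v, v.metric, map_zero]
  generalize divMom d Γ P = B
  simp only [Fin.sum_univ_three, m.q_symm 1 0, m.q_symm 2 0, m.q_symm 2 1, m.q_symm a 0,
    m.q_symm a 1, m.q_symm a 2]
  ring

/-- Variation of the constraints along Lie derivatives. -/
theorem lie_constraints (m : DiffMetric d q h Γ) (w : DiffVol q h r ri) (hP : ∀ a b, P a b = P b a)
    {δ : Derivation ℤ R R} (v : Variation d φ V V' hf k lam lami δ)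
    (vd : ∀ c, Variation d φ V V' hf k lam lami (d c)) {N : Fin 3 → R}
    (hq : ∀ a b, δ (q a b) = lieMetric d N q a b) (hp : ∀ a b, δ (P a b) = lieMom d N P a b)
    (hφ : δ φ = ∑ e, N e * d e φ) (hπ : δ π = ∑ e, d e (N e * π)) :
    δ (hamOf d q h P Γ r ri φ π V hf k lam lami) =
      ∑ e, d e (N e * hamOf d q h P Γ r ri φ π V hf k lam lami) ∧
    ∀ a, δ (momOf d q P Γ φ π k a) = ∑ e, d e (N e * momOf d q P Γ φ π k a) +
      ∑ e, d a (N e) * momOf d q P Γ φ π k e := by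
  -- Removing the transport term leaves a derivation that acts algebraically on tensors. Restoring
  -- it turns the density laws for `D` into divergences.
  set D : Derivation ℤ R R := δ - ∑ e, N e • d e with hD
  have hDf : ∀ f, D f = δ f - ∑ e, N e * d e f := by
    intro f
    simp [hD, Fin.sum_univ_three]
  have c : Covariant d N q P φ π V hf k lam lami D := by
    refine ⟨fun a f => ?_, fun a b => ?_, fun a b => ?_, ?_, ?_, ?_, ?_, ?_, ?_, ?_⟩
    · rw [hDf, hDf, map_sub, v.comm, map_sum]
      simp only [Derivation.leibniz, smul_eq_mul, m.comm a, Finset.sum_add_distrib]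
      simp only [mul_comm (d _ f)]
      ring
    · rw [hDf, hq, lieMetric]
      simp only [Fin.sum_univ_three]
      ring
    · rw [hDf, hp, lieMom]
      simp only [Fin.sum_univ_three]
      ring
    · rw [hDf, hφ, sub_self]
    · rw [hDf, hπ]
      simp only [Fin.sum_univ_three, Derivation.leibniz, smul_eq_mul]
      ring
    · rw [hDf, v.pot, hφ]
      simp only [(vd _).pot, Fin.sum_univ_three]
      ring
    · simp [hDf, v.half, (vd _).half]
    · simp [hDf, v.kap, (vd _).kap]
    · simp [hDf, v.lam, (vd _).lam]
    · simp [hDf, v.lami, (vd _).lami]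
  constructor
  · have h1 := m.covariant_ham w c
    rw [hDf] at h1
    rw [sub_eq_iff_eq_add.1 h1]
    simp only [Fin.sum_univ_three, Derivation.leibniz, smul_eq_mul]
    ring
  · intro a
    have h1 := m.covariant_mom hP c a
    rw [hDf] at h1
    rw [sub_eq_iff_eq_add.1 h1]
    simp only [Fin.sum_univ_three, Derivation.leibniz, smul_eq_mul]
    ring

end DiffMetric
end DiffRing

end

section

/-! ### Scalar fields -/

section ScalarFields

variable {X : Type} [AddCommGroup X] [Module ℝ X] [DVS X] {D : Set X}
  {V W : Type} [NormedAddCommGroup V] [NormedSpace ℝ V] [FVal V]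
  [NormedAddCommGroup W] [NormedSpace ℝ W] [FVal W]

theorem hasDerivAt_dd (hD : POpen D) {Φ : X → Pt → V} (hΦ : Sm D Φ) {x v : X} (hx : x ∈ D)
    (hv : v ∈ (pts : Set X)) (y : Pt) :
    HasDerivAt (fun s : ℝ => Φ (x + s • v) y) (dd Φ x v y) 0 := by
  have h1 := (hΦ.pl_line hD hx hv).1
  have hO := hD.isOpen_line hx hv
  have h0 : ((0 : ℝ), y) ∈ {s : ℝ | x + s • v ∈ D} ×ˢ (univ : Set Pt) := by simpa using hx
  have h2 := hasDerivAt_slice (hO.prod isOpen_univ) h1 (hasDerivAt_id (0 : ℝ)) h0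
  exact h2.differentiableAt.hasDerivAt

theorem Sm.mul {Φ Ψ : X → Pt → ℝ} (hΦ : Sm D Φ) (hΨ : Sm D Ψ) : Sm D fun x => Φ x * Ψ x := by
  have h1 : Sm {u : Pt → ℝ × ℝ | ∀ x, u x ∈ (univ : Set (ℝ × ℝ))}
      (fun (u : Pt → ℝ × ℝ) (x : Pt) => (u x).1 * (u x).2) :=
    Sm.pointwise (V := ℝ × ℝ) (W := ℝ) (g := fun v => v.1 * v.2)
      (contDiff_fst.mul contDiff_snd).contDiffOn fun _ _ _ => trivial
  exact h1.comp (Sm.joint.comp (hΦ.prodMk hΨ) (D' := univ) fun _ _ => mem_univ _)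
    fun _ _ _ => mem_univ _

theorem dd_mul (hD : POpen D) {Φ Ψ : X → Pt → ℝ} (hΦ : Sm D Φ) (hΨ : Sm D Ψ) {x v : X} (hx : x ∈ D)
    (hv : v ∈ (pts : Set X)) :
    dd (fun y => Φ y * Ψ y) x v = dd Φ x v * Ψ x + Φ x * dd Ψ x v := by
  funext y
  have h := (hasDerivAt_dd hD hΦ hx hv y).mul (hasDerivAt_dd hD hΨ hx hv y)
  simp only [zero_smul, add_zero] at h
  exact h.deriv

/-- Composition with a smooth real function. -/
theorem Sm.comp_real {S : Set ℝ} {g : ℝ → ℝ} (hg : ContDiffOn ℝ ∞ g S) {Φ : X → Pt → ℝ}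
    (hΦ : Sm D Φ) (hS : ∀ x ∈ D, ∀ y, Φ x y ∈ S) : Sm D fun x y => g (Φ x y) := by
  have h1 : Sm {u : Pt → ℝ | ∀ x, u x ∈ S} (fun (u : Pt → ℝ) (x : Pt) => g (u x)) :=
    Sm.pointwise hg fun _ _ _ => trivial
  exact h1.comp hΦ hS

theorem dd_comp_real {S : Set ℝ} (hS' : IsOpen S) {g : ℝ → ℝ} (hg : ContDiffOn ℝ ∞ g S)
    {Φ : X → Pt → ℝ} (hD : POpen D) (hΦ : Sm D Φ) (hS : ∀ x ∈ D, ∀ y, Φ x y ∈ S) {x v : X}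
    (hx : x ∈ D) (hv : v ∈ (pts : Set X)) :
    dd (fun x y => g (Φ x y)) x v = (fun y => deriv g (Φ x y)) * dd Φ x v := by
  funext y
  have h := hasDerivAt_dd hD hΦ hx hv y
  have h1 : HasDerivAt g (deriv g (Φ x y)) (Φ (x + (0 : ℝ) • v) y) := by
    simp only [zero_smul, add_zero]
    exact ((hg.contDiffAt (hS'.mem_nhds (hS x hx y))).differentiableAt (by simp)).hasDerivAt
  exact (h1.comp (0 : ℝ) h).deriv

theorem pd_comm {u : Pt → ℝ} (hu : u ∈ (pts : Set (Pt → ℝ))) (i j : Fin 3) :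
    pd i (pd j u) = pd j (pd i u) := by
  have hc := contDiff_of_mem_pts hu
  have h2 : ∀ x, DifferentiableAt ℝ (fderiv ℝ u) x := fun x =>
    ((hc.fderiv_right (m := 1) (by norm_cast)).differentiable (by simp)) x
  have key : ∀ i j x, pd i (pd j u) x = fderiv ℝ (fderiv ℝ u) x (Pi.single i 1) (Pi.single j 1) := by
    intro i j x
    change fderiv ℝ (fun y => fderiv ℝ u y (Pi.single j 1)) x (Pi.single i 1) = _
    rw [fderiv_clm_apply (h2 x) (differentiableAt_const _)]
    simp
  funext x
  rw [key, key]
  exact (hc.contDiffAt.isSymmSndFDerivAt (by simp; norm_cast)).eq _ _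

theorem ip_mul (u v w : Pt → ℝ) : ip u (v * w) = ip (u * v) w := by
  simp only [ip, dot, Pi.mul_apply, mul_assoc]

theorem const_mem_pts (a : ℝ) : (fun _ : Pt => a) ∈ (pts : Set (Pt → ℝ)) :=
  mem_pts_scalar.2 ⟨contDiff_const, fun _ _ => rfl⟩

/-- Smooth maps from `D` to scalar fields. -/
def FieldRing (D : Set X) : Subring (D → Pt → ℝ) where
  carrier := {u | ∃ Φ : X → Pt → ℝ, Sm D Φ ∧ ∀ x : D, u x = Φ x}
  mul_mem' := by
    rintro u v ⟨Φ, hΦ, h⟩ ⟨Ψ, hΨ, h'⟩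
    exact ⟨_, hΦ.mul hΨ, fun x => by rw [Pi.mul_apply, h, h']⟩
  one_mem' := ⟨_, Sm.const (const_mem_pts 1), fun _ => rfl⟩
  add_mem' := by
    rintro u v ⟨Φ, hΦ, h⟩ ⟨Ψ, hΨ, h'⟩
    exact ⟨_, hΦ.add hΨ, fun x => by rw [Pi.add_apply, h, h']⟩
  zero_mem' := ⟨_, Sm.const (const_mem_pts 0), fun _ => rfl⟩
  neg_mem' := by
    rintro u ⟨Φ, hΦ, h⟩
    exact ⟨_, hΦ.neg, fun x => by rw [Pi.neg_apply, h]⟩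

namespace FieldRing

/-- The element of the ring given by a smooth map. -/
def mk (Φ : X → Pt → ℝ) (hΦ : Sm D Φ) : FieldRing D := ⟨fun x => Φ x, Φ, hΦ, fun _ => rfl⟩

/-- Evaluation at a point of `D`. -/
def eval (x : D) : FieldRing D →+* (Pt → ℝ) :=
  (Pi.evalRingHom (fun _ : D => Pt → ℝ) x).comp (FieldRing D).subtype

theorem eval_mk (x : D) (Φ : X → Pt → ℝ) (hΦ : Sm D Φ) : eval x (mk Φ hΦ) = Φ x := rfl

theorem ext_eval {u v : FieldRing D} (h : ∀ x, eval x u = eval x v) : u = v :=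
  Subtype.ext (funext h)

theorem exists_mk (u : FieldRing D) : ∃ (Φ : X → Pt → ℝ) (hΦ : Sm D Φ), u = mk Φ hΦ := by
  obtain ⟨Φ, hΦ, h⟩ := u.2
  exact ⟨Φ, hΦ, ext_eval h⟩

/-- A smooth map representing an element of the ring. -/
def rep (u : FieldRing D) : X → Pt → ℝ := (exists_mk u).choose

theorem rep_sm (u : FieldRing D) : Sm D (rep u) := (exists_mk u).choose_spec.choose

theorem mk_rep (u : FieldRing D) : mk (rep u) (rep_sm u) = u :=
  (exists_mk u).choose_spec.choose_spec.symm

theorem rep_apply (u : FieldRing D) (x : D) : (rep u) x = eval x u := by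
  conv_rhs => rw [← mk_rep u]
  rfl

theorem rep_mk {Φ : X → Pt → ℝ} (hΦ : Sm D Φ) {x : X} (hx : x ∈ D) : rep (mk Φ hΦ) x = Φ x :=
  rep_apply (mk Φ hΦ) ⟨x, hx⟩

theorem eval_mem_pts (hD : POpen D) (u : FieldRing D) (x : D) :
    eval x u ∈ (pts : Set (Pt → ℝ)) := by
  rw [← rep_apply]
  exact (rep_sm u).mem_pts hD x.2

/-- Spatial derivatives. -/
def partialDeriv (hD : POpen D) (i : Fin 3) : Derivation ℤ (FieldRing D) (FieldRing D) :=
  Derivation.mk' (AddMonoidHom.toIntLinearMap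
    { toFun := fun u => mk (fun x => pd i ((rep u) x))
        ((Sm.pd i).comp (rep_sm u) (D' := univ) fun _ _ => mem_univ _)
      map_zero' := ext_eval fun x => by
        simp only [eval_mk, rep_apply, map_zero]
        exact (isLin_pd i).zero
      map_add' := fun u v => ext_eval fun x => by
        simp only [eval_mk, rep_apply, map_add]
        exact pd_add (eval_mem_pts hD u x) (eval_mem_pts hD v x) i })
    fun u v => ext_eval fun x => by
      simp only [AddMonoidHom.coe_toIntLinearMap, AddMonoidHom.coe_mk, ZeroHom.coe_mk, eval_mk,
        rep_apply, map_add, smul_eq_mul, map_mul]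
      rw [pd_mul (eval_mem_pts hD u x) (eval_mem_pts hD v x) i]
      ring

theorem eval_partialDeriv (hD : POpen D) (i : Fin 3) (u : FieldRing D) (x : D) :
    eval x (partialDeriv hD i u) = pd i (eval x u) := by
  rw [← rep_apply u]
  rfl

/-- The derivative along a vector field. -/
def along (hD : POpen D) {v : X → X} (hv : Sm D v) : Derivation ℤ (FieldRing D) (FieldRing D) :=
  Derivation.mk' (AddMonoidHom.toIntLinearMap
    { toFun := fun u => mk (fun x => dd (rep u) x (v x))
        ((rep_sm u).dd_apply hD Sm.id hv fun _ h => h)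
      map_zero' := ext_eval fun x => by
        simp only [eval_mk, map_zero]
        rw [dd_congr (Φ := fun _ => 0) (Sm.const zero_mem_pts) hD
          (fun y hy => (rep_apply (0 : FieldRing D) ⟨y, hy⟩).trans (map_zero _)) x.2
          (hv.mem_pts hD x.2), dd_const zero_mem_pts]
      map_add' := fun u w => ext_eval fun x => by
        simp only [eval_mk, map_add]
        rw [dd_congr (Φ := fun y => (rep u) y + (rep w) y) ((rep_sm u).add (rep_sm w)) hD
          (fun y hy => by
            rw [rep_apply (u + w) ⟨y, hy⟩, rep_apply u ⟨y, hy⟩, rep_apply w ⟨y, hy⟩, map_add]) x.2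
          (hv.mem_pts hD x.2), dd_fun_add (rep_sm u) (rep_sm w) hD x.2 (hv.mem_pts hD x.2)] })
    fun u w => ext_eval fun x => by
      simp only [AddMonoidHom.coe_toIntLinearMap, AddMonoidHom.coe_mk, ZeroHom.coe_mk, eval_mk,
        map_add, smul_eq_mul, map_mul]
      rw [dd_congr (Φ := fun y => (rep u) y * (rep w) y) ((rep_sm u).mul (rep_sm w)) hD
          (fun y hy => by
            rw [rep_apply (u * w) ⟨y, hy⟩, rep_apply u ⟨y, hy⟩, rep_apply w ⟨y, hy⟩, map_mul]) x.2
          (hv.mem_pts hD x.2), dd_mul hD (rep_sm u) (rep_sm w) x.2 (hv.mem_pts hD x.2), rep_apply,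
          rep_apply]
      ring

theorem eval_along (hD : POpen D) {v : X → X} (hv : Sm D v) {Φ : X → Pt → ℝ} (hΦ : Sm D Φ)
    (x : D) : eval x (along hD hv (mk Φ hΦ)) = dd Φ x (v x) :=
  dd_congr hΦ hD (fun _ hy => rep_mk hΦ hy) x.2 (hv.mem_pts hD x.2)

theorem eval_along_rep (hD : POpen D) {v : X → X} (hv : Sm D v) (u : FieldRing D) (x : D) :
    eval x (along hD hv u) = dd (rep u) x (v x) := rfl

theorem partialDeriv_comm (hD : POpen D) (i j : Fin 3) (u : FieldRing D) :
    partialDeriv hD i (partialDeriv hD j u) = partialDeriv hD j (partialDeriv hD i u) :=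
  ext_eval fun x => by
    simp only [eval_partialDeriv]
    exact pd_comm (eval_mem_pts hD u x) i j

/-- Spatial differentiation is a linear operator on fields, so it passes through directional
derivatives. -/
theorem along_comm (hD : POpen D) {v : X → X} (hv : Sm D v) (i : Fin 3) (u : FieldRing D) :
    along hD hv (partialDeriv hD i u) = partialDeriv hD i (along hD hv u) :=
  ext_eval fun x => by
    rw [eval_partialDeriv, eval_along_rep, eval_along_rep]
    rw [dd_congr (Φ := fun y => pd i ((rep u) y)) ((Sm.pd i).comp (rep_sm u) (D' := univ)
      fun _ _ => mem_univ _) hD (fun y hy => by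
        rw [rep_apply _ ⟨y, hy⟩, eval_partialDeriv, rep_apply u ⟨y, hy⟩]) x.2 (hv.mem_pts hD x.2)]
    exact dd_lin_comp (isLin_pd i) (Sm.pd i) (rep_sm u) hD x.2 (hv.mem_pts hD x.2)

/-- Elements of the ring that depend neither on the point of `D` nor on the spatial point. -/
def real (D : Set X) (a : ℝ) : FieldRing D := mk _ (Sm.const (const_mem_pts a))

theorem eval_real (a : ℝ) (x : D) : eval x (real D a) = fun _ => a := rfl

/-- Elements of the ring that do not depend on the point of `D`. -/
def field (D : Set X) (u : Pt → ℝ) (hu : u ∈ (pts : Set (Pt → ℝ))) : FieldRing D :=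
  mk _ (Sm.const hu)

theorem eval_field {u : Pt → ℝ} (hu : u ∈ (pts : Set (Pt → ℝ))) (x : D) :
    eval x (field D u hu) = u := rfl

theorem along_field (hD : POpen D) {v : X → X} (hv : Sm D v) {u : Pt → ℝ}
    (hu : u ∈ (pts : Set (Pt → ℝ))) : along hD hv (field D u hu) = 0 :=
  ext_eval fun x => by
    rw [field, eval_along, dd_const hu, map_zero]

theorem along_real (hD : POpen D) {v : X → X} (hv : Sm D v) (a : ℝ) :
    along hD hv (real D a) = 0 := along_field hD hv (const_mem_pts a)

theorem partialDeriv_real (hD : POpen D) (i : Fin 3) (a : ℝ) : partialDeriv hD i (real D a) = 0 :=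
  ext_eval fun x => by
    rw [eval_partialDeriv, eval_real, map_zero]
    funext y
    simp [pd]

/-- Divergences integrate to zero. -/
theorem integral_div (hD : POpen D) (J : Fin 3 → FieldRing D) (x : D) :
    ∫ y in cell, eval x (∑ c, partialDeriv hD c (J c)) y = 0 := by
  have h1 : ∀ y, eval x (∑ c, partialDeriv hD c (J c)) y = ∑ c, pd c (eval x (J c)) y := by
    intro y
    simp only [map_sum, eval_partialDeriv, Finset.sum_apply]
  simp only [h1]
  rw [integral_finsetSum]
  · exact Finset.sum_eq_zero fun c _ => integral_pd (eval_mem_pts hD _ x) c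
  · intro c _
    exact ((contDiff_of_mem_pts (pd_mem_pts (eval_mem_pts hD (J c) x) c)).continuous.continuousOn
      ).integrableOn_compact isCompact_cell

end FieldRing

end ScalarFields

end

section

/-! ### Functional derivatives of scalar fields and of their combinations -/

section RegScalar

variable {A : Type} [AddCommGroup A] [Module ℝ A] [DVS A]
  {V W W' : Type} [NormedAddCommGroup V] [NormedSpace ℝ V] [FVal V]
  [NormedAddCommGroup W] [NormedSpace ℝ W] [FVal W]
  [NormedAddCommGroup W'] [NormedSpace ℝ W'] [FVal W']
  {D : Set (A × (Pt → V))}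

theorem Reg.const {u : Pt → W} (hu : u ∈ (pts : Set (Pt → W))) (hD : POpen D) :
    Reg D fun _ => u :=
  Reg.of_param (D := D) (D' := pts) (Φ := fun _ => u) (Sm.const hu) hD
    fun _ hx => (mem_pts_prod.1 (hD.subset hx)).1

/-- A product is varied by moving the other factor onto the test field. Together with the analogous
rules for sums, spatial derivatives and smooth functions this yields functional derivatives of the
constraints without writing them out. -/
theorem Reg.mul {Φ Φ' : A × (Pt → V) → Pt → ℝ} (h : Reg D Φ) (h' : Reg D Φ') (hD : POpen D) :
    Reg D fun x => Φ x * Φ' x := by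
  obtain ⟨Ψ, hΨ⟩ := h
  obtain ⟨Ψ', hΨ'⟩ := h'
  have m1 : ∀ x ∈ D, Φ x ∈ (pts : Set (Pt → ℝ)) := fun x hx => hΨ.sm.mem_pts hD hx
  have m2 : ∀ x ∈ D, Φ' x ∈ (pts : Set (Pt → ℝ)) := fun x hx => hΨ'.sm.mem_pts hD hx
  have s1 : Sm (D ×ˢ (pts : Set (Pt → ℝ))) fun y => Ψ (y.1, y.2 * Φ' y.1) :=
    hΨ.adj_sm.comp (Sm.fst.prodMk (Sm.snd.mul (hΨ'.sm.comp Sm.fst fun y hy => hy.1)))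
      fun y hy => ⟨hy.1, mul_mem_pts hy.2 (m2 _ hy.1)⟩
  have s2 : Sm (D ×ˢ (pts : Set (Pt → ℝ))) fun y => Ψ' (y.1, y.2 * Φ y.1) :=
    hΨ'.adj_sm.comp (Sm.fst.prodMk (Sm.snd.mul (hΨ.sm.comp Sm.fst fun y hy => hy.1)))
      fun y hy => ⟨hy.1, mul_mem_pts hy.2 (m1 _ hy.1)⟩
  refine ⟨_, hΨ.sm.mul hΨ'.sm, s1.add s2, fun x hx η hη v hv => ?_⟩
  have hv' := zero_prod_mem_pts (A := A) hv
  have d1 := dd_mem_pts hΨ.sm hD hx hv'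
  have d2 := dd_mem_pts hΨ'.sm hD hx hv'
  rw [dd_mul hD hΨ.sm hΨ'.sm hx hv', (ip_isLin_right hη).add (mul_mem_pts d1 (m2 x hx))
    (mul_mem_pts (m1 x hx) d2), mul_comm (dd Φ x (0, v)), ip_mul, ip_mul,
    hΨ.adj x hx _ (mul_mem_pts hη (m2 x hx)) v hv, hΨ'.adj x hx _ (mul_mem_pts hη (m1 x hx)) v hv]
  exact ((ip_isLin_left hv).add (hΨ.mem_pts hD hx (mul_mem_pts hη (m2 x hx)))
    (hΨ'.mem_pts hD hx (mul_mem_pts hη (m1 x hx)))).symm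

theorem Reg.comp_real {S : Set ℝ} (hS' : IsOpen S) {g : ℝ → ℝ} (hg : ContDiffOn ℝ ∞ g S)
    {Φ : A × (Pt → V) → Pt → ℝ} (h : Reg D Φ) (hD : POpen D) (hS : ∀ x ∈ D, ∀ y, Φ x y ∈ S) :
    Reg D fun x y => g (Φ x y) := by
  obtain ⟨Ψ, hΨ⟩ := h
  have hg' : ContDiffOn ℝ ∞ (deriv g) S := hg.deriv_of_isOpen hS' (by simp)
  have sg : Sm D fun x y => deriv g (Φ x y) := hΨ.sm.comp_real hg' hS
  have m1 : ∀ x ∈ D, (fun y => deriv g (Φ x y)) ∈ (pts : Set (Pt → ℝ)) :=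
    fun x hx => sg.mem_pts hD hx
  have s1 : Sm (D ×ˢ (pts : Set (Pt → ℝ))) fun y => Ψ (y.1, y.2 * fun p => deriv g (Φ y.1 p)) :=
    hΨ.adj_sm.comp (Sm.fst.prodMk (Sm.snd.mul (sg.comp Sm.fst fun y hy => hy.1)))
      fun y hy => ⟨hy.1, mul_mem_pts hy.2 (m1 _ hy.1)⟩
  refine ⟨_, hΨ.sm.comp_real hg hS, s1, fun x hx η hη v hv => ?_⟩
  rw [dd_comp_real hS' hg hD hΨ.sm hS hx (zero_prod_mem_pts hv), ip_mul,
    hΨ.adj x hx _ (mul_mem_pts hη (m1 x hx)) v hv]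

/-- Integration by parts: the transpose of a spatial derivative is its negative. -/
theorem Reg.pd {Φ : A × (Pt → V) → Pt → ℝ} (h : Reg D Φ) (hD : POpen D) (i : Fin 3) :
    Reg D fun x => ADM.pd i (Φ x) :=
  h.lin_comp hD (isLin_pd i) (Sm.pd i) (Lt := fun η => -ADM.pd i η) (Sm.pd i).neg
    fun _ hη _ hξ => ip_pd hη hξ i

theorem Reg.snd (hD : POpen D) : Reg D fun x => x.2 := by
  refine ⟨fun y => y.2, Sm.snd, Sm.snd, fun x hx η hη v hv => ?_⟩
  have : dd (fun y : A × (Pt → V) => y.2) x (0, v) = v := by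
    rw [← dd_snd' (Φ := fun y : A × (Pt → V) => y), dd_id (hD.subset hx) (zero_prod_mem_pts hv)]
  rw [this]

/-- Composition with a linear map of the values that has a transpose. -/
theorem Reg.pointwise_lin {Φ : A × (Pt → V) → Pt → W} (h : Reg D Φ) (hD : POpen D)
    (L : W →L[ℝ] W') (Lt : W' →L[ℝ] W)
    (hL : ∀ w ∈ (sym : Submodule ℝ W), L w ∈ (sym : Submodule ℝ W'))
    (hLt : ∀ w ∈ (sym : Submodule ℝ W'), Lt w ∈ (sym : Submodule ℝ W))
    (ht : ∀ w ∈ (sym : Submodule ℝ W'), ∀ u ∈ (sym : Submodule ℝ W), dot w (L u) = dot (Lt w) u) :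
    Reg D fun x y => L (Φ x y) :=
  h.lin_comp hD (L := fun u y => L (u y)) (isLin_pointwise L) (Sm.pointwise_lin L hL)
    (Lt := fun u y => Lt (u y)) (Sm.pointwise_lin Lt hLt) fun η hη ξ hξ => by
      simp only [ip]
      refine integral_congr_ae (Filter.Eventually.of_forall fun y => ?_)
      exact ht _ ((mem_pts_field.1 hη).2 y).2 _ ((mem_pts_field.1 hξ).2 y).2

theorem Reg.fst' {Φ : A × (Pt → V) → Pt → W × W'} (h : Reg D Φ) (hD : POpen D) :
    Reg D fun x y => (Φ x y).1 :=
  h.pointwise_lin hD (ContinuousLinearMap.fst ℝ W W') (ContinuousLinearMap.inl ℝ W W')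
    (fun _ hw => hw.1) (fun _ hw => ⟨hw, Submodule.zero_mem _⟩) fun w _ u _ => by
      simp only [dot, ContinuousLinearMap.inl_apply, ContinuousLinearMap.coe_fst']
      have := FVal.dot_smul_left 0 (0 : W') u.2
      rw [zero_smul, zero_mul] at this
      rw [this, add_zero]

theorem Reg.snd' {Φ : A × (Pt → V) → Pt → W × W'} (h : Reg D Φ) (hD : POpen D) :
    Reg D fun x y => (Φ x y).2 :=
  h.pointwise_lin hD (ContinuousLinearMap.snd ℝ W W') (ContinuousLinearMap.inr ℝ W W')
    (fun _ hw => hw.2) (fun _ hw => ⟨Submodule.zero_mem _, hw⟩) fun w _ u _ => by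
      simp only [dot, ContinuousLinearMap.inr_apply, ContinuousLinearMap.coe_snd']
      have := FVal.dot_smul_left 0 (0 : W) u.1
      rw [zero_smul, zero_mul] at this
      rw [this, zero_add]

theorem Reg.joint {Φ : A × (Pt → V) → Pt → W} {Φ' : A × (Pt → V) → Pt → W'} (h : Reg D Φ)
    (h' : Reg D Φ') (hD : POpen D) : Reg D fun x y => (Φ x y, Φ' x y) := by
  have h1 : Reg D fun x y => ContinuousLinearMap.inl ℝ W W' (Φ x y) :=
    h.pointwise_lin hD (ContinuousLinearMap.inl ℝ W W') (ContinuousLinearMap.fst ℝ W W')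
    (fun _ hw => ⟨hw, Submodule.zero_mem _⟩) (fun _ hw => hw.1) fun w _ u _ => by
      simp only [dot, ContinuousLinearMap.inl_apply, ContinuousLinearMap.coe_fst']
      have := FVal.dot_smul_left 0 (0 : W') w.2
      rw [zero_smul, zero_mul, FVal.dot_comm] at this
      rw [this, add_zero]
  have h2 : Reg D fun x y => ContinuousLinearMap.inr ℝ W W' (Φ' x y) :=
    h'.pointwise_lin hD (ContinuousLinearMap.inr ℝ W W') (ContinuousLinearMap.snd ℝ W W')
    (fun _ hw => ⟨Submodule.zero_mem _, hw⟩) (fun _ hw => hw.2) fun w _ u _ => by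
      simp only [dot, ContinuousLinearMap.inr_apply, ContinuousLinearMap.coe_snd']
      have := FVal.dot_smul_left 0 (0 : W) w.1
      rw [zero_smul, zero_mul, FVal.dot_comm] at this
      rw [this, zero_add]
  refine (h1.add h2 hD).congr hD fun x _ => ?_
  funext y
  simp

theorem dot_four (v w : Fin 4 → ℝ) : dot v w = ∑ μ, v μ * w μ := rfl

theorem Reg.four_apply {Φ : A × (Pt → V) → Pt → Fin 4 → ℝ} (h : Reg D Φ) (hD : POpen D)
    (μ : Fin 4) : Reg D fun x y => Φ x y μ :=
  h.pointwise_lin hD (ContinuousLinearMap.proj (R := ℝ) (φ := fun _ : Fin 4 => ℝ) μ)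
    (ContinuousLinearMap.single ℝ (fun _ : Fin 4 => ℝ) μ) (fun _ _ => trivial)
    (fun _ _ => trivial) fun w _ u _ => by
      simp only [dot_four, ContinuousLinearMap.single_apply, ContinuousLinearMap.proj_apply]
      change w * u μ = _
      simp [Pi.single_apply, ite_mul]

theorem Reg.sum {ι : Type} (s : Finset ι) {Φ : ι → A × (Pt → V) → Pt → W}
    (h : ∀ i, Reg D (Φ i)) (hD : POpen D) : Reg D fun x => ∑ i ∈ s, Φ i x := by
  classical
  induction s using Finset.induction_on with
  | empty => simpa using Reg.const zero_mem_pts hD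
  | insert i s hi ih =>
    simp only [Finset.sum_insert hi]
    exact (h i).add ih hD

theorem Reg.four {Φ : A × (Pt → V) → Pt → Fin 4 → ℝ} (h : ∀ μ, Reg D fun x y => Φ x y μ)
    (hD : POpen D) : Reg D Φ := by
  have h1 : ∀ μ, Reg D fun x y => ContinuousLinearMap.single ℝ (fun _ : Fin 4 => ℝ) μ (Φ x y μ) :=
    fun μ => (h μ).pointwise_lin hD (ContinuousLinearMap.single ℝ (fun _ : Fin 4 => ℝ) μ)
      (ContinuousLinearMap.proj (R := ℝ) (φ := fun _ : Fin 4 => ℝ) μ) (fun _ _ => trivial)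
      (fun _ _ => trivial) fun w _ u _ => by
        simp only [dot_four, ContinuousLinearMap.single_apply, ContinuousLinearMap.proj_apply]
        change _ = w μ * u
        simp [Pi.single_apply, mul_ite]
  refine (Reg.sum Finset.univ h1 hD).congr hD fun x _ => ?_
  funext y ν
  simp [Finset.sum_apply, Pi.single_apply]

/-- The naive transpose of reading off a component, a single matrix unit, is not symmetric. Half the
sum of the units at `(a, b)` and `(b, a)` is, and has the same pairing with symmetric tensors. -/
theorem Reg.tensor_apply {Φ : A × (Pt → V) → Pt → Fin 3 → Fin 3 → ℝ} (h : Reg D Φ) (hD : POpen D)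
    (a b : Fin 3) : Reg D fun x y => Φ x y a b := by
  refine h.pointwise_lin hD ((ContinuousLinearMap.proj (R := ℝ) (φ := fun _ : Fin 3 => ℝ) b).comp
      (ContinuousLinearMap.proj (R := ℝ) (φ := fun _ : Fin 3 => Fin 3 → ℝ) a))
    ((1 / 2 : ℝ) • ((ContinuousLinearMap.single ℝ (fun _ : Fin 3 => Fin 3 → ℝ) a).comp
      (ContinuousLinearMap.single ℝ (fun _ : Fin 3 => ℝ) b) +
      (ContinuousLinearMap.single ℝ (fun _ : Fin 3 => Fin 3 → ℝ) b).comp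
      (ContinuousLinearMap.single ℝ (fun _ : Fin 3 => ℝ) a))) (fun _ _ => trivial)
    (fun w _ i j => ?_) fun w _ u hu => ?_
  · have e : ∀ a b i j : Fin 3, (Pi.single a (Pi.single b w : Fin 3 → ℝ) : Fin 3 → Fin 3 → ℝ) i j =
        (Pi.single b (Pi.single a w : Fin 3 → ℝ) : Fin 3 → Fin 3 → ℝ) j i := by
      intro a b i j
      simp only [Pi.single_apply, ite_apply, Pi.zero_apply]
      split_ifs <;> rfl
    change (1 / 2 : ℝ) * ((Pi.single a (Pi.single b w : Fin 3 → ℝ) : Fin 3 → Fin 3 → ℝ) i j +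
      (Pi.single b (Pi.single a w : Fin 3 → ℝ) : Fin 3 → Fin 3 → ℝ) i j) = (1 / 2 : ℝ) *
      ((Pi.single a (Pi.single b w : Fin 3 → ℝ) : Fin 3 → Fin 3 → ℝ) j i +
      (Pi.single b (Pi.single a w : Fin 3 → ℝ) : Fin 3 → Fin 3 → ℝ) j i)
    rw [e a b i j, e b a i j, add_comm]
  · have hab : u a b = u b a := hu a b
    change w * u a b = ∑ i, ∑ j, _
    simp only [smul_apply, add_apply,
      ContinuousLinearMap.comp_apply, ContinuousLinearMap.single_apply, Pi.smul_apply, Pi.add_apply,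
      smul_eq_mul]
    have e : ∀ a b : Fin 3, ∑ i, ∑ j, (Pi.single a (Pi.single b w : Fin 3 → ℝ) :
        Fin 3 → Fin 3 → ℝ) i j * u i j = w * u a b := by
      intro a b
      simp [Pi.single_apply, ite_apply, ite_mul]
    have e2 : ∀ i j, 1 / 2 * ((Pi.single a (Pi.single b w : Fin 3 → ℝ) : Fin 3 → Fin 3 → ℝ) i j +
        (Pi.single b (Pi.single a w : Fin 3 → ℝ) : Fin 3 → Fin 3 → ℝ) i j) * u i j = 1 / 2 *
        ((Pi.single a (Pi.single b w : Fin 3 → ℝ) : Fin 3 → Fin 3 → ℝ) i j * u i j) +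
        1 / 2 * ((Pi.single b (Pi.single a w : Fin 3 → ℝ) : Fin 3 → Fin 3 → ℝ) i j * u i j) :=
      fun i j => by ring
    simp only [e2, Finset.sum_add_distrib, ← Finset.mul_sum, e]
    rw [hab]
    ring

namespace FieldRing

/-- Elements of the ring that have functional derivatives. -/
def IsReg (u : FieldRing D) : Prop := Reg D (rep u)

theorem isReg_mk {Φ : A × (Pt → V) → Pt → ℝ} (hD : POpen D) (h : Reg D Φ) :
    IsReg (mk Φ h.sm) := h.congr hD fun _ hx => rep_mk h.sm hx

theorem IsReg.of_eval {u : FieldRing D} (hD : POpen D) {Φ : A × (Pt → V) → Pt → ℝ} (hu : IsReg u)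
    (h : ∀ x : D, eval x u = Φ x) : Reg D Φ :=
  Reg.congr hu hD fun x hx => by rw [← h ⟨x, hx⟩, ← rep_apply]

theorem IsReg.add {u v : FieldRing D} (hD : POpen D) (hu : IsReg u) (hv : IsReg v) :
    IsReg (u + v) :=
  (Reg.add hu hv hD).congr hD fun x hx => by
    simp only [rep_apply _ ⟨x, hx⟩, map_add]

theorem IsReg.sub {u v : FieldRing D} (hD : POpen D) (hu : IsReg u) (hv : IsReg v) :
    IsReg (u - v) :=
  (Reg.sub hu hv hD).congr hD fun x hx => by
    simp only [rep_apply _ ⟨x, hx⟩, map_sub]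

theorem IsReg.mul {u v : FieldRing D} (hD : POpen D) (hu : IsReg u) (hv : IsReg v) :
    IsReg (u * v) :=
  (Reg.mul hu hv hD).congr hD fun x hx => by
    simp only [rep_apply _ ⟨x, hx⟩, map_mul]

theorem IsReg.partialDeriv {u : FieldRing D} (hD : POpen D) (hu : IsReg u) (i : Fin 3) :
    IsReg (partialDeriv hD i u) :=
  (Reg.pd hu hD i).congr hD fun x hx => by
    simp only [rep_apply _ ⟨x, hx⟩, eval_partialDeriv]

theorem isReg_field {u : Pt → ℝ} (hD : POpen D) (hu : u ∈ (pts : Set (Pt → ℝ))) :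
    IsReg (field D u hu) := isReg_mk hD (Reg.const hu hD)

theorem isReg_real (hD : POpen D) (a : ℝ) : IsReg (real D a) := isReg_field hD (const_mem_pts a)

theorem isReg_two (hD : POpen D) : IsReg (2 : FieldRing D) := by
  have : (2 : FieldRing D) = real D 2 := ext_eval fun x => by
    rw [eval_real, map_ofNat]
    rfl
  rw [this]
  exact isReg_real hD 2

end FieldRing

end RegScalar

end

section

/-! ### The Levi-Civita connection and the volume density of an invertible metric -/

section DiffRing

variable {R : Type} [CommRing R] {d : Fin 3 → Derivation ℤ R R} {q h : Fin 3 → Fin 3 → R}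
  {r ri hf : R}

/-- The Levi-Civita connection. -/
theorem DiffMetric.of_inv (comm : ∀ a b f, d a (d b f) = d b (d a f))
    (hhalf : 2 * hf = 1) (q_symm : ∀ a b, q a b = q b a)
    (h_symm : ∀ a b, h a b = h b a) (inv : ∀ a b, ∑ c, h a c * q c b = if a = b then 1 else 0) :
    DiffMetric d q h fun c a b =>
      hf * ∑ e, h c e * (d a (q e b) + d b (q e a) - d e (q a b)) := by
  have inv' : ∀ a b, ∑ c, q a c * h c b = if a = b then 1 else 0 := by
    intro a b
    have h1 := inv b a
    simp only [eq_comm (a := b)] at h1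
    rw [← h1]
    exact Finset.sum_congr rfl fun c _ => by rw [q_symm a c, h_symm c b, mul_comm]
  have low : ∀ (a : Fin 3) (v : Fin 3 → R), ∑ e, q a e * ∑ f, h e f * v f = v a := by
    intro a v
    have : ∑ e, q a e * ∑ f, h e f * v f = ∑ f, (∑ e, q a e * h e f) * v f := by
      simp only [Finset.mul_sum, Finset.sum_mul]
      rw [Finset.sum_comm]
      simp only [mul_assoc]
    rw [this]
    simp [inv']
  refine ⟨comm, fun x hx => ?_, q_symm, h_symm, inv, fun c a b => ?_, fun c a b => ?_⟩
  · linear_combination hf * hx - x * hhalf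
  · refine congrArg _ (Finset.sum_congr rfl fun e _ => ?_)
    rw [q_symm a b]
    ring
  · have l1 := low a fun e => d c (q e b) + d b (q e c) - d e (q c b)
    have l2 := low b fun e => d c (q e a) + d a (q e c) - d e (q c a)
    have e1 : ∑ e, (q a e * (hf * ∑ f, h e f * (d c (q f b) + d b (q f c) - d f (q c b))) +
        q b e * (hf * ∑ f, h e f * (d c (q f a) + d a (q f c) - d f (q c a)))) =
        hf * (∑ e, q a e * ∑ f, h e f * (d c (q f b) + d b (q f c) - d f (q c b)) +
          ∑ e, q b e * ∑ f, h e f * (d c (q f a) + d a (q f c) - d f (q c a))) := by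
      rw [← Finset.sum_add_distrib, Finset.mul_sum]
      exact Finset.sum_congr rfl fun e _ => by ring
    rw [e1, l1, l2, q_symm b a, q_symm c a, q_symm c b]
    linear_combination -(d c (q a b)) * hhalf

/-- Jacobi's formula for the derivative of a determinant, written for a symmetric three by three
matrix whose inverse is the adjugate divided by `r²`. -/
theorem DiffVol.of_det (q_symm : ∀ a b, q a b = q b a) (hr : r * r = (Matrix.of q).det)
    (hri : r * ri = 1) (hh : ∀ a b, h a b = ri * ri * (Matrix.of q).adjugate a b) :
    DiffVol q h r ri := by
  refine ⟨hri, fun δ => ?_⟩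
  have h1 := congrArg δ hr
  rw [Matrix.det_fin_three] at h1
  simp only [hh, Matrix.adjugate_fin_three, Fin.sum_univ_three, Matrix.of_apply, Matrix.cons_val',
    Matrix.cons_val_zero, Matrix.cons_val_one, Matrix.cons_val, map_add, map_sub,
    Derivation.leibniz, smul_eq_mul, q_symm 1 0, q_symm 2 0, q_symm 2 1] at h1 ⊢
  linear_combination r * ri * ri * h1 - 2 * δ r * (r * ri + 1) * hri

end DiffRing

/-! ### The constraints as elements of a differential ring -/

section Elements

variable {A : Type} [AddCommGroup A] [Module ℝ A] [DVS A] {D : Set (A × (Pt → ExtVal))}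

open FieldRing

/-- The elements with functional derivatives form a subring. -/
def regRing (hD : POpen D) : Subring (FieldRing D) where
  carrier := {u | IsReg u}
  mul_mem' := IsReg.mul hD
  one_mem' := by
    have : (1 : FieldRing D) = real D 1 := ext_eval fun x => by rw [eval_real, map_one]; rfl
    rw [this]
    exact isReg_real hD 1
  add_mem' := IsReg.add hD
  zero_mem' := isReg_field hD zero_mem_pts
  neg_mem' {u} hu := by
    have := IsReg.sub hD (isReg_field hD zero_mem_pts) hu
    have e : field D 0 zero_mem_pts - u = -u := ext_eval fun x => by
      rw [map_sub, eval_field, map_neg, zero_sub]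
    rwa [e] at this

/-- Open sets of parameters and of fields whose metric is positive definite. -/
structure MetricDom (D : Set (A × (Pt → ExtVal))) : Prop where
  isOpen : POpen D
  posDef : ∀ x ∈ D, ∀ y, (Matrix.of (x.2 y).1.1).PosDef

theorem reg_ext (hD : POpen D) : Reg D fun x y => (x.2 y).1 := (Reg.snd hD).fst' hD

theorem reg_q (hD : POpen D) (a b : Fin 3) : Reg D fun x y => (x.2 y).1.1 a b :=
  ((reg_ext hD).fst' hD).tensor_apply hD a b

theorem reg_P (hD : POpen D) (a b : Fin 3) : Reg D fun x y => (x.2 y).1.2.1 a b :=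
  (((reg_ext hD).snd' hD).fst' hD).tensor_apply hD a b

theorem reg_phi (hD : POpen D) : Reg D fun x y => (x.2 y).1.2.2.1 :=
  (((reg_ext hD).snd' hD).snd' hD).fst' hD

theorem reg_pi (hD : POpen D) : Reg D fun x y => (x.2 y).1.2.2.2 :=
  (((reg_ext hD).snd' hD).snd' hD).snd' hD

/-- The metric. -/
def elQ (hD : POpen D) (a b : Fin 3) : FieldRing D := mk _ (reg_q hD a b).sm

/-- The momentum of the metric. -/
def elP (hD : POpen D) (a b : Fin 3) : FieldRing D := mk _ (reg_P hD a b).sm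

/-- The scalar field. -/
def elPhi (hD : POpen D) : FieldRing D := mk _ (reg_phi hD).sm

/-- The momentum of the scalar field. -/
def elPi (hD : POpen D) : FieldRing D := mk _ (reg_pi hD).sm

/-- Evaluation at a point of `D` and a spatial point. -/
def evalPt (x : D) (y : Pt) : FieldRing D →+* ℝ := (Pi.evalRingHom (fun _ : Pt => ℝ) y).comp (eval x)

theorem evalPt_apply (x : D) (y : Pt) (u : FieldRing D) : evalPt x y u = eval x u y := rfl

theorem ext_evalPt {u v : FieldRing D} (h : ∀ x y, evalPt x y u = evalPt x y v) : u = v :=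
  ext_eval fun x => funext fun y => h x y

theorem elQ_mem (hD : POpen D) (a b : Fin 3) : elQ hD a b ∈ regRing hD := isReg_mk hD (reg_q hD a b)

theorem evalPt_matrix (hD : POpen D) (x : D) (y : Pt) :
    (evalPt x y).mapMatrix (Matrix.of (elQ hD)) = Matrix.of (x.1.2 y).1.1 := rfl

/-- The determinant can be formed inside the subring of regular elements, so it is regular without
expanding it. -/
theorem det_mem (hD : POpen D) : (Matrix.of (elQ hD)).det ∈ regRing hD := by
  let Q : Matrix (Fin 3) (Fin 3) (regRing hD) := fun a b => ⟨elQ hD a b, elQ_mem hD a b⟩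
  have : (Matrix.of (elQ hD)).det = (regRing hD).subtype Q.det := by
    rw [RingHom.map_det]
    rfl
  rw [this]
  exact Subtype.prop _

theorem adjugate_mem (hD : POpen D) (a b : Fin 3) :
    (Matrix.of (elQ hD)).adjugate a b ∈ regRing hD := by
  let Q : Matrix (Fin 3) (Fin 3) (regRing hD) := fun a b => ⟨elQ hD a b, elQ_mem hD a b⟩
  have : (Matrix.of (elQ hD)).adjugate = (regRing hD).subtype.mapMatrix Q.adjugate := by
    rw [RingHom.map_adjugate]
    rfl
  rw [this]
  exact Subtype.prop _

namespace MetricDom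

theorem det_pos (m : MetricDom D) {x : A × (Pt → ExtVal)} (hx : x ∈ D) (y : Pt) :
    0 < (Matrix.of (x.2 y).1.1).det := (m.posDef x hx y).det_pos

theorem reg_det (m : MetricDom D) : Reg D fun x y => (Matrix.of (x.2 y).1.1).det :=
  IsReg.of_eval m.isOpen (det_mem m.isOpen) fun x => by
    funext y
    rw [← evalPt_apply, RingHom.map_det, evalPt_matrix]

theorem reg_vol (m : MetricDom D) : Reg D fun x => sqrtDet fun y => (x.2 y).1.1 :=
  m.reg_det.comp_real (S := Ioi 0) isOpen_Ioi (g := Real.sqrt)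
    (fun _ hs => (Real.contDiffAt_sqrt (ne_of_gt hs)).contDiffWithinAt) m.isOpen
    fun _ hx y => m.det_pos hx y

theorem vol_pos (m : MetricDom D) {x : A × (Pt → ExtVal)} (hx : x ∈ D) (y : Pt) :
    0 < sqrtDet (fun y => (x.2 y).1.1) y := Real.sqrt_pos.2 (m.det_pos hx y)

theorem reg_volInv (m : MetricDom D) : Reg D fun x y => (sqrtDet (fun y => (x.2 y).1.1) y)⁻¹ :=
  m.reg_vol.comp_real (S := Ioi 0) isOpen_Ioi (g := fun s => s⁻¹)
    (fun _ hs => (contDiffAt_inv ℝ (ne_of_gt hs)).contDiffWithinAt) m.isOpen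
    fun _ hx y => m.vol_pos hx y

/-- The volume density. -/
def elVol (m : MetricDom D) : FieldRing D := FieldRing.mk _ m.reg_vol.sm

/-- The inverse of the volume density. -/
def elVolInv (m : MetricDom D) : FieldRing D := FieldRing.mk _ m.reg_volInv.sm

/-- The inverse metric. -/
def elInv (m : MetricDom D) (a b : Fin 3) : FieldRing D :=
  m.elVolInv * m.elVolInv * (Matrix.of (elQ m.isOpen)).adjugate a b

theorem vol_mem (m : MetricDom D) : m.elVol ∈ regRing m.isOpen := isReg_mk m.isOpen m.reg_vol

theorem volInv_mem (m : MetricDom D) : m.elVolInv ∈ regRing m.isOpen :=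
  isReg_mk m.isOpen m.reg_volInv

theorem inv_mem (m : MetricDom D) (a b : Fin 3) : m.elInv a b ∈ regRing m.isOpen :=
  mul_mem (mul_mem m.volInv_mem m.volInv_mem) (adjugate_mem m.isOpen a b)

theorem vol_mul_inv (m : MetricDom D) : m.elVol * m.elVolInv = 1 := ext_evalPt fun x y => by
  rw [map_mul, map_one]
  exact mul_inv_cancel₀ (m.vol_pos x.2 y).ne'

theorem vol_sq (m : MetricDom D) : m.elVol * m.elVol = (Matrix.of (elQ m.isOpen)).det :=
  ext_evalPt fun x y => by
    rw [map_mul, RingHom.map_det, evalPt_matrix]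
    exact Real.mul_self_sqrt (m.det_pos x.2 y).le

/-- The ring contains no matrix inverses a priori. The inverse metric is modelled as adjugate over
squared volume, which at each point is the inverse matrix. -/
theorem evalPt_inv (m : MetricDom D) (x : D) (y : Pt) (a b : Fin 3) :
    evalPt x y (m.elInv a b) = invMetric (fun y => (x.1.2 y).1.1) y a b := by
  have h1 : evalPt x y ((Matrix.of (elQ m.isOpen)).adjugate a b) =
      (Matrix.of (x.1.2 y).1.1).adjugate a b := by
    rw [← evalPt_matrix m.isOpen x y, ← RingHom.map_adjugate]
    rfl
  have h2 : evalPt x y (m.elVolInv * m.elVolInv) = ((Matrix.of (x.1.2 y).1.1).det)⁻¹ := by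
    rw [map_mul, ← Real.mul_self_sqrt (m.det_pos x.2 y).le, mul_inv]
    rfl
  rw [elInv, map_mul, h1, h2, invMetric, Matrix.inv_def, Ring.inverse_eq_inv']
  rfl

theorem q_symm (hD : POpen D) (a b : Fin 3) : elQ hD a b = elQ hD b a := ext_evalPt fun x y => by
  have h1 := ((mem_pts_field.1 (mem_pts_prod.1 (hD.subset x.2)).2).2 y).2
  exact h1.1.1 a b

theorem P_symm (hD : POpen D) (a b : Fin 3) : elP hD a b = elP hD b a := ext_evalPt fun x y => by
  have h1 := ((mem_pts_field.1 (mem_pts_prod.1 (hD.subset x.2)).2).2 y).2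
  exact h1.1.2.1 a b

theorem inv_symm (m : MetricDom D) (a b : Fin 3) : m.elInv a b = m.elInv b a :=
  ext_evalPt fun x y => by
    rw [m.evalPt_inv, m.evalPt_inv, invMetric, invMetric]
    have h1 : (Matrix.of (x.1.2 y).1.1).transpose = Matrix.of (x.1.2 y).1.1 := by
      ext i j
      have h2 := ((mem_pts_field.1 (mem_pts_prod.1 (m.isOpen.subset x.2)).2).2 y).2
      exact h2.1.1 j i
    conv_rhs => rw [← h1, ← Matrix.transpose_nonsing_inv]
    rfl

theorem inv_mul (m : MetricDom D) (a b : Fin 3) :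
    ∑ c, m.elInv a c * elQ m.isOpen c b = if a = b then 1 else 0 := ext_evalPt fun x y => by
  have h1 : (Matrix.of (x.1.2 y).1.1)⁻¹ * Matrix.of (x.1.2 y).1.1 = 1 :=
    Matrix.nonsing_inv_mul _ (isUnit_iff_ne_zero.2 (m.det_pos x.2 y).ne')
  have h2 := congrFun (congrFun h1 a) b
  rw [Matrix.mul_apply, Matrix.one_apply] at h2
  rw [map_sum, apply_ite (evalPt x y), map_one, map_zero, ← h2]
  refine Finset.sum_congr rfl fun c _ => ?_
  rw [map_mul, m.evalPt_inv]
  rfl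

theorem two_mul_half : 2 * real D (1 / 2) = 1 := ext_evalPt fun x y => by
  rw [map_mul, map_one, map_ofNat, evalPt_apply, eval_real]
  norm_num

/-- The Christoffel symbols. -/
def elChr (m : MetricDom D) (c a b : Fin 3) : FieldRing D :=
  real D (1 / 2) * ∑ e, m.elInv c e * (partialDeriv m.isOpen a (elQ m.isOpen e b) +
    partialDeriv m.isOpen b (elQ m.isOpen e a) - partialDeriv m.isOpen e (elQ m.isOpen a b))

theorem diffMetric (m : MetricDom D) :
    DiffMetric (partialDeriv m.isOpen) (elQ m.isOpen) m.elInv m.elChr :=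
  DiffMetric.of_inv (partialDeriv_comm m.isOpen) two_mul_half (q_symm m.isOpen) m.inv_symm
    m.inv_mul

theorem diffVol (m : MetricDom D) : DiffVol (elQ m.isOpen) m.elInv m.elVol m.elVolInv :=
  DiffVol.of_det (q_symm m.isOpen) m.vol_sq m.vol_mul_inv fun _ _ => rfl

theorem chr_mem (m : MetricDom D) (c a b : Fin 3) : m.elChr c a b ∈ regRing m.isOpen :=
  mul_mem (isReg_real m.isOpen _) (sum_mem fun e _ => mul_mem (m.inv_mem c e)
    (sub_mem (add_mem (IsReg.partialDeriv m.isOpen (elQ_mem _ _ _) a)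
      (IsReg.partialDeriv m.isOpen (elQ_mem _ _ _) b))
      (IsReg.partialDeriv m.isOpen (elQ_mem _ _ _) e)))

theorem eval_chr (m : MetricDom D) (x : D) (c a b : Fin 3) :
    eval x (m.elChr c a b) = christoffel (fun y => (x.1.2 y).1.1) c a b := by
  funext y
  rw [← evalPt_apply, elChr]
  simp only [map_mul, map_sum, map_add, map_sub, m.evalPt_inv]
  simp only [evalPt_apply, eval_real, eval_partialDeriv]
  rfl

end MetricDom

end Elements

end

section

/-! ### Identification of the constraints with expressions in the differential ring -/

section Constraints

variable {A : Type} [AddCommGroup A] [Module ℝ A] [DVS A] {D : Set (A × (Pt → ExtVal))}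

open FieldRing

theorem reg_pot (M : Couplings) (hD : POpen D) : Reg D fun x y => M.pot (x.2 y).1.2.2.1 :=
  (reg_phi hD).comp_real isOpen_univ M.pot_smooth.contDiffOn hD fun _ _ _ => mem_univ _

theorem reg_pot' (M : Couplings) (hD : POpen D) : Reg D fun x y => deriv M.pot (x.2 y).1.2.2.1 :=
  (reg_phi hD).comp_real (g := deriv M.pot) isOpen_univ
    (M.pot_smooth.contDiffOn.deriv_of_isOpen isOpen_univ (by simp)) hD fun _ _ _ => mem_univ _

/-- The potential of the scalar field. -/
def elPot (M : Couplings) (hD : POpen D) : FieldRing D := mk _ (reg_pot M hD).sm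

/-- The derivative of the potential of the scalar field. -/
def elPot' (M : Couplings) (hD : POpen D) : FieldRing D := mk _ (reg_pot' M hD).sm

/-- The coupling `1 / κ`. -/
def elKap (M : Couplings) : FieldRing D := real D (1 / M.κ)

/-- The coupling `λ_φ`. -/
def elLam (M : Couplings) : FieldRing D := real D M.lamφ

/-- The coupling `1 / λ_φ`. -/
def elLamInv (M : Couplings) : FieldRing D := real D (1 / M.lamφ)

theorem lam_mul_inv (M : Couplings) : (elLam M : FieldRing D) * elLamInv M = 1 :=
  ext_evalPt fun x y => by
    rw [map_mul, map_one]
    exact mul_one_div_cancel M.lamφ_pos.ne'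

namespace MetricDom

/-- The Hamiltonian constraint. -/
def elHam (M : Couplings) (m : MetricDom D) : FieldRing D :=
  hamOf (partialDeriv m.isOpen) (elQ m.isOpen) m.elInv (elP m.isOpen) m.elChr m.elVol m.elVolInv
    (elPhi m.isOpen) (elPi m.isOpen) (elPot M m.isOpen) (real D (1 / 2)) (elKap M) (elLam M)
    (elLamInv M)

/-- The diffeomorphism constraint. -/
def elMom (M : Couplings) (m : MetricDom D) (a : Fin 3) : FieldRing D :=
  momOf (partialDeriv m.isOpen) (elQ m.isOpen) (elP m.isOpen) m.elChr (elPhi m.isOpen)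
    (elPi m.isOpen) (elKap M) a

theorem elP_mem (hD : POpen D) (a b : Fin 3) : elP hD a b ∈ regRing hD := isReg_mk hD (reg_P hD a b)

theorem elPhi_mem (hD : POpen D) : elPhi hD ∈ regRing hD := isReg_mk hD (reg_phi hD)

theorem elPi_mem (hD : POpen D) : elPi hD ∈ regRing hD := isReg_mk hD (reg_pi hD)

theorem partial_mem (hD : POpen D) {u : FieldRing D} (hu : u ∈ regRing hD) (i : Fin 3) :
    partialDeriv hD i u ∈ regRing hD := IsReg.partialDeriv hD hu i

theorem ricci_mem (m : MetricDom D) (a b : Fin 3) :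
    ricciOf (partialDeriv m.isOpen) m.elChr a b ∈ regRing m.isOpen :=
  add_mem (sum_mem fun c _ => sub_mem (partial_mem _ (m.chr_mem c a b) c)
    (partial_mem _ (m.chr_mem c a c) b))
    (sum_mem fun c _ => sum_mem fun e _ => sub_mem (mul_mem (m.chr_mem c c e) (m.chr_mem e a b))
      (mul_mem (m.chr_mem c b e) (m.chr_mem e a c)))

theorem scal_mem (m : MetricDom D) :
    scalOf (partialDeriv m.isOpen) m.elInv m.elChr ∈ regRing m.isOpen :=
  sum_mem fun a _ => sum_mem fun b _ => mul_mem (m.inv_mem a b) (m.ricci_mem a b)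

/-- The expression is a polynomial in regular elements and their spatial derivatives, and the
regular elements form a subring closed under these derivatives. -/
theorem ham_mem (M : Couplings) (m : MetricDom D) : m.elHam M ∈ regRing m.isOpen := by
  have hq := elQ_mem m.isOpen
  have hP := elP_mem m.isOpen
  have hc : ∀ a, real D a ∈ regRing m.isOpen := isReg_real m.isOpen
  have hd := partial_mem m.isOpen (elPhi_mem m.isOpen)
  have hπ := elPi_mem m.isOpen
  refine add_mem (add_mem (mul_mem (hc _) (sub_mem (mul_mem (sub_mem ?_ (mul_mem (hc _) ?_))
    m.volInv_mem) (mul_mem m.vol_mem m.scal_mem))) (mul_mem (mul_mem (mul_mem (hc _) (hc _))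
    m.volInv_mem) (pow_mem hπ 2))) (mul_mem (mul_mem (mul_mem m.vol_mem (hc _)) (hc _))
    (add_mem ?_ (isReg_mk m.isOpen (reg_pot M m.isOpen))))
  · exact sum_mem fun a _ => sum_mem fun b _ => sum_mem fun c _ => sum_mem fun e _ =>
      mul_mem (mul_mem (mul_mem (hq a c) (hq b e)) (hP a b)) (hP c e)
  · exact pow_mem (sum_mem fun a _ => sum_mem fun b _ => mul_mem (hq a b) (hP a b)) 2
  · exact sum_mem fun a _ => sum_mem fun b _ => mul_mem (mul_mem (m.inv_mem a b) (hd a)) (hd b)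

theorem mom_mem (M : Couplings) (m : MetricDom D) (a : Fin 3) : m.elMom M a ∈ regRing m.isOpen := by
  have hP := elP_mem m.isOpen
  refine sub_mem (mul_mem (elPi_mem m.isOpen) (partial_mem _ (elPhi_mem m.isOpen) a))
    (mul_mem (mul_mem (isReg_two m.isOpen) (isReg_real m.isOpen _)) (sum_mem fun c _ =>
      mul_mem (elQ_mem m.isOpen a c) (add_mem (sum_mem fun b _ => partial_mem _ (hP b c) b)
        (sum_mem fun b _ => sum_mem fun e _ => mul_mem (m.chr_mem c b e) (hP b e)))))

theorem eval_ricci (m : MetricDom D) (x : D) (a b : Fin 3) :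
    eval x (ricciOf (partialDeriv m.isOpen) m.elChr a b) =
      ricci (fun y => (x.1.2 y).1.1) a b := by
  funext y
  simp only [ricciOf, map_add, map_sub, map_sum, map_mul, eval_partialDeriv, m.eval_chr, Pi.add_apply,
    Pi.sub_apply, Pi.mul_apply, Finset.sum_apply]
  rfl

theorem eval_inv (m : MetricDom D) (x : D) (a b : Fin 3) :
    eval x (m.elInv a b) = fun y => invMetric (fun y => (x.1.2 y).1.1) y a b :=
  funext fun y => m.evalPt_inv x y a b

theorem eval_scal (m : MetricDom D) (x : D) :
    eval x (scalOf (partialDeriv m.isOpen) m.elInv m.elChr) =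
      scalarCurv (fun y => (x.1.2 y).1.1) := by
  funext y
  simp only [scalOf, map_sum, map_mul, m.eval_ricci, m.eval_inv, Pi.mul_apply, Finset.sum_apply]
  rfl

theorem eval_ham (M : Couplings) (m : MetricDom D) (x : D) :
    eval x (m.elHam M) = hamConstraint M (red x.1.2) := by
  funext y
  simp only [elHam, hamOf, map_add, map_sub, map_sum, map_mul, map_pow, m.eval_scal, m.eval_inv,
    eval_partialDeriv, Pi.add_apply, Pi.sub_apply, Pi.mul_apply, Pi.pow_apply, Finset.sum_apply,
    hamConstraint, elKap, elLam, elLamInv, eval_real]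
  simp only [elQ, elP, elPhi, elPi, elPot, elVol, elVolInv, eval_mk, red]
  ring

theorem eval_mom (M : Couplings) (m : MetricDom D) (x : D) (a : Fin 3) :
    eval x (m.elMom M a) = diffConstraint M (red x.1.2) a := by
  funext y
  simp only [elMom, momOf, divMom, map_add, map_sub, map_sum, map_mul, map_ofNat, m.eval_chr,
    eval_partialDeriv, Pi.add_apply, Pi.sub_apply, Pi.mul_apply, Finset.sum_apply, Pi.ofNat_apply,
    diffConstraint, elKap, eval_real]
  simp only [elQ, elP, elPhi, elPi, eval_mk, red]
  ring

theorem reg_constraints (M : Couplings) (m : MetricDom D) : Reg D fun x => constraints M x.2 := by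
  have hD := m.isOpen
  refine Reg.joint (Φ := fun x => secondary M (red x.2)) (Φ' := fun x => lapseMom x.2) ?_
    (((Reg.snd hD).snd' hD).snd' hD) hD
  refine Reg.four (fun μ => ?_) hD
  refine Fin.cases ?_ (fun a => ?_) μ
  · exact IsReg.of_eval hD (m.ham_mem M) fun x => m.eval_ham M x
  · exact IsReg.of_eval hD (m.mom_mem M a) fun x => m.eval_mom M x a

theorem variation (M : Couplings) (m : MetricDom D) {δ : Derivation ℤ (FieldRing D) (FieldRing D)}
    (comm : ∀ a f, δ (partialDeriv m.isOpen a f) = partialDeriv m.isOpen a (δ f))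
    (hc : ∀ a, δ (real D a) = 0) (hV : δ (elPot M m.isOpen) = elPot' M m.isOpen * δ (elPhi m.isOpen)) :
    Variation (partialDeriv m.isOpen) (elPhi m.isOpen) (elPot M m.isOpen) (elPot' M m.isOpen)
      (real D (1 / 2)) (elKap M) (elLam M) (elLamInv M) δ :=
  ⟨comm, hc _, hc _, hc _, hc _, hV⟩

/-- Directional derivatives kill the couplings, commute with spatial derivatives and obey the chain
rule for the potential, so all identities for abstract variations apply to them. -/
theorem variation_along (M : Couplings) (m : MetricDom D)
    {v : A × (Pt → ExtVal) → A × (Pt → ExtVal)} (hv : Sm D v) :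
    Variation (partialDeriv m.isOpen) (elPhi m.isOpen) (elPot M m.isOpen) (elPot' M m.isOpen)
      (real D (1 / 2)) (elKap M) (elLam M) (elLamInv M) (along m.isOpen hv) :=
  m.variation M (along_comm m.isOpen hv) (along_real m.isOpen hv) (ext_eval fun x => by
    rw [elPot, eval_along, map_mul, elPhi, eval_along]
    exact dd_comp_real isOpen_univ M.pot_smooth.contDiffOn m.isOpen (reg_phi m.isOpen).sm
      (fun _ _ _ => mem_univ _) x.2 (hv.mem_pts m.isOpen x.2))

theorem variation_partial (M : Couplings) (m : MetricDom D) (c : Fin 3) :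
    Variation (partialDeriv m.isOpen) (elPhi m.isOpen) (elPot M m.isOpen) (elPot' M m.isOpen)
      (real D (1 / 2)) (elKap M) (elLam M) (elLamInv M) (partialDeriv m.isOpen c) :=
  m.variation M (partialDeriv_comm m.isOpen c) (partialDeriv_real m.isOpen c) (ext_eval fun x => by
    rw [eval_partialDeriv, map_mul, eval_partialDeriv]
    funext y
    have hφ : eval x (elPhi m.isOpen) ∈ (pts : Set (Pt → ℝ)) := eval_mem_pts m.isOpen _ x
    have h1 : DifferentiableAt ℝ (eval x (elPhi m.isOpen)) y :=
      (contDiff_of_mem_pts hφ).differentiable (by simp) y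
    have h2 : HasDerivAt M.pot (deriv M.pot (eval x (elPhi m.isOpen) y))
        (eval x (elPhi m.isOpen) y) :=
      (M.pot_smooth.differentiable (by simp) _).hasDerivAt
    have h3 := (h2.comp_hasFDerivAt y h1.hasFDerivAt).fderiv
    change fderiv ℝ (M.pot ∘ eval x (elPhi m.isOpen)) y _ = _
    rw [h3]
    rfl)

end MetricDom

end Constraints

end

section

/-! ### Fields of the extended phase space in components -/

section Components

variable {X : Type} [AddCommGroup X] [Module ℝ X] [DVS X] {D : Set X}

theorem Sm.tensor {Φ : X → Pt → Fin 3 → Fin 3 → ℝ} (h : ∀ a b, Sm D fun x y => Φ x y a b)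
    (hs : ∀ x ∈ D, ∀ y a b, Φ x y a b = Φ x y b a) : Sm D Φ where
  map {E} _ _ _ O p hO hp hm := by
    refine ⟨contDiffOn_pi.2 fun a => contDiffOn_pi.2 fun b => ((h a b).map hO hp hm).1,
      fun e he y => ⟨fun i => ?_, fun a b => hs _ (hm e he) y a b⟩⟩
    funext a b
    exact ((((h a b).map hO hp hm).2 e he) y).1 i

theorem Sm.four {Φ : X → Pt → Fin 4 → ℝ} (h : ∀ μ, Sm D fun x y => Φ x y μ) : Sm D Φ where
  map {E} _ _ _ O p hO hp hm := by
    refine ⟨contDiffOn_pi.2 fun μ => ((h μ).map hO hp hm).1, fun e he y => ⟨fun i => ?_, trivial⟩⟩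
    funext μ
    exact ((((h μ).map hO hp hm).2 e he) y).1 i

theorem Sm.joint' {V W : Type} [NormedAddCommGroup V] [NormedSpace ℝ V] [FVal V]
    [NormedAddCommGroup W] [NormedSpace ℝ W] [FVal W] {Φ : X → Pt → V} {Ψ : X → Pt → W}
    (hΦ : Sm D Φ) (hΨ : Sm D Ψ) : Sm D fun x y => (Φ x y, Ψ x y) :=
  Sm.joint.comp (D' := univ) (hΦ.prodMk hΨ) fun _ _ => mem_univ _

/-- A field of the extended phase space with given components. -/
def extOf (Q P : Fin 3 → Fin 3 → Pt → ℝ) (f p : Pt → ℝ) (n l : Fin 4 → Pt → ℝ) : Pt → ExtVal :=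
  fun y => ((fun a b => Q a b y, fun a b => P a b y, f y, p y), fun μ => n μ y, fun μ => l μ y)

theorem Sm.extOf {Q P : Fin 3 → Fin 3 → X → Pt → ℝ} {f p : X → Pt → ℝ} {n l : Fin 4 → X → Pt → ℝ}
    (hQ : ∀ a b, Sm D (Q a b)) (hQ' : ∀ x ∈ D, ∀ a b, Q a b x = Q b a x)
    (hP : ∀ a b, Sm D (P a b)) (hP' : ∀ x ∈ D, ∀ a b, P a b x = P b a x)
    (hf : Sm D f) (hp : Sm D p) (hn : ∀ μ, Sm D (n μ)) (hl : ∀ μ, Sm D (l μ)) :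
    Sm D fun x => extOf (fun a b => Q a b x) (fun a b => P a b x) (f x) (p x) (fun μ => n μ x)
      (fun μ => l μ x) :=
  ((Sm.tensor (Φ := fun x y a b => Q a b x y) hQ fun x hx y a b => congrFun (hQ' x hx a b) y).joint'
    ((Sm.tensor (Φ := fun x y a b => P a b x y) hP fun x hx y a b =>
      congrFun (hP' x hx a b) y).joint' (hf.joint' hp))).joint'
    ((Sm.four (Φ := fun x y μ => n μ x y) hn).joint' (Sm.four (Φ := fun x y μ => l μ x y) hl))

theorem extOf_mem_pts {Q P : Fin 3 → Fin 3 → Pt → ℝ} {f p : Pt → ℝ} {n l : Fin 4 → Pt → ℝ}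
    (hQ : ∀ a b, Q a b ∈ (pts : Set (Pt → ℝ))) (hQ' : ∀ a b, Q a b = Q b a)
    (hP : ∀ a b, P a b ∈ (pts : Set (Pt → ℝ))) (hP' : ∀ a b, P a b = P b a)
    (hf : f ∈ (pts : Set (Pt → ℝ))) (hp : p ∈ (pts : Set (Pt → ℝ)))
    (hn : ∀ μ, n μ ∈ (pts : Set (Pt → ℝ))) (hl : ∀ μ, l μ ∈ (pts : Set (Pt → ℝ))) :
    extOf Q P f p n l ∈ (pts : Set (Pt → ExtVal)) :=
  (Sm.extOf (X := ℝ) (D := univ) (Q := fun a b _ => Q a b) (P := fun a b _ => P a b)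
    (f := fun _ => f) (p := fun _ => p) (n := fun μ _ => n μ) (l := fun μ _ => l μ)
    (fun a b => Sm.const (hQ a b)) (fun _ _ => hQ') (fun a b => Sm.const (hP a b)) (fun _ _ => hP')
    (Sm.const hf) (Sm.const hp) (fun μ => Sm.const (hn μ)) fun μ => Sm.const (hl μ)).mem_pts
    (POpen.real isOpen_univ) (mem_univ 0)

theorem lin_mem_pts {V W : Type} [NormedAddCommGroup V] [NormedSpace ℝ V] [FVal V]
    [NormedAddCommGroup W] [NormedSpace ℝ W] [FVal W] (L : V →L[ℝ] W)
    (hL : ∀ v ∈ (sym : Submodule ℝ V), L v ∈ (sym : Submodule ℝ W)) {u : Pt → V}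
    (hu : u ∈ (pts : Set (Pt → V))) : (fun y => L (u y)) ∈ (pts : Set (Pt → W)) :=
  (Sm.pointwise_lin (D := pts) L hL).mem_pts POpen.pts hu

theorem dd_pointwise_lin {V W : Type} [NormedAddCommGroup V] [NormedSpace ℝ V] [FVal V]
    [NormedAddCommGroup W] [NormedSpace ℝ W] [FVal W] (L : V →L[ℝ] W)
    (hL : ∀ v ∈ (sym : Submodule ℝ V), L v ∈ (sym : Submodule ℝ W)) (hD : POpen D)
    {Φ : X → Pt → V} (hΦ : Sm D Φ) {x v : X} (hx : x ∈ D) (hv : v ∈ (pts : Set X)) (y : Pt) :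
    L (dd Φ x v y) = dd (fun x y => L (Φ x y)) x v y :=
  (congrFun (dd_lin_comp (L := fun (u : Pt → V) y => L (u y)) (isLin_pointwise L)
    (Sm.pointwise_lin L hL) hΦ hD hx hv) y).symm

/-- The `μ`-th component of the first half. -/
def fstProj (μ : Fin 4) : Eight →L[ℝ] ℝ :=
  (ContinuousLinearMap.proj (R := ℝ) (φ := fun _ : Fin 4 => ℝ) μ).comp
    (ContinuousLinearMap.fst ℝ Four Four)

/-- The `μ`-th component of the second half. -/
def sndProj (μ : Fin 4) : Eight →L[ℝ] ℝ :=
  (ContinuousLinearMap.proj (R := ℝ) (φ := fun _ : Fin 4 => ℝ) μ).comp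
    (ContinuousLinearMap.snd ℝ Four Four)

theorem fst_mem_pts {σ : Pt → Eight} (hσ : σ ∈ (pts : Set (Pt → Eight))) (μ : Fin 4) :
    (fun y => (σ y).1 μ) ∈ (pts : Set (Pt → ℝ)) := lin_mem_pts (fstProj μ) (fun _ _ => trivial) hσ

theorem snd_mem_pts {σ : Pt → Eight} (hσ : σ ∈ (pts : Set (Pt → Eight))) (μ : Fin 4) :
    (fun y => (σ y).2 μ) ∈ (pts : Set (Pt → ℝ)) := lin_mem_pts (sndProj μ) (fun _ _ => trivial) hσ

theorem dot_eight (v w : Eight) : dot v w = ∑ μ, v.1 μ * w.1 μ + ∑ μ, v.2 μ * w.2 μ := rfl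

theorem dot_extVal (v w : ExtVal) : dot v w = (∑ a, ∑ b, v.1.1 a b * w.1.1 a b +
    (∑ a, ∑ b, v.1.2.1 a b * w.1.2.1 a b + (v.1.2.2.1 * w.1.2.2.1 + v.1.2.2.2 * w.1.2.2.2))) +
    (∑ μ, v.2.1 μ * w.2.1 μ + ∑ μ, v.2.2 μ * w.2.2 μ) := rfl

/-- The Poisson tensor. -/
def poissonTensor (M : Couplings) : ExtVal →L[ℝ] ExtVal :=
  LinearMap.toContinuousLinearMap
    { toFun := fun γ => ((M.κ • γ.1.2.1, -(M.κ • γ.1.1), γ.1.2.2.2, -γ.1.2.2.1), γ.2.2, -γ.2.1)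
      map_add' := fun u v => by
        simp only [Prod.fst_add, Prod.snd_add, smul_add, neg_add, Prod.mk_add_mk]
      map_smul' := fun a u => by
        simp only [Prod.smul_fst, Prod.smul_snd, smul_comm M.κ a, Prod.smul_mk, smul_neg,
          RingHom.id_apply] }

theorem poissonTensor_apply (M : Couplings) (γ : ExtVal) : poissonTensor M γ =
    ((M.κ • γ.1.2.1, -(M.κ • γ.1.1), γ.1.2.2.2, -γ.1.2.2.1), γ.2.2, -γ.2.1) := rfl

theorem poissonTensor_sym (M : Couplings) (v : ExtVal) (hv : v ∈ (sym : Submodule ℝ ExtVal)) :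
    poissonTensor M v ∈ (sym : Submodule ℝ ExtVal) :=
  ⟨⟨Submodule.smul_mem _ _ hv.1.2.1, Submodule.neg_mem _ (Submodule.smul_mem _ _ hv.1.1), trivial,
    trivial⟩, trivial, trivial⟩

/-- The Poisson tensor acting on fields. -/
def omega (M : Couplings) (u : Pt → ExtVal) : Pt → ExtVal := fun y => poissonTensor M (u y)

theorem omega_isLin (M : Couplings) : IsLin (omega M) := isLin_pointwise (poissonTensor M)

theorem omega_sm (M : Couplings) : Sm (pts : Set (Pt → ExtVal)) (omega M) :=
  Sm.pointwise_lin (poissonTensor M) (poissonTensor_sym M)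

theorem omega_antisymm (M : Couplings) (u v : Pt → ExtVal) : ip u (omega M v) = -ip (omega M u) v := by
  simp only [ip]
  rw [← integral_neg]
  refine integral_congr_ae (Filter.Eventually.of_forall fun y => ?_)
  simp only [omega, poissonTensor_apply, dot_extVal, Pi.smul_apply, Pi.neg_apply, smul_eq_mul]
  simp only [Fin.sum_univ_three, Fin.sum_univ_four]
  ring

end Components

section FieldRing

variable {X : Type} [AddCommGroup X] [Module ℝ X] [DVS X] {D : Set X}

/-- This turns ring identities modulo divergences into identities between smeared quantities on the
torus. -/
theorem FieldRing.integral_eq_of_div (hD : POpen D) (J : Fin 3 → FieldRing D) (x : D)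
    {f g : Pt → ℝ} (hg : IntegrableOn g cell)
    (h : ∀ y, f y = g y + eval x (∑ c, partialDeriv hD c (J c)) y) :
    ∫ y in cell, f y = ∫ y in cell, g y := by
  simp only [h]
  rw [integral_add hg, integral_div, add_zero]
  exact ((contDiff_of_mem_pts (eval_mem_pts hD _ x)).continuous.continuousOn).integrableOn_compact
    isCompact_cell

theorem dd_coord {A : Type} [AddCommGroup A] [Module ℝ A] [DVS A] {V : Type} [NormedAddCommGroup V]
    [NormedSpace ℝ V] [FVal V] (L : V →ₗ[ℝ] ℝ) (x : A × (Pt → V)) (a : A) (w : Pt → V) :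
    dd (fun (x : A × (Pt → V)) y => L (x.2 y)) x (a, w) = fun y => L (w y) := by
  funext y
  change deriv (fun s : ℝ => L ((x + s • (a, w)).2 y)) 0 = _
  simp

end FieldRing

end

section

/-! ### Symmetry of Lie derivatives of tensors -/

section DiffRing

variable {R : Type} [CommRing R] {d : Fin 3 → Derivation ℤ R R} {N : Fin 3 → R}
  {q P : Fin 3 → Fin 3 → R}

theorem DiffMetric.lieMetric_symm (hq : ∀ a b, q a b = q b a) (a b : Fin 3) :
    lieMetric d N q a b = lieMetric d N q b a := by
  refine Finset.sum_congr rfl fun e _ => ?_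
  rw [hq a b, hq e b, hq a e]
  ring

theorem DiffMetric.lieMom_symm (hP : ∀ a b, P a b = P b a) (a b : Fin 3) :
    lieMom d N P a b = lieMom d N P b a := by
  refine Finset.sum_congr rfl fun e _ => ?_
  rw [hP a b, hP e b, hP a e]
  ring

end DiffRing

/-! ### The flows of the constraints and the algebra of the constraints -/

section Flows

variable {A : Type} [AddCommGroup A] [Module ℝ A] [DVS A] {D : Set (A × (Pt → ExtVal))}

open FieldRing

/-- The constraints as a map of parameters and of fields. -/
def conMap (M : Couplings) (x : A × (Pt → ExtVal)) : Pt → Eight := constraints M x.2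

namespace MetricDom

variable {v : A × (Pt → ExtVal) → A × (Pt → ExtVal)}

theorem conMap_sm (M : Couplings) (m : MetricDom D) : Sm D (conMap M) := (m.reg_constraints M).sm

theorem dd_conMap_ham (M : Couplings) (m : MetricDom D) (hv : Sm D v) (x : D) (y : Pt) :
    (dd (conMap M) x (v x) y).1 0 = eval x (along m.isOpen hv (m.elHam M)) y := by
  have h1 := dd_pointwise_lin (fstProj 0) (fun _ _ => trivial) m.isOpen (m.conMap_sm M) x.2
    (hv.mem_pts m.isOpen x.2) y
  refine h1.trans (congrFun ?_ y)
  exact dd_congr (rep_sm (m.elHam M)) m.isOpen (fun z hz => by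
    rw [rep_apply _ ⟨z, hz⟩, m.eval_ham]; rfl) x.2 (hv.mem_pts m.isOpen x.2)

theorem dd_conMap_mom (M : Couplings) (m : MetricDom D) (hv : Sm D v) (x : D) (y : Pt) (a : Fin 3) :
    (dd (conMap M) x (v x) y).1 a.succ = eval x (along m.isOpen hv (m.elMom M a)) y := by
  have h1 := dd_pointwise_lin (fstProj a.succ) (fun _ _ => trivial) m.isOpen (m.conMap_sm M) x.2
    (hv.mem_pts m.isOpen x.2) y
  refine h1.trans (congrFun ?_ y)
  exact dd_congr (rep_sm (m.elMom M a)) m.isOpen (fun z hz => by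
    rw [rep_apply _ ⟨z, hz⟩, m.eval_mom]; rfl) x.2 (hv.mem_pts m.isOpen x.2)

theorem dd_conMap_snd (M : Couplings) (m : MetricDom D) {x w : A × (Pt → ExtVal)} (hx : x ∈ D)
    (hw : w ∈ (pts : Set (A × (Pt → ExtVal)))) (y : Pt) :
    (dd (conMap M) x w y).2 = (w.2 y).2.2 := by
  funext μ
  have h1 := dd_pointwise_lin (sndProj μ) (fun _ _ => trivial) m.isOpen (m.conMap_sm M) hx hw y
  refine h1.trans ?_
  exact congrFun (dd_coord ((LinearMap.proj μ).comp ((LinearMap.snd ℝ Four Four).comp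
    (LinearMap.snd ℝ RedVal (Four × Four)))) x w.1 w.2) y

theorem along_q (hD : POpen D) {Q : Fin 3 → Fin 3 → FieldRing D} (hv : Sm D v) (a b : Fin 3)
    (h : ∀ (x : D) y, ((v x).2 y).1.1 a b = eval x (Q a b) y) :
    along hD hv (elQ hD a b) = Q a b := ext_eval fun x => by
  rw [elQ, eval_along]
  refine (dd_coord ((LinearMap.proj b).comp ((LinearMap.proj a).comp ((LinearMap.fst ℝ Tens
    (Tens × ℝ × ℝ)).comp (LinearMap.fst ℝ RedVal (Four × Four))))) x.1 (v x).1 (v x).2).trans ?_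
  exact funext fun y => h x y

theorem along_P (hD : POpen D) {Q : Fin 3 → Fin 3 → FieldRing D} (hv : Sm D v) (a b : Fin 3)
    (h : ∀ (x : D) y, ((v x).2 y).1.2.1 a b = eval x (Q a b) y) :
    along hD hv (elP hD a b) = Q a b := ext_eval fun x => by
  rw [elP, eval_along]
  refine (dd_coord ((LinearMap.proj b).comp ((LinearMap.proj a).comp ((LinearMap.fst ℝ Tens
    (ℝ × ℝ)).comp ((LinearMap.snd ℝ Tens (Tens × ℝ × ℝ)).comp
    (LinearMap.fst ℝ RedVal (Four × Four)))))) x.1 (v x).1 (v x).2).trans ?_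
  exact funext fun y => h x y

theorem along_phi (hD : POpen D) {Q : FieldRing D} (hv : Sm D v)
    (h : ∀ (x : D) y, ((v x).2 y).1.2.2.1 = eval x Q y) :
    along hD hv (elPhi hD) = Q := ext_eval fun x => by
  rw [elPhi, eval_along]
  refine (dd_coord ((LinearMap.fst ℝ ℝ ℝ).comp ((LinearMap.snd ℝ Tens (ℝ × ℝ)).comp
    ((LinearMap.snd ℝ Tens (Tens × ℝ × ℝ)).comp
    (LinearMap.fst ℝ RedVal (Four × Four))))) x.1 (v x).1 (v x).2).trans ?_
  exact funext fun y => h x y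

theorem along_pi (hD : POpen D) {Q : FieldRing D} (hv : Sm D v)
    (h : ∀ (x : D) y, ((v x).2 y).1.2.2.2 = eval x Q y) :
    along hD hv (elPi hD) = Q := ext_eval fun x => by
  rw [elPi, eval_along]
  refine (dd_coord ((LinearMap.snd ℝ ℝ ℝ).comp ((LinearMap.snd ℝ Tens (ℝ × ℝ)).comp
    ((LinearMap.snd ℝ Tens (Tens × ℝ × ℝ)).comp
    (LinearMap.fst ℝ RedVal (Four × Four))))) x.1 (v x).1 (v x).2).trans ?_
  exact funext fun y => h x y

/-- The components of a smearing field as constant elements of the ring. -/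
def elSmear (D : Set (A × (Pt → ExtVal))) {σ : Pt → Eight} (hσ : σ ∈ (pts : Set (Pt → Eight)))
    (μ : Fin 4) : FieldRing D := field D _ (fst_mem_pts hσ μ)

/-- The Lie derivative of the metric along the shift of a smearing field. -/
def elLieQ (m : MetricDom D) {σ : Pt → Eight} (hσ : σ ∈ (pts : Set (Pt → Eight))) (a b : Fin 3) :
    FieldRing D :=
  DiffMetric.lieMetric (partialDeriv m.isOpen) (fun e => elSmear D hσ e.succ) (elQ m.isOpen) a b

/-- The Lie derivative of the momentum of the metric along the shift of a smearing field. -/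
def elLieP (m : MetricDom D) {σ : Pt → Eight} (hσ : σ ∈ (pts : Set (Pt → Eight))) (a b : Fin 3) :
    FieldRing D :=
  DiffMetric.lieMom (partialDeriv m.isOpen) (fun e => elSmear D hσ e.succ) (elP m.isOpen) a b

/-- The Lie derivative of the scalar field along the shift of a smearing field. -/
def elLiePhi (m : MetricDom D) {σ : Pt → Eight} (hσ : σ ∈ (pts : Set (Pt → Eight))) :
    FieldRing D := ∑ e : Fin 3, elSmear D hσ e.succ * partialDeriv m.isOpen e (elPhi m.isOpen)

/-- The Lie derivative of the momentum of the scalar field along the shift of a smearing field. -/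
def elLiePi (m : MetricDom D) {σ : Pt → Eight} (hσ : σ ∈ (pts : Set (Pt → Eight))) :
    FieldRing D := ∑ e : Fin 3, partialDeriv m.isOpen e (elSmear D hσ e.succ * elPi m.isOpen)

theorem lieQ_symm (m : MetricDom D) {σ : Pt → Eight} (hσ : σ ∈ (pts : Set (Pt → Eight)))
    (a b : Fin 3) : m.elLieQ hσ a b = m.elLieQ hσ b a :=
  DiffMetric.lieMetric_symm (q_symm m.isOpen) a b

theorem lieP_symm (m : MetricDom D) {σ : Pt → Eight} (hσ : σ ∈ (pts : Set (Pt → Eight)))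
    (a b : Fin 3) : m.elLieP hσ a b = m.elLieP hσ b a :=
  DiffMetric.lieMom_symm (P_symm m.isOpen) a b

/-- The Lie derivative of the phase space variables along a shift. -/
def lieFlow (m : MetricDom D) {σ : Pt → Eight} (hσ : σ ∈ (pts : Set (Pt → Eight)))
    (x : A × (Pt → ExtVal)) : Pt → ExtVal :=
  extOf (fun a b => rep (m.elLieQ hσ a b) x) (fun a b => rep (m.elLieP hσ a b) x)
    (rep (m.elLiePhi hσ) x) (rep (m.elLiePi hσ) x) (fun μ y => (σ y).2 μ) (fun _ _ => 0)

theorem lieFlow_sm (m : MetricDom D) {σ : Pt → Eight} (hσ : σ ∈ (pts : Set (Pt → Eight))) :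
    Sm D (m.lieFlow hσ) :=
  Sm.extOf (fun a b => rep_sm _) (fun x _ a b => by rw [m.lieQ_symm]) (fun a b => rep_sm _)
    (fun x _ a b => by rw [m.lieP_symm]) (rep_sm _) (rep_sm _)
    (fun μ => Sm.const (snd_mem_pts hσ μ)) fun _ => Sm.const (const_mem_pts 0)

theorem eval_along_q (hD : POpen D) {w : Pt → ExtVal}
    (hv : Sm D fun _ : A × (Pt → ExtVal) => ((0 : A), w)) (x : D) (y : Pt) (a b : Fin 3) :
    eval x (along hD hv (elQ hD a b)) y = (w y).1.1 a b := by
  rw [elQ, eval_along]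
  exact congrFun (dd_coord ((LinearMap.proj b).comp ((LinearMap.proj a).comp ((LinearMap.fst ℝ Tens
    (Tens × ℝ × ℝ)).comp (LinearMap.fst ℝ RedVal (Four × Four))))) x.1 0 w) y

theorem eval_along_P (hD : POpen D) {w : Pt → ExtVal}
    (hv : Sm D fun _ : A × (Pt → ExtVal) => ((0 : A), w)) (x : D) (y : Pt) (a b : Fin 3) :
    eval x (along hD hv (elP hD a b)) y = (w y).1.2.1 a b := by
  rw [elP, eval_along]
  exact congrFun (dd_coord ((LinearMap.proj b).comp ((LinearMap.proj a).comp ((LinearMap.fst ℝ Tens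
    (ℝ × ℝ)).comp ((LinearMap.snd ℝ Tens (Tens × ℝ × ℝ)).comp
    (LinearMap.fst ℝ RedVal (Four × Four)))))) x.1 0 w) y

theorem eval_along_phi (hD : POpen D) {w : Pt → ExtVal}
    (hv : Sm D fun _ : A × (Pt → ExtVal) => ((0 : A), w)) (x : D) (y : Pt) :
    eval x (along hD hv (elPhi hD)) y = (w y).1.2.2.1 := by
  rw [elPhi, eval_along]
  exact congrFun (dd_coord ((LinearMap.fst ℝ ℝ ℝ).comp ((LinearMap.snd ℝ Tens (ℝ × ℝ)).comp
    ((LinearMap.snd ℝ Tens (Tens × ℝ × ℝ)).comp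
    (LinearMap.fst ℝ RedVal (Four × Four))))) x.1 0 w) y

theorem eval_along_pi (hD : POpen D) {w : Pt → ExtVal}
    (hv : Sm D fun _ : A × (Pt → ExtVal) => ((0 : A), w)) (x : D) (y : Pt) :
    eval x (along hD hv (elPi hD)) y = (w y).1.2.2.2 := by
  rw [elPi, eval_along]
  exact congrFun (dd_coord ((LinearMap.snd ℝ ℝ ℝ).comp ((LinearMap.snd ℝ Tens (ℝ × ℝ)).comp
    ((LinearMap.snd ℝ Tens (Tens × ℝ × ℝ)).comp
    (LinearMap.fst ℝ RedVal (Four × Four))))) x.1 0 w) y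

/-- The ring identity is applied to differentiation in a fixed direction `w` and with smearing
constant over the phase space, then evaluated at one point. -/
theorem mom_variation_eval (M : Couplings) (m : MetricDom D) {σ : Pt → Eight}
    (hσ : σ ∈ (pts : Set (Pt → Eight))) {w : Pt → ExtVal}
    (hw : w ∈ (pts : Set (Pt → ExtVal))) (x : D) :
    ∃ J : Fin 3 → FieldRing D, ∀ y,
      ∑ a : Fin 3, (σ y).1 a.succ * (dd (conMap M) x.1 ((0 : A), w) y).1 a.succ =
      1 / M.κ * (∑ a, ∑ b, ((w y).1.2.1 a b * eval x (m.elLieQ hσ a b) y -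
        (w y).1.1 a b * eval x (m.elLieP hσ a b) y)) + (w y).1.2.2.2 * eval x (m.elLiePhi hσ) y -
        (w y).1.2.2.1 * eval x (m.elLiePi hσ) y + eval x (∑ c, partialDeriv m.isOpen c (J c)) y := by
  have hD := m.isOpen
  have hv : Sm D fun _ : A × (Pt → ExtVal) => ((0 : A), w) := Sm.const (zero_prod_mem_pts hw)
  obtain ⟨J, hJ⟩ := m.diffMetric.mom_variation (P := elP hD) (φ := elPhi hD) (π := elPi hD)
    (P_symm hD) (along_comm hD hv) (along_real hD hv (1 / M.κ)) (fun c => partialDeriv_real hD c _)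
    (N := fun e => elSmear D hσ e.succ) (fun a => along_field hD hv _)
  refine ⟨J, fun y => ?_⟩
  have h1 : ∑ a : Fin 3, elSmear D hσ a.succ * along hD hv (m.elMom M a) =
      elKap M * (∑ a, ∑ b, (along hD hv (elP hD a b) * m.elLieQ hσ a b -
        along hD hv (elQ hD a b) * m.elLieP hσ a b)) + along hD hv (elPi hD) * m.elLiePhi hσ -
      along hD hv (elPhi hD) * m.elLiePi hσ + ∑ c, partialDeriv hD c (J c) := hJ
  have h2 := congrFun (congrArg (eval x) h1) y
  rw [map_add, map_sub, map_add, map_sum, Pi.add_apply, Pi.sub_apply, Pi.add_apply,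
    Finset.sum_apply, map_mul, map_mul, map_mul, map_sum, Pi.mul_apply, Pi.mul_apply, Pi.mul_apply,
    Finset.sum_apply, eval_along_phi, eval_along_pi] at h2
  have e1 : ∀ a : Fin 3, eval x (elSmear D hσ a.succ * along hD hv (m.elMom M a)) y =
      (σ y).1 a.succ * (dd (conMap M) x.1 ((0 : A), w) y).1 a.succ := fun a => by
    rw [map_mul, Pi.mul_apply, ← m.dd_conMap_mom M hv]
    rfl
  have e2 : ∀ a : Fin 3, eval x (∑ b, (along hD hv (elP hD a b) * m.elLieQ hσ a b -
      along hD hv (elQ hD a b) * m.elLieP hσ a b)) y =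
      ∑ b, ((w y).1.2.1 a b * eval x (m.elLieQ hσ a b) y -
        (w y).1.1 a b * eval x (m.elLieP hσ a b) y) := fun a => by
    rw [map_sum, Finset.sum_apply]
    refine Finset.sum_congr rfl fun b _ => ?_
    rw [map_sub, map_mul, map_mul, Pi.sub_apply, Pi.mul_apply, Pi.mul_apply, eval_along_q,
      eval_along_P]
  simp only [e1, e2] at h2
  exact h2

/-- The functional derivative of the diffeomorphism and of the primary constraints. -/
def lieGrad (M : Couplings) (m : MetricDom D) {σ : Pt → Eight} (hσ : σ ∈ (pts : Set (Pt → Eight)))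
    (x : D) : Pt → ExtVal :=
  extOf (fun a b => -((1 / M.κ) • eval x (m.elLieP hσ a b)))
    (fun a b => (1 / M.κ) • eval x (m.elLieQ hσ a b))
    (-eval x (m.elLiePi hσ)) (eval x (m.elLiePhi hσ)) (fun _ _ => 0) (fun μ y => (σ y).2 μ)

theorem lieGrad_mem_pts (M : Couplings) (m : MetricDom D) {σ : Pt → Eight}
    (hσ : σ ∈ (pts : Set (Pt → Eight))) (x : D) : m.lieGrad M hσ x ∈ (pts : Set (Pt → ExtVal)) :=
  extOf_mem_pts (fun a b => neg_mem_pts (smul_mem_pts _ (eval_mem_pts m.isOpen _ x)))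
    (fun a b => by rw [m.lieP_symm]) (fun a b => smul_mem_pts _ (eval_mem_pts m.isOpen _ x))
    (fun a b => by rw [m.lieQ_symm]) (neg_mem_pts (eval_mem_pts m.isOpen _ x))
    (eval_mem_pts m.isOpen _ x) (fun _ => const_mem_pts 0) fun μ => snd_mem_pts hσ μ

theorem dot_lieGrad (M : Couplings) (m : MetricDom D) {σ : Pt → Eight}
    (hσ : σ ∈ (pts : Set (Pt → Eight))) (x : D) (w : ExtVal) (y : Pt) :
    dot w (m.lieGrad M hσ x y) = 1 / M.κ * (∑ a, ∑ b, (w.1.2.1 a b * eval x (m.elLieQ hσ a b) y -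
        w.1.1 a b * eval x (m.elLieP hσ a b) y)) + w.1.2.2.2 * eval x (m.elLiePhi hσ) y -
        w.1.2.2.1 * eval x (m.elLiePi hσ) y + ∑ μ, (σ y).2 μ * w.2.2 μ := by
  rw [dot_extVal, lieGrad]
  generalize (fun a b => eval x (m.elLieQ hσ a b)) = Lq
  simp only [extOf, Pi.neg_apply, Pi.smul_apply, smul_eq_mul]
  generalize eval x (m.elLiePhi hσ) y = Lf
  generalize eval x (m.elLiePi hσ) y = Lp
  simp only [Fin.sum_univ_three, Fin.sum_univ_four]
  ring

/-- For smearings without lapse the functional derivative is needed explicitly, because its flow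
must be recognized as a Lie derivative. It is identified by pairing with all variations, the
divergence in the pointwise identity integrating to zero. -/
theorem adj_vector (M : Couplings) (m : MetricDom D)
    {γ : (A × (Pt → ExtVal)) × (Pt → Eight) → Pt → ExtVal} (hγ : HasAdj D (conMap M) γ)
    {σ : Pt → Eight} (hσ : σ ∈ (pts : Set (Pt → Eight))) (h0 : ∀ y, (σ y).1 0 = 0) (x : D) :
    γ (x.1, σ) = m.lieGrad M hσ x := by
  refine eq_of_ip (hγ.mem_pts m.isOpen x.2 hσ) (m.lieGrad_mem_pts M hσ x) fun w hw => ?_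
  rw [ip_comm, ← hγ.adj x x.2 σ hσ w hw]
  obtain ⟨J, hJ⟩ := m.mom_variation_eval M hσ hw x
  refine integral_eq_of_div m.isOpen J x (integrableOn_dot hw (m.lieGrad_mem_pts M hσ x))
    fun y => ?_
  rw [dot_eight, m.dd_conMap_snd M x.2 (zero_prod_mem_pts hw), Fin.sum_univ_succ, h0, zero_mul,
    zero_add, hJ, dot_lieGrad]
  ring

/-- The Hamiltonian vector field of the diffeomorphism and of the primary constraints. -/
theorem omega_vector (M : Couplings) (m : MetricDom D)
    {γ : (A × (Pt → ExtVal)) × (Pt → Eight) → Pt → ExtVal} (hγ : HasAdj D (conMap M) γ)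
    {σ : Pt → Eight} (hσ : σ ∈ (pts : Set (Pt → Eight))) (h0 : ∀ y, (σ y).1 0 = 0)
    {x : A × (Pt → ExtVal)} (hx : x ∈ D) : omega M (γ (x, σ)) = m.lieFlow hσ x := by
  rw [m.adj_vector M hγ hσ h0 ⟨x, hx⟩]
  funext y
  have hκ : M.κ * (1 / M.κ) = 1 := mul_one_div_cancel M.κ_pos.ne'
  simp only [omega, poissonTensor_apply, lieGrad, lieFlow, rep_apply _ (⟨x, hx⟩ : D), extOf]
  refine Prod.ext (Prod.ext ?_ (Prod.ext ?_ (Prod.ext rfl ?_))) (Prod.ext rfl ?_)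
  · funext a b
    simp only [Pi.smul_apply, smul_eq_mul, ← mul_assoc, hκ, one_mul]
  · funext a b
    simp only [Pi.smul_apply, Pi.neg_apply, smul_eq_mul, mul_neg, neg_neg, ← mul_assoc, hκ, one_mul]
  · simp only [Pi.neg_apply, neg_neg]
  · funext μ
    simp

end MetricDom

end Flows

end

section

/-! ### Smearing fields and the structure functions of the hypersurface deformations -/

section DiffRing

variable {R : Type} [CommRing R] {d : Fin 3 → Derivation ℤ R R}

/-- Integration by parts in the action of a diffeomorphism on the smeared constraints. -/
theorem transport_by_parts (N : Fin 3 → R) (M C : R) (m c : Fin 3 → R) :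
    M * ∑ e, d e (N e * C) + ∑ a, m a * (∑ e, d e (N e * c a) + ∑ e, d a (N e) * c e) =
      -(∑ e, N e * d e M) * C + ∑ a, (∑ b, (m b * d b (N a) - N b * d b (m a))) * c a +
      ∑ e, d e (M * (N e * C) + ∑ a, m a * (N e * c a)) := by
  simp only [Fin.sum_univ_three, Derivation.leibniz, map_add, smul_eq_mul]
  ring

theorem revMom_symm {q P : Fin 3 → Fin 3 → R} (hq : ∀ a b, q a b = q b a)
    (hP : ∀ a b, P a b = P b a) (a b : Fin 3) : revMom q P a b = revMom q P b a := by
  rw [revMom, revMom, hq a b, Finset.sum_comm]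
  congr 2
  refine Finset.sum_congr rfl fun c _ => Finset.sum_congr rfl fun e _ => ?_
  rw [hP e c]
  ring

end DiffRing

section Smearing

/-- An eight-component field with given components. -/
def eightOf (f g : Fin 4 → Pt → ℝ) : Pt → Eight := fun y => (fun μ => f μ y, fun μ => g μ y)

theorem Sm.eightOf {X : Type} [AddCommGroup X] [Module ℝ X] [DVS X] {D : Set X}
    {f g : Fin 4 → X → Pt → ℝ} (hf : ∀ μ, Sm D (f μ)) (hg : ∀ μ, Sm D (g μ)) :
    Sm D fun x => eightOf (fun μ => f μ x) (fun μ => g μ x) :=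
  (Sm.four (Φ := fun x y μ => f μ x y) hf).joint' (Sm.four (Φ := fun x y μ => g μ x y) hg)

theorem eightOf_mem_pts {f g : Fin 4 → Pt → ℝ} (hf : ∀ μ, f μ ∈ (pts : Set (Pt → ℝ)))
    (hg : ∀ μ, g μ ∈ (pts : Set (Pt → ℝ))) : eightOf f g ∈ (pts : Set (Pt → Eight)) :=
  (Sm.eightOf (X := ℝ) (D := univ) (f := fun μ _ => f μ) (g := fun μ _ => g μ)
    (fun μ => Sm.const (hf μ)) fun μ => Sm.const (hg μ)).mem_pts (POpen.real isOpen_univ)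
    (mem_univ 0)

/-- A component of the first half. -/
def comp₁ (σ : Pt → Eight) (μ : Fin 4) : Pt → ℝ := fun y => (σ y).1 μ

theorem comp₁_mem_pts {σ : Pt → Eight} (hσ : σ ∈ (pts : Set (Pt → Eight))) (μ : Fin 4) :
    comp₁ σ μ ∈ (pts : Set (Pt → ℝ)) := fst_mem_pts hσ μ

/-- The lapse part of a smearing field. -/
def lapsePart (σ : Pt → Eight) : Pt → Eight :=
  eightOf (Fin.cons (comp₁ σ 0) fun _ _ => 0) fun _ _ => 0

/-- The shift part of a smearing field, with the part that smears the primary constraints. -/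
def shiftPart (σ : Pt → Eight) : Pt → Eight :=
  eightOf (Fin.cons (fun _ => 0) fun a => comp₁ σ a.succ) fun μ y => (σ y).2 μ

theorem lapsePart_mem_pts {σ : Pt → Eight} (hσ : σ ∈ (pts : Set (Pt → Eight))) :
    lapsePart σ ∈ (pts : Set (Pt → Eight)) :=
  eightOf_mem_pts (fun μ => by
    refine Fin.cases ?_ (fun a => ?_) μ
    · exact fst_mem_pts hσ 0
    · exact const_mem_pts 0) fun _ => const_mem_pts 0

theorem shiftPart_mem_pts {σ : Pt → Eight} (hσ : σ ∈ (pts : Set (Pt → Eight))) :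
    shiftPart σ ∈ (pts : Set (Pt → Eight)) :=
  eightOf_mem_pts (fun μ => by
    refine Fin.cases ?_ (fun a => ?_) μ
    · exact const_mem_pts 0
    · exact fst_mem_pts hσ a.succ) fun μ => snd_mem_pts hσ μ

theorem lapsePart_add_shiftPart (σ : Pt → Eight) : lapsePart σ + shiftPart σ = σ := by
  funext y
  refine Prod.ext (funext fun μ => ?_) (funext fun μ => ?_)
  · refine Fin.cases ?_ (fun a => ?_) μ <;>
      simp [lapsePart, shiftPart, eightOf, comp₁]
  · simp [lapsePart, shiftPart, eightOf]

/-- The structure functions of the hypersurface deformation algebra. -/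
def structFn (h : Fin 3 → Fin 3 → Pt → ℝ) (τ σ : Pt → Eight) : Pt → Eight :=
  eightOf (Fin.cons
    (∑ a : Fin 3, (comp₁ τ a.succ * pd a (comp₁ σ 0) - comp₁ σ a.succ * pd a (comp₁ τ 0)))
    fun a => ∑ b : Fin 3, (comp₁ τ b.succ * pd b (comp₁ σ a.succ) -
        comp₁ σ b.succ * pd b (comp₁ τ a.succ)) +
      ∑ b : Fin 3, h a b * (comp₁ τ 0 * pd b (comp₁ σ 0) - comp₁ σ 0 * pd b (comp₁ τ 0)))
    fun _ _ => 0

theorem pd_zero (i : Fin 3) : pd i (fun _ => 0) = 0 := (isLin_pd i).zero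

/-- Bilinearity and antisymmetry reduce the structure functions to the two cases that are computed
directly: no lapse in the second argument, and lapses only. The bracket of the constraints is
decomposed in the same way. -/
theorem structFn_split (h : Fin 3 → Fin 3 → Pt → ℝ) (τ σ : Pt → Eight) :
    structFn h τ σ = structFn h τ (shiftPart σ) + structFn h (lapsePart τ) (lapsePart σ) -
      structFn h (lapsePart σ) (shiftPart τ) := by
  have l0 : ∀ σ, comp₁ (lapsePart σ) 0 = comp₁ σ 0 := fun σ => rfl
  have l1 : ∀ σ (a : Fin 3), comp₁ (lapsePart σ) a.succ = fun _ => 0 := fun σ a => rfl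
  have s0 : ∀ σ, comp₁ (shiftPart σ) 0 = fun _ => 0 := fun σ => rfl
  have s1 : ∀ σ (a : Fin 3), comp₁ (shiftPart σ) a.succ = comp₁ σ a.succ := fun σ a => rfl
  funext y
  refine Prod.ext (funext fun μ => ?_) (funext fun μ => ?_)
  · refine Fin.cases ?_ (fun a => ?_) μ
    · simp only [structFn, eightOf, Pi.add_apply, Pi.sub_apply, Prod.fst_add, Prod.fst_sub,
        Fin.cons_zero, l0, l1, s0, s1, pd_zero, Pi.mul_apply, Pi.zero_apply,
        Fin.sum_univ_three]
      ring
    · simp only [structFn, eightOf, Pi.add_apply, Pi.sub_apply, Prod.fst_add, Prod.fst_sub,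
        Fin.cons_succ, l0, l1, s0, s1, pd_zero, Pi.mul_apply, Pi.zero_apply,
        Fin.sum_univ_three]
      ring
  · simp [structFn, eightOf]

theorem structFn_mem_pts {h : Fin 3 → Fin 3 → Pt → ℝ} (hh : ∀ a b, h a b ∈ (pts : Set (Pt → ℝ)))
    {τ σ : Pt → Eight} (hτ : τ ∈ (pts : Set (Pt → Eight))) (hσ : σ ∈ (pts : Set (Pt → Eight))) :
    structFn h τ σ ∈ (pts : Set (Pt → Eight)) := by
  have sum_mem : ∀ {f : Fin 3 → Pt → ℝ}, (∀ a, f a ∈ (pts : Set (Pt → ℝ))) →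
      ∑ a, f a ∈ (pts : Set (Pt → ℝ)) := fun {f} hf => by
    rw [Fin.sum_univ_three]
    exact add_mem_pts (add_mem_pts (hf 0) (hf 1)) (hf 2)
  have t := comp₁_mem_pts hτ
  have s := comp₁_mem_pts hσ
  refine eightOf_mem_pts (fun μ => ?_) fun _ => const_mem_pts 0
  refine Fin.cases ?_ (fun a => ?_) μ
  · rw [Fin.cons_zero]
    exact sum_mem fun a => sub_mem_pts (mul_mem_pts (t _) (pd_mem_pts (s _) _))
      (mul_mem_pts (s _) (pd_mem_pts (t _) _))
  · rw [Fin.cons_succ]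
    exact add_mem_pts (sum_mem fun b => sub_mem_pts (mul_mem_pts (t _) (pd_mem_pts (s _) _))
      (mul_mem_pts (s _) (pd_mem_pts (t _) _))) (sum_mem fun b => mul_mem_pts (hh a b)
      (sub_mem_pts (mul_mem_pts (t _) (pd_mem_pts (s _) _))
      (mul_mem_pts (s _) (pd_mem_pts (t _) _))))

theorem ip_structFn (h : Fin 3 → Fin 3 → Pt → ℝ) (τ σ c : Pt → Eight) (y : Pt) :
    dot (structFn h τ σ y) (c y) =
      (∑ a : Fin 3, (comp₁ τ a.succ y * pd a (comp₁ σ 0) y - comp₁ σ a.succ y * pd a (comp₁ τ 0) y)) *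
        (c y).1 0 +
      ∑ a : Fin 3, (∑ b : Fin 3, (comp₁ τ b.succ y * pd b (comp₁ σ a.succ) y -
          comp₁ σ b.succ y * pd b (comp₁ τ a.succ) y) +
        ∑ b : Fin 3, h a b y * (comp₁ τ 0 y * pd b (comp₁ σ 0) y -
          comp₁ σ 0 y * pd b (comp₁ τ 0) y)) * (c y).1 a.succ := by
  rw [dot_eight, Fin.sum_univ_succ]
  simp [structFn, eightOf, Finset.sum_apply]

end Smearing

/-! ### Splitting of the Poisson tensor into one half and its transpose -/

section HalfTensor

/-- The part of the Poisson tensor that maps momenta to velocities. -/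
def halfTensor (M : Couplings) : ExtVal →L[ℝ] ExtVal :=
  LinearMap.toContinuousLinearMap
    { toFun := fun γ => ((M.κ • γ.1.2.1, 0, γ.1.2.2.2, 0), γ.2.2, 0)
      map_add' := fun u v => by
        simp only [Prod.fst_add, Prod.snd_add, smul_add, Prod.mk_add_mk, add_zero]
      map_smul' := fun a u => by
        simp only [Prod.smul_fst, Prod.smul_snd, smul_comm M.κ a, Prod.smul_mk, smul_zero,
          RingHom.id_apply] }

/-- The transpose of `halfTensor`. -/
def halfTensorT (M : Couplings) : ExtVal →L[ℝ] ExtVal :=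
  LinearMap.toContinuousLinearMap
    { toFun := fun γ => ((0, M.κ • γ.1.1, 0, γ.1.2.2.1), 0, γ.2.1)
      map_add' := fun u v => by
        simp only [Prod.fst_add, Prod.snd_add, smul_add, Prod.mk_add_mk, add_zero]
      map_smul' := fun a u => by
        simp only [Prod.smul_fst, Prod.smul_snd, smul_comm M.κ a, Prod.smul_mk, smul_zero,
          RingHom.id_apply] }

theorem halfTensor_apply (M : Couplings) (γ : ExtVal) :
    halfTensor M γ = ((M.κ • γ.1.2.1, 0, γ.1.2.2.2, 0), γ.2.2, 0) := rfl

theorem halfTensorT_apply (M : Couplings) (γ : ExtVal) :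
    halfTensorT M γ = ((0, M.κ • γ.1.1, 0, γ.1.2.2.1), 0, γ.2.1) := rfl

theorem halfTensor_sym (M : Couplings) (v : ExtVal) (hv : v ∈ (sym : Submodule ℝ ExtVal)) :
    halfTensor M v ∈ (sym : Submodule ℝ ExtVal) :=
  ⟨⟨Submodule.smul_mem _ _ hv.1.2.1, Submodule.zero_mem _, trivial, trivial⟩, trivial, trivial⟩

theorem halfTensorT_sym (M : Couplings) (v : ExtVal) (hv : v ∈ (sym : Submodule ℝ ExtVal)) :
    halfTensorT M v ∈ (sym : Submodule ℝ ExtVal) :=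
  ⟨⟨Submodule.zero_mem _, Submodule.smul_mem _ _ hv.1.1, trivial, trivial⟩, trivial, trivial⟩

theorem halfTensor_mem_pts (M : Couplings) {u : Pt → ExtVal} (hu : u ∈ (pts : Set (Pt → ExtVal))) :
    (fun y => halfTensor M (u y)) ∈ (pts : Set (Pt → ExtVal)) :=
  lin_mem_pts (halfTensor M) (halfTensor_sym M) hu

theorem halfTensorT_mem_pts (M : Couplings) {u : Pt → ExtVal} (hu : u ∈ (pts : Set (Pt → ExtVal))) :
    (fun y => halfTensorT M (u y)) ∈ (pts : Set (Pt → ExtVal)) :=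
  lin_mem_pts (halfTensorT M) (halfTensorT_sym M) hu

theorem dot_halfTensor (M : Couplings) (u v : ExtVal) :
    dot (halfTensor M u) v = dot u (halfTensorT M v) := by
  simp only [halfTensor_apply, halfTensorT_apply, dot_extVal, Pi.smul_apply, smul_eq_mul,
    Pi.zero_apply, mul_zero, zero_mul, Finset.sum_const_zero, add_zero, zero_add]
  simp only [Fin.sum_univ_three, Fin.sum_univ_four]
  ring

theorem omega_eq (M : Couplings) (u : Pt → ExtVal) :
    omega M u = (fun y => halfTensor M (u y)) - fun y => halfTensorT M (u y) := by
  funext y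
  simp only [omega, poissonTensor_apply, Pi.sub_apply, halfTensor_apply, halfTensorT_apply,
    Prod.mk_sub_mk, sub_zero, zero_sub]

/-- Each term contains only the velocities of one flow. For two Hamiltonian constraints this avoids
the explicit functional derivative with respect to the metric: one varies each constraint along the
velocities generated by the other. -/
theorem ip_omega (M : Couplings) {u v : Pt → ExtVal} (hu : u ∈ (pts : Set (Pt → ExtVal)))
    (hv : v ∈ (pts : Set (Pt → ExtVal))) :
    ip u (omega M v) = ip u (fun y => halfTensor M (v y)) - ip v (fun y => halfTensor M (u y)) := by
  rw [omega_eq, (ip_isLin_right hu).sub (halfTensor_mem_pts M hv) (halfTensorT_mem_pts M hv),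
    ip_comm v]
  congr 1
  simp only [ip, dot_halfTensor]

end HalfTensor

end

section

/-! ### The constraint algebra evaluated on the phase space -/

section Closure

variable {A : Type} [AddCommGroup A] [Module ℝ A] [DVS A] {D : Set (A × (Pt → ExtVal))}

open FieldRing

/-- The inverse metric of a point of the extended phase space. -/
def invField (z : Pt → ExtVal) (a b : Fin 3) : Pt → ℝ :=
  fun y => invMetric (fun y => (z y).1.1) y a b

namespace MetricDom

/-- The velocity of the metric generated by the Hamiltonian constraint. -/
def elVelQ (m : MetricDom D) {σ : Pt → Eight} (hσ : σ ∈ (pts : Set (Pt → Eight))) (a b : Fin 3) :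
    FieldRing D :=
  elSmear D hσ 0 * (m.elVolInv * revMom (elQ m.isOpen) (elP m.isOpen) a b)

/-- The velocity of the scalar field generated by the Hamiltonian constraint. -/
def elVelPhi (M : Couplings) (m : MetricDom D) {σ : Pt → Eight}
    (hσ : σ ∈ (pts : Set (Pt → Eight))) : FieldRing D :=
  elSmear D hσ 0 * (elLam M * m.elVolInv * elPi m.isOpen)

theorem velQ_symm (m : MetricDom D) {σ : Pt → Eight} (hσ : σ ∈ (pts : Set (Pt → Eight)))
    (a b : Fin 3) : m.elVelQ hσ a b = m.elVelQ hσ b a := by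
  rw [elVelQ, elVelQ, revMom_symm (q_symm m.isOpen) (P_symm m.isOpen) a b]

/-- The velocities generated by the Hamiltonian constraint. -/
def velFlow (M : Couplings) (m : MetricDom D) {σ : Pt → Eight}
    (hσ : σ ∈ (pts : Set (Pt → Eight))) (x : A × (Pt → ExtVal)) : Pt → ExtVal :=
  extOf (fun a b => rep (m.elVelQ hσ a b) x) (fun _ _ _ => 0)
    (rep (m.elVelPhi M hσ) x) (fun _ => 0) (fun _ _ => 0) (fun _ _ => 0)

theorem velFlow_sm (M : Couplings) (m : MetricDom D) {σ : Pt → Eight}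
    (hσ : σ ∈ (pts : Set (Pt → Eight))) : Sm D (m.velFlow M hσ) :=
  Sm.extOf (fun a b => rep_sm _) (fun x _ a b => by rw [m.velQ_symm])
    (fun a b => Sm.const (const_mem_pts 0)) (fun _ _ _ _ => rfl) (rep_sm _)
    (Sm.const (const_mem_pts 0)) (fun _ => Sm.const (const_mem_pts 0))
    fun _ => Sm.const (const_mem_pts 0)

/-- Along directions that change only momenta the Hamiltonian constraint varies algebraically, with
the velocities as coefficients; no integration by parts occurs. -/
theorem dd_conMap_lapse (M : Couplings) (m : MetricDom D) {u : Pt → ExtVal}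
    (hu : u ∈ (pts : Set (Pt → ExtVal))) (hq : ∀ y a b, (u y).1.1 a b = 0)
    (hφ : ∀ y, (u y).1.2.2.1 = 0) {σ : Pt → Eight} (hσ : σ ∈ (pts : Set (Pt → Eight))) (x : D)
    (y : Pt) : (σ y).1 0 * (dd (conMap M) x.1 ((0 : A), u) y).1 0 =
      1 / M.κ * (∑ a, ∑ b, eval x (m.elVelQ hσ a b) y * (u y).1.2.1 a b) +
        eval x (m.elVelPhi M hσ) y * (u y).1.2.2.2 := by
  have hD := m.isOpen
  have hv : Sm D fun _ : A × (Pt → ExtVal) => ((0 : A), u) := Sm.const (zero_prod_mem_pts hu)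
  have h1 : along hD hv (m.elHam M) = elKap M * ∑ a, ∑ b, m.elVolInv *
      revMom (elQ hD) (elP hD) a b * along hD hv (elP hD a b) +
      elLam M * m.elVolInv * elPi hD * along hD hv (elPi hD) :=
    m.diffMetric.ham_momentum m.diffVol two_mul_half (m.variation_along M hv)
      (fun a b => ext_eval fun x => funext fun y => (eval_along_q hD hv x y a b).trans (hq y a b))
      (ext_eval fun x => funext fun y => (eval_along_phi hD hv x y).trans (hφ y))
  have h2 := congrFun (congrArg (eval x) h1) y
  rw [map_add, map_mul, map_mul _ (_ * _) (along hD hv _), Pi.add_apply, Pi.mul_apply, Pi.mul_apply,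
    map_sum, Finset.sum_apply, eval_along_pi] at h2
  have e2 : ∀ a : Fin 3, eval x (∑ b, m.elVolInv * revMom (elQ hD) (elP hD) a b *
      along hD hv (elP hD a b)) y = ∑ b, eval x (m.elVolInv * revMom (elQ hD) (elP hD) a b) y *
        (u y).1.2.1 a b := fun a => by
    rw [map_sum, Finset.sum_apply]
    refine Finset.sum_congr rfl fun b _ => ?_
    rw [map_mul _ (_ * _), Pi.mul_apply, eval_along_P]
  have e3 : ∀ a b, eval x (m.elVelQ hσ a b) y =
      (σ y).1 0 * eval x (m.elVolInv * revMom (elQ hD) (elP hD) a b) y := fun a b => by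
    rw [elVelQ, map_mul, Pi.mul_apply]
    rfl
  have e4 : eval x (m.elVelPhi M hσ) y = (σ y).1 0 * eval x (elLam M * m.elVolInv * elPi hD) y := by
    rw [elVelPhi, map_mul, Pi.mul_apply]
    rfl
  have e5 : eval x (elKap M) y = 1 / M.κ := rfl
  have e6 : ∀ (s k p t : ℝ) (F U : Fin 3 → Fin 3 → ℝ), s * (k * ∑ a, ∑ b, F a b * U a b + p * t) =
      k * ∑ a, ∑ b, s * F a b * U a b + s * p * t := fun s k p t F U => by
    simp only [Fin.sum_univ_three]
    ring
  simp only [e2] at h2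
  rw [m.dd_conMap_ham M hv x y, h2, e4, e5]
  simp only [e3]
  exact e6 _ _ _ _ (fun a b => eval x (m.elVolInv * revMom (elQ hD) (elP hD) a b) y) _

/-- Pairing with `u` and transposing the half tensor leaves a variation of the constraint along
momenta alone, and this determines the velocities. -/
theorem half_adj_lapse (M : Couplings) (m : MetricDom D)
    {γ : (A × (Pt → ExtVal)) × (Pt → Eight) → Pt → ExtVal} (hγ : HasAdj D (conMap M) γ)
    {σ : Pt → Eight} (hσ : σ ∈ (pts : Set (Pt → Eight))) (hs : lapsePart σ = σ)
    {x : A × (Pt → ExtVal)} (hx : x ∈ D) :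
    (fun y => halfTensor M (γ (x, σ) y)) = m.velFlow M hσ x := by
  have hg := hγ.mem_pts m.isOpen hx hσ
  refine eq_of_ip (halfTensor_mem_pts M hg) ((m.velFlow_sm M hσ).mem_pts m.isOpen hx)
    fun u hu => ?_
  have hT := halfTensorT_mem_pts M hu
  have h1 : ip u (fun y => halfTensor M (γ (x, σ) y)) =
      ip (γ (x, σ)) fun y => halfTensorT M (u y) := by
    rw [ip_comm]
    simp only [ip, dot_halfTensor]
  rw [h1, ← hγ.adj x hx σ hσ _ hT]
  refine integral_congr_ae (Filter.Eventually.of_forall fun y => ?_)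
  have hκ : M.κ * (1 / M.κ) = 1 := mul_one_div_cancel M.κ_pos.ne'
  have s1 : ∀ a : Fin 3, (σ y).1 a.succ = 0 := fun a => by rw [← hs]; rfl
  have s2 : ∀ μ, (σ y).2 μ = 0 := fun μ => by rw [← hs]; rfl
  have h3 := m.dd_conMap_lapse M hT (fun _ _ _ => rfl) (fun _ => rfl) hσ ⟨x, hx⟩ y
  simp only
  rw [dot_eight, Fin.sum_univ_succ]
  simp only [s1, s2, zero_mul, Finset.sum_const_zero, add_zero]
  refine h3.trans ?_
  simp only [dot_extVal, velFlow, extOf, rep_apply _ (⟨x, hx⟩ : D), halfTensorT_apply, mul_zero,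
    Finset.sum_const_zero, add_zero, zero_add, Pi.smul_apply, smul_eq_mul]
  have e6 : ∀ (p t : ℝ) (F V : Fin 3 → Fin 3 → ℝ), 1 / M.κ * ∑ a, ∑ b, F a b * (M.κ * V a b) +
      p * t = ∑ a, ∑ b, V a b * F a b + t * p := fun p t F V => by
    rw [mul_comm p, Finset.mul_sum]
    congr 1
    refine Finset.sum_congr rfl fun a _ => ?_
    rw [Finset.mul_sum]
    exact Finset.sum_congr rfl fun b _ => by linear_combination F a b * V a b * hκ
  exact e6 _ _ (fun a b => eval ⟨x, hx⟩ (m.elVelQ hσ a b) y) _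

theorem eval_smear {σ : Pt → Eight} (hσ : σ ∈ (pts : Set (Pt → Eight))) (μ : Fin 4) (x : D) :
    eval x (elSmear D hσ μ) = comp₁ σ μ := rfl

theorem conMap_zero (M : Couplings) (m : MetricDom D) (x : D) (y : Pt) :
    (conMap M x.1 y).1 0 = eval x (m.elHam M) y := by
  rw [m.eval_ham]
  rfl

theorem conMap_succ (M : Couplings) (m : MetricDom D) (x : D) (y : Pt) (a : Fin 3) :
    (conMap M x.1 y).1 a.succ = eval x (m.elMom M a) y := by
  rw [m.eval_mom]
  rfl

theorem eval_invField (m : MetricDom D) (x : D) (a b : Fin 3) :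
    invField x.1.2 a b = eval x (m.elInv a b) := (m.eval_inv x a b).symm

theorem reg_invField (m : MetricDom D) (a b : Fin 3) : Reg D fun x => invField x.2 a b :=
  IsReg.of_eval m.isOpen (m.inv_mem a b) fun x => m.eval_inv x a b

/-- The smearings are constant over the phase space, so the derivatives along the two velocity
fields satisfy the hypotheses of the ring identity `DiffMetric.ham_ham`. -/
theorem ham_ham_eval (M : Couplings) (m : MetricDom D) {τ σ : Pt → Eight}
    (hτ : τ ∈ (pts : Set (Pt → Eight))) (hσ : σ ∈ (pts : Set (Pt → Eight))) (x : D) :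
    ∃ J : Fin 3 → FieldRing D, ∀ y,
      (τ y).1 0 * (dd (conMap M) x.1 ((0 : A), m.velFlow M hσ x) y).1 0 -
        (σ y).1 0 * (dd (conMap M) x.1 ((0 : A), m.velFlow M hτ x) y).1 0 =
      ∑ a : Fin 3, (∑ b : Fin 3, invField x.1.2 a b y * (comp₁ τ 0 y * pd b (comp₁ σ 0) y -
        comp₁ σ 0 y * pd b (comp₁ τ 0) y)) * (conMap M x.1 y).1 a.succ +
      eval x (∑ c, partialDeriv m.isOpen c (J c)) y := by
  have hD := m.isOpen
  have sm : ∀ {σ : Pt → Eight} (hσ : σ ∈ (pts : Set (Pt → Eight))),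
      Sm D fun x : A × (Pt → ExtVal) => ((0 : A), m.velFlow M hσ x) := fun hσ =>
    (Sm.const zero_mem_pts).prodMk (m.velFlow_sm M hσ)
  have z : ∀ (x : D) (y : Pt), (0 : ℝ) = eval x (0 : FieldRing D) y := fun x y => by
    rw [map_zero]; rfl
  have aq : ∀ {σ : Pt → Eight} (hσ : σ ∈ (pts : Set (Pt → Eight))) a b,
      along hD (sm hσ) (elQ hD a b) = m.elVelQ hσ a b := fun hσ a b =>
    along_q hD (sm hσ) a b fun x y => congrFun (rep_apply (m.elVelQ hσ a b) x) y
  have aP : ∀ {σ : Pt → Eight} (hσ : σ ∈ (pts : Set (Pt → Eight))) a b,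
      along hD (sm hσ) (elP hD a b) = 0 := fun hσ a b =>
    along_P hD (Q := fun _ _ => 0) (sm hσ) a b fun x y => z x y
  have aφ : ∀ {σ : Pt → Eight} (hσ : σ ∈ (pts : Set (Pt → Eight))),
      along hD (sm hσ) (elPhi hD) = m.elVelPhi M hσ := fun hσ =>
    along_phi hD (sm hσ) fun x y => congrFun (rep_apply (m.elVelPhi M hσ) x) y
  have aπ : ∀ {σ : Pt → Eight} (hσ : σ ∈ (pts : Set (Pt → Eight))),
      along hD (sm hσ) (elPi hD) = 0 := fun hσ => along_pi hD (sm hσ) fun x y => z x y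
  obtain ⟨J, hJ⟩ := m.diffMetric.ham_ham m.diffVol (P_symm hD) two_mul_half (lam_mul_inv M)
    (m.variation_along M (sm hσ)) (m.variation_along M (sm hτ)) (aq hσ) (aq hτ) (aP hσ) (aP hτ)
    (aφ hσ) (aφ hτ) (aπ hσ) (aπ hτ) fun c => partialDeriv_real hD c _
  refine ⟨J, fun y => ?_⟩
  have h1 : elSmear D hτ 0 * along hD (sm hσ) (m.elHam M) -
      elSmear D hσ 0 * along hD (sm hτ) (m.elHam M) =
      ∑ c, ∑ b, (elSmear D hτ 0 * partialDeriv hD c (elSmear D hσ 0) -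
        elSmear D hσ 0 * partialDeriv hD c (elSmear D hτ 0)) * m.elInv c b * m.elMom M b +
      ∑ c, partialDeriv hD c (J c) := hJ
  have h2 := congrFun (congrArg (eval x) h1) y
  rw [map_sub, map_mul, map_mul, Pi.sub_apply, Pi.mul_apply, Pi.mul_apply,
    ← m.dd_conMap_ham M (sm hσ) x y, ← m.dd_conMap_ham M (sm hτ) x y] at h2
  refine h2.trans ?_
  rw [map_add, Pi.add_apply]
  congr 1
  have e1 : ∀ c b : Fin 3, eval x ((elSmear D hτ 0 * partialDeriv hD c (elSmear D hσ 0) -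
        elSmear D hσ 0 * partialDeriv hD c (elSmear D hτ 0)) * m.elInv c b * m.elMom M b) y =
      invField x.1.2 b c y * (comp₁ τ 0 y * pd c (comp₁ σ 0) y -
        comp₁ σ 0 y * pd c (comp₁ τ 0) y) * (conMap M x.1 y).1 b.succ := fun c b => by
    rw [map_mul, map_mul, map_sub, map_mul, map_mul, Pi.mul_apply, Pi.mul_apply, Pi.sub_apply,
      Pi.mul_apply, Pi.mul_apply, eval_partialDeriv, eval_partialDeriv, eval_smear, eval_smear,
      ← m.conMap_succ, m.eval_invField, m.inv_symm b c]
    ring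
  rw [map_sum, Finset.sum_apply]
  simp only [map_sum, Finset.sum_apply, e1]
  rw [Finset.sum_comm]
  simp only [Finset.sum_mul]

/-- The constraints change by Lie derivatives along the flow; one integration by parts moves these
from the constraints to the smearing `τ`. -/
theorem lie_eval (M : Couplings) (m : MetricDom D) {τ σ : Pt → Eight}
    (hτ : τ ∈ (pts : Set (Pt → Eight))) (hσ : σ ∈ (pts : Set (Pt → Eight))) (x : D) :
    ∃ J : Fin 3 → FieldRing D, ∀ y,
      (τ y).1 0 * (dd (conMap M) x.1 ((0 : A), m.lieFlow hσ x) y).1 0 +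
        ∑ a : Fin 3, (τ y).1 a.succ * (dd (conMap M) x.1 ((0 : A), m.lieFlow hσ x) y).1 a.succ =
      -(∑ a : Fin 3, comp₁ σ a.succ y * pd a (comp₁ τ 0) y) * (conMap M x.1 y).1 0 +
      ∑ a : Fin 3, (∑ b : Fin 3, (comp₁ τ b.succ y * pd b (comp₁ σ a.succ) y -
        comp₁ σ b.succ y * pd b (comp₁ τ a.succ) y)) * (conMap M x.1 y).1 a.succ +
      eval x (∑ c, partialDeriv m.isOpen c (J c)) y := by
  have hD := m.isOpen
  have sm : Sm D fun x : A × (Pt → ExtVal) => ((0 : A), m.lieFlow hσ x) :=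
    (Sm.const zero_mem_pts).prodMk (m.lieFlow_sm hσ)
  have aq : ∀ a b, along hD sm (elQ hD a b) = m.elLieQ hσ a b := fun a b =>
    along_q hD sm a b fun x y => congrFun (rep_apply (m.elLieQ hσ a b) x) y
  have aP : ∀ a b, along hD sm (elP hD a b) = m.elLieP hσ a b := fun a b =>
    along_P hD sm a b fun x y => congrFun (rep_apply (m.elLieP hσ a b) x) y
  have aφ : along hD sm (elPhi hD) = m.elLiePhi hσ :=
    along_phi hD sm fun x y => congrFun (rep_apply (m.elLiePhi hσ) x) y
  have aπ : along hD sm (elPi hD) = m.elLiePi hσ :=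
    along_pi hD sm fun x y => congrFun (rep_apply (m.elLiePi hσ) x) y
  obtain ⟨hh, hm⟩ := m.diffMetric.lie_constraints m.diffVol (P_symm hD) (m.variation_along M sm)
    (m.variation_partial M) aq aP aφ aπ
  have hh' : along hD sm (m.elHam M) =
    ∑ e : Fin 3, partialDeriv hD e (elSmear D hσ e.succ * m.elHam M) := hh
  have hm' : ∀ a, along hD sm (m.elMom M a) =
    ∑ e : Fin 3, partialDeriv hD e (elSmear D hσ e.succ * m.elMom M a) +
    ∑ e : Fin 3, partialDeriv hD a (elSmear D hσ e.succ) * m.elMom M e := hm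
  have h1 := transport_by_parts (d := partialDeriv hD) (fun e => elSmear D hσ e.succ)
    (elSmear D hτ 0) (m.elHam M) (fun a => elSmear D hτ a.succ) (m.elMom M)
  rw [← hh'] at h1
  simp only [← hm'] at h1
  refine ⟨fun e => elSmear D hτ 0 * (elSmear D hσ e.succ * m.elHam M) +
    ∑ a : Fin 3, elSmear D hτ a.succ * (elSmear D hσ e.succ * m.elMom M a), fun y => ?_⟩
  have h2 := congrFun (congrArg (eval x) h1) y
  rw [map_add, map_mul, map_sum, Pi.add_apply, Pi.mul_apply, Finset.sum_apply,
    ← m.dd_conMap_ham M sm x y] at h2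
  simp only [map_mul, Pi.mul_apply, ← m.dd_conMap_mom M sm x y] at h2
  refine h2.trans ?_
  rw [map_add, Pi.add_apply]
  refine congrArg₂ _ ?_ ?_
  · simp only [map_add, map_mul, map_neg, map_sum, map_sub, Pi.add_apply, Pi.mul_apply,
      Pi.neg_apply, Finset.sum_apply, Pi.sub_apply, eval_partialDeriv, eval_smear, m.conMap_zero,
      m.conMap_succ]
  · simp only

end MetricDom

end Closure

end

section

/-! ### Regularity of the structure functions and the first class property -/

section Transpose

variable {A : Type} [AddCommGroup A] [Module ℝ A] [DVS A]
  {W W' : Type} [NormedAddCommGroup W] [NormedSpace ℝ W] [FVal W]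
  [NormedAddCommGroup W'] [NormedSpace ℝ W'] [FVal W']

/-- The transpose of a family of linear operators. -/
theorem Reg.transpose {D : Set A} {K : A × (Pt → W) → Pt → W'}
    (h : Reg (D ×ˢ (pts : Set (Pt → W))) K) (hD : POpen D)
    (hK : ∀ x ∈ D, IsLin fun τ => K (x, τ)) :
    ∃ Kt : A × (Pt → W') → Pt → W, Sm (D ×ˢ pts) Kt ∧ ∀ x ∈ D, ∀ τ ∈ (pts : Set (Pt → W)),
      ∀ k ∈ (pts : Set (Pt → W')), ip (K (x, τ)) k = ip τ (Kt (x, k)) := by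
  obtain ⟨Ψ, hΨ⟩ := h
  -- A linear operator is its own derivative, so its functional derivative at the zero field is its
  -- transpose.
  refine ⟨fun y => Ψ ((y.1, 0), y.2), hΨ.adj_sm.comp
    ((Sm.fst.prodMk (Sm.const zero_mem_pts)).prodMk Sm.snd) fun y hy =>
      ⟨⟨hy.1, zero_mem_pts⟩, hy.2⟩, fun x hx τ hτ k hk => ?_⟩
  have h1 := hΨ.adj (x, 0) ⟨hx, zero_mem_pts⟩ k hk τ hτ
  rw [ip_comm, ip_comm τ, ← h1]
  congr 1
  have h2 := dd_of_isLin (hK x hx) (hΨ.sm.comp ((Sm.const (D := pts) (hD.subset hx)).prodMk Sm.id)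
    fun k hk => ⟨hx, hk⟩) zero_mem_pts hτ
  refine h2.symm.trans ?_
  simp only [dd, Prod.smul_mk, Prod.mk_add_mk, smul_zero, add_zero]

end Transpose

section StructureFunctions

theorem Reg.structFn {A : Type} [AddCommGroup A] [Module ℝ A] [DVS A] {V : Type}
    [NormedAddCommGroup V] [NormedSpace ℝ V] [FVal V] {D : Set (A × (Pt → V))} (hD : POpen D)
    {h : A × (Pt → V) → Fin 3 → Fin 3 → Pt → ℝ} (hh : ∀ a b, Reg D fun x => h x a b)
    {τ σ : A × (Pt → V) → Pt → Eight} (hτ : Reg D τ) (hσ : Reg D σ) :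
    Reg D fun x => structFn (h x) (τ x) (σ x) := by
  have t : ∀ μ, Reg D fun x => comp₁ (τ x) μ := (hτ.fst' hD).four_apply hD
  have s : ∀ μ, Reg D fun x => comp₁ (σ x) μ := (hσ.fst' hD).four_apply hD
  have p : ∀ {f g : A × (Pt → V) → Pt → ℝ} (a : Fin 3), Reg D f → Reg D g →
      Reg D fun x => f x * ADM.pd a (g x) := fun a hf hg => hf.mul (hg.pd hD a) hD
  refine Reg.joint (Φ := fun x y => (ADM.structFn (h x) (τ x) (σ x) y).1) (Φ' := fun _ => 0)
    (Reg.four (fun μ => ?_) hD) (Reg.const zero_mem_pts hD) hD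
  refine Fin.cases ?_ (fun a => ?_) μ
  · exact Reg.sum Finset.univ (Φ := fun (a : Fin 3) x => comp₁ (τ x) a.succ * ADM.pd a (comp₁ (σ x) 0) -
      comp₁ (σ x) a.succ * ADM.pd a (comp₁ (τ x) 0))
      (fun a => (p a (t _) (s _)).sub (p a (s _) (t _)) hD) hD
  · exact (Reg.sum Finset.univ (Φ := fun (b : Fin 3) x => comp₁ (τ x) b.succ *
        ADM.pd b (comp₁ (σ x) a.succ) - comp₁ (σ x) b.succ * ADM.pd b (comp₁ (τ x) a.succ))
      (fun b => (p b (t _) (s _)).sub (p b (s _) (t _)) hD) hD).add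
      (Reg.sum Finset.univ (Φ := fun (b : Fin 3) x => h x a b * (comp₁ (τ x) 0 *
        ADM.pd b (comp₁ (σ x) 0) - comp₁ (σ x) 0 * ADM.pd b (comp₁ (τ x) 0)))
      (fun b => (hh a b).mul ((p b (t _) (s _)).sub (p b (s _) (t _)) hD) hD) hD) hD

theorem structFn_isLin (h : Fin 3 → Fin 3 → Pt → ℝ) (σ : Pt → Eight) :
    IsLin fun τ => structFn h τ σ := by
  intro τ hτ τ' hτ' r
  have c : ∀ μ, comp₁ (r • τ + τ') μ = r • comp₁ τ μ + comp₁ τ' μ := fun μ => rfl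
  have d : ∀ (i : Fin 3) μ, pd i (r • comp₁ τ μ + comp₁ τ' μ) =
      r • pd i (comp₁ τ μ) + pd i (comp₁ τ' μ) := fun i μ =>
    isLin_pd i _ (comp₁_mem_pts hτ μ) _ (comp₁_mem_pts hτ' μ) r
  funext y
  refine Prod.ext (funext fun μ => ?_) (funext fun μ => ?_)
  · refine Fin.cases ?_ (fun a => ?_) μ
    · simp only [structFn, eightOf, c, d, Pi.add_apply, Pi.sub_apply, Prod.fst_add, Pi.smul_apply,
        Prod.smul_fst, smul_eq_mul, Fin.cons_zero, Pi.mul_apply, Fin.sum_univ_three]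
      ring
    · simp only [structFn, eightOf, c, d, Pi.add_apply, Pi.sub_apply, Prod.fst_add, Pi.smul_apply,
        Prod.smul_fst, smul_eq_mul, Fin.cons_succ, Pi.mul_apply, Fin.sum_univ_three]
      ring
  · simp [structFn, eightOf]

end StructureFunctions

section Closure

variable {A : Type} [AddCommGroup A] [Module ℝ A] [DVS A] {D : Set (A × (Pt → ExtVal))}

open FieldRing

namespace MetricDom

variable {γ : (A × (Pt → ExtVal)) × (Pt → Eight) → Pt → ExtVal}

theorem invField_mem_pts (m : MetricDom D) {x : A × (Pt → ExtVal)} (hx : x ∈ D) (a b : Fin 3) :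
    invField x.2 a b ∈ (pts : Set (Pt → ℝ)) := (m.reg_invField a b).sm.mem_pts m.isOpen hx

theorem integrableOn_struct (M : Couplings) (m : MetricDom D) {τ σ : Pt → Eight}
    (hτ : τ ∈ (pts : Set (Pt → Eight))) (hσ : σ ∈ (pts : Set (Pt → Eight)))
    {x : A × (Pt → ExtVal)} (hx : x ∈ D) :
    IntegrableOn (fun y => dot (structFn (invField x.2) τ σ y) (conMap M x y)) cell :=
  integrableOn_dot (structFn_mem_pts (m.invField_mem_pts hx) hτ hσ)
    ((m.conMap_sm M).mem_pts m.isOpen hx)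

/-- Without lapse in `σ` the flow is the Lie derivative along its shift, and the action of
diffeomorphisms on the constraints gives the structure functions. -/
theorem closure_shift (M : Couplings) (m : MetricDom D) (hγ : HasAdj D (conMap M) γ)
    {τ σ : Pt → Eight} (hτ : τ ∈ (pts : Set (Pt → Eight))) (hσ : σ ∈ (pts : Set (Pt → Eight)))
    (h0 : comp₁ σ 0 = fun _ => 0) {x : A × (Pt → ExtVal)} (hx : x ∈ D) :
    ip (γ (x, τ)) (omega M (γ (x, σ))) = ip (structFn (invField x.2) τ σ) (conMap M x) := by
  have hf := (m.lieFlow_sm hσ).mem_pts m.isOpen hx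
  rw [m.omega_vector M hγ hσ (fun y => congrFun h0 y) hx, ← hγ.adj x hx τ hτ _ hf]
  obtain ⟨J, hJ⟩ := m.lie_eval M hτ hσ ⟨x, hx⟩
  refine integral_eq_of_div m.isOpen J ⟨x, hx⟩ (m.integrableOn_struct M hτ hσ hx) fun y => ?_
  rw [ip_structFn, dot_eight, m.dd_conMap_snd M hx (zero_prod_mem_pts hf), Fin.sum_univ_succ]
  rw [hJ y, h0]
  simp only [pd_zero, lieFlow, extOf, mul_zero, Finset.sum_const_zero, add_zero, Pi.zero_apply, zero_mul,
    zero_sub, sub_zero, Finset.sum_neg_distrib]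

/-- By `ip_omega` the bracket is the antisymmetrized variation of one smeared Hamiltonian constraint
along the velocities of the other, which `ham_ham_eval` computes up to a divergence. -/
theorem closure_lapse (M : Couplings) (m : MetricDom D) (hγ : HasAdj D (conMap M) γ)
    {τ σ : Pt → Eight} (hτ : τ ∈ (pts : Set (Pt → Eight))) (hσ : σ ∈ (pts : Set (Pt → Eight)))
    (hτ' : lapsePart τ = τ) (hσ' : lapsePart σ = σ) {x : A × (Pt → ExtVal)} (hx : x ∈ D) :
    ip (γ (x, τ)) (omega M (γ (x, σ))) = ip (structFn (invField x.2) τ σ) (conMap M x) := by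
  have hD := m.isOpen
  have fσ := (m.velFlow_sm M hσ).mem_pts hD hx
  have fτ := (m.velFlow_sm M hτ).mem_pts hD hx
  have dσ := dd_mem_pts (m.conMap_sm M) hD hx (zero_prod_mem_pts (A := A) fσ)
  have dτ := dd_mem_pts (m.conMap_sm M) hD hx (zero_prod_mem_pts (A := A) fτ)
  rw [ip_omega M (hγ.mem_pts hD hx hτ) (hγ.mem_pts hD hx hσ), m.half_adj_lapse M hγ hσ hσ' hx,
    m.half_adj_lapse M hγ hτ hτ' hx, ← hγ.adj x hx τ hτ _ fσ, ← hγ.adj x hx σ hσ _ fτ]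
  obtain ⟨J, hJ⟩ := m.ham_ham_eval M hτ hσ ⟨x, hx⟩
  rw [ip, ip, ← integral_sub (integrableOn_dot hτ dσ) (integrableOn_dot hσ dτ)]
  have z : ∀ {σ : Pt → Eight}, lapsePart σ = σ → ∀ a : Fin 3, comp₁ σ a.succ = fun _ => 0 :=
    fun h a => by rw [← h]; rfl
  have z' : ∀ {σ : Pt → Eight}, lapsePart σ = σ → ∀ y μ, (σ y).2 μ = 0 :=
    fun h a => by rw [← h]; intro μ; rfl
  refine integral_eq_of_div hD J ⟨x, hx⟩ (m.integrableOn_struct M hτ hσ hx) fun y => ?_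
  rw [ip_structFn, dot_eight, dot_eight]
  simp only [z' hτ', z' hσ', zero_mul, Finset.sum_const_zero, add_zero]
  rw [Fin.sum_univ_succ, Fin.sum_univ_succ (f := fun μ => (σ y).1 μ * _)]
  have z1 := fun a : Fin 3 => congrFun (z hτ' a) y
  have z2 := fun a : Fin 3 => congrFun (z hσ' a) y
  have z3 : ∀ a : Fin 3, (τ y).1 a.succ = 0 := z1
  have z4 : ∀ a : Fin 3, (σ y).1 a.succ = 0 := z2
  have h2 := hJ y
  simp only at h2
  simp only [z1, z2, z3, z4, zero_mul, Finset.sum_const_zero, add_zero, sub_zero,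
    zero_add]
  exact h2

theorem closure (M : Couplings) (m : MetricDom D) (hγ : HasAdj D (conMap M) γ)
    {τ σ : Pt → Eight} (hτ : τ ∈ (pts : Set (Pt → Eight))) (hσ : σ ∈ (pts : Set (Pt → Eight)))
    {x : A × (Pt → ExtVal)} (hx : x ∈ D) :
    ip τ (dd (conMap M) x (0, omega M (γ (x, σ)))) =
      ip (structFn (invField x.2) τ σ) (conMap M x) := by
  have hD := m.isOpen
  have om : ∀ {u : Pt → ExtVal}, u ∈ (pts : Set (Pt → ExtVal)) →
      omega M u ∈ (pts : Set (Pt → ExtVal)) := fun hu => (omega_sm M).mem_pts POpen.pts hu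
  have g := fun {σ : Pt → Eight} (hσ : σ ∈ (pts : Set (Pt → Eight))) => hγ.mem_pts hD hx hσ
  have tl := lapsePart_mem_pts hτ
  have ts := shiftPart_mem_pts hτ
  have sl := lapsePart_mem_pts hσ
  have ss := shiftPart_mem_pts hσ
  have hc := (m.conMap_sm M).mem_pts hD hx
  have k := fun {τ σ : Pt → Eight} (hτ : τ ∈ (pts : Set (Pt → Eight)))
    (hσ : σ ∈ (pts : Set (Pt → Eight))) => structFn_mem_pts (m.invField_mem_pts hx) hτ hσ
  have split : ∀ {σ : Pt → Eight}, σ ∈ (pts : Set (Pt → Eight)) →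
      γ (x, σ) = γ (x, lapsePart σ) + γ (x, shiftPart σ) := fun {σ} hσ => by
    have := (hγ.isLin hD hx).add (lapsePart_mem_pts hσ) (shiftPart_mem_pts hσ)
    rwa [lapsePart_add_shiftPart] at this
  -- The remaining mixed term has its lapse in the second slot; antisymmetry of the Poisson tensor
  -- exchanges the slots and produces the minus sign.
  have e1 : ip (γ (x, τ)) (omega M (γ (x, σ))) = ip (γ (x, τ)) (omega M (γ (x, shiftPart σ))) +
      ip (γ (x, lapsePart τ)) (omega M (γ (x, lapsePart σ))) -
      ip (γ (x, lapsePart σ)) (omega M (γ (x, shiftPart τ))) := by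
    have a1 := omega_antisymm M (γ (x, shiftPart τ)) (γ (x, lapsePart σ))
    rw [split hσ, (omega_isLin M).add (g sl) (g ss), (ip_isLin_right (g hτ)).add (om (g sl))
      (om (g ss)), ip_comm (γ (x, lapsePart σ)), ← neg_eq_iff_eq_neg.2 a1]
    have a2 : ip (γ (x, τ)) (omega M (γ (x, lapsePart σ))) =
        ip (γ (x, lapsePart τ)) (omega M (γ (x, lapsePart σ))) +
        ip (γ (x, shiftPart τ)) (omega M (γ (x, lapsePart σ))) := by
      rw [split hτ]
      exact (ip_isLin_left (om (g sl))).add (g tl) (g ts)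
    rw [a2]
    ring
  rw [hγ.adj x hx τ hτ _ (om (g hσ)), e1, m.closure_shift M hγ hτ ss rfl hx,
    m.closure_lapse M hγ tl sl rfl rfl hx, m.closure_shift M hγ sl ts rfl hx,
    structFn_split _ τ σ, (ip_isLin_left hc).sub (add_mem_pts (k hτ ss) (k tl sl)) (k sl ts),
    (ip_isLin_left hc).add (k hτ ss) (k tl sl)]

/-- The structure functions with the fields as arguments. -/
def structMap (y : (A × (Pt → ExtVal)) × ((Pt → Eight) × (Pt → Eight))) : Pt → Eight :=
  structFn (invField y.1.2) y.2.1 y.2.2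

/-- Here `τ` plays the role of the field and the phase space point is a parameter, so that the
functional derivative is the transpose in the slot of `τ`. -/
theorem reg_structMap_left (m : MetricDom D) :
    Reg ((D ×ˢ (pts : Set (Pt → Eight))) ×ˢ (pts : Set (Pt → Eight)))
      fun y => structFn (invField y.1.1.2) y.2 y.1.2 := by
  have hD := (m.isOpen.prod (POpen.pts (X := Pt → Eight))).prod (POpen.pts (X := Pt → Eight))
  have s1 : ∀ a b, Sm (D ×ˢ (pts : Set (Pt → Eight)))
      fun w : (A × (Pt → ExtVal)) × (Pt → Eight) => invField w.1.2 a b := fun a b =>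
    (m.reg_invField a b).sm.comp (Φ := fun w : (A × (Pt → ExtVal)) × (Pt → Eight) => w.1) Sm.fst
      fun w hw => hw.1
  have s2 : Sm (D ×ˢ (pts : Set (Pt → Eight)))
      fun w : (A × (Pt → ExtVal)) × (Pt → Eight) => w.2 := Sm.snd
  have r1 := fun a b => Reg.of_param (V := Eight) (s1 a b) hD fun y hy => hy.1
  have r2 := Reg.of_param (V := Eight) s2 hD fun y hy => hy.1
  exact Reg.structFn hD r1 (Reg.snd hD) r2

theorem struct_sm (m : MetricDom D) :
    Sm (D ×ˢ (pts : Set ((Pt → Eight) × (Pt → Eight)))) structMap := by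
  have h1 : Sm (D ×ˢ (pts : Set ((Pt → Eight) × (Pt → Eight))))
      fun y : (A × (Pt → ExtVal)) × ((Pt → Eight) × (Pt → Eight)) => ((y.1, y.2.2), y.2.1) :=
    (Sm.fst.prodMk Sm.snd.snd').prodMk Sm.snd.fst'
  have h2 : MapsTo (fun y : (A × (Pt → ExtVal)) × ((Pt → Eight) × (Pt → Eight)) =>
      ((y.1, y.2.2), y.2.1)) (D ×ˢ (pts : Set ((Pt → Eight) × (Pt → Eight))))
      ((D ×ˢ (pts : Set (Pt → Eight))) ×ˢ (pts : Set (Pt → Eight))) := fun y hy =>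
    ⟨⟨hy.1, (mem_pts_prod.1 hy.2).2⟩, (mem_pts_prod.1 hy.2).1⟩
  have h3 := m.reg_structMap_left.sm.comp h1 h2
  exact h3

theorem struct_transp (m : MetricDom D) :
    ∃ κt : ((A × (Pt → ExtVal)) × (Pt → Eight)) × (Pt → Eight) → Pt → Eight,
    Sm ((D ×ˢ pts) ×ˢ pts) κt ∧
    ∀ x ∈ D, ∀ τ ∈ (pts : Set (Pt → Eight)), ∀ σ ∈ (pts : Set (Pt → Eight)),
      ∀ k ∈ (pts : Set (Pt → Eight)), ip (structMap (x, (τ, σ))) k = ip τ (κt ((x, σ), k)) := by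
  obtain ⟨Kt, hs, ht⟩ := m.reg_structMap_left.transpose (m.isOpen.prod POpen.pts)
    fun x _ => structFn_isLin (invField x.1.2) x.2
  exact ⟨Kt, hs, fun x hx τ hτ σ hσ k hk => ht (x, σ) ⟨hx, hσ⟩ τ hτ k hk⟩

/-- The two smearings are moved into the parameters, so that functional differentiation acts only on
the phase space field, through the inverse metric. -/
theorem struct_adj (m : MetricDom D) :
    ∃ κr : ((A × (Pt → ExtVal)) × ((Pt → Eight) × (Pt → Eight))) × (Pt → Eight) → Pt → ExtVal,
    Sm ((D ×ˢ pts) ×ˢ pts) κr ∧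
    ∀ x ∈ D, ∀ p ∈ (pts : Set ((Pt → Eight) × (Pt → Eight))), ∀ k ∈ (pts : Set (Pt → Eight)),
      ∀ v ∈ (pts : Set (Pt → ExtVal)),
      ip k (dd structMap (x, p) ((0, v), 0)) = ip (κr ((x, p), k)) v := by
  set D₂ : Set ((A × ((Pt → Eight) × (Pt → Eight))) × (Pt → ExtVal)) :=
    {w | w ∈ pts ∧ (w.1.1, w.2) ∈ D} with hD₂
  have o : POpen D₂ := POpen.pts.preimage m.isOpen (Sm.fst.fst'.prodMk Sm.snd)
  have m₂ : MetricDom D₂ := ⟨o, fun x hx => m.posDef _ hx.2⟩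
  obtain ⟨Ψ, hΨ⟩ : Reg D₂ fun w => structFn (invField w.2) w.1.2.1 w.1.2.2 :=
    Reg.structFn o (h := fun y => invField y.2) m₂.reg_invField
      (Reg.of_param (D' := pts) (Φ := fun w => w.2.1) Sm.snd.fst' o
        fun y hy => (mem_pts_prod.1 hy.1).1)
      (Reg.of_param (D' := pts) (Φ := fun w => w.2.2) Sm.snd.snd' o
        fun y hy => (mem_pts_prod.1 hy.1).1)
  have mem : ∀ x ∈ D, ∀ p ∈ (pts : Set ((Pt → Eight) × (Pt → Eight))), ((x.1, p), x.2) ∈ D₂ :=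
    fun x hx p hp => ⟨prodMk_mem_pts (prodMk_mem_pts (mem_pts_prod.1 (m.isOpen.subset hx)).1 hp)
      (mem_pts_prod.1 (m.isOpen.subset hx)).2, hx⟩
  refine ⟨fun y => Ψ (((y.1.1.1, y.1.2), y.1.1.2), y.2), hΨ.adj_sm.comp
    (((Sm.fst.fst'.fst'.prodMk Sm.fst.snd').prodMk Sm.fst.fst'.snd').prodMk Sm.snd)
    fun y hy => ⟨mem _ hy.1.1 _ hy.1.2, hy.2⟩, fun x hx p hp k hk v hv => ?_⟩
  exact hΨ.adj _ (mem x hx p hp) k hk v hv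

theorem dd_conMap_param (M : Couplings) (m : MetricDom D) {x : A × (Pt → ExtVal)} (hx : x ∈ D)
    (a : A) : dd (conMap M) x (a, 0) = 0 := by
  have h1 := dd_const ((m.conMap_sm M).mem_pts m.isOpen hx) x (a, 0)
  simpa [dd, conMap] using h1

/-- The constraints are first class. -/
theorem firstClass (M : Couplings) (m : MetricDom D) (hγ : HasAdj D (conMap M) γ) :
    FirstClass D (conMap M) γ (omega M) structMap where
  isOpen := m.isOpen
  adj := hγ
  indep x hx a _ := m.dd_conMap_param M hx a
  indep_adj x hx σ hσ a ha := by
    have hD := m.isOpen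
    have h1 := hγ.param_deriv hD ha
    refine eq_of_ip (h1.mem_pts hD hx hσ) zero_mem_pts fun v hv => ?_
    rw [ip_comm, ← h1.adj x hx σ hσ v hv, dd_congr (Φ := fun _ => 0) (Sm.const zero_mem_pts) hD
      (fun y hy => m.dd_conMap_param M hy a) hx (zero_prod_mem_pts hv), dd_const zero_mem_pts,
      (ip_isLin_right hσ).zero, (ip_isLin_right hv).zero]
  lin := omega_isLin M
  sm := omega_sm M
  antisymm u _ v _ := omega_antisymm M u v
  struct_sm := m.struct_sm
  closure x hx τ hτ σ hσ := m.closure M hγ hτ hσ hx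
  struct_adj := m.struct_adj
  struct_transp := m.struct_transp

end MetricDom

end Closure

end

section

/-! ### Pairs of fields -/

section Joint

variable {X : Type} [AddCommGroup X] [Module ℝ X] [DVS X] {D : Set X}
  {V W : Type} [NormedAddCommGroup V] [NormedSpace ℝ V] [FVal V]
  [NormedAddCommGroup W] [NormedSpace ℝ W] [FVal W]

/-- The first of two fields regarded as one. -/
def fstF (u : Pt → V × W) : Pt → V := fun y => (u y).1

/-- The second of two fields regarded as one. -/
def sndF (u : Pt → V × W) : Pt → W := fun y => (u y).2

theorem fstF_isLin : IsLin (fstF : (Pt → V × W) → Pt → V) := fun _ _ _ _ _ => rfl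

theorem fstF_sm {D : Set (Pt → V × W)} : Sm D (fstF : (Pt → V × W) → Pt → V) := Sm.unjoint.fst'

theorem sndF_sm {D : Set (Pt → V × W)} : Sm D (sndF : (Pt → V × W) → Pt → W) := Sm.unjoint.snd'

theorem Sm.fstF {Φ : X → Pt → V × W} (h : Sm D Φ) : Sm D fun x => fstF (Φ x) :=
  fstF_sm.comp (D' := univ) h fun _ _ => mem_univ _

theorem Sm.sndF {Φ : X → Pt → V × W} (h : Sm D Φ) : Sm D fun x => sndF (Φ x) :=
  sndF_sm.comp (D' := univ) h fun _ _ => mem_univ _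

theorem Sm.jointF {Φ : X → Pt → V} {Ψ : X → Pt → W} (hΦ : Sm D Φ) (hΨ : Sm D Ψ) :
    Sm D fun x => ADM.joint (Φ x) (Ψ x) := hΦ.joint' hΨ

theorem fstF_mem_pts {u : Pt → V × W} (hu : u ∈ (pts : Set (Pt → V × W))) :
    fstF u ∈ (pts : Set (Pt → V)) := (fstF_sm (D := pts)).mem_pts POpen.pts hu

theorem sndF_mem_pts {u : Pt → V × W} (hu : u ∈ (pts : Set (Pt → V × W))) :
    sndF u ∈ (pts : Set (Pt → W)) := (sndF_sm (D := pts)).mem_pts POpen.pts hu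

theorem joint_mem_pts {u : Pt → V} {v : Pt → W} (hu : u ∈ (pts : Set (Pt → V)))
    (hv : v ∈ (pts : Set (Pt → W))) : joint u v ∈ (pts : Set (Pt → V × W)) :=
  (Sm.joint (D := pts)).mem_pts POpen.pts (x := (u, v)) ⟨hu, hv⟩

theorem joint_isLin : IsLin fun y : (Pt → V) × (Pt → W) => joint y.1 y.2 := fun _ _ _ _ _ => rfl

theorem joint_fstF_sndF (u : Pt → V × W) : joint (fstF u) (sndF u) = u := rfl

theorem joint_add (u u' : Pt → V) (v v' : Pt → W) :
    joint (u + u') (v + v') = joint u v + joint u' v' := rfl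

theorem dd_joint {Φ : X → Pt → V} {Ψ : X → Pt → W} (hΦ : Sm D Φ) (hΨ : Sm D Ψ) (hD : POpen D)
    {x v : X} (hx : x ∈ D) (hv : v ∈ (pts : Set X)) :
    dd (fun x => joint (Φ x) (Ψ x)) x v = joint (dd Φ x v) (dd Ψ x v) :=
  dd_lin_comp (L := fun y : (Pt → V) × (Pt → W) => joint y.1 y.2) joint_isLin Sm.joint
    (Φ := fun x => (Φ x, Ψ x)) (hΦ.prodMk hΨ) hD hx hv

theorem ip_joint {u u' : Pt → V} {v v' : Pt → W} (hu : u ∈ (pts : Set (Pt → V)))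
    (hu' : u' ∈ (pts : Set (Pt → V))) (hv : v ∈ (pts : Set (Pt → W)))
    (hv' : v' ∈ (pts : Set (Pt → W))) : ip (joint u v) (joint u' v') = ip u u' + ip v v' :=
  integral_add (integrableOn_dot hu hu') (integrableOn_dot hv hv')

/-- A map that is constant along a line has derivative zero in its direction. -/
theorem dd_eq_zero_of_line {Y : Type} [AddCommGroup Y] [Module ℝ Y] [DVS Y] {Φ : X → Y}
    (hΦ : Sm D Φ) (hD : POpen D) {x v : X} (hx : x ∈ D) (hv : v ∈ (pts : Set X))
    (h : ∀ s : ℝ, x + s • v ∈ D → Φ (x + s • v) = Φ x) : dd Φ x v = 0 :=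
  (der_congr (hD.isOpen_line hx hv) (by simpa using hx)
    (pl_const (hΦ.mem_pts hD hx)) h).trans (dd_const (hΦ.mem_pts hD hx) x v)

/-- Derivatives at points with the same values along parallel lines agree. -/
theorem dd_congr_line {Y : Type} [AddCommGroup Y] [Module ℝ Y] [DVS Y] {Φ : X → Y}
    (hΦ : Sm D Φ) (hD : POpen D) {x x' v : X} (hx : x ∈ D) (hx' : x' ∈ D) (hv : v ∈ (pts : Set X))
    (h : ∀ s : ℝ, x + s • v ∈ D → x' + s • v ∈ D → Φ (x' + s • v) = Φ (x + s • v)) :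
    dd Φ x' v = dd Φ x v :=
  der_congr ((hD.isOpen_line hx hv).inter (hD.isOpen_line hx' hv))
    ⟨by simpa using hx, by simpa using hx'⟩ (pl_mono (hΦ.pl_line hD hx hv) fun _ hs => hs.1)
    fun s hs => h s hs.1 hs.2

end Joint

/-! ### Clocks -/

section Clocks

variable {R W : Type} [NormedAddCommGroup R] [NormedSpace ℝ R] [FVal R]
  [NormedAddCommGroup W] [NormedSpace ℝ W] [FVal W]

/-- Parameters `(t, β)` and fields. -/
abbrev Ext (R W : Type) := (ℝ × (Pt → W × W)) × (Pt → R × (W × W))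

/-- Clocks `T` for first class constraints `c` whose second half consists of momenta that generate
shifts of the fields `N`, with an inverse `B` of the bracket of the clocks with the first half of
the constraints. -/
structure ClockSystem (D : Set (Ext R W)) (c : Ext R W → Pt → W × W)
    (γ : Ext R W × (Pt → W × W) → Pt → R × (W × W)) (Ω : (Pt → R × (W × W)) → Pt → R × (W × W))
    (κ : Ext R W × ((Pt → W × W) × (Pt → W × W)) → Pt → W × W)
    (T : Ext R W → Pt → W) (B Bt : Ext R W × (Pt → W) → Pt → W) : Prop where
  firstClass : FirstClass D c γ Ω κ
  flow_mom : ∀ x ∈ D, ∀ ζ ∈ (pts : Set (Pt → W)), Ω (γ (x, joint 0 ζ)) = joint 0 (joint ζ 0)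
  reparam : ∀ x ∈ D, ∀ β ∈ (pts : Set (Pt → W × W)), ((x.1.1, β), x.2) ∈ D
  clock_reg : Reg D T
  clock_indep : ∀ x ∈ D, ∀ x' ∈ D, x'.1.1 = x.1.1 → fstF x'.2 = fstF x.2 → T x' = T x
  inv_indep : ∀ x ∈ D, ∀ x' ∈ D, x'.1.1 = x.1.1 → fstF x'.2 = fstF x.2 →
    ∀ η ∈ (pts : Set (Pt → W)), B (x', η) = B (x, η)
  inv_sm : Sm (D ×ˢ pts) B
  transp_sm : Sm (D ×ˢ pts) Bt
  transp : ∀ x ∈ D, ∀ η ∈ (pts : Set (Pt → W)), ∀ ξ ∈ (pts : Set (Pt → W)),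
    ip η (B (x, ξ)) = ip (Bt (x, η)) ξ
  right_inv : ∀ x ∈ D, ∀ η ∈ (pts : Set (Pt → W)),
    dd T x (0, Ω (γ (x, joint (B (x, η)) 0))) = η
  left_inv : ∀ x ∈ D, ∀ ξ ∈ (pts : Set (Pt → W)), B (x, dd T x (0, Ω (γ (x, joint ξ 0)))) = ξ

namespace ClockSystem

variable (γ : Ext R W × (Pt → W × W) → Pt → R × (W × W))
  (Ω : (Pt → R × (W × W)) → Pt → R × (W × W)) (T : Ext R W → Pt → W)
  (B : Ext R W × (Pt → W) → Pt → W)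

/-- The bracket of the clocks with the first half of the constraints. -/
def mat (y : Ext R W × (Pt → W)) : Pt → W := dd T y.1 (0, Ω (γ (y.1, joint y.2 0)))

/-- Lapse and shift. -/
def lapse (x : Ext R W) : Pt → W := fstF (sndF x.2)

/-- The rate of change of the clocks. -/
def rate (x : Ext R W) : Pt → W := dd T x ((1, 0), 0) + mat γ Ω T (x, lapse x)

/-- The bracket of the rates with the first half of the constraints. -/
def rateMat (y : Ext R W × (Pt → W)) : Pt → W :=
  dd (rate γ Ω T) y.1 (0, Ω (γ (y.1, joint y.2 0)))

/-- The inverse of the bracket of the clocks and their rates with all constraints. -/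
def invBlock (y : Ext R W × (Pt → W × W)) : Pt → W × W :=
  joint (B (y.1, fstF y.2))
    (B (y.1, sndF y.2) - B (y.1, rateMat γ Ω T (y.1, B (y.1, fstF y.2))))

/-- The multipliers that make the rates stable. -/
def mult (x : Ext R W) : Pt → W :=
  B (x, -dd (rate γ Ω T) x ((1, 0), 0) - rateMat γ Ω T (x, lapse x))

/-- The clocks and their rates. -/
def gauge (x : Ext R W) : Pt → W × W := joint (T x) (rate γ Ω T x)

variable {γ Ω T B}

variable {D : Set (Ext R W)} {c : Ext R W → Pt → W × W}
  {κ : Ext R W × ((Pt → W × W) × (Pt → W × W)) → Pt → W × W} {Bt : Ext R W × (Pt → W) → Pt → W}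

theorem isOpen (h : ClockSystem D c γ Ω κ T B Bt) : POpen D := h.firstClass.isOpen

theorem one_mem_pts : (((1 : ℝ), (0 : Pt → W × W)), (0 : Pt → R × (W × W))) ∈
    (pts : Set (Ext R W)) := prodMk_mem_pts (prodMk_mem_pts (pts_real 1) zero_mem_pts) zero_mem_pts

/-- Smearing the first half of the constraints is smearing all of them with a vanishing second
component, so the functional derivative is inherited. -/
theorem secondary_adj (h : ClockSystem D c γ Ω κ T B Bt) :
    HasAdj D (fun x => fstF (c x)) fun y => γ (y.1, joint y.2 0) := by
  have hD := h.isOpen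
  have hc := h.firstClass.adj
  refine ⟨hc.sm.fstF, hc.adj_sm.comp (Sm.fst.prodMk (Sm.snd.jointF (Sm.const zero_mem_pts)))
    fun y hy => ⟨hy.1, joint_mem_pts hy.2 zero_mem_pts⟩, fun x hx η hη v hv => ?_⟩
  have hv' := zero_prod_mem_pts (A := ℝ × (Pt → W × W)) hv
  have hd := dd_mem_pts hc.sm hD hx hv'
  rw [dd_lin_comp fstF_isLin fstF_sm hc.sm hD hx hv',
    ← hc.adj x hx _ (joint_mem_pts hη zero_mem_pts) v hv, ← joint_fstF_sndF (dd c x (0, v)),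
    ip_joint hη (fstF_mem_pts hd) zero_mem_pts (sndF_mem_pts hd),
    (ip_isLin_left (sndF_mem_pts hd)).zero, add_zero]
  rfl

theorem mat_regOp (h : ClockSystem D c γ Ω κ T B Bt) : RegOp D (mat γ Ω T) := by
  obtain ⟨Ψ, hΨ⟩ := h.clock_reg
  exact (hΨ.bracket h.isOpen h.secondary_adj h.firstClass.lin h.firstClass.sm
    h.firstClass.antisymm).1

theorem inv_regOp (h : ClockSystem D c γ Ω κ T B Bt) : RegOp D B :=
  h.mat_regOp.inverse h.isOpen h.inv_sm h.transp_sm h.right_inv h.left_inv h.transp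

theorem reg_lapse (h : ClockSystem D c γ Ω κ T B Bt) : Reg D lapse :=
  (((Reg.snd h.isOpen).snd' h.isOpen).fst' h.isOpen)

theorem reg_rate (h : ClockSystem D c γ Ω κ T B Bt) : Reg D (rate γ Ω T) := by
  obtain ⟨Ψ, hΨ⟩ := h.clock_reg
  exact Reg.add ⟨_, hΨ.param_deriv h.isOpen (prodMk_mem_pts (pts_real 1) zero_mem_pts)⟩
    (h.mat_regOp.reg_comp h.isOpen h.reg_lapse) h.isOpen

theorem rateMat_regOp (h : ClockSystem D c γ Ω κ T B Bt) : RegOp D (rateMat γ Ω T) := by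
  obtain ⟨Ψ, hΨ⟩ := h.reg_rate
  exact (hΨ.bracket h.isOpen h.secondary_adj h.firstClass.lin h.firstClass.sm
    h.firstClass.antisymm).1

/-- The smearing `β` is a parameter here. Functional derivatives of this field dependent smearing
are what the Hamiltonian vector field of the abelianized constraints requires. -/
theorem reg_invBlock (h : ClockSystem D c γ Ω κ T B Bt) :
    Reg D fun x => invBlock γ Ω T B (x, x.1.2) := by
  have hD := h.isOpen
  have hB := h.inv_regOp
  have m : ∀ x ∈ D, x.1 ∈ (pts : Set (ℝ × (Pt → W × W))) := fun x hx =>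
    (mem_pts_prod.1 (hD.subset hx)).1
  have r1 : Reg D fun x => fstF x.1.2 := Reg.of_param (D' := pts) (Φ := fun a => fstF a.2)
    Sm.snd.fstF hD m
  have r2 : Reg D fun x => sndF x.1.2 := Reg.of_param (D' := pts) (Φ := fun a => sndF a.2)
    Sm.snd.sndF hD m
  have r3 := hB.reg_comp hD r1
  exact r3.joint ((hB.reg_comp hD r2).sub (hB.reg_comp hD (h.rateMat_regOp.reg_comp hD r3)) hD) hD

theorem op_mem {W' : Type} [NormedAddCommGroup W'] [NormedSpace ℝ W'] [FVal W']
    (hD : POpen D) {K : Ext R W × (Pt → W) → Pt → W'} (hK : RegOp D K)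
    {x : Ext R W} (hx : x ∈ D) {ξ : Pt → W} (hξ : ξ ∈ (pts : Set (Pt → W))) :
    K (x, ξ) ∈ (pts : Set (Pt → W')) :=
  hK.sm.mem_pts (hD.prod POpen.pts) (x := (x, ξ)) ⟨hx, hξ⟩

theorem invBlock_sm (h : ClockSystem D c γ Ω κ T B Bt) : Sm (D ×ˢ pts) (invBlock γ Ω T B) := by
  have hD := h.isOpen
  have s1 : Sm (D ×ˢ pts) fun y : Ext R W × (Pt → W × W) => B (y.1, fstF y.2) :=
    h.inv_sm.comp (Sm.fst.prodMk Sm.snd.fstF) fun y hy => ⟨hy.1, fstF_mem_pts hy.2⟩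
  have s2 : Sm (D ×ˢ pts) fun y : Ext R W × (Pt → W × W) => B (y.1, sndF y.2) :=
    h.inv_sm.comp (Sm.fst.prodMk Sm.snd.sndF) fun y hy => ⟨hy.1, sndF_mem_pts hy.2⟩
  have m1 : ∀ y ∈ D ×ˢ (pts : Set (Pt → W × W)), B (y.1, fstF y.2) ∈ (pts : Set (Pt → W)) :=
    fun y hy => op_mem hD h.inv_regOp hy.1 (fstF_mem_pts hy.2)
  have s3 : Sm (D ×ˢ pts) fun y : Ext R W × (Pt → W × W) =>
      rateMat γ Ω T (y.1, B (y.1, fstF y.2)) :=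
    h.rateMat_regOp.sm.comp (Sm.fst.prodMk s1) fun y hy => ⟨hy.1, m1 y hy⟩
  have s4 : Sm (D ×ˢ pts) fun y : Ext R W × (Pt → W × W) =>
      B (y.1, rateMat γ Ω T (y.1, B (y.1, fstF y.2))) :=
    h.inv_sm.comp (Sm.fst.prodMk s3) fun y hy => ⟨hy.1, op_mem hD h.rateMat_regOp hy.1 (m1 y hy)⟩
  exact s1.jointF (s2.sub s4)

theorem invBlock_isLin (h : ClockSystem D c γ Ω κ T B Bt) {x : Ext R W} (hx : x ∈ D) :
    IsLin fun k => invBlock γ Ω T B (x, k) := by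
  have hD := h.isOpen
  have hB := h.inv_regOp
  have hM := h.rateMat_regOp
  intro k hk k' hk' a
  have b1 := op_mem hD hB hx (fstF_mem_pts hk)
  have b2 := op_mem hD hB hx (fstF_mem_pts hk')
  have e1 := hB.lin x hx _ (fstF_mem_pts hk) _ (fstF_mem_pts hk') a
  have e2 := hB.lin x hx _ (sndF_mem_pts hk) _ (sndF_mem_pts hk') a
  have e3 := hM.lin x hx _ b1 _ b2 a
  have e4 := hB.lin x hx _ (op_mem hD hM hx b1) _ (op_mem hD hM hx b2) a
  simp only at e1 e2 e3 e4
  have f1 : fstF (a • k + k') = a • fstF k + fstF k' := rfl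
  have f2 : sndF (a • k + k') = a • sndF k + sndF k' := rfl
  simp only [invBlock]
  rw [f1, f2, e1, e2, e3, e4]
  funext y
  simp only [joint, Pi.add_apply, Pi.smul_apply, Pi.sub_apply, Prod.smul_mk, Prod.mk_add_mk]
  rw [Prod.mk.injEq]
  refine ⟨rfl, ?_⟩
  rw [smul_sub]
  abel

theorem mult_sm (h : ClockSystem D c γ Ω κ T B Bt) : Sm D (mult γ Ω T B) := by
  have hD := h.isOpen
  have s1 : Sm D fun x => dd (rate γ Ω T) x ((1, 0), 0) :=
    h.reg_rate.sm.dd_apply hD Sm.id (Sm.const one_mem_pts) fun _ h => h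
  have s2 : Sm D fun x => rateMat γ Ω T (x, lapse x) :=
    h.rateMat_regOp.sm.comp (Sm.id.prodMk h.reg_lapse.sm)
      fun x hx => ⟨hx, h.reg_lapse.sm.mem_pts hD hx⟩
  have s3 := s1.neg.sub s2
  exact h.inv_sm.comp (Sm.id.prodMk s3) fun x hx => ⟨hx, s3.mem_pts hD hx⟩

theorem gauge_sm (h : ClockSystem D c γ Ω κ T B Bt) : Sm D (gauge γ Ω T) :=
  h.clock_reg.sm.jointF h.reg_rate.sm

/-- The flow of the constraints could a priori depend on all fields. Independence of lapse, shift,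
their momenta and `β` is read off from the inverse, which is assumed to depend on time and reduced
variables only. -/
theorem mat_indep (h : ClockSystem D c γ Ω κ T B Bt) {x x' : Ext R W} (hx : x ∈ D) (hx' : x' ∈ D)
    (ht : x'.1.1 = x.1.1) (hr : fstF x'.2 = fstF x.2) {ξ : Pt → W}
    (hξ : ξ ∈ (pts : Set (Pt → W))) : mat γ Ω T (x', ξ) = mat γ Ω T (x, ξ) := by
  have h1 : B (x, mat γ Ω T (x, ξ)) = ξ := h.left_inv x hx ξ hξ
  have h2 := op_mem h.isOpen h.mat_regOp hx hξ
  have h3 : mat γ Ω T (x', B (x', mat γ Ω T (x, ξ))) = mat γ Ω T (x, ξ) := h.right_inv x' hx' _ h2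
  rwa [h.inv_indep x hx x' hx' ht hr _ h2, h1] at h3

/-- The rate is affine in lapse and shift: its explicit time derivative and the matrix multiplying
them depend on time and reduced variables only. -/
theorem rate_shift (h : ClockSystem D c γ Ω κ T B Bt) {x x' : Ext R W} (hx : x ∈ D) (hx' : x' ∈ D)
    (ht : x'.1.1 = x.1.1) (hr : fstF x'.2 = fstF x.2) :
    rate γ Ω T x' = rate γ Ω T x + mat γ Ω T (x, lapse x' - lapse x) := by
  have hD := h.isOpen
  have l := h.reg_lapse.sm.mem_pts hD hx
  have l' := h.reg_lapse.sm.mem_pts hD hx'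
  have h1 : dd T x' ((1, 0), 0) = dd T x ((1, 0), 0) :=
    dd_congr_line h.clock_reg.sm hD hx hx' one_mem_pts fun s hs hs' =>
      h.clock_indep _ hs _ hs' (by simp [ht]) (by
        funext y
        have := congrFun hr y
        simpa [fstF] using this)
  have e1 := (h.mat_regOp.lin x hx).sub l' l
  rw [rate, rate, h1, h.mat_indep hx hx' ht hr l', e1]
  abel

theorem dd_clock_invisible (h : ClockSystem D c γ Ω κ T B Bt) {x : Ext R W} (hx : x ∈ D)
    {b : Pt → W × W} (hb : b ∈ (pts : Set (Pt → W × W))) {n : Pt → W × W}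
    (hn : n ∈ (pts : Set (Pt → W × W))) : dd T x ((0, b), joint 0 n) = 0 :=
  dd_eq_zero_of_line h.clock_reg.sm h.isOpen hx (prodMk_mem_pts (prodMk_mem_pts zero_mem_pts hb)
    (joint_mem_pts zero_mem_pts hn)) fun s hs => h.clock_indep _ hx _ hs (by simp)
      (by funext y; simp [fstF, joint])

/-- Since the rate is affine in lapse and shift, its derivative in these directions is its linear
part; neither `β` nor the conjugate momenta contribute. -/
theorem dd_rate_invisible (h : ClockSystem D c γ Ω κ T B Bt) {x : Ext R W} (hx : x ∈ D)
    {b : Pt → W × W} (hb : b ∈ (pts : Set (Pt → W × W))) {n : Pt → W × W}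
    (hn : n ∈ (pts : Set (Pt → W × W))) :
    dd (rate γ Ω T) x ((0, b), joint 0 n) = mat γ Ω T (x, fstF n) := by
  have hD := h.isOpen
  have hv : ((0, b), joint 0 n) ∈ (pts : Set (Ext R W)) :=
    prodMk_mem_pts (prodMk_mem_pts zero_mem_pts hb) (joint_mem_pts zero_mem_pts hn)
  have hr := h.reg_rate.sm.mem_pts hD hx
  have hm := op_mem hD h.mat_regOp hx (fstF_mem_pts hn)
  refine (der_congr (hD.isOpen_line hx hv)
    (show x + (0 : ℝ) • ((0, b), joint 0 n) ∈ D by rw [zero_smul, add_zero]; exact hx)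
    (p := fun s : ℝ => rate γ Ω T x + s • mat γ Ω T (x, fstF n)) ?_ fun s hs => ?_).trans
    (der_line hr hm)
  · exact pl_mono (pl_line_const hr hm) fun _ _ => mem_univ _
  · have e1 := (h.mat_regOp.lin x hx).smul (fstF_mem_pts hn) (a := s)
    rw [h.rate_shift hx hs (by simp) (by funext y; simp [fstF, joint]), ← e1]
    congr 3
    funext y
    simp [lapse, fstF, sndF, joint]

theorem flow_joint (h : ClockSystem D c γ Ω κ T B Bt) {x : Ext R W} (hx : x ∈ D) {ξ ζ : Pt → W}
    (hξ : ξ ∈ (pts : Set (Pt → W))) (hζ : ζ ∈ (pts : Set (Pt → W))) :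
    Ω (γ (x, joint ξ ζ)) = Ω (γ (x, joint ξ 0)) + joint 0 (joint ζ 0) := by
  have hf := h.firstClass
  have m1 : joint ξ (0 : Pt → W) ∈ (pts : Set (Pt → W × W)) := joint_mem_pts hξ zero_mem_pts
  have m2 : joint (0 : Pt → W) ζ ∈ (pts : Set (Pt → W × W)) := joint_mem_pts zero_mem_pts hζ
  have e1 := (hf.adj.isLin h.isOpen hx).add m1 m2
  rw [← h.flow_mom x hx ζ hζ, ← hf.lin.add (hf.adj.mem_pts h.isOpen hx m1)
    (hf.adj.mem_pts h.isOpen hx m2), ← e1, ← joint_add, add_zero, zero_add]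

theorem dd_add_parts {Y : Type} [AddCommGroup Y] [Module ℝ Y] [DVS Y] {Φ : Ext R W → Y}
    (hΦ : Sm D Φ) (hD : POpen D) {x : Ext R W} (hx : x ∈ D) {a a' : ℝ × (Pt → W × W)}
    {u u' : Pt → R × (W × W)} (ha : a ∈ (pts : Set (ℝ × (Pt → W × W))))
    (ha' : a' ∈ (pts : Set (ℝ × (Pt → W × W)))) (hu : u ∈ (pts : Set (Pt → R × (W × W))))
    (hu' : u' ∈ (pts : Set (Pt → R × (W × W)))) :
    dd Φ x (a + a', u + u') = dd Φ x (a, u) + dd Φ x (a', u') :=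
  dd_add hΦ hD hx (prodMk_mem_pts ha hu) (prodMk_mem_pts ha' hu')

theorem dd_gauge (h : ClockSystem D c γ Ω κ T B Bt) {x v : Ext R W} (hx : x ∈ D)
    (hv : v ∈ (pts : Set (Ext R W))) :
    dd (gauge γ Ω T) x v = joint (dd T x v) (dd (rate γ Ω T) x v) :=
  dd_joint h.clock_reg.sm h.reg_rate.sm h.isOpen hx hv

/-- The primary constraints shift lapse and shift. They leave the clocks invariant and act on the
rates through the clock matrix, so the bracket is block lower triangular with that matrix in both
diagonal blocks. -/
theorem dd_gauge_flow (h : ClockSystem D c γ Ω κ T B Bt) {x : Ext R W} (hx : x ∈ D)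
    {ξ ζ : Pt → W} (hξ : ξ ∈ (pts : Set (Pt → W))) (hζ : ζ ∈ (pts : Set (Pt → W))) :
    dd (gauge γ Ω T) x (0, Ω (γ (x, joint ξ ζ))) =
      joint (mat γ Ω T (x, ξ)) (rateMat γ Ω T (x, ξ) + mat γ Ω T (x, ζ)) := by
  have hD := h.isOpen
  have hf := h.firstClass
  have m1 := hf.flow_mem hx (joint_mem_pts hξ (zero_mem_pts (X := Pt → W)))
  have m2 := joint_mem_pts hζ (zero_mem_pts (X := Pt → W))
  have m3 := joint_mem_pts (zero_mem_pts (X := Pt → R)) m2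
  have z := zero_mem_pts (X := ℝ × (Pt → W × W))
  have e0 : ((0 : ℝ × (Pt → W × W)), Ω (γ (x, joint ξ ζ))) =
      (0 + 0, Ω (γ (x, joint ξ 0)) + joint 0 (joint ζ 0)) := by
    rw [h.flow_joint hx hξ hζ, add_zero]
  rw [h.dd_gauge hx (zero_prod_mem_pts (hf.flow_mem hx (joint_mem_pts hξ hζ))), e0,
    dd_add_parts h.clock_reg.sm hD hx z z m1 m3, dd_add_parts h.reg_rate.sm hD hx z z m1 m3]
  have e1 := h.dd_clock_invisible hx zero_mem_pts m2
  have e2 := h.dd_rate_invisible hx zero_mem_pts m2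
  rw [← Prod.zero_eq_mk] at e1 e2
  rw [e1, e2, add_zero]
  rfl

theorem invBlock_dd_gauge (h : ClockSystem D c γ Ω κ T B Bt) {x : Ext R W} (hx : x ∈ D)
    {σ : Pt → W × W} (hσ : σ ∈ (pts : Set (Pt → W × W))) :
    invBlock γ Ω T B (x, dd (gauge γ Ω T) x (0, Ω (γ (x, σ)))) = σ := by
  have hD := h.isOpen
  have h1 := fstF_mem_pts hσ
  have h2 := sndF_mem_pts hσ
  have e1 : ∀ {ξ : Pt → W}, ξ ∈ (pts : Set (Pt → W)) → B (x, mat γ Ω T (x, ξ)) = ξ :=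
    fun hξ => h.left_inv x hx _ hξ
  have e0 := h.dd_gauge_flow hx h1 h2
  rw [joint_fstF_sndF] at e0
  have e2 := (h.inv_regOp.lin x hx).add (op_mem hD h.rateMat_regOp hx h1)
    (op_mem hD h.mat_regOp hx h2)
  rw [e0]
  change joint (B (x, mat γ Ω T (x, fstF σ))) (B (x, rateMat γ Ω T (x, fstF σ) +
    mat γ Ω T (x, sndF σ)) - B (x, rateMat γ Ω T (x, B (x, mat γ Ω T (x, fstF σ))))) = σ
  rw [e2, e1 h1, e1 h2, add_sub_cancel_left, joint_fstF_sndF]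

theorem dd_gauge_invBlock (h : ClockSystem D c γ Ω κ T B Bt) {x : Ext R W} (hx : x ∈ D)
    {β : Pt → W × W} (hβ : β ∈ (pts : Set (Pt → W × W))) :
    dd (gauge γ Ω T) x (0, Ω (γ (x, invBlock γ Ω T B (x, β)))) = β := by
  have hD := h.isOpen
  have hB := h.inv_regOp
  have e1 : ∀ {η : Pt → W}, η ∈ (pts : Set (Pt → W)) → mat γ Ω T (x, B (x, η)) = η :=
    fun hη => h.right_inv x hx _ hη
  have m1 := op_mem hD hB hx (fstF_mem_pts hβ)
  have m2 := op_mem hD hB hx (sndF_mem_pts hβ)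
  have m3 := op_mem hD h.rateMat_regOp hx m1
  have m4 := op_mem hD hB hx m3
  have e2 := (h.mat_regOp.lin x hx).sub m2 m4
  rw [invBlock, h.dd_gauge_flow hx m1 (sub_mem_pts m2 m4), e2, e1 (fstF_mem_pts hβ),
    e1 (sndF_mem_pts hβ), e1 m3, add_sub_cancel, joint_fstF_sndF]

/-! #### The two flows -/

variable (γ Ω T B c) in
/-- The evolution of the fields, of the time, and of the parameters of the gauge flow. -/
def evolution (x : Ext R W) : Ext R W :=
  -- The parameters obey the law that the gauge fixing conditions obey: the first half moves with
  -- the second as velocity, the second is at rest. The last summand of the field part is the change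
  -- of the momenta of lapse and shift, because the Hamiltonian depends on lapse and shift through
  -- their products with the constraints.
  ((1, joint (sndF x.1.2) 0),
    Ω (γ (x, joint (lapse x) (mult γ Ω T B x))) + joint 0 (joint 0 (-fstF (c x))))

variable (γ Ω T B c) in
/-- The gauge flow, where `Ψ` is the functional derivative of the abelianizing matrix. -/
def gaugeFlow (Ψ : Ext R W × (Pt → W × W) → Pt → R × (W × W)) (x : Ext R W) : Ext R W :=
  (0, Ω (γ (x, invBlock γ Ω T B (x, x.1.2))) + Ω (Ψ (x, c x)))

theorem smear_sm (h : ClockSystem D c γ Ω κ T B Bt) :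
    Sm D fun x => joint (lapse x) (mult γ Ω T B x) := h.reg_lapse.sm.jointF h.mult_sm

theorem param_sm : Sm D fun x : Ext R W => ((1 : ℝ), joint (sndF x.1.2) (0 : Pt → W)) :=
  (Sm.const (pts_real 1)).prodMk (Sm.fst.snd'.sndF.jointF (Sm.const zero_mem_pts))

/-- The momenta of lapse and shift change by minus the secondary constraints, which is linear in the
constraints and therefore an admissible error. -/
theorem evolution_error :
    WZ D c fun x => joint (0 : Pt → R) (joint (0 : Pt → W) (-fstF (c x))) :=
  ⟨fun y => joint 0 (joint 0 (-fstF y.2)), (Sm.const zero_mem_pts).jointF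
    ((Sm.const zero_mem_pts).jointF Sm.snd.fstF.neg), fun x _ k _ k' _ a => by
      funext y
      simp only [joint, fstF, Pi.add_apply, Pi.smul_apply, Pi.neg_apply, Pi.zero_apply,
        Prod.smul_mk, Prod.mk_add_mk, smul_zero, add_zero, Prod.fst_add, Prod.smul_fst]
      rw [neg_add, smul_neg], fun _ _ => rfl⟩

theorem evolution_sm (h : ClockSystem D c γ Ω κ T B Bt) : Sm D (evolution γ Ω T B c) :=
  h.firstClass.field_sm h.smear_sm evolution_error param_sm fun _ => rfl

variable {Ψ : Ext R W × (Pt → W × W) → Pt → R × (W × W)}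

theorem gaugeFlow_error (h : ClockSystem D c γ Ω κ T B Bt)
    (hΨ : HasAdj D (fun x => invBlock γ Ω T B (x, x.1.2)) Ψ) : WZ D c fun x => Ω (Ψ (x, c x)) := by
  have hf := h.firstClass
  refine ⟨fun y => Ω (Ψ y), hf.sm.comp hΨ.adj_sm fun y hy => hΨ.mem_pts h.isOpen hy.1 hy.2,
    fun x hx k hk k' hk' a => ?_, fun _ _ => rfl⟩
  have e1 := hΨ.isLin h.isOpen hx k hk k' hk' a
  simp only at e1 ⊢
  rw [e1, hf.lin _ (hΨ.mem_pts h.isOpen hx hk) _ (hΨ.mem_pts h.isOpen hx hk') a]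

theorem gaugeFlow_smear (h : ClockSystem D c γ Ω κ T B Bt) :
    Sm D fun x => invBlock γ Ω T B (x, x.1.2) := h.reg_invBlock.sm

theorem gaugeFlow_sm (h : ClockSystem D c γ Ω κ T B Bt)
    (hΨ : HasAdj D (fun x => invBlock γ Ω T B (x, x.1.2)) Ψ) :
    Sm D (gaugeFlow γ Ω T B c Ψ) :=
  h.firstClass.field_sm h.gaugeFlow_smear (h.gaugeFlow_error hΨ) (Sm.const zero_mem_pts)
    fun _ => rfl

/-- The rates of change of the clocks and of their rates. -/
theorem dd_gauge_evolution (h : ClockSystem D c γ Ω κ T B Bt) {x : Ext R W} (hx : x ∈ D) :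
    dd (gauge γ Ω T) x (evolution γ Ω T B c x) = joint (rate γ Ω T x) 0 := by
  have hD := h.isOpen
  have hf := h.firstClass
  have hb : joint (sndF x.1.2) (0 : Pt → W) ∈ (pts : Set (Pt → W × W)) := joint_mem_pts
    (sndF_mem_pts (mem_pts_prod.1 (mem_pts_prod.1 (hD.subset hx)).1).2) zero_mem_pts
  have hk : joint (0 : Pt → W) (-fstF (c x)) ∈ (pts : Set (Pt → W × W)) :=
    joint_mem_pts zero_mem_pts (neg_mem_pts (fstF_mem_pts (hf.adj.sm.mem_pts hD hx)))
  have hl := h.reg_lapse.sm.mem_pts hD hx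
  have hm := h.mult_sm.mem_pts hD hx
  have hfl := hf.flow_mem hx (joint_mem_pts hl hm)
  have hv1 : (((1 : ℝ), (0 : Pt → W × W)), (0 : Pt → R × (W × W))) ∈ (pts : Set (Ext R W)) :=
    one_mem_pts
  have hv2 := zero_prod_mem_pts (A := ℝ × (Pt → W × W)) hfl
  have hv3 : (((0 : ℝ), joint (sndF x.1.2) (0 : Pt → W)), joint (0 : Pt → R)
      (joint (0 : Pt → W) (-fstF (c x)))) ∈ (pts : Set (Ext R W)) :=
    prodMk_mem_pts (prodMk_mem_pts zero_mem_pts hb) (joint_mem_pts zero_mem_pts hk)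
  have e0 : evolution γ Ω T B c x = ((1, 0), 0) + (0, Ω (γ (x, joint (lapse x) (mult γ Ω T B x)))) +
      ((0, joint (sndF x.1.2) 0), joint 0 (joint 0 (-fstF (c x)))) := by
    simp [evolution]
  have hs1 : dd (rate γ Ω T) x ((1, 0), 0) ∈ (pts : Set (Pt → W)) :=
    dd_mem_pts h.reg_rate.sm hD hx hv1
  have hs2 := op_mem hD h.rateMat_regOp hx hl
  -- This is the stability condition that defines the multipliers. It cancels the explicit time
  -- derivative of the rates and their bracket with the lapse part of the Hamiltonian.
  have e3 : mat γ Ω T (x, mult γ Ω T B x) =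
      -dd (rate γ Ω T) x ((1, 0), 0) - rateMat γ Ω T (x, lapse x) :=
    h.right_inv x hx _ (sub_mem_pts (neg_mem_pts hs1) hs2)
  have e4 := h.dd_clock_invisible hx hb hk
  have e5 := h.dd_rate_invisible hx hb hk
  have e6 : mat γ Ω T (x, fstF (joint (0 : Pt → W) (-fstF (c x)))) = 0 :=
    (h.mat_regOp.lin x hx).zero
  rw [e0, dd_add h.gauge_sm hD hx (add_mem_pts hv1 hv2) hv3, dd_add h.gauge_sm hD hx hv1 hv2,
    h.dd_gauge_flow hx hl hm, h.dd_gauge hx hv1, h.dd_gauge hx hv3, e4, e5, e6, e3, ← joint_add,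
    ← joint_add, add_zero, add_zero, rate]
  congr 1
  abel

/-- The abelianizing matrix inverts the bracket exactly. The only discrepancy is the flow from the
field dependence of that matrix, which carries a factor of the constraints. -/
theorem dd_gauge_gaugeFlow (h : ClockSystem D c γ Ω κ T B Bt)
    (hΨ : HasAdj D (fun x => invBlock γ Ω T B (x, x.1.2)) Ψ) :
    WZ D c fun x => dd (gauge γ Ω T) x (gaugeFlow γ Ω T B c Ψ x) - x.1.2 := by
  have hD := h.isOpen
  have hf := h.firstClass
  refine ((h.gaugeFlow_error hΨ).map (L := fun y : Ext R W × (Pt → R × (W × W)) =>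
    dd (gauge γ Ω T) y.1 (0, y.2)) (h.gauge_sm.dd_apply hD Sm.fst ((Sm.const zero_mem_pts).prodMk
      Sm.snd) fun y hy => hy.1) (fun x hx u hu v hv b => ?_) hD).congr fun x hx => ?_
  · have := dd_isLin h.gauge_sm hD hx _ (zero_prod_mem_pts (A := ℝ × (Pt → W × W)) hu) _
      (zero_prod_mem_pts hv) b
    simpa using this
  · have hβ := (mem_pts_prod.1 (mem_pts_prod.1 (hD.subset hx)).1).2
    have m1 := hf.flow_mem hx (h.gaugeFlow_smear.mem_pts hD hx)
    have m2 := ((h.gaugeFlow_error hΨ).sm hD hf.adj.sm).mem_pts hD hx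
    have e0 : gaugeFlow γ Ω T B c Ψ x = (0, Ω (γ (x, invBlock γ Ω T B (x, x.1.2)))) +
        (0, Ω (Ψ (x, c x))) := by simp [gaugeFlow]
    rw [e0, dd_add h.gauge_sm hD hx (zero_prod_mem_pts m1) (zero_prod_mem_pts m2),
      h.dd_gauge_invBlock hx hβ, add_sub_cancel_left]

/-- The evolution and the gauge flow commute weakly. -/
theorem commute (h : ClockSystem D c γ Ω κ T B Bt)
    (hΨ : HasAdj D (fun x => invBlock γ Ω T B (x, x.1.2)) Ψ) :
    WZ D c fun x => dd (gaugeFlow γ Ω T B c Ψ) x (evolution γ Ω T B c x) -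
      dd (evolution γ Ω T B c) x (gaugeFlow γ Ω T B c Ψ x) := by
  have hD := h.isOpen
  have hf := h.firstClass
  have sA := h.evolution_sm
  have sB := h.gaugeFlow_sm hΨ
  have wB := h.dd_gauge_gaugeFlow hΨ
  have mA := fun x (hx : x ∈ D) => sA.mem_pts hD hx
  have mB := fun x (hx : x ∈ D) => sB.mem_pts hD hx
  have sβ : Sm D fun x : Ext R W => x.1.2 := Sm.fst.snd'
  have sr : Sm D fun x => joint (rate γ Ω T x) (0 : Pt → W) :=
    h.reg_rate.sm.jointF (Sm.const zero_mem_pts)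
  refine hf.commutator_weak (σA := fun x => joint (lapse x) (mult γ Ω T B x))
    (eA := fun x => joint (0 : Pt → R) (joint (0 : Pt → W) (-fstF (c x))))
    h.smear_sm h.gaugeFlow_smear evolution_error (h.gaugeFlow_error hΨ) param_sm (fun _ => rfl)
    (fun _ => rfl) (fun x hx => ?_) h.gauge_sm h.invBlock_sm (fun x hx => h.invBlock_isLin hx)
    (fun x hx σ hσ => h.invBlock_dd_gauge hx hσ) sr sβ
    (WZ.zero.congr fun x hx => ?_) wB ?_
  -- The gauge flow fixes time and `β`, so the parameter part of the evolution is constant along it.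
  · exact dd_eq_zero_of_line param_sm hD hx (mB x hx) fun s _ => by simp [gaugeFlow]
  · rw [h.dd_gauge_evolution hx, sub_self]
  -- The evolution moves `β` by its second half, and the gauge flow moves the rates weakly by the
  -- same second half; the two contributions to the commutator on clocks and rates cancel.
  · have w2 := (wB.map (L := fun y : Ext R W × (Pt → W × W) => joint (sndF y.2) (0 : Pt → W))
      (Sm.snd.sndF.jointF (Sm.const zero_mem_pts)) (fun x _ k _ k' _ a => by
        funext y
        simp [joint, sndF]) hD).neg hD
    refine w2.congr fun x hx => ?_
    have e1 : dd (fun x : Ext R W => x.1.2) x (evolution γ Ω T B c x) = joint (sndF x.1.2) 0 := by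
      exact congrArg (fun v : Ext R W => v.1.2) (dd_id (hD.subset hx) (mA x hx))
    have e2 : dd (fun x => joint (rate γ Ω T x) (0 : Pt → W)) x (gaugeFlow γ Ω T B c Ψ x) =
        joint (dd (rate γ Ω T) x (gaugeFlow γ Ω T B c Ψ x)) 0 := by
      rw [dd_joint h.reg_rate.sm (Sm.const zero_mem_pts) hD hx (mB x hx), dd_const zero_mem_pts]
    rw [e1, e2, h.dd_gauge hx (mB x hx)]
    funext y
    simp [joint, sndF]

theorem tangent_gaugeFlow (h : ClockSystem D c γ Ω κ T B Bt)
    (hΨ : HasAdj D (fun x => invBlock γ Ω T B (x, x.1.2)) Ψ) :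
    WZ D c fun x => dd c x (gaugeFlow γ Ω T B c Ψ x) :=
  h.firstClass.tangent h.gaugeFlow_smear (h.gaugeFlow_error hΨ) (Sm.const zero_mem_pts)

/-- Evolution commutes weakly with the iterated gauge flow. -/
theorem iterate_commute (h : ClockSystem D c γ Ω κ T B Bt)
    (hΨ : HasAdj D (fun x => invBlock γ Ω T B (x, x.1.2)) Ψ) {f : Ext R W → ℝ} (hf : Sm D f)
    (n : ℕ) :
    WZ D c fun x =>
      dd ((fun (g : Ext R W → ℝ) x => dd g x (gaugeFlow γ Ω T B c Ψ x))^[n] f) x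
        (evolution γ Ω T B c x) -
      ((fun (g : Ext R W → ℝ) x => dd g x (gaugeFlow γ Ω T B c Ψ x))^[n]
        fun y => dd f y (evolution γ Ω T B c y)) x :=
  h.firstClass.iterate_weak h.evolution_sm (h.gaugeFlow_sm hΨ) (h.tangent_gaugeFlow hΨ)
    (h.commute hΨ) hf n

variable (γ Ω T) in
/-- Insertion of the gauge fixing conditions into the parameters. -/
def insert (x : Ext R W) : Ext R W := ((x.1.1, -gauge γ Ω T x), x.2)

theorem insert_sm (h : ClockSystem D c γ Ω κ T B Bt) : Sm D (insert γ Ω T) :=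
  (Sm.fst.fst'.prodMk h.gauge_sm.neg).prodMk Sm.snd

theorem insert_mem (h : ClockSystem D c γ Ω κ T B Bt) {x : Ext R W} (hx : x ∈ D) :
    insert γ Ω T x ∈ D := h.reparam x hx _ (neg_mem_pts (h.gauge_sm.mem_pts h.isOpen hx))

/-- The derivative of a quantity, with gauge fixing conditions inserted, along a direction that
shares time and fields with the evolution. -/
theorem dd_insert (h : ClockSystem D c γ Ω κ T B Bt) {Φ : Ext R W → ℝ} (hΦ : Sm D Φ)
    {x : Ext R W} (hx : x ∈ D)
    (he : (evolution γ Ω T B c (insert γ Ω T x)).2 = (evolution γ Ω T B c x).2) :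
    dd (fun y => Φ (insert γ Ω T y)) x (evolution γ Ω T B c x) =
      dd Φ (insert γ Ω T x) (evolution γ Ω T B c (insert γ Ω T x)) := by
  have hD := h.isOpen
  have hA := h.evolution_sm.mem_pts hD hx
  rw [dd_comp hΦ hD h.insert_sm hD (fun y hy => h.insert_mem hy) hx hA]
  congr 1
  -- The inserted value of `β` evolves with velocity minus `(rate, 0)`, which is the velocity that
  -- the evolution assigns to `β` at the inserted point.
  have e1 : dd (fun y => -gauge γ Ω T y) x (evolution γ Ω T B c x) = -joint (rate γ Ω T x) 0 := by
    rw [dd_fun_neg h.gauge_sm hD hx hA, h.dd_gauge_evolution hx]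
  have e2 := dd_id (hD.subset hx) hA
  have e4 := congrArg (fun v : Ext R W => v.1.1) e2
  have e5 := congrArg (fun v : Ext R W => v.2) e2
  have e3 : dd (insert γ Ω T) x (evolution γ Ω T B c x) =
      ((1, dd (fun y => -gauge γ Ω T y) x (evolution γ Ω T B c x)), (evolution γ Ω T B c x).2) := by
    refine Prod.ext (Prod.ext ?_ rfl) ?_
    · exact e4
    · exact e5
  rw [e3, e1]
  refine Prod.ext (Prod.ext rfl ?_) he.symm
  funext y
  simp [joint, evolution, insert, gauge, sndF]

end ClockSystem

end Clocks

end

section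

/-! ### Smooth families of fields -/

section Families

variable {V W : Type} [NormedAddCommGroup V] [NormedSpace ℝ V] [FVal V]
  [NormedAddCommGroup W] [NormedSpace ℝ W] [FVal W]

theorem mem_pts_of_isField {u : Pt → V} (hu : IsField u)
    (hs : ∀ x, u x ∈ (sym : Submodule ℝ V)) : u ∈ (pts : Set (Pt → V)) :=
  mem_pts_field.2 ⟨hu.1, fun x => ⟨hu.2 x, hs x⟩⟩

theorem mem_pts_eight {u : Pt → Eight} : u ∈ (pts : Set (Pt → Eight)) ↔ IsField u :=
  ⟨isField_of_mem_pts, fun h => mem_pts_of_isField h fun _ => ⟨trivial, trivial⟩⟩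

theorem mem_pts_redVal {u : Pt → RedVal} : u ∈ (pts : Set (Pt → RedVal)) ↔ IsRedVariation u :=
  ⟨fun h => ⟨isField_of_mem_pts h, fun x a b => ⟨((mem_pts_field.1 h).2 x).2.1 a b,
    ((mem_pts_field.1 h).2 x).2.2.1 a b⟩⟩, fun h => mem_pts_of_isField h.1 fun x =>
      ⟨fun a b => (h.2 x a b).1, fun a b => (h.2 x a b).2, trivial, trivial⟩⟩

theorem mem_pts_extVal {u : Pt → ExtVal} : u ∈ (pts : Set (Pt → ExtVal)) ↔ IsVariation u :=
  ⟨fun h => ⟨isField_of_mem_pts h, mem_pts_redVal.1 (fstF_mem_pts h)⟩, fun h =>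
    mem_pts_of_isField h.1 fun x => ⟨((mem_pts_field.1 (mem_pts_redVal.2 h.2)).2 x).2,
      trivial, trivial⟩⟩

/-- Smooth families with parameters in a finite dimensional space, in coordinates. -/
theorem exists_isPlot {E : Type} [NormedAddCommGroup E] [NormedSpace ℝ E] [FiniteDimensional ℝ E]
    {O : Set E} (hO : IsOpen O) {p : E → Pt → V} (hp : pl O p) {D : Set (Pt → V)}
    (hD : ∀ e ∈ O, p e ∈ D) :
    ∃ (k : ℕ) (L : E ≃L[ℝ] (Fin k → ℝ)), IsPlot (L.symm ⁻¹' O) D fun s => p (L.symm s) := by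
  refine ⟨_, (Module.finBasis ℝ E).equivFunL, hO.preimage (ContinuousLinearEquiv.continuous _), ?_,
    fun s hs => hD _ hs⟩
  exact hp.1.comp (f := fun q : _ × Pt => ((Module.finBasis ℝ E).equivFunL.symm q.1, q.2))
    (((ContinuousLinearEquiv.contDiff _).comp contDiff_fst).prodMk contDiff_snd).contDiffOn
    fun q hq => ⟨hq.1, mem_univ _⟩

/-- The definition treats time as a separate variable and allows only coordinate parameter spaces; a
general plot, whose time component also varies, factors through such a family. -/
theorem SmoothFunctional.sm {J : Set ℝ} {D : Set (Pt → V)} {F : ℝ → (Pt → V) → ℝ}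
    (h : SmoothFunctional J D F) : Sm (J ×ˢ D) fun y : ℝ × (Pt → V) => F y.1 y.2 where
  map {E} _ _ _ O p hO hp hm := by
    obtain ⟨k, L, hZ⟩ := exists_isPlot hO hp.2 fun e he => (hm e he).2
    have h1 := (h k _ _ hZ).comp (f := fun e : E => ((p e).1, L e))
      (ContDiffOn.prodMk hp.1 L.contDiff.contDiffOn)
      fun e he => ⟨(hm e he).1, by simpa using he⟩
    exact h1.congr fun e _ => by simp

theorem SmoothFieldMap.sm {J : Set ℝ} {D : Set (Pt → V)} {Φ : ℝ → (Pt → V) → Pt → W}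
    (h : SmoothFieldMap J D Φ)
    (hs : ∀ t ∈ J, ∀ z ∈ D, ∀ x, Φ t z x ∈ (sym : Submodule ℝ W)) :
    Sm (J ×ˢ D) fun y : ℝ × (Pt → V) => Φ y.1 y.2 where
  map {E} _ _ _ O p hO hp hm := by
    obtain ⟨k, L, hZ⟩ := exists_isPlot hO hp.2 fun e he => (hm e he).2
    have hc : ContDiffOn ℝ ∞ (fun e => (p e).1) O := hp.1
    have h1 := (h.2 k _ _ hZ).comp (s := O ×ˢ univ)
      (f := fun q : E × Pt => ((p q.1).1, L q.1, q.2))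
      ((hc.comp contDiffOn_fst fun q hq => hq.1).prodMk
        ((L.contDiff.comp contDiff_fst).contDiffOn.prodMk contDiffOn_snd))
      fun q hq => ⟨(hm q.1 hq.1).1, by simpa using hq.1, mem_univ _⟩
    refine ⟨h1.congr fun q _ => by simp, fun e he x => ⟨(h.1 _ (hm e he).1 _ (hm e he).2).2 x,
      hs _ (hm e he).1 _ (hm e he).2 x⟩⟩

theorem Sm.smoothFunctional {J : Set ℝ} (hJ : IsOpen J) {D : Set (Pt → V)} (hD : D ⊆ pts)
    {F : ℝ → (Pt → V) → ℝ} (h : Sm (J ×ˢ D) fun y : ℝ × (Pt → V) => F y.1 y.2) :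
    SmoothFunctional J D F := by
  intro k O Z hZ
  refine h.map (p := fun p : ℝ × (Fin k → ℝ) => (p.1, Z p.2)) (hJ.prod hZ.1)
    ⟨contDiffOn_fst, ?_, fun e he => (mem_pts_field.1 (hD (hZ.2.2 _ he.2))).2⟩
    fun e he => ⟨he.1, hZ.2.2 _ he.2⟩
  exact hZ.2.1.comp (f := fun q : (ℝ × (Fin k → ℝ)) × Pt => (q.1.2, q.2)) (by fun_prop)
    fun q hq => ⟨hq.1.2, mem_univ _⟩

end Families

/-! ### Regions of the phase space -/

section Region

/-- Homogeneity restricts the test vectors to a compact set, as the openness of the phase space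
needs. -/
theorem posDef_iff_forall_sphere {q : Tens} (hq : ∀ a b, q a b = q b a) :
    (Matrix.of q).PosDef ↔ ∀ v ∈ Metric.sphere (0 : Pt) 1, 0 < ∑ a, ∑ b, v a * q a b * v b := by
  have e : ∀ v : Pt, star v ⬝ᵥ (Matrix.of q).mulVec v = ∑ a, ∑ b, v a * q a b * v b := fun v => by
    simp [dotProduct, Matrix.mulVec, Finset.mul_sum, mul_assoc]
  refine Matrix.posDef_iff_dotProduct_mulVec.trans ⟨fun h v hv => ?_, fun h => ⟨?_, fun v hv => ?_⟩⟩
  · rw [← e]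
    exact h.2 (by rintro rfl; simp at hv)
  · ext a b
    simpa using hq b a
  · rw [e]
    have h0 : 0 < ‖v‖ := norm_pos_iff.2 hv
    have h1 := h (‖v‖⁻¹ • v) (by simp [norm_smul, h0.ne'])
    have h2 : ∑ a, ∑ b, (‖v‖⁻¹ • v) a * q a b * (‖v‖⁻¹ • v) b =
        ‖v‖⁻¹ ^ 2 * ∑ a, ∑ b, v a * q a b * v b := by
      simp only [Pi.smul_apply, smul_eq_mul, Finset.mul_sum]
      exact Finset.sum_congr rfl fun a _ => Finset.sum_congr rfl fun b _ => by ring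
    rw [h2] at h1
    exact pos_of_mul_pos_right h1 (by positivity)

/-- Positivity over the compact product of the cell and the unit sphere persists for nearby
parameters, and periodicity carries it from the cell to all points. -/
theorem POpen.redPhase : POpen redPhase where
  subset z hz := mem_pts_redVal.2 hz.1
  isOpen {E} _ _ _ O p hO hp := by
    refine isOpen_iff_mem_nhds.2 fun e he => ?_
    have hsym : ∀ e ∈ O, ∀ x a b, (p e x).1 a b = (p e x).1 b a :=
      fun e he x => ((mem_pts_redVal.1 (mem_pts_of_pl hp he)).2 x · · |>.1)
    have hK : IsCompact (cell ×ˢ Metric.sphere (0 : Pt) 1) := isCompact_cell.prod (isCompact_sphere _ _)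
    have hc : ContinuousOn (fun r : E × Pt × Pt => ∑ a, ∑ b, r.2.2 a * (p r.1 r.2.1).1 a b * r.2.2 b)
        (O ×ˢ univ) := by
      have h1 : ContinuousOn (fun r : E × Pt × Pt => (p r.1 r.2.1).1) (O ×ˢ univ) :=
        (hp.1.continuousOn.comp (f := fun r : E × Pt × Pt => (r.1, r.2.1)) (by fun_prop)
          fun r hr => ⟨hr.1, mem_univ _⟩).fst
      have h2 : ∀ a b, ContinuousOn (fun r : E × Pt × Pt => (p r.1 r.2.1).1 a b) (O ×ˢ univ) :=
        fun a b => continuousOn_pi.1 (continuousOn_pi.1 h1 a) b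
      fun_prop
    have h1 : ∀ᶠ e' in 𝓝 e, ∀ r ∈ cell ×ˢ Metric.sphere (0 : Pt) 1,
        0 < ∑ a, ∑ b, r.2 a * (p e' r.1).1 a b * r.2 b := by
      refine hK.eventually_forall_of_forall_eventually fun r hr => ?_
      refine (hc.continuousAt ((hO.prod isOpen_univ).mem_nhds ⟨he.1, mem_univ _⟩)).eventually
        (lt_mem_nhds ?_)
      exact (posDef_iff_forall_sphere (hsym e he.1 r.1)).1 (he.2.2 r.1) r.2 hr.2
    filter_upwards [h1, hO.mem_nhds he.1] with e' h2 h3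
    refine ⟨h3, mem_pts_redVal.1 (mem_pts_of_pl hp h3), fun x => ?_⟩
    obtain ⟨n, hn⟩ := exists_int_shift x
    rw [← periodic_int_shift (fun x i => (hp.2 e' h3 x).1 i) x n]
    exact (posDef_iff_forall_sphere (hsym e' h3 _)).2 fun v hv => h2 (_, v) ⟨hn, hv⟩

/-- Openness of `U` is only given for families inside the phase space, so the parameters are first
restricted to the open set where the family lies there. -/
theorem IsOpenRegion.pOpen {U : Set (Pt → RedVal)} (hU : IsOpenRegion U) : POpen U where
  subset z hz := POpen.redPhase.subset (hU.1 hz)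
  isOpen {E} _ _ _ O p hO hp := by
    have h1 := POpen.redPhase.isOpen hO hp
    obtain ⟨k, L, hZ⟩ := exists_isPlot h1 (pl_mono hp fun e he => he.1) fun e he => he.2
    convert (hU.2 k _ _ hZ).preimage L.continuous using 1
    ext e
    simp only [mem_ofPred_eq, mem_preimage, L.symm_apply_apply]
    exact ⟨fun h => ⟨⟨h.1, hU.1 h.2⟩, h.2⟩, fun h => ⟨h.1.1, h.2⟩⟩

/-- Times in `J`, parameters, and fields over `U`. -/
def region (J : Set ℝ) (U : Set (Pt → RedVal)) : Set (Ext RedVal Four) :=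
  {x | x ∈ (J ×ˢ (pts : Set (Pt → Eight))) ×ˢ (pts : Set (Pt → ExtVal)) ∧ red x.2 ∈ U}

theorem mem_pts_of_extOver {U : Set (Pt → RedVal)} (hU : IsOpenRegion U) {z : Pt → ExtVal}
    (hz : z ∈ extOver U) : z ∈ (pts : Set (Pt → ExtVal)) := mem_pts_extVal.2 ⟨hz.1, (hU.1 hz.2).1⟩

theorem mem_region {J : Set ℝ} {U : Set (Pt → RedVal)} (hU : IsOpenRegion U) {t : ℝ} (ht : t ∈ J)
    {z : Pt → ExtVal} (hz : z ∈ extOver U) {β : Pt → Eight} (hβ : β ∈ (pts : Set (Pt → Eight))) :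
    ((t, β), z) ∈ region J U := ⟨⟨⟨ht, hβ⟩, mem_pts_of_extOver hU hz⟩, hz.2⟩

theorem extOver_of_region {J : Set ℝ} {U : Set (Pt → RedVal)} {x : Ext RedVal Four}
    (hx : x ∈ region J U) : x.2 ∈ extOver U := ⟨isField_of_mem_pts hx.1.2, hx.2⟩

theorem red_sm {D : Set (Pt → ExtVal)} : Sm D red := fstF_sm

theorem metricDom_region {J : Set ℝ} (hJ : IsOpen J) {U : Set (Pt → RedVal)} (hU : IsOpenRegion U) :
    MetricDom (region J U) where
  isOpen := (((POpen.real hJ).prod POpen.pts).prod POpen.pts).preimage hU.pOpen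
    (Φ := fun x => red x.2) (red_sm.comp (D' := univ) Sm.snd fun _ _ => mem_univ _)
  posDef _ hx y := (hU.1 hx.2).2 y

end Region

end

section

/-! ### Poisson brackets as derivatives along Hamiltonian vector fields -/

section Brackets

variable {A : Type} [AddCommGroup A] [Module ℝ A] [DVS A] {D : Set (A × (Pt → ExtVal))}
  {M : Couplings}

theorem valDot_eq (v w : ExtVal) : valDot v w = dot v w := by
  rw [dot_extVal, valDot]
  ring

/-- The functional derivative is chosen among candidates; nondegeneracy of the pairing on admissible
fields leaves only one. -/
theorem functionalDeriv_eq {F : (Pt → ExtVal) → ℝ} {z γ : Pt → ExtVal}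
    (h : HasFunctionalDeriv F z γ) : functionalDeriv F z = γ := by
  have hex : ∃ γ, HasFunctionalDeriv F z γ := ⟨γ, h⟩
  have h' := hex.choose_spec
  rw [functionalDeriv, dif_pos hex]
  refine eq_of_ip (mem_pts_extVal.2 h'.1) (mem_pts_extVal.2 h.1) fun w hw => ?_
  have e := (h'.2 w (mem_pts_extVal.1 hw)).unique (h.2 w (mem_pts_extVal.1 hw))
  simp only [valDot_eq] at e
  rw [ip_comm, ip_comm w]
  exact e

theorem hamVec_eq {F : (Pt → ExtVal) → ℝ} {z γ : Pt → ExtVal} (h : HasFunctionalDeriv F z γ) :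
    hamVec M F z = omega M γ := by
  funext y
  simp only [hamVec, functionalDeriv_eq h]
  rfl

theorem hasDerivAt_dd_real {X : Type} [AddCommGroup X] [Module ℝ X] [DVS X] {D : Set X} {Φ : X → ℝ}
    (hΦ : Sm D Φ) (hD : POpen D) {x v : X} (hx : x ∈ D) (hv : v ∈ (pts : Set X)) :
    HasDerivAt (fun s : ℝ => Φ (x + s • v)) (dd Φ x v) 0 := by
  have h1 : ContDiffOn ℝ ∞ (fun s : ℝ => Φ (x + s • v)) {s : ℝ | x + s • v ∈ D} :=
    hΦ.pl_line hD hx hv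
  exact ((h1.contDiffAt ((hD.isOpen_line hx hv).mem_nhds (by simpa using hx))).differentiableAt
    (by simp)).hasDerivAt

/-- A functional that agrees with a smooth one has the same derivatives. -/
theorem hasDerivAt_of_eq_on {F : (Pt → ExtVal) → ℝ} {Φ : A × (Pt → ExtVal) → ℝ} (hΦ : Sm D Φ)
    (hD : POpen D) {x : A × (Pt → ExtVal)} (hx : x ∈ D)
    (hF : ∀ z, (x.1, z) ∈ D → F z = Φ (x.1, z)) {v : Pt → ExtVal}
    (hv : v ∈ (pts : Set (Pt → ExtVal))) :
    HasDerivAt (fun s : ℝ => F (x.2 + s • v)) (dd Φ x (0, v)) 0 := by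
  have hv' := zero_prod_mem_pts (A := A) hv
  refine (hasDerivAt_dd_real hΦ hD hx hv').congr_of_eventuallyEq ?_
  have h0 : x + (0 : ℝ) • ((0 : A), v) ∈ D := by rwa [zero_smul, add_zero]
  filter_upwards [(hD.isOpen_line hx hv').mem_nhds h0] with s hs
  have e : x + s • ((0 : A), v) = (x.1, x.2 + s • v) := by ext1 <;> simp
  rw [e] at hs ⊢
  exact hF _ hs

theorem hasFunctionalDeriv_of_dd {F : (Pt → ExtVal) → ℝ} {Φ : A × (Pt → ExtVal) → ℝ}
    (hΦ : Sm D Φ) (hD : POpen D) {x : A × (Pt → ExtVal)} (hx : x ∈ D)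
    (hF : ∀ z, (x.1, z) ∈ D → F z = Φ (x.1, z)) {γ : Pt → ExtVal}
    (hγ : γ ∈ (pts : Set (Pt → ExtVal)))
    (h : ∀ v ∈ (pts : Set (Pt → ExtVal)), dd Φ x (0, v) = ip γ v) :
    HasFunctionalDeriv F x.2 γ := by
  refine ⟨mem_pts_extVal.1 hγ, fun v hv => ?_⟩
  simp only [valDot_eq]
  have e := hasDerivAt_of_eq_on hΦ hD hx hF (mem_pts_extVal.2 hv)
  rwa [h v (mem_pts_extVal.2 hv)] at e

/-- Brackets see only values near the given point at fixed parameters. It therefore suffices that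
the functional agrees on the region with a smooth map of parameters and fields. -/
theorem poisson_eq_dd {F H : (Pt → ExtVal) → ℝ} {Φ : A × (Pt → ExtVal) → ℝ}
    (hΦ : Sm D Φ) (hD : POpen D) {x : A × (Pt → ExtVal)} (hx : x ∈ D)
    (hF : ∀ z, (x.1, z) ∈ D → F z = Φ (x.1, z)) {w : Pt → ExtVal} (hw : hamVec M H x.2 = w)
    (hw' : w ∈ (pts : Set (Pt → ExtVal))) : poisson M F H x.2 = dd Φ x (0, w) := by
  rw [poisson, hw, (hasDerivAt_of_eq_on hΦ hD hx hF hw').deriv]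

theorem Sm.eval_four {X : Type} [AddCommGroup X] [Module ℝ X] [DVS X] {D : Set X}
    {Φ : X → Pt → Four} (hΦ : Sm D Φ) (y : Pt) (μ : Fin 4) : Sm D fun x => Φ x y μ :=
  ⟨fun hO hp hm => DVS.pl_ev (X := Pt → Four)
    (y, ContinuousLinearMap.proj (R := ℝ) (φ := fun _ : Fin 4 => ℝ) μ) (hΦ.map hO hp hm)⟩

theorem dd_eval_four {X : Type} [AddCommGroup X] [Module ℝ X] [DVS X] {D : Set X}
    {Φ : X → Pt → Four} (hΦ : Sm D Φ) (hD : POpen D) {x v : X} (hx : x ∈ D)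
    (hv : v ∈ (pts : Set X)) (y : Pt) (μ : Fin 4) :
    dd (fun x => Φ x y μ) x v = dd Φ x v y μ :=
  (ev_dd hΦ hD hx hv (y, ContinuousLinearMap.proj (R := ℝ) (φ := fun _ : Fin 4 => ℝ) μ)).symm

theorem poisson_eq_dd_four {F : Pt → Fin 4 → (Pt → ExtVal) → ℝ} {H : (Pt → ExtVal) → ℝ}
    {Φ : A × (Pt → ExtVal) → Pt → Four} (hΦ : Sm D Φ) (hD : POpen D) {x : A × (Pt → ExtVal)}
    (hx : x ∈ D) (hF : ∀ z y μ, (x.1, z) ∈ D → F y μ z = Φ (x.1, z) y μ) {w : Pt → ExtVal}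
    (hw : hamVec M H x.2 = w) (hw' : w ∈ (pts : Set (Pt → ExtVal))) :
    (fun y μ => poisson M (F y μ) H x.2) = dd Φ x (0, w) := by
  funext y μ
  rw [poisson_eq_dd (hΦ.eval_four y μ) hD hx (fun z hz => hF z y μ hz) hw hw',
    dd_eval_four hΦ hD hx (zero_prod_mem_pts hw')]

variable {γ : (A × (Pt → ExtVal)) × (Pt → Eight) → Pt → ExtVal}

theorem dd_ip {X V : Type} [AddCommGroup X] [Module ℝ X] [DVS X] [NormedAddCommGroup V]
    [NormedSpace ℝ V] [FVal V] {D : Set X} {Φ Ψ : X → Pt → V} (hΦ : Sm D Φ) (hΨ : Sm D Ψ)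
    (hD : POpen D) {x v : X} (hx : x ∈ D) (hv : v ∈ (pts : Set X)) :
    dd (fun x => ip (Φ x) (Ψ x)) x v = ip (dd Φ x v) (Ψ x) + ip (Φ x) (dd Ψ x v) := by
  have m1 := hΦ.mem_pts hD hx
  have m2 := hΨ.mem_pts hD hx
  have d1 := dd_mem_pts hΦ hD hx hv
  have d2 := dd_mem_pts hΨ hD hx hv
  have e := dd_comp (Sm.ip (D := pts)) POpen.pts (hΦ.prodMk hΨ) hD
    (fun y hy => ⟨hΦ.mem_pts hD hy, hΨ.mem_pts hD hy⟩) hx hv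
  have e' : dd (fun x => (Φ x, Ψ x)) x v = (dd Φ x v, dd Ψ x v) := rfl
  rw [e', dd_prod Sm.ip POpen.pts (prodMk_mem_pts m1 m2) d1 d2] at e
  simp only at e
  rw [e, ip_dd_left POpen.pts Sm.id m2 m1 d1, ip_dd_right POpen.pts Sm.id m1 m2 d2, dd_id m1 d1,
    dd_id m2 d2]

theorem hamVec_smeared (hγ : HasAdj D (conMap M) γ) (hD : POpen D) {x : A × (Pt → ExtVal)}
    (hx : x ∈ D) {σ : Pt → Eight} (hσ : σ ∈ (pts : Set (Pt → Eight))) :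
    hamVec M (smeared M σ) x.2 = omega M (γ (x, σ)) := by
  refine hamVec_eq (hasFunctionalDeriv_of_dd (Φ := fun x => ip σ (conMap M x))
    (Sm.ip_apply (Sm.const hσ) hγ.sm) hD hx (fun z _ => rfl) (hγ.mem_pts hD hx hσ) fun v hv => ?_)
  rw [ip_dd_right hD hγ.sm hσ hx (zero_prod_mem_pts hv), hγ.adj x hx σ hσ v hv]

theorem omega_mem_pts {u : Pt → ExtVal} (hu : u ∈ (pts : Set (Pt → ExtVal))) :
    omega M u ∈ (pts : Set (Pt → ExtVal)) := (omega_sm M).mem_pts POpen.pts hu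

theorem omega_joint (ξ ζ : Pt → Four) :
    omega M (joint 0 (joint ξ ζ)) = joint 0 (joint ζ (-ξ)) := by
  funext y
  simp only [omega, joint, poissonTensor_apply, Pi.zero_apply, Prod.fst_zero, Prod.snd_zero,
    smul_zero, neg_zero, Pi.neg_apply]
  rfl

/-- The functional derivative of the smeared primary constraints is the smearing itself in the slot
of the momenta; the Poisson tensor turns it into a shift of lapse and shift vector. -/
theorem omega_momentum (m : MetricDom D) (hγ : HasAdj D (conMap M) γ) {x : A × (Pt → ExtVal)}
    (hx : x ∈ D) {ζ : Pt → Four} (hζ : ζ ∈ (pts : Set (Pt → Four))) :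
    omega M (γ (x, joint 0 ζ)) = joint 0 (joint ζ 0) := by
  have hz : joint (0 : Pt → Four) ζ ∈ (pts : Set (Pt → Eight)) := joint_mem_pts zero_mem_pts hζ
  have hz' : joint (0 : Pt → RedVal) (joint (0 : Pt → Four) ζ) ∈ (pts : Set (Pt → ExtVal)) :=
    joint_mem_pts zero_mem_pts hz
  have e : γ (x, joint 0 ζ) = joint 0 (joint 0 ζ) := by
    refine eq_of_ip (hγ.mem_pts m.isOpen hx hz) hz' fun v hv => ?_
    have hv' := zero_prod_mem_pts (A := A) hv
    have hd := dd_mem_pts hγ.sm m.isOpen hx hv'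
    have e1 : sndF (dd (conMap M) x (0, v)) = sndF (sndF v) := funext fun y =>
      m.dd_conMap_snd M hx hv' y
    rw [ip_comm v, ip_comm v, ← hγ.adj x hx _ hz v hv, ← joint_fstF_sndF (dd (conMap M) x (0, v)),
      ip_joint zero_mem_pts (fstF_mem_pts hd) hζ (sndF_mem_pts hd), e1,
      (ip_isLin_left (fstF_mem_pts hd)).zero, zero_add]
    have e2 := ip_joint (zero_mem_pts (X := Pt → RedVal)) (fstF_mem_pts hv) hz (sndF_mem_pts hv)
    have e3 := ip_joint (zero_mem_pts (X := Pt → Four)) (fstF_mem_pts (sndF_mem_pts hv)) hζ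
      (sndF_mem_pts (sndF_mem_pts hv))
    rw [joint_fstF_sndF] at e2 e3
    rw [e2, e3, (ip_isLin_left (fstF_mem_pts hv)).zero,
      (ip_isLin_left (fstF_mem_pts (sndF_mem_pts hv))).zero, zero_add, zero_add]
  rw [e, omega_joint, neg_zero]

end Brackets

end

section

/-! ### Clocks of general relativity -/

section GeneralRelativity

/-- Clocks as a map of time, parameters and fields. -/
def clockMap (T : Clock) (x : Ext RedVal Four) : Pt → Four := T x.1.1 (red x.2)

/-- An operator as a map of time, parameters, fields, and the argument. -/
def opMap (B : RedOp) (y : Ext RedVal Four × (Pt → Four)) : Pt → Four := B y.1.1.1 (red y.1.2) y.2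

variable {M : Couplings} {J : Set ℝ} {U : Set (Pt → RedVal)} {T : Clock} {B Bt : RedOp}
  {γ : Ext RedVal Four × (Pt → Eight) → Pt → ExtVal}

theorem clockMap_sm (h : SmoothFieldMap J U T) : Sm (region J U) (clockMap T) :=
  (h.sm fun _ _ _ _ _ => trivial).comp (Φ := fun x : Ext RedVal Four => (x.1.1, red x.2))
    (Sm.fst.fst'.prodMk
    (red_sm.comp (D' := univ) Sm.snd fun _ _ => mem_univ _)) fun _ hx => ⟨hx.1.1.1, hx.2⟩

theorem opMap_sm (h : SmoothFieldMap J (jointDom U)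
    (fun t (y : Pt → RedVal × Four) => B t (fun x => (y x).1) (fun x => (y x).2))) :
    Sm (region J U ×ˢ pts) (opMap B) :=
  (h.sm fun _ _ _ _ _ => trivial).comp (Φ := fun y : Ext RedVal Four × (Pt → Four) =>
    (y.1.1.1, joint (red y.1.2) y.2)) (Sm.fst.fst'.fst'.prodMk
    ((red_sm.comp (D' := univ) Sm.fst.snd' fun _ _ => mem_univ _).jointF Sm.snd))
    fun _ hy => ⟨hy.1.1.1.1, hy.1.2, isField_of_mem_pts hy.2⟩

/-- The functional derivatives of the smeared clocks are given; uniqueness of the derivative of a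
real function along a line identifies them with the transpose of the linearization. -/
theorem clockMap_reg (hJ : IsOpen J) (hU : IsOpenRegion U) (hT : IsClockSystem M J U T B Bt) :
    Reg (region J U) (clockMap T) := by
  obtain ⟨Γ, h1, h2⟩ := hT.clock_deriv
  have hD := (metricDom_region hJ hU).isOpen
  have hs := clockMap_sm hT.clock_smooth
  refine ⟨fun y => Γ y.1.1.1 (joint y.1.2 y.2), hs, (h1.sm fun t ht y hy => ?_).comp
    (Φ := fun y : Ext RedVal Four × (Pt → Four) => (y.1.1.1, joint y.1.2 y.2))
    (Sm.fst.fst'.fst'.prodMk (Sm.fst.snd'.jointF Sm.snd))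
    fun y hy => ⟨hy.1.1.1.1, extOver_of_region hy.1, isField_of_mem_pts hy.2⟩,
    fun x hx η hη v hv => ?_⟩
  · have h3 := mem_pts_extVal.2 (h2 t ht _ hy.1 _ hy.2).1
    exact fun x => ((mem_pts_field.1 h3).2 x).2
  · have h3 := (h2 x.1.1 hx.1.1.1 x.2 (extOver_of_region hx) η (isField_of_mem_pts hη)).2 v
      (mem_pts_extVal.1 hv)
    have h4 := hasDerivAt_of_eq_on (F := fun z' => pairing η (T x.1.1 (red z')))
      (Φ := fun x => ip η (clockMap T x)) (Sm.ip_apply (Sm.const hη) hs) hD hx (fun z _ => rfl) hv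
    rw [ip_dd_right hD hs hη hx (zero_prod_mem_pts hv)] at h4
    simp only [valDot_eq] at h3
    exact h4.unique h3

theorem clockMatrix_eq (hJ : IsOpen J) (hU : IsOpenRegion U) (hT : IsClockSystem M J U T B Bt)
    (hγ : HasAdj (region J U) (conMap M) γ) {x : Ext RedVal Four} (hx : x ∈ region J U)
    {ξ : Pt → Four} (hξ : ξ ∈ (pts : Set (Pt → Four))) :
    clockMatrix M T x.1.1 x.2 ξ = ClockSystem.mat γ (omega M) (clockMap T) (x, ξ) := by
  have hD := (metricDom_region hJ hU).isOpen
  have hz : joint ξ (0 : Pt → Four) ∈ (pts : Set (Pt → Eight)) := joint_mem_pts hξ zero_mem_pts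
  exact poisson_eq_dd_four (F := fun y μ z' => T x.1.1 (red z') y μ) (clockMap_sm hT.clock_smooth)
    hD hx (fun _ _ _ _ => rfl) (hamVec_smeared hγ hD hx hz) (omega_mem_pts (hγ.mem_pts hD hx hz))

/-- Everything that the abstract argument needs of general relativity is collected here: the first
class algebra, the action of the primary constraints, and the invertible clock matrix. -/
theorem clockSystem (hJ : IsOpen J) (hU : IsOpenRegion U) (hT : IsClockSystem M J U T B Bt)
    (hγ : HasAdj (region J U) (conMap M) γ) :
    ClockSystem (region J U) (conMap M) γ (omega M) MetricDom.structMap (clockMap T) (opMap B)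
      (opMap Bt) := by
  have m := metricDom_region hJ hU
  have hs := opMap_sm hT.inv_smooth
  have hm : ∀ x ∈ region J U, ∀ η ∈ (pts : Set (Pt → Four)),
      opMap B (x, η) ∈ (pts : Set (Pt → Four)) :=
    fun x hx η hη => hs.mem_pts (m.isOpen.prod POpen.pts) ⟨hx, hη⟩
  refine ⟨m.firstClass M hγ, fun x hx ζ hζ => omega_momentum m hγ hx hζ,
    fun x hx β hβ => ⟨⟨⟨hx.1.1.1, hβ⟩, hx.1.2⟩, hx.2⟩, clockMap_reg hJ hU hT,
    fun x _ x' _ h1 h2 => ?_, fun x _ x' _ h1 h2 η _ => ?_, hs, opMap_sm hT.transp_smooth,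
    fun x hx η hη ξ hξ => hT.transp x.1.1 hx.1.1.1 (red x.2) hx.2 η ξ (isField_of_mem_pts hη)
      (isField_of_mem_pts hξ), fun x hx η hη => ?_, fun x hx ξ hξ => ?_⟩
  · have h3 : red x'.2 = red x.2 := h2
    rw [clockMap, clockMap, h1, h3]
  · have h3 : red x'.2 = red x.2 := h2
    simp only [opMap, h1, h3]
  · exact (clockMatrix_eq hJ hU hT hγ hx (hm x hx η hη)).symm.trans
      (hT.right_inv x.1.1 hx.1.1.1 x.2 (extOver_of_region hx) η (isField_of_mem_pts hη))
  · have e := hT.left_inv x.1.1 hx.1.1.1 x.2 (extOver_of_region hx) ξ (isField_of_mem_pts hξ)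
    rw [clockMatrix_eq hJ hU hT hγ hx hξ] at e
    exact e

end GeneralRelativity

end

section

/-! ### The gauge fixing conditions, multipliers and Hamiltonian vector fields as abstract objects
-/

open ClockSystem

theorem ip_joint_left {V W : Type} [NormedAddCommGroup V] [NormedSpace ℝ V] [FVal V]
    [NormedAddCommGroup W] [NormedSpace ℝ W] [FVal W] {a : Pt → V} {b : Pt → W} {w : Pt → V × W}
    (ha : a ∈ (pts : Set (Pt → V))) (hb : b ∈ (pts : Set (Pt → W)))
    (hw : w ∈ (pts : Set (Pt → V × W))) : ip (joint a b) w = ip a (fstF w) + ip b (sndF w) := by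
  rw [← ip_joint ha (fstF_mem_pts hw) hb (sndF_mem_pts hw), joint_fstF_sndF]

/-- A system of clocks, with the functional derivative `γ` of the constraints. -/
structure AdmClocks (M : Couplings) (J : Set ℝ) (U : Set (Pt → RedVal)) (T : Clock) (B Bt : RedOp)
    (γ : Ext RedVal Four × (Pt → Eight) → Pt → ExtVal) : Prop where
  times : IsOpen J
  open_region : IsOpenRegion U
  clocks : IsClockSystem M J U T B Bt
  adj : HasAdj (region J U) (conMap M) γ

namespace AdmClocks

variable {M : Couplings} {J : Set ℝ} {U : Set (Pt → RedVal)} {T : Clock} {B Bt : RedOp}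
  {γ : Ext RedVal Four × (Pt → Eight) → Pt → ExtVal} {x : Ext RedVal Four}

theorem system (h : AdmClocks M J U T B Bt γ) :
    ClockSystem (region J U) (conMap M) γ (omega M) MetricDom.structMap (clockMap T) (opMap B)
      (opMap Bt) := clockSystem h.times h.open_region h.clocks h.adj

theorem metricDom (h : AdmClocks M J U T B Bt γ) : MetricDom (region J U) :=
  metricDom_region h.times h.open_region

theorem isOpen (h : AdmClocks M J U T B Bt γ) : POpen (region J U) := h.metricDom.isOpen

/-- Explicit time derivatives become directional derivatives along the time parameter; openness of
the set of times makes the comparison local. -/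
theorem deriv_time (h : AdmClocks M J U T B Bt γ) {F : ℝ → ℝ} {Φ : Ext RedVal Four → ℝ}
    (hΦ : Sm (region J U) Φ) (hx : x ∈ region J U) (hF : ∀ s ∈ J, F s = Φ ((s, x.1.2), x.2)) :
    deriv F x.1.1 = dd Φ x ((1, 0), 0) := by
  have hv : (((1 : ℝ), (0 : Pt → Eight)), (0 : Pt → ExtVal)) ∈ (pts : Set (Ext RedVal Four)) :=
    ClockSystem.one_mem_pts
  rw [← (hasDerivAt_dd_real hΦ h.isOpen hx hv).deriv]
  have e1 : deriv F x.1.1 = deriv (fun s => F (x.1.1 + s)) 0 := by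
    rw [deriv_comp_const_add, add_zero]
  rw [e1]
  refine Filter.EventuallyEq.deriv_eq ?_
  have h0 : x + (0 : ℝ) • (((1 : ℝ), (0 : Pt → Eight)), (0 : Pt → ExtVal)) ∈ region J U := by
    rwa [zero_smul, add_zero]
  filter_upwards [(h.isOpen.isOpen_line hx hv).mem_nhds h0] with s hs
  have e2 : x + s • (((1 : ℝ), (0 : Pt → Eight)), (0 : Pt → ExtVal)) =
      ((x.1.1 + s, x.1.2), x.2) := by
    refine Prod.ext (Prod.ext ?_ ?_) ?_ <;> simp
  have hs' : x + s • (((1 : ℝ), (0 : Pt → Eight)), (0 : Pt → ExtVal)) ∈ region J U := hs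
  rw [e2] at hs' ⊢
  exact hF _ hs'.1.1.1

theorem lapse_eq (x : Ext RedVal Four) : lapseShift x.2 = lapse x := rfl

theorem clockDot_eq (h : AdmClocks M J U T B Bt γ) (hx : x ∈ region J U) :
    clockDot M T x.1.1 x.2 = rate γ (omega M) (clockMap T) x := by
  have hs := h.system.clock_reg.sm
  have hl := h.system.reg_lapse.sm.mem_pts h.isOpen hx
  funext y μ
  have e1 := h.deriv_time (F := fun s => T s (red x.2) y μ) (hs.eval_four y μ) hx fun _ _ => rfl
  rw [dd_eval_four hs h.isOpen hx one_mem_pts] at e1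
  rw [clockDot, e1, lapse_eq, clockMatrix_eq h.times h.open_region h.clocks h.adj hx hl]
  rfl

theorem clockDotMatrix_eq (h : AdmClocks M J U T B Bt γ) (hx : x ∈ region J U) {ξ : Pt → Four}
    (hξ : ξ ∈ (pts : Set (Pt → Four))) :
    clockDotMatrix M T x.1.1 x.2 ξ = rateMat γ (omega M) (clockMap T) (x, ξ) := by
  have hz : joint ξ (0 : Pt → Four) ∈ (pts : Set (Pt → Eight)) := joint_mem_pts hξ zero_mem_pts
  exact poisson_eq_dd_four (F := fun y μ z' => clockDot M T x.1.1 z' y μ) h.system.reg_rate.sm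
    h.isOpen hx (fun z y μ hz => congrFun (congrFun (h.clockDot_eq (x := (x.1, z)) hz) y) μ)
    (hamVec_smeared h.adj h.isOpen hx hz) (omega_mem_pts (h.adj.mem_pts h.isOpen hx hz))

theorem bigB_eq (h : AdmClocks M J U T B Bt γ) (hx : x ∈ region J U) {β : Pt → Eight}
    (hβ : β ∈ (pts : Set (Pt → Eight))) :
    bigB M T B x.1.1 x.2 β = invBlock γ (omega M) (clockMap T) (opMap B) (x, β) := by
  have e := h.clockDotMatrix_eq hx (op_mem h.isOpen h.system.inv_regOp hx (fstF_mem_pts hβ))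
  have e1 : bigB M T B x.1.1 x.2 β = joint (opMap B (x, fstF β)) (opMap B (x, sndF β) -
      opMap B (x, clockDotMatrix M T x.1.1 x.2 (opMap B (x, fstF β)))) := rfl
  rw [e1, e]
  rfl

theorem multiplier_eq (h : AdmClocks M J U T B Bt γ) (hx : x ∈ region J U) :
    multiplier M T B x.1.1 x.2 = mult γ (omega M) (clockMap T) (opMap B) x := by
  have hs := h.system.reg_rate.sm
  have hl := h.system.reg_lapse.sm.mem_pts h.isOpen hx
  have e : (fun y μ => deriv (fun s => -clockDot M T s x.2 y μ) x.1.1 -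
      clockDotMatrix M T x.1.1 x.2 (lapseShift x.2) y μ) =
      -dd (rate γ (omega M) (clockMap T)) x ((1, 0), 0) -
        rateMat γ (omega M) (clockMap T) (x, lapse x) := by
    funext y μ
    have e1 := h.deriv_time (F := fun s => clockDot M T s x.2 y μ) (hs.eval_four y μ) hx
      fun s hs => congrFun (congrFun (h.clockDot_eq (x := ((s, x.1.2), x.2))
        ⟨⟨⟨hs, hx.1.1.2⟩, hx.1.2⟩, hx.2⟩) y) μ
    rw [dd_eval_four hs h.isOpen hx one_mem_pts] at e1
    rw [deriv.fun_neg, e1, lapse_eq, h.clockDotMatrix_eq hx hl]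
    rfl
  rw [multiplier, e]
  rfl

theorem gaugeFix_eq (h : AdmClocks M J U T B Bt γ) (hx : x ∈ region J U) :
    gaugeFix M T x.1.1 x.2 = -gauge γ (omega M) (clockMap T) x := by
  funext y
  rw [gaugeFix, h.clockDot_eq hx]
  rfl

/-- Hamiltonian vector fields of smeared constraints with field dependent smearing. -/
theorem hamVec_ip (h : AdmClocks M J U T B Bt γ) {F : (Pt → ExtVal) → ℝ}
    {σ : Ext RedVal Four → Pt → Eight} (hσ : Sm (region J U) σ) (hx : x ∈ region J U)
    (hF : ∀ z, (x.1, z) ∈ region J U → F z = ip (σ (x.1, z)) (conMap M (x.1, z)))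
    {δ : Pt → ExtVal} (hδ : δ ∈ (pts : Set (Pt → ExtVal)))
    (hd : ∀ v ∈ (pts : Set (Pt → ExtVal)), ip (conMap M x) (dd σ x (0, v)) = ip δ v) :
    hamVec M F x.2 = omega M (γ (x, σ x)) + omega M δ := by
  have hm := hσ.mem_pts h.isOpen hx
  have hg := h.adj.mem_pts h.isOpen hx hm
  have e := hamVec_eq (M := M) (hasFunctionalDeriv_of_dd (γ := γ (x, σ x) + δ)
    (Sm.ip_apply hσ h.adj.sm) h.isOpen hx hF (add_mem_pts hg hδ) fun v hv => by
      rw [dd_ip hσ h.adj.sm h.isOpen hx (zero_prod_mem_pts hv), h.adj.adj x hx _ hm v hv, ip_comm,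
        hd v hv, add_comm, (ip_isLin_left hv).add hg hδ])
  rw [e, (omega_isLin M).add hg hδ]

/-- The smearing depends on the fields through the abelianizing matrix, so besides the flow of the
smeared constraints there is a term from the derivative of the matrix, contracted with the
constraints. -/
theorem hamVec_abelianized (h : AdmClocks M J U T B Bt γ)
    {Ψ : Ext RedVal Four × (Pt → Eight) → Pt → ExtVal}
    (hΨ : HasAdj (region J U) (fun x => invBlock γ (omega M) (clockMap T) (opMap B) (x, x.1.2)) Ψ)
    (hx : x ∈ region J U) : hamVec M (abelianized M T B x.1.1 x.1.2) x.2 =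
      (gaugeFlow γ (omega M) (clockMap T) (opMap B) (conMap M) Ψ x).2 := by
  have hc := h.adj.sm.mem_pts h.isOpen hx
  refine h.hamVec_ip hΨ.sm hx (fun z hz => ?_) (hΨ.mem_pts h.isOpen hx hc)
    fun v hv => hΨ.adj x hx _ hc v hv
  have e := h.bigB_eq hz hz.1.1.2
  simp only at e
  rw [abelianized, e]
  rfl

/-- The multipliers are constants while the bracket is taken, but lapse and shift are canonical
variables; varying them adds the secondary constraints to the functional derivative. -/
theorem hamVec_hamCan (h : AdmClocks M J U T B Bt γ) (hx : x ∈ region J U) :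
    hamVec M (hamCan M (multiplier M T B x.1.1 x.2)) x.2 =
      (evolution γ (omega M) (clockMap T) (opMap B) (conMap M) x).2 := by
  have hc := fstF_mem_pts (h.adj.sm.mem_pts h.isOpen hx)
  have hm := h.system.mult_sm.mem_pts h.isOpen hx
  have hl := h.system.reg_lapse.sm
  have hz : joint (fstF (conMap M x)) (0 : Pt → Four) ∈ (pts : Set (Pt → Eight)) :=
    joint_mem_pts hc zero_mem_pts
  have e := h.hamVec_ip (F := hamCan M (mult γ (omega M) (clockMap T) (opMap B) x))
    (hl.jointF (Sm.const hm)) hx (fun z _ => rfl)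
    (δ := joint (0 : Pt → RedVal) (joint (fstF (conMap M x)) (0 : Pt → Four)))
    (joint_mem_pts zero_mem_pts hz) fun v hv => by
      have hv' := zero_prod_mem_pts (A := ℝ × (Pt → Eight)) hv
      have e1 : dd (lapse (R := RedVal) (W := Four)) x (0, v) = fstF (sndF v) :=
        dd_of_isLin (fun _ _ _ _ _ => rfl) Sm.snd.sndF.fstF (h.isOpen.subset hx) hv'
      have hv2 := sndF_mem_pts hv
      have hv3 := fstF_mem_pts hv2
      rw [dd_joint hl (Sm.const hm) h.isOpen hx hv', e1, dd_const hm, ip_comm,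
        ip_joint_left hv3 zero_mem_pts (h.adj.sm.mem_pts h.isOpen hx),
        ip_joint_left zero_mem_pts hz hv, ip_joint_left hc zero_mem_pts hv2,
        (ip_isLin_left (sndF_mem_pts (h.adj.sm.mem_pts h.isOpen hx))).zero,
        (ip_isLin_left (fstF_mem_pts hv)).zero, (ip_isLin_left (sndF_mem_pts hv2)).zero, add_zero,
        add_zero, zero_add, ip_comm]
  rw [h.multiplier_eq hx, e, omega_joint]
  rfl

end AdmClocks

end

section

/-! ### The terms of the series and their total time derivatives -/

open ClockSystem

namespace AdmClocks

variable {M : Couplings} {J : Set ℝ} {U : Set (Pt → RedVal)} {T : Clock} {B Bt : RedOp}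
  {γ Ψ : Ext RedVal Four × (Pt → Eight) → Pt → ExtVal} {x : Ext RedVal Four}

variable (M T B γ Ψ) in
/-- The derivative along the gauge flow. -/
def gaugeDeriv (g : Ext RedVal Four → ℝ) (x : Ext RedVal Four) : ℝ :=
  dd g x (gaugeFlow γ (omega M) (clockMap T) (opMap B) (conMap M) Ψ x)

variable (M T B γ) in
/-- The time evolution. -/
def evo (x : Ext RedVal Four) : Ext RedVal Four :=
  evolution γ (omega M) (clockMap T) (opMap B) (conMap M) x

theorem gaugeDeriv_sm (h : AdmClocks M J U T B Bt γ)
    (hΨ : HasAdj (region J U) (fun x => invBlock γ (omega M) (clockMap T) (opMap B) (x, x.1.2)) Ψ)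
    {g : Ext RedVal Four → ℝ} (hg : Sm (region J U) g) (n : ℕ) :
    Sm (region J U) ((gaugeDeriv M T B γ Ψ)^[n] g) :=
  h.system.firstClass.iterate_sm (h.system.gaugeFlow_sm hΨ) hg n

/-- Time and smearing stay fixed through all `n` brackets, and the gauge flow does not move them, so
the iterated bracket is an iterated derivative on the larger space at constant parameters. -/
theorem iterate_poisson (h : AdmClocks M J U T B Bt γ)
    (hΨ : HasAdj (region J U) (fun x => invBlock γ (omega M) (clockMap T) (opMap B) (x, x.1.2)) Ψ)
    (a : ℝ × (Pt → Eight)) (n : ℕ) {F : (Pt → ExtVal) → ℝ} {Φ : Ext RedVal Four → ℝ}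
    (hΦ : Sm (region J U) Φ) (hF : ∀ z, (a, z) ∈ region J U → F z = Φ (a, z)) {z : Pt → ExtVal}
    (hz : (a, z) ∈ region J U) :
    ((fun g => poisson M g (abelianized M T B a.1 a.2))^[n] F) z =
      (gaugeDeriv M T B γ Ψ)^[n] Φ (a, z) := by
  induction n generalizing F Φ with
  | zero => exact hF z hz
  | succ n ih =>
    rw [Function.iterate_succ_apply, Function.iterate_succ_apply]
    refine ih (h.gaugeDeriv_sm hΨ hΦ 1) fun z' hz' => ?_
    have hm := (h.system.gaugeFlow_sm hΨ).mem_pts h.isOpen hz'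
    have hv := h.hamVec_abelianized (x := (a, z')) hΨ hz'
    exact poisson_eq_dd (x := (a, z')) hΦ h.isOpen hz' hF hv (mem_pts_prod.1 hm).2

theorem obsTerm_eq (h : AdmClocks M J U T B Bt γ)
    (hΨ : HasAdj (region J U) (fun x => invBlock γ (omega M) (clockMap T) (opMap B) (x, x.1.2)) Ψ)
    (n : ℕ) {F : (Pt → ExtVal) → ℝ} {Φ : Ext RedVal Four → ℝ} (hΦ : Sm (region J U) Φ)
    (hx : x ∈ region J U)
    (hF : ∀ β z, ((x.1.1, β), z) ∈ region J U → F z = Φ ((x.1.1, β), z)) :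
    obsTerm M T B F x.1.1 n x.2 = (1 / (n.factorial : ℝ)) *
      (gaugeDeriv M T B γ Ψ)^[n] Φ (insert γ (omega M) (clockMap T) x) := by
  rw [obsTerm, h.gaugeFix_eq hx]
  congr 1
  exact h.iterate_poisson hΨ (x.1.1, -gauge γ (omega M) (clockMap T) x) n hΦ (hF _)
    (h.system.insert_mem hx)

theorem evolve_eq (h : AdmClocks M J U T B Bt γ) {F : (Pt → ExtVal) → ℝ}
    {Φ : Ext RedVal Four → ℝ} (hΦ : Sm (region J U) Φ) (hx : x ∈ region J U)
    (hF : ∀ z, (x.1, z) ∈ region J U → F z = Φ (x.1, z)) :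
    evolve M T B F x.1.1 x.2 = dd Φ x (0, (evo M T B γ x).2) :=
  poisson_eq_dd hΦ h.isOpen hx hF (h.hamVec_hamCan hx)
    (mem_pts_prod.1 (h.system.evolution_sm.mem_pts h.isOpen hx)).2

theorem evo_sm (h : AdmClocks M J U T B Bt γ) : Sm (region J U) (evo M T B γ) :=
  h.system.evolution_sm

/-- The term is a function on the larger space pulled back along the insertion of the gauge fixing
conditions. Since the evolution is compatible with the insertion, differentiating in time amounts to
differentiating along the evolution before inserting. -/
theorem obsTermDot_eq (h : AdmClocks M J U T B Bt γ)
    (hΨ : HasAdj (region J U) (fun x => invBlock γ (omega M) (clockMap T) (opMap B) (x, x.1.2)) Ψ)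
    (n : ℕ) {f : (Pt → ExtVal) → ℝ} (hf : Sm (region J U) fun x => f x.2) (hx : x ∈ region J U)
    (h0 : x.1.2 = 0) :
    obsTermDot M T B f x.1.1 n x.2 = (1 / (n.factorial : ℝ)) *
      dd ((gaugeDeriv M T B γ Ψ)^[n] fun x => f x.2) (insert γ (omega M) (clockMap T) x)
        (evo M T B γ (insert γ (omega M) (clockMap T) x)) := by
  have hD := h.isOpen
  have hi := h.system.insert_mem hx
  have hg := h.gaugeDeriv_sm hΨ hf n
  have hgi : Sm (region J U) fun x => (gaugeDeriv M T B γ Ψ)^[n] (fun x => f x.2)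
      (insert γ (omega M) (clockMap T) x) :=
    hg.comp h.system.insert_sm fun y hy => h.system.insert_mem hy
  have hgc : Sm (region J U) fun x => (1 / (n.factorial : ℝ)) *
      (gaugeDeriv M T B γ Ψ)^[n] (fun x => f x.2) (insert γ (omega M) (clockMap T) x) :=
    Sm.smul (Sm.const (pts_real _)) hgi
  have hm := h.evo_sm.mem_pts hD hx
  have hm2 := zero_prod_mem_pts (A := ℝ × (Pt → Eight)) (mem_pts_prod.1 hm).2
  -- After insertion nothing depends on the initial `β`. The value `0` is chosen because the
  -- evolution does not move it, so the evolution is the sum of the time derivative and the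
  -- Hamiltonian flow.
  have e0 : evo M T B γ x = ((1, 0), 0) + (0, (evo M T B γ x).2) := by
    refine Prod.ext (Prod.ext ?_ ?_) ?_
    · simp [evo, evolution]
    · have e : joint (sndF (0 : Pt → Eight)) (0 : Pt → Four) = 0 := rfl
      simp [evo, evolution, h0, e]
    · simp
  -- The canonical Hamiltonian does not involve `β`, so its vector field is the same before and
  -- after insertion.
  have he : (evo M T B γ (insert γ (omega M) (clockMap T) x)).2 = (evo M T B γ x).2 :=
    (h.hamVec_hamCan hi).symm.trans (h.hamVec_hamCan hx)
  rw [obsTermDot, h.deriv_time hgc hx fun s hs => h.obsTerm_eq (x := ((s, x.1.2), x.2)) hΨ n hf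
      ⟨⟨⟨hs, hx.1.1.2⟩, hx.1.2⟩, hx.2⟩ fun _ _ _ => rfl,
    h.evolve_eq hgc hx fun z hz => h.obsTerm_eq (x := (x.1, z)) hΨ n hf hz fun _ _ _ => rfl,
    ← dd_add hgc hD hx one_mem_pts hm2, ← e0,
    dd_lin_comp (L := fun r : ℝ => (1 / (n.factorial : ℝ)) * r) (fun u _ v _ a => by
      simp only [smul_eq_mul]; ring) (Sm.smul (Sm.const (pts_real _)) Sm.id) hgi hD hx hm]
  congr 1
  exact h.system.dd_insert hg hx he

theorem weaklyZero (h : AdmClocks M J U T B Bt γ) {f : (Pt → ExtVal) → ℝ}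
    (hf : SmoothFunctional J (extOver U) fun _ => f) (n : ℕ) :
    WeaklyZero M J (extOver U) fun t z =>
      obsTermDot M T B f t n z - obsTerm M T B (evolve M T B f t) t n z := by
  obtain ⟨Ψ, hΨ⟩ := h.system.reg_invBlock
  have hU := h.open_region
  have hf' : Sm (region J U) fun x => f x.2 := hf.sm.comp
    (Φ := fun x : Ext RedVal Four => (x.1.1, x.2)) (Sm.fst.fst'.prodMk Sm.snd)
    fun x hx => ⟨hx.1.1.1, extOver_of_region hx⟩
  have hfe : Sm (region J U) fun x => dd (fun x : Ext RedVal Four => f x.2) x (evo M T B γ x) :=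
    hf'.dd_apply h.isOpen Sm.id h.evo_sm fun _ hx => hx
  obtain ⟨α, hα, hlin, heq⟩ := h.system.iterate_commute hΨ hf' n
  have hp : ∀ t ∈ J, ∀ z ∈ extOver U, ((t, (0 : Pt → Eight)), z) ∈ region J U := fun t ht z hz =>
    mem_region hU ht hz zero_mem_pts
  have hj : (jointDom (extOver U) : Set (Pt → ExtVal × Eight)) ⊆ pts := fun y hy =>
    joint_mem_pts (u := fun x => (y x).1) (v := fun x => (y x).2) (mem_pts_of_extOver hU hy.1)
      (mem_pts_eight.2 hy.2)
  -- The coefficients are those of the weak commutation of the evolution with the iterated gauge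
  -- flow, evaluated at `β` equal to the gauge fixing conditions. Insertion leaves the phase space
  -- point, hence the constraints, unchanged.
  refine ⟨fun t y => (1 / (n.factorial : ℝ)) *
    α (insert γ (omega M) (clockMap T) ((t, 0), fstF y), sndF y),
    Sm.smoothFunctional h.times hj ?_, fun t ht z hz a c c' hc hc' => ?_, fun t ht z hz => ?_⟩
  · refine Sm.smul (Sm.const (pts_real _)) (hα.comp
      (Φ := fun y : ℝ × (Pt → ExtVal × Eight) =>
        (insert γ (omega M) (clockMap T) ((y.1, 0), fstF y.2), sndF y.2))
      ((h.system.insert_sm.comp (Φ := fun y : ℝ × (Pt → ExtVal × Eight) =>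
        ((y.1, (0 : Pt → Eight)), fstF y.2)) ((Sm.fst.prodMk (Sm.const zero_mem_pts)).prodMk
          Sm.snd.fstF) fun y hy => hp _ hy.1 _ hy.2.1).prodMk Sm.snd.sndF)
      fun y hy => ⟨h.system.insert_mem (hp _ hy.1 _ hy.2.1), mem_pts_eight.2 hy.2.2⟩)
  · have e := hlin _ (h.system.insert_mem (hp t ht z hz)) c (mem_pts_eight.2 hc) c'
      (mem_pts_eight.2 hc') a
    simp only [smul_eq_mul] at e
    change (1 / (n.factorial : ℝ)) * α (insert γ (omega M) (clockMap T) ((t, 0), z), a • c + c') =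
      a * ((1 / (n.factorial : ℝ)) * α (insert γ (omega M) (clockMap T) ((t, 0), z), c)) +
        (1 / (n.factorial : ℝ)) * α (insert γ (omega M) (clockMap T) ((t, 0), z), c')
    rw [e]
    ring
  · have hx := hp t ht z hz
    have e1 := h.obsTermDot_eq hΨ n hf' hx rfl
    have e2 := h.obsTerm_eq (F := evolve M T B f t) hΨ n hfe hx fun β z' hz' =>
      h.evolve_eq (x := ((t, β), z')) hf' hz' fun _ _ => rfl
    have e3 := heq _ (h.system.insert_mem hx)
    simp only at e1 e2
    exact (congrArg₂ (fun a b => a - b) e1 e2).trans ((mul_sub _ _ _).symm.trans (congrArg _ e3))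

end AdmClocks

end

end

end ADM

theorem lemma1 (M : ADM.Couplings) (J : Set ℝ) (hJ : IsOpen J)
    (U : Set (ADM.Pt → ADM.RedVal)) (hU : ADM.IsOpenRegion U)
    (T : ADM.Clock) (B Bt : ADM.RedOp) (hT : ADM.IsClockSystem M J U T B Bt)
    (hA : ADM.OpWeaklyZero M J (ADM.extOver U)
      (fun t z ξ x μ => deriv (fun s => ADM.clockMatrix M T s z ξ x μ) t))
    (f : (ADM.Pt → ADM.ExtVal) → ℝ)
    (hf : ADM.SmoothFunctional J (ADM.extOver U) (fun _ => f)) :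
    (∀ n : ℕ, ADM.WeaklyZero M J (ADM.extOver U)
      (fun t z => ADM.obsTermDot M T B f t n z -
        ADM.obsTerm M T B (ADM.evolve M T B f t) t n z)) ∧
    (∀ t ∈ J, ∀ z ∈ ADM.extOver U, ADM.constraints M z = 0 →
      HasSum (fun n => ADM.obsTermDot M T B f t n z) (ADM.obsDot M T B f t z) →
        HasSum (fun n => ADM.obsTerm M T B (ADM.evolve M T B f t) t n z)
          (ADM.obsDot M T B f t z)) := by
  obtain ⟨γ, hγ⟩ := (ADM.metricDom_region hJ hU).reg_constraints M
  have hw := fun n => ADM.AdmClocks.weaklyZero ⟨hJ, hU, hT, hγ⟩ hf n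
  refine ⟨hw, fun t ht z hz hc hs => ?_⟩
  convert hs using 2 with n
  obtain ⟨α, -, hlin, heq⟩ := hw n
  have e1 := heq t ht z hz
  have h0 : ADM.IsField (0 : ADM.Pt → ADM.Eight) := ADM.mem_pts_eight.1 ADM.zero_mem_pts
  -- Where the constraints vanish, the coefficient functional is evaluated at the zero field, and
  -- linearity gives `0`; hence the two series have equal terms at this point.
  have e2 := hlin t ht z hz 1 0 0 h0 h0
  rw [one_smul, zero_add, one_mul] at e2
  have e3 : α t (ADM.joint z 0) = 0 := by linarith
  rw [hc, e3] at e1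
  exact (sub_eq_zero.1 e1).symm
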